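/- \textbf{Setting.} Let $p$ be a prime, let ${\bf C}$ be a complete algebraically closed non-archimedean valued field of characteristic $p$, and let $F\subset{\bf C}$ be a non-archimedean local field (for instance ${\bf C}$ is the completion of a separable closure of $F$), with ring of integers $\mathcal O_F$, maximal ideal $\mathfrak p$, uniformizer $\varpi$ and residue field of cardinality $q$. Let $v$ be the valuation of ${\bf C}$ with $v(\varpi)=1$. Let $n\ge 2$, $\zeta\in\mathbb F_{q^2}\setminus\mathbb F_q$, $\zeta_1=\zeta^q-\zeta$, $F_2=F(\zeta)$ with ring of integers $\mathcal O_{F_2}$ and maximal ideal $\mathfrak p_{F_2}$, $U^0=\mathcal O_{F_2}^\times$ and $U^k=1+\mathfrak p_{F_2}^k$ for $k\ge1$. Let $\widehat F^{\rm ur}\subset {\bf C}$ be the completion of the maximal unramified extension of $F$. Put $[\varpi]_u(X)=X^{q^2}+uX^q+\varpi X$, and $[a]_u(X)=\sum_i a_i[\varpi^i]_u(X)$ for $a=\sum_i a_i\varpi^i$, where $a_i\in\mathbb F_q$ if $a\in\mathcal O_F$ (the universal formal $\mathcal O_F$-module). For $u=0$ we also allow $a\in\mathcal O_{F_2}$ with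 $a_i\in\mathbb F_{q^2}$, and write $[a]_{\mathscr F}=[a]_0$. The Lubin--Tate curve ${\bf X}(\mathfrak p^n)$ is the space of $(u,X_n,Y_n)$ in the open unit polydisc with \[[\varpi^n]_u(X_n)=[\varpi^n]_u(Y_n)=0,\qquad (X_1^qY_1-X_1Y_1^q)^{q-1}=\varpi,\] where $X_1=[\varpi^{n-1}]_u(X_n)$ and $Y_1=[\varpi^{n-1}]_u(Y_n)$. A matrix $g=\begin{pmatrix}a&b\\c&d\end{pmatrix}\in{\rm GL}_2(\mathcal O_F)$ acts on it from the right by $(u,X_n,Y_n)\mapsto(u,[a]_u(X_n)+[c]_u(Y_n),[b]_u(X_n)+[d]_u(Y_n))$. For $\varpi_n$ in the set $\mathscr F[\mathfrak p^n]_{\rm prim}$ of the elements of ${\bf C}$ with $[\varpi^n]_{\mathscr F}(\varpi_n)=0\ne[\varpi^{n-1}]_{\mathscr F}(\varpi_n)$, put $\varpi_i=[\varpi^{n-i}]_{\mathscr F}(\varpi_n)$, $S=X_n-\varpi_n$, $T=Y_n-\zeta\varpi_n$, $U=\zeta^qS-T$, $h=1/(q^2-1)$ and $m=[(n+1)/2]$,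 and let ${\bf X}_{\varpi_n}\subset{\bf X}(\mathfrak p^n)$ be the affinoid defined by \[v(u)\ge m\ (n\text{ even}),\quad v(u)\ge m-\tfrac1{q+1}\ (n\text{ odd}),\qquad v(S)\ge h/q^{n-1},\qquad v(U)\ge h.\] Over $K=\widehat F^{\rm ur}(\varpi_n)$ it has the coordinates $X=U/(\zeta_1\varpi_1)$ and $Y=S/\varpi_m$ for $n$ odd, $Y=S/\varpi_{m+1}^q$ for $n$ even, together with $u_0=u/(\varpi^{m-1}\varpi_1^{q(q-1)})$ for $n$ odd, $u_0=u/\varpi^m$ for $n$ even. Let $A$ be its affinoid algebra over $K$, and let $\overline A=A^\circ/A^{\circ\circ}$ be its canonical reduction, formed with the supremum norm. It is an algebra over the residue field $\mathbb F$ of $K$ (which is the residue field of $\widehat F^{\rm ur}$), and $\overline{\bf X}_{\varpi_n}={\rm Spec}\,\overline A$. Let $\iota_\zeta\colon F_2\hookrightarrow{\rm M}_2(F)$, $a+b\zeta\mapsto\begin{pmatrix}a&-b\zeta^{q+1}\\b&a+b(\zeta+\zeta^q)\end{pmatrix}$. We view $F_2$ in ${\rm M}_2(F)$ through it. Let $C_1$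 be the orthogonal complement of $F_2$ for the form ${\rm Tr}(g_1g_2)$, $\mathfrak C_1=C_1\cap{\rm M}_2(\mathcal O_F)$, and $H^n_\zeta=1+\mathfrak p_{F_2}^{n-1}+\mathfrak p^{[n/2]}\mathfrak C_1$. Write $g(a,b)=\begin{pmatrix}a&a(\zeta+\zeta^q)+b\zeta^{q+1}\\b&-a\end{pmatrix}\in C_1$. \textbf{Statement.} Let $\varpi_n\in\mathscr F[\mathfrak p^n]_{\rm prim}$. (0) The elements of $\mathscr F[\mathfrak p^n]_{\rm prim}$ are the $[a]_{\mathscr F}(\varpi_n)$ with $a\in U^0$. The affinoid ${\bf X}_{[a]_{\mathscr F}(\varpi_n)}$ is non-empty and depends only on the class of $a$ in $\mathfrak S_n=U^0/U^{n-1}$, and different classes give disjoint affinoids. Thus ${\bf X}_{n,\zeta}=\bigcup_{\varpi_n'}{\bf X}_{\varpi_n'}$ is the disjoint union of these affinoids, indexed by $\mathfrak S_n$. (1) $H^n_\zeta$ and $U^0H^n_\zeta$ are groups. The latter acts on ${\bf X}(\mathfrak p^n)$ and permutes the affinoids in (0). The resulting right action on $\mathfrak S_n$ is transitive, and the stabilizer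 of (the index of) ${\bf X}_{\varpi_n}$ in $U^0H^n_\zeta$ is $H^n_\zeta$. (2) There is an isomorphism of $\mathbb F$-algebras \[\overline A\simeq\mathbb F[X,Y]\big/\big(X^{q^2}-X-(Y^{q(q+1)}-Y^{q+1})^{q^{n-1}}\big)\] under which $X$ and $Y$ correspond to the classes of the coordinates $X$ and $Y$ above. (3) Let $a,b,a_2,b_2,c_2,d_2\in\mathcal O_F$ and \[1+g=1+\varpi^{[n/2]}g(a,b)+\varpi^{n-1}\begin{pmatrix}a_2&b_2\\c_2&d_2\end{pmatrix}.\] Then $1+g\in H^n_\zeta$. With bars denoting images in $\mathbb F$, put \[\beta(g)=\overline{a+b\zeta},\qquad \gamma(g)=\overline{\zeta_1^{-1}\big(\zeta^q(a_2+c_2\zeta)-(b_2+d_2\zeta)\big)}.\] There is a unique $K$-algebra endomorphism of $A$ that is the pull-back of functions along the action of $1+g$ on ${\bf X}_{\varpi_n}$. It induces an endomorphism of $\overline A$, and the induced map $\overline{\bf X}_{\varpi_n}\to\overline{\bf X}_{\varpi_n}$ is \[(X,Y)\mapsto\begin{cases}(X+\beta(g)^qY^{q^{n-1}}+\gamma(g),\;Y+\beta(g))&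 n\text{ odd},\\(X+\gamma(g),\;Y)& n\text{ even}.\end{cases}\] In particular, if $\begin{pmatrix}a_2&b_2\\c_2&d_2\end{pmatrix}=\iota_\zeta(x)$ with $x\in\mathcal O_{F_2}$, then $\gamma(g)=\bar x$. -/

import Mathlib

open Filter Topology

noncomputable section

namespace LubinTate

/-! ### Affinoid algebras over a complete subfield `K` of `C` and their canonical reductions -/

section Affinoid

variable {C : Type*} [NormedField C] [IsUltrametricDist C]

/-- The valuation ring of a subfield `K` of `C`. -/
abbrev intRing (K : Subfield C) : ValuationSubring K :=
  (NormedField.valuation (K := K)).valuationSubring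

/-- The residue field of a subfield `K` of `C`. -/
abbrev Residue (K : Subfield C) : Type _ := IsLocalRing.ResidueField (intRing K)

/-- The reduction map from the valuation ring of `K` to the residue field of `K`
(extended by `0` to the elements of `C` that do not lie in this valuation ring). -/
def bar (K : Subfield C) (x : C) : Residue K :=
  open scoped Classical in
  if h : ∃ hx : x ∈ K, (⟨x, hx⟩ : K) ∈ intRing K then
    IsLocalRing.residue (intRing K) ⟨⟨x, h.choose⟩, h.choose_spec⟩ else 0

/-- The Tate algebra `K⟨T_0, …, T_{d-1}⟩` of strictly convergent power series. -/
def Tate (K : Subfield C) (d : ℕ) : Subalgebra K (MvPowerSeries (Fin d) K) :=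
  { MvPowerSeries.IsRestricted.subring (R := K) (fun _ : Fin d => (1 : ℝ)) with
    algebraMap_mem' := fun a => MvPowerSeries.isRestricted_C (fun _ : Fin d => (1 : ℝ)) a }

variable {K : Subfield C} {d : ℕ}

/-- The coordinate function `T_i` in the Tate algebra. -/
def Tate.X (K : Subfield C) {d : ℕ} (i : Fin d) : Tate K d :=
  ⟨MvPowerSeries.X i, MvPowerSeries.isRestricted_monomial (fun _ : Fin d => (1 : ℝ)) _ _⟩

/-- The term of index `m` of the series `f` at the point `P`. -/
def Tate.term (P : Fin d → C) (f : Tate K d) (m : Fin d →₀ ℕ) : C :=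
  ((MvPowerSeries.coeff m f.1 : K) : C) * m.prod fun i e => P i ^ e

theorem Tate.summable_term [CompleteSpace C] (P : Fin d → C) (hP : ∀ i, ‖P i‖ ≤ 1)
    (f : Tate K d) : Summable (Tate.term P f) := by
  apply NonarchimedeanAddGroup.summable_of_tendsto_cofinite_zero
  rw [tendsto_zero_iff_norm_tendsto_zero]
  have hf : Tendsto (fun m : Fin d →₀ ℕ =>
      ‖MvPowerSeries.coeff m f.1‖ * m.prod fun _ e => (1 : ℝ) ^ e)
      cofinite (𝓝 0) := f.2
  refine squeeze_zero (fun _ => norm_nonneg _) (fun m => ?_) hf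
  rw [Tate.term, norm_mul]
  refine mul_le_mul_of_nonneg_left ?_ (norm_nonneg _)
  simp only [Finsupp.prod, norm_prod, norm_pow]
  exact Finset.prod_le_prod (fun _ _ => by positivity)
    fun i _ => pow_le_pow_left₀ (norm_nonneg _) (hP i) _

/-- Evaluation of strictly convergent power series at a point of the closed unit polydisc. -/
def Tate.eval [CompleteSpace C] (P : Fin d → C) (hP : ∀ i, ‖P i‖ ≤ 1) : Tate K d →ₐ[K] C where
  toFun f := ∑' m, Tate.term P f m
  map_one' := by
    rw [tsum_eq_single 0]
    · simp [Tate.term]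
    · intro m hm
      simp [Tate.term, MvPowerSeries.coeff_one, hm]
  map_zero' := by simp [Tate.term]
  map_add' f g := by
    rw [← (Tate.summable_term P hP f).tsum_add (Tate.summable_term P hP g)]
    exact tsum_congr fun m => by simp [Tate.term, add_mul]
  map_mul' f g := by
    have : NonarchimedeanRing C :=
      { is_nonarchimedean := NonarchimedeanAddGroup.is_nonarchimedean }
    rw [(Tate.summable_term P hP f).tsum_mul_tsum_eq_tsum_sum_antidiagonal
      (Tate.summable_term P hP g)
      ((Tate.summable_term P hP f).mul_of_nonarchimedean (Tate.summable_term P hP g))]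
    refine tsum_congr fun m => ?_
    classical
    simp only [Tate.term, MulMemClass.coe_mul, MvPowerSeries.coeff_mul]
    push_cast
    rw [Finset.sum_mul]
    refine Finset.sum_congr rfl fun x hx => ?_
    rw [← Finset.HasAntidiagonal.mem_antidiagonal.mp hx,
      Finsupp.prod_add_index' (fun i => pow_zero _) (fun i a b => pow_add _ _ _)]
    ring
  commutes' a := by
    rw [tsum_eq_single 0]
    · simp [Tate.term, MvPowerSeries.algebraMap_apply]
      rfl
    · intro m hm
      classical
      simp [Tate.term, MvPowerSeries.algebraMap_apply, MvPowerSeries.coeff_C, hm]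

theorem Tate.eval_X [CompleteSpace C] (P : Fin d → C) (hP : ∀ i, ‖P i‖ ≤ 1) (i : Fin d) :
    Tate.eval (K := K) P hP (Tate.X K i) = P i := by
  classical
  change ∑' m, Tate.term P (Tate.X K i) m = P i
  rw [tsum_eq_single (Finsupp.single i 1)]
  · simp [Tate.term, Tate.X]
  · intro m hm
    simp [Tate.term, Tate.X, MvPowerSeries.coeff_X, hm]

/-- The affinoid algebra `K⟨T_0, …, T_{d-1}⟩ / I`. -/
def AffAlg (I : Ideal (Tate K d)) : Type _ := Tate K d ⧸ I

instance (I : Ideal (Tate K d)) : CommRing (AffAlg I) := Ideal.Quotient.commRing I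

instance (I : Ideal (Tate K d)) : Algebra K (AffAlg I) := Ideal.Quotient.algebra K

/-- The quotient map from the Tate algebra to the affinoid algebra. -/
def AffAlg.mk (I : Ideal (Tate K d)) : Tate K d →ₐ[K] AffAlg I := Ideal.Quotient.mkₐ K I

variable [CompleteSpace C]

/-- The `C`-valued points of the affinoid variety `Sp (K⟨T_0, …, T_{d-1}⟩ / I)`. -/
def Points (I : Ideal (Tate K d)) : Set (Fin d → C) :=
  {P | ∃ hP : ∀ i, ‖P i‖ ≤ 1, ∀ f ∈ I, Tate.eval P hP f = 0}

/-- The value of an element of the affinoid algebra at a point. -/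
def evalAt {I : Ideal (Tate K d)} (P : Points I) : AffAlg I →ₐ[K] C :=
  Ideal.Quotient.liftₐ I (Tate.eval P.1 P.2.choose) P.2.choose_spec

/-- The ring `A°` of the elements of supremum norm at most `1`. -/
def powerBdd (I : Ideal (Tate K d)) : Subring (AffAlg I) where
  carrier := {f | ∀ P : Points I, ‖evalAt P f‖ ≤ 1}
  mul_mem' {f g} hf hg P := by
    rw [map_mul, norm_mul]
    exact mul_le_one₀ (hf P) (norm_nonneg _) (hg P)
  one_mem' P := by simp
  add_mem' {f g} hf hg P := by
    rw [map_add]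
    exact (IsUltrametricDist.norm_add_le_max _ _).trans (max_le (hf P) (hg P))
  zero_mem' P := by simp
  neg_mem' {f} hf P := by
    rw [map_neg, norm_neg]
    exact hf P

/-- The ideal `A°°` of `A°` of the elements of supremum norm less than `1`. -/
def topNil (I : Ideal (Tate K d)) : Ideal (powerBdd I) where
  carrier := {f | ∃ r : ℝ, r < 1 ∧ ∀ P : Points I, ‖evalAt P (f : AffAlg I)‖ ≤ r}
  add_mem' {f g} := by
    rintro ⟨r, hr, hf⟩ ⟨s, hs, hg⟩
    refine ⟨max r s, max_lt hr hs, fun P => ?_⟩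
    push_cast
    rw [map_add]
    exact (IsUltrametricDist.norm_add_le_max _ _).trans (max_le_max (hf P) (hg P))
  zero_mem' := ⟨0, zero_lt_one, fun P => by simp⟩
  smul_mem' c f := by
    rintro ⟨r, hr, hf⟩
    refine ⟨r, hr, fun P => ?_⟩
    rw [smul_eq_mul, Subring.coe_mul, map_mul, norm_mul]
    exact (mul_le_of_le_one_left (norm_nonneg _) (c.2 P)).trans (hf P)

/-- The canonical reduction `A° / A°°` of the affinoid algebra `A`. -/
abbrev Reduction (I : Ideal (Tate K d)) : Type _ := powerBdd I ⧸ topNil I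

/-- The structure map from the valuation ring of `K` to `A°`. -/
def intToPowerBdd (I : Ideal (Tate K d)) : intRing K →+* powerBdd I :=
  ((algebraMap K (AffAlg I)).comp (intRing K).subtype).codRestrict (powerBdd I) fun a P => by
    have : evalAt P (algebraMap K (AffAlg I) (a : K)) = ((a : K) : C) :=
      (evalAt P).commutes (a : K)
    simp only [RingHom.comp_apply]
    erw [this]
    exact a.2

/-- The reduction is an algebra over the residue field of `K`. -/
instance (I : Ideal (Tate K d)) : Algebra (Residue K) (Reduction I) :=
  (Ideal.Quotient.lift (IsLocalRing.maximalIdeal (intRing K))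
    ((Ideal.Quotient.mk (topNil I)).comp (intToPowerBdd I)) fun a ha => by
      rw [RingHom.comp_apply, Ideal.Quotient.eq_zero_iff_mem]
      have h1 : ‖(a : K)‖ < 1 := (Valuation.mem_maximalIdeal_iff _ NormedField.valuation).mp ha
      refine ⟨‖(a : K)‖, h1, fun P => ?_⟩
      have : evalAt P (algebraMap K (AffAlg I) (a : K)) = ((a : K) : C) :=
        (evalAt P).commutes (a : K)
      exact (congrArg norm this).le).toAlgebra

/-- The class in the reduction of the coordinate function `T_i`. -/
def redCoord (I : Ideal (Tate K d)) (i : Fin d) : Reduction I :=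
  Ideal.Quotient.mk (topNil I) ⟨AffAlg.mk I (Tate.X K i), fun P => by
    have : evalAt P (AffAlg.mk I (Tate.X K i)) = P.1 i := Tate.eval_X P.1 P.2.choose i
    rw [this]
    exact P.2.choose i⟩

end Affinoid

/-! ### The universal formal module and the Lubin-Tate curve in explicit coordinates -/

section Formulas

variable {R : Type*} [CommRing R]

/-- Multiplication by the uniformizer `[ϖ]_u(x) = x^{q²} + u x^q + ϖ x` of the universal formal
module; for `u = 0` it is `[ϖ]` for the formal `𝒪_{F_2}`-module with complex multiplication. -/
def mulUnif (q : ℕ) (ϖ u x : R) : R := x ^ q ^ 2 + u * x ^ q + ϖ * x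

/-- The polynomial `μ_1(S, T) = S^q T - S T^q`. -/
def mu (q : ℕ) (S T : R) : R := S ^ q * T - S * T ^ q

/-- The elements of which the vanishing defines the Lubin-Tate curve of level `𝔭^n` in the
coordinates `P = (u, X_n, Y_n)`. -/
def drinfeldEqs (q n : ℕ) (ϖ : R) (P : Fin 3 → R) : Set R :=
  {(mulUnif q ϖ (P 0))^[n] (P 1), (mulUnif q ϖ (P 0))^[n] (P 2),
    mu q ((mulUnif q ϖ (P 0))^[n - 1] (P 1)) ((mulUnif q ϖ (P 0))^[n - 1] (P 2)) ^ (q - 1) - ϖ}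

/-- The torsion point `ϖ_i = [ϖ^{n-i}](ϖ_n)`, where `w = ϖ_n`. -/
def torsionPt (q n : ℕ) (ϖ w : R) (i : ℕ) : R := (mulUnif q ϖ 0)^[n - i] w

/-- The coordinates `(u, X_n, Y_n)` in terms of the normalized coordinates `v = (u_0, X, Y)`:
`X_n = ϖ_n + S`, `Y_n = ζ ϖ_n + T` with `U = ζ^q S - T = (ζ^q - ζ) ϖ_1 X`, and, for `n = 2m - 1`,
`u = ϖ^{m-1} ϖ_1^{q(q-1)} u_0`, `S = ϖ_m Y`, for `n = 2m`, `u = ϖ^m u_0`, `S = ϖ_{m+1}^q Y`. -/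
def coords (q n : ℕ) (ϖ ζ w : R) (v : Fin 3 → R) : Fin 3 → R :=
  let m := (n + 1) / 2
  let u := (if Odd n then ϖ ^ (m - 1) * torsionPt q n ϖ w 1 ^ (q * (q - 1)) else ϖ ^ m) * v 0
  let U := (ζ ^ q - ζ) * torsionPt q n ϖ w 1 * v 1
  let S := (if Odd n then torsionPt q n ϖ w m else torsionPt q n ϖ w (m + 1) ^ q) * v 2
  ![u, w + S, ζ * w + (ζ ^ q * S - U)]

end Formulas

section Curve

variable {C : Type*} [NormedField C]

/-- `ϖ` is a uniformizer of the subfield `F` of `C`. -/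
def IsUniformizer (F : Subfield C) (ϖ : C) : Prop :=
  ϖ ∈ F ∧ ϖ ≠ 0 ∧ ‖ϖ‖ < 1 ∧ ∀ x ∈ F, ‖x‖ < 1 → ‖x‖ ≤ ‖ϖ‖

open scoped Classical in
/-- The element `t` of `𝔽_{q²}` (that is, `t^{q²} = t`) that is congruent to `a`, if there is one. -/
def teich (q : ℕ) (a : C) : C :=
  if h : ∃ t : C, t ^ q ^ 2 = t ∧ ‖a - t‖ < 1 then h.choose else 0

/-- The digits `a_i ∈ 𝔽_{q²}` of `a = ∑ a_i ϖ^i`. -/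
def digit (q : ℕ) (ϖ : C) : ℕ → C → C
  | 0, a => teich q a
  | i + 1, a => digit q ϖ i ((a - teich q a) / ϖ)

/-- `[a]_u(x) = ∑ a_i [ϖ^i]_u(x)` for `a = ∑ a_i ϖ^i`: for `a ∈ 𝒪_F` this is multiplication by `a`
in the universal formal module, and for `u = 0` and `a ∈ 𝒪_{F_2}` it is multiplication by `a` in
the formal `𝒪_{F_2}`-module with complex multiplication. -/
def smul (q : ℕ) (ϖ u a x : C) : C := ∑' i, digit q ϖ i a * (mulUnif q ϖ u)^[i] x

/-- The `C`-valued points `(u, X_n, Y_n)` of the Lubin-Tate curve of level `𝔭^n`. -/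
def curve (q n : ℕ) (ϖ : C) : Set (Fin 3 → C) :=
  {P | (∀ i, ‖P i‖ < 1) ∧ ∀ f ∈ drinfeldEqs q n ϖ P, f = 0}

/-- The right action of a matrix on the Lubin-Tate curve, given by composition with the level
structure that sends the standard basis to `X_n` and `Y_n`. -/
def rightAct (q : ℕ) (ϖ : C) (g : Matrix (Fin 2) (Fin 2) C) (P : Fin 3 → C) : Fin 3 → C :=
  ![P 0, smul q ϖ (P 0) (g 0 0) (P 1) + smul q ϖ (P 0) (g 1 0) (P 2),
    smul q ϖ (P 0) (g 0 1) (P 1) + smul q ϖ (P 0) (g 1 1) (P 2)]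

/-- The primitive `ϖ^n`-torsion points of the formal `𝒪_{F_2}`-module. -/
def primTorsion (q n : ℕ) (ϖ : C) : Set C :=
  {w | (mulUnif q ϖ 0)^[n] w = 0 ∧ (mulUnif q ϖ 0)^[n - 1] w ≠ 0}

/-- The affinoid attached to `ζ` and to a primitive torsion point `w`. With the valuation `v`
normalized by `v(ϖ) = 1`, the condition `v(x) ≥ r` reads `‖x‖ ≤ ‖ϖ‖ ^ r`. -/
def affinoid (q n : ℕ) (ϖ ζ w : C) : Set (Fin 3 → C) :=
  {P ∈ curve q n ϖ |
    let m : ℕ := (n + 1) / 2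
    let h : ℝ := 1 / ((q : ℝ) ^ 2 - 1)
    let S := P 1 - w
    let T := P 2 - ζ * w
    ‖P 0‖ ≤ ‖ϖ‖ ^ (if Odd n then (m : ℝ) - 1 / ((q : ℝ) + 1) else (m : ℝ)) ∧
    ‖S‖ ≤ ‖ϖ‖ ^ (h / (q : ℝ) ^ (n - 1)) ∧
    ‖ζ ^ q * S - T‖ ≤ ‖ϖ‖ ^ h}

/-! ### Fields, unit groups and matrix groups -/

/-- The field generated by `F` and `ζ`. -/
def adj (F : Subfield C) (ζ : C) : Subfield C := Subfield.closure ((F : Set C) ∪ {ζ})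

/-- The completion of the maximal unramified extension of `F`, where `q` is the cardinality of the
residue field. -/
def hatUr (F : Subfield C) (q : ℕ) : Subfield C :=
  (Subfield.closure ((F : Set C) ∪ {x | ∃ k : ℕ, 0 < k ∧ x ^ q ^ k = x})).topologicalClosure

theorem mem_adj_self (F : Subfield C) (ζ : C) : ζ ∈ adj F ζ :=
  Subfield.subset_closure (Or.inr rfl)

theorem mem_adj_hatUr {F : Subfield C} {x : C} (hx : x ∈ F) (q : ℕ) (w : C) :
    x ∈ adj (hatUr F q) w :=
  Subfield.subset_closure
    (Or.inl (Subfield.le_topologicalClosure _ (Subfield.subset_closure (Or.inl hx))))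

theorem mem_adj_hatUr_of_pow (F : Subfield C) {q : ℕ} {ζ : C} (h : ζ ^ q ^ 2 = ζ) (w : C) :
    ζ ∈ adj (hatUr F q) w :=
  Subfield.subset_closure (Or.inl (Subfield.le_topologicalClosure _
    (Subfield.subset_closure (Or.inr ⟨2, two_pos, h⟩))))

/-- The unit group `U^k` of the valuation ring of `E`, if `ϖ` is a uniformizer of `E`. -/
def unitFilt (E : Subfield C) (ϖ : C) [IsUltrametricDist C] (k : ℕ) : Subgroup Eˣ where
  carrier := {x | ‖((x : E) : C)‖ = 1 ∧ ‖((x : E) : C) - 1‖ ≤ ‖ϖ‖ ^ k}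
  mul_mem' {x y} hx hy := by
    refine ⟨by simp [hx.1, hy.1], ?_⟩
    have e : (((x * y : Eˣ) : E) : C) - 1
        = ((x : E) : C) * (((y : E) : C) - 1) + (((x : E) : C) - 1) := by
      push_cast
      ring
    rw [e]
    refine (IsUltrametricDist.norm_add_le_max _ _).trans (max_le ?_ hx.2)
    rw [norm_mul, hx.1, one_mul]
    exact hy.2
  one_mem' := by simp
  inv_mem' {x} hx := by
    have h0 : ((x : E) : C) ≠ 0 := by simp
    refine ⟨by simp [hx.1], ?_⟩
    have e : (((x⁻¹ : Eˣ) : E) : C) - 1 = -(((x : E) : C)⁻¹ * (((x : E) : C) - 1)) := by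
      push_cast
      field_simp
      ring
    rw [e, norm_neg, norm_mul, norm_inv, hx.1, inv_one, one_mul]
    exact hx.2

/-- The index set `U^0 / U^{n-1}` for the field `E`. -/
abbrev IndexSet (E : Subfield C) (ϖ : C) [IsUltrametricDist C] (n : ℕ) : Type _ :=
  unitFilt E ϖ 0 ⧸ (unitFilt E ϖ (n - 1)).subgroupOf (unitFilt E ϖ 0)

/-- The matrix of multiplication by `a + b ζ` with respect to the basis `1, ζ`. -/
def iota (q : ℕ) (ζ a b : C) : Matrix (Fin 2) (Fin 2) C :=
  !![a, -b * ζ ^ (q + 1); b, a + b * (ζ + ζ ^ q)]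

/-- The orthogonal complement of `F_2` in the matrix algebra `M_2(F)` for the trace form. -/
def orthC (F : Subfield C) (q : ℕ) (ζ : C) : Set (Matrix (Fin 2) (Fin 2) C) :=
  {c | (∀ i j, c i j ∈ F) ∧ ∀ a ∈ F, ∀ b ∈ F, (iota q ζ a b * c).trace = 0}

/-- The element `g(a, b)` of the orthogonal complement. -/
def gC (q : ℕ) (ζ a b : C) : Matrix (Fin 2) (Fin 2) C :=
  !![a, a * (ζ + ζ ^ q) + b * ζ ^ (q + 1); b, -a]

/-- The set `H = 1 + 𝔭_{F_2}^{n-1} + 𝔭^{[n/2]} ℭ_1`. -/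
def setH (F : Subfield C) (q n : ℕ) (ϖ ζ : C) : Set (Matrix (Fin 2) (Fin 2) C) :=
  {g | ∃ x ∈ F, ∃ y ∈ F, ∃ c ∈ orthC F q ζ, ‖x‖ ≤ 1 ∧ ‖y‖ ≤ 1 ∧ (∀ i j, ‖c i j‖ ≤ 1) ∧
    g = 1 + ϖ ^ (n - 1) • iota q ζ x y + ϖ ^ (n / 2) • c}

/-- The set `U_{F_2}^0 H`. -/
def setUH (F : Subfield C) (q n : ℕ) (ϖ ζ : C) : Set (Matrix (Fin 2) (Fin 2) C) :=
  {g | ∃ a ∈ F, ∃ b ∈ F, ‖a + b * ζ‖ = 1 ∧ ∃ h ∈ setH F q n ϖ ζ, g = iota q ζ a b * h}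

end Curve

section Component

variable {C : Type*} [NormedField C] [IsUltrametricDist C] [CompleteSpace C]

/-- The ideal of the Tate algebra `K⟨u_0, X, Y⟩` that defines the affinoid attached to `w`. -/
def affIdeal {K : Subfield C} (q n : ℕ) (ϖ ζ w : K) : Ideal (Tate K 3) :=
  Ideal.span (drinfeldEqs q n (algebraMap K (Tate K 3) ϖ)
    (coords q n (algebraMap K (Tate K 3) ϖ) (algebraMap K (Tate K 3) ζ)
      (algebraMap K (Tate K 3) w) (Tate.X K)))

/-- The equation `X^{q²} - X - (Y^{q(q+1)} - Y^{q+1})^{q^{n-1}}` of the reduction. -/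
def curveEq (k : Type*) [CommRing k] (q n : ℕ) : MvPolynomial (Fin 2) k :=
  MvPolynomial.X 0 ^ q ^ 2 - MvPolynomial.X 0 -
    (MvPolynomial.X 1 ^ (q * (q + 1)) - MvPolynomial.X 1 ^ (q + 1)) ^ q ^ (n - 1)

/-- The algebra endomorphism `φ` of the affinoid algebra is the pull-back of functions along the
map that `ρ` induces on the points, where `ψ` expresses the ambient coordinates of the points. -/
def IsPullback {K : Subfield C} {d : ℕ} {I : Ideal (Tate K d)} (ψ ρ : (Fin d → C) → (Fin d → C))
    (φ : AffAlg I →ₐ[K] AffAlg I) : Prop :=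
  ∀ P : Points I, ∃ P' : Points I, ψ P' = ρ (ψ P) ∧ ∀ f, evalAt P (φ f) = evalAt P' f

/-- The endomorphism `φbar` of the reduction is induced by the endomorphism `φ`. -/
def IsReductionOf {K : Subfield C} {d : ℕ} {I : Ideal (Tate K d)} (φ : AffAlg I →ₐ[K] AffAlg I)
    (φbar : Reduction I →ₐ[Residue K] Reduction I) : Prop :=
  ∀ f : powerBdd I, ∃ hf : φ f ∈ powerBdd I,
    φbar (Ideal.Quotient.mk (topNil I) f) = Ideal.Quotient.mk (topNil I) ⟨φ f, hf⟩

end Component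

end LubinTate

end

/-! The proof lives in the diagonal coordinates `X_n = A + B`, `Y_n = ζ A + ζ^q B`. Because `ζ^{q²}
= ζ`, multiplication by `ϖ` becomes `(A, B) ↦ (L A + u B^q, L B + u A^q)` with the additive operator
`L x = x^{q²} + ϖ x` (`mulUnif_diag`). The two torsion equations say that the `n`-th iterate kills
`(A, B)`, and the affinoid is cut out by putting `u`, `A - ϖ_n` and `B` in fixed discs
(`mem_affinoid_iff`). The determinant equation is then automatic: one step before zero `μ^q = ϖ μ`
holds identically, and `μ ≠ 0` because `A` has the size of `ϖ_1` there while `B` is smaller.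

Write `A = ϖ_n + ϖ_1 x`, `B = s y - ϖ_1 x` with the scaling constant `s`. The operator `L` sends
`ϖ_{i+1} y` nearly to `ϖ_i y^{q²}`, sends `ϖ_1 x` exactly to `ϖ ϖ_1 (x - x^{q²})`, and is nearly
multiplication by `ϖ` on still smaller elements. Unrolling the recursion, only few terms survive.
With `y' = y^{q^{n-1}}` they are, for `n` odd, `B_n ≈ ϖ^m ϖ_1 (y' - y'^{q²} - u_0)` and `A_n ≈ ϖ^n
ϖ_1 (x - x^{q²} - u_0 y'^q)`; for `n` even, `B_n ≈ ϖ^m ϖ_1^q (y'^q + u_0)` and `A_n ≈ ϖ^n ϖ_1 (x -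
x^{q²} + u_0 (y' - y'^{q²}))`. Eliminating `u_0` gives the same curve in both parities
(`exists_isChart`).

The passage to the canonical reduction is a general fact about small perturbations of `X^{p^e} - X =
cc(Y)`, `u_0 = g(Y)` (`IsChart`). A contraction argument lifts every solution of the model to a
point. The fibre over `y` then has `p^e` points at mutual distance one, so that a polynomial of
`X`-degree less than `p^e` has Gauss norm at most its supremum norm
(`IsChart.exists_norm_coeff_le`). Division by the monic equation shows that such polynomials
approximate all functions modulo the ideal (`IsChart.exists_approx`). Together these identify the
reduction (`IsChart.exists_algEquiv`) and show that a function vanishing at all points is zero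
(`IsChart.mem_of_vanish`), which makes pull-backs exist and be unique.

A matrix `M` is recorded by `α`, `β` with `(1, ζ) M = α (1, ζ) + β (1, ζ^q)`. In diagonal
coordinates it acts by `A' = ∑ (α_i A_i + β_i^q B_i)`, `B' = ∑ (β_i A_i + α_i^q B_i)`, with the
digits of `α`, `β` and the iterates `(A_i, B_i)` (`rightAct_diagPt`). Hence `U^0 H` moves the centre
`ϖ_n` to `[α] ϖ_n`, and two centres give the same affinoid exactly when they are congruent modulo
`𝔭^{n-1}` (`norm_smul_sub_le_iff`). For `H` only the digits `α_{n-1}` and `β_{n/2}` matter for the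
reduction, and they give the stated formulas. -/

open Filter Topology

noncomputable section

namespace LubinTate

/-! ### The Gauss norm, substitution and evaluation in Tate algebras -/

section TateNorm

variable {C : Type*} [NormedField C] [IsUltrametricDist C] {K : Subfield C} {d : ℕ}

theorem Tate.tendsto_coeff (f : Tate K d) :
    Tendsto (fun m : Fin d →₀ ℕ => ‖MvPowerSeries.coeff m f.1‖) cofinite (𝓝 0) := by
  have hf : Tendsto (fun m : Fin d →₀ ℕ =>
      ‖MvPowerSeries.coeff m f.1‖ * m.prod fun _ e => (1 : ℝ) ^ e) cofinite (𝓝 0) := f.2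
  simpa [Finsupp.prod] using hf

theorem Tate.mem_of_tendsto (f : MvPowerSeries (Fin d) K)
    (hf : Tendsto (fun m : Fin d →₀ ℕ => ‖MvPowerSeries.coeff m f‖) cofinite (𝓝 0)) :
    f ∈ Tate K d := by
  change Tendsto (fun m : Fin d →₀ ℕ =>
      ‖MvPowerSeries.coeff m f‖ * m.prod fun _ e => (1 : ℝ) ^ e) cofinite (𝓝 0)
  simpa [Finsupp.prod] using hf

theorem Tate.bddAbove_coeff (f : Tate K d) :
    BddAbove (Set.range fun m : Fin d →₀ ℕ => ‖MvPowerSeries.coeff m f.1‖) := by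
  have h := (Tate.tendsto_coeff f).eventually (gt_mem_nhds (zero_lt_one (α := ℝ)))
  rw [eventually_cofinite] at h
  obtain ⟨M, hM⟩ := (h.image fun m => ‖MvPowerSeries.coeff m f.1‖).bddAbove
  refine ⟨max M 1, ?_⟩
  rintro _ ⟨m, rfl⟩
  by_cases hm : ‖MvPowerSeries.coeff m f.1‖ < 1
  · exact hm.le.trans (le_max_right _ _)
  · exact (hM ⟨m, hm, rfl⟩).trans (le_max_left _ _)

/-- The Gauss norm. -/
instance : Norm (Tate K d) := ⟨fun f => ⨆ m : Fin d →₀ ℕ, ‖MvPowerSeries.coeff m f.1‖⟩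

theorem Tate.norm_coeff_le (f : Tate K d) (m : Fin d →₀ ℕ) :
    ‖MvPowerSeries.coeff m f.1‖ ≤ ‖f‖ :=
  le_ciSup (Tate.bddAbove_coeff f) m

theorem Tate.norm_le {f : Tate K d} {r : ℝ}
    (h : ∀ m, ‖MvPowerSeries.coeff m f.1‖ ≤ r) : ‖f‖ ≤ r :=
  ciSup_le h

theorem Tate.norm_nonneg' (f : Tate K d) : 0 ≤ ‖f‖ :=
  (norm_nonneg _).trans (Tate.norm_coeff_le f 0)

theorem Tate.norm_add_le' (f g : Tate K d) : ‖f + g‖ ≤ max ‖f‖ ‖g‖ :=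
  Tate.norm_le fun m => by
    have : MvPowerSeries.coeff m (f + g).1 = MvPowerSeries.coeff m f.1 + MvPowerSeries.coeff m g.1 := by
      simp
    rw [this]
    exact (IsUltrametricDist.norm_add_le_max _ _).trans
      (max_le_max (Tate.norm_coeff_le f m) (Tate.norm_coeff_le g m))

theorem Tate.norm_mul_le' (f g : Tate K d) : ‖f * g‖ ≤ ‖f‖ * ‖g‖ :=
  Tate.norm_le fun m => by
    classical
    have : MvPowerSeries.coeff m (f * g).1 = ∑ x ∈ Finset.HasAntidiagonal.antidiagonal m,
        MvPowerSeries.coeff x.1 f.1 * MvPowerSeries.coeff x.2 g.1 := by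
      simp [MvPowerSeries.coeff_mul]
    rw [this]
    refine IsUltrametricDist.norm_sum_le_of_forall_le_of_nonneg
      (mul_nonneg (Tate.norm_nonneg' f) (Tate.norm_nonneg' g)) fun x _ => ?_
    rw [norm_mul]
    exact mul_le_mul (Tate.norm_coeff_le f _) (Tate.norm_coeff_le g _) (norm_nonneg _)
      (Tate.norm_nonneg' f)

instance : NormedCommRing (Tate K d) :=
  { (inferInstance : CommRing (Tate K d)), (inferInstance : Norm (Tate K d)) with
    dist := fun f g => ‖-f + g‖
    dist_self := fun f => by
      rw [neg_add_cancel]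
      exact le_antisymm (Tate.norm_le fun m => by simp) (Tate.norm_nonneg' _)
    dist_comm := fun f g => by
      have h : ∀ f : Tate K d, ‖-f‖ ≤ ‖f‖ := fun f => Tate.norm_le fun m => by
        have : MvPowerSeries.coeff m (-f).1 = - MvPowerSeries.coeff m f.1 := by simp
        rw [this, norm_neg]
        exact Tate.norm_coeff_le f m
      have e : -f + g = -(-g + f) := by ring
      refine le_antisymm ?_ ?_
      · change ‖-f + g‖ ≤ ‖-g + f‖
        rw [e]; exact h _
      · change ‖-g + f‖ ≤ ‖-f + g‖
        refine le_trans (le_of_eq ?_) (h _)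
        congr 1; ring
    dist_triangle := fun f g h => by
      have e : -f + h = (-f + g) + (-g + h) := by ring
      change ‖-f + h‖ ≤ ‖-f + g‖ + ‖-g + h‖
      rw [e]
      exact (Tate.norm_add_le' _ _).trans
        (max_le_add_of_nonneg (Tate.norm_nonneg' _) (Tate.norm_nonneg' _))
    eq_of_dist_eq_zero := fun {f g} h => by
      have h : ‖-f + g‖ = 0 := h
      have h0 : -f + g = 0 := by
        apply Subtype.ext
        ext m
        have := (Tate.norm_coeff_le (-f + g) m).trans h.le
        rw [norm_le_zero_iff] at this
        rw [this]
        simp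
      exact (neg_add_eq_zero.mp h0)
    dist_eq := fun f g => rfl
    norm_mul_le := Tate.norm_mul_le' }

instance : IsUltrametricDist (Tate K d) :=
  IsUltrametricDist.isUltrametricDist_of_forall_norm_add_le_max_norm Tate.norm_add_le'

theorem Tate.norm_smul' (c : K) (f : Tate K d) : ‖c • f‖ ≤ ‖c‖ * ‖f‖ :=
  Tate.norm_le fun m => by
    have : MvPowerSeries.coeff m (c • f).1 = c * MvPowerSeries.coeff m f.1 := by
      simp
    rw [this, norm_mul]
    exact mul_le_mul_of_nonneg_left (Tate.norm_coeff_le f m) (norm_nonneg _)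

instance : NormedAlgebra K (Tate K d) where
  norm_smul_le := Tate.norm_smul'

/-- All but finitely many coefficients have norm below half of the Gauss norm, so the supremum is a
maximum. This provides a scalar of `K` of norm `‖f‖`, by which `f` can be divided to reach norm one.
-/
theorem Tate.exists_norm_eq (f : Tate K d) : ∃ m, ‖MvPowerSeries.coeff m f.1‖ = ‖f‖ := by
  by_cases h : ‖f‖ = 0
  · exact ⟨0, le_antisymm (Tate.norm_coeff_le f 0) (h ▸ norm_nonneg _)⟩
  have hpos : 0 < ‖f‖ := lt_of_le_of_ne (norm_nonneg f) (Ne.symm h)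
  have hfin := (Tate.tendsto_coeff f).eventually (gt_mem_nhds (half_pos hpos))
  rw [eventually_cofinite] at hfin
  by_contra! hne
  have hlt : ∀ m, ‖MvPowerSeries.coeff m f.1‖ < ‖f‖ :=
    fun m => lt_of_le_of_ne (Tate.norm_coeff_le f m) (hne m)
  obtain ⟨M, hM, hM'⟩ : ∃ M < ‖f‖, ∀ m ∈ hfin.toFinset, ‖MvPowerSeries.coeff m f.1‖ ≤ M := by
    rcases hfin.toFinset.eq_empty_or_nonempty with he | hne
    · exact ⟨0, hpos, fun m hm => absurd hm (he ▸ Finset.notMem_empty m)⟩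
    · obtain ⟨a, ha, hmax⟩ := hfin.toFinset.exists_max_image
        (fun m => ‖MvPowerSeries.coeff m f.1‖) hne
      exact ⟨_, hlt a, hmax⟩
  have : ‖f‖ ≤ max M (‖f‖ / 2) := Tate.norm_le fun m => by
    by_cases hm : ‖MvPowerSeries.coeff m f.1‖ < ‖f‖ / 2
    · exact hm.le.trans (le_max_right _ _)
    · exact (hM' m (hfin.mem_toFinset.mpr hm)).trans (le_max_left _ _)
  exact absurd this (not_le.mpr (max_lt hM (half_lt_self hpos)))

instance : NormOneClass (Tate K d) where
  norm_one := by
    classical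
    refine le_antisymm (Tate.norm_le fun m => ?_) ?_
    · have : MvPowerSeries.coeff m (1 : Tate K d).1 = if m = 0 then 1 else 0 := by
        simp [MvPowerSeries.coeff_one]
      rw [this]
      split_ifs <;> simp
    · refine le_trans (le_of_eq ?_) (Tate.norm_coeff_le (1 : Tate K d) 0)
      simp

theorem Tate.norm_X_le (i : Fin d) : ‖Tate.X K i‖ ≤ 1 :=
  Tate.norm_le fun m => by
    classical
    have : MvPowerSeries.coeff m (Tate.X K i).1 = if m = Finsupp.single i 1 then 1 else 0 := by
      simp [Tate.X, MvPowerSeries.coeff_X]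
    rw [this]
    split_ifs <;> simp

/-- The limit is taken coefficientwise; uniformity in the index, recorded in `key`, is what makes
the limit series again strictly convergent. -/
theorem Tate.completeSpace (hK : CompleteSpace K) : CompleteSpace (Tate K d) := by
  refine Metric.complete_of_cauchySeq_tendsto fun u hu => ?_
  have hcoeff : ∀ m, CauchySeq fun i => MvPowerSeries.coeff m (u i).1 := fun m => by
    rw [Metric.cauchySeq_iff] at hu ⊢
    intro ε hε
    obtain ⟨N, hN⟩ := hu ε hε
    refine ⟨N, fun i hi j hj => lt_of_le_of_lt ?_ (hN i hi j hj)⟩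
    rw [dist_eq_norm, dist_eq_norm]
    refine le_trans (le_of_eq ?_) (Tate.norm_coeff_le (u i - u j) m)
    simp
  choose c hc using fun m => cauchySeq_tendsto_of_complete (hcoeff m)
  have key : ∀ ε > 0, ∃ N, ∀ i ≥ N, ∀ m, ‖MvPowerSeries.coeff m (u i).1 - c m‖ ≤ ε := by
    intro ε hε
    rw [Metric.cauchySeq_iff] at hu
    obtain ⟨N, hN⟩ := hu ε hε
    refine ⟨N, fun i hi m => ?_⟩
    have ht : Tendsto (fun j => ‖MvPowerSeries.coeff m (u i).1 - MvPowerSeries.coeff m (u j).1‖)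
        atTop (𝓝 ‖MvPowerSeries.coeff m (u i).1 - c m‖) := (tendsto_const_nhds.sub (hc m)).norm
    refine le_of_tendsto ht ?_
    filter_upwards [eventually_ge_atTop N] with j hj
    refine le_trans (le_trans (le_of_eq ?_) (Tate.norm_coeff_le (u i - u j) m))
      (le_of_lt (by simpa [dist_eq_norm] using hN i hi j hj))
    simp
  let F : MvPowerSeries (Fin d) K := fun m => c m
  have hF : ∀ m, MvPowerSeries.coeff m F = c m := fun m => rfl
  have hmem : F ∈ Tate K d := by
    refine Tate.mem_of_tendsto F ?_
    rw [Metric.tendsto_nhds]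
    intro ε hε
    obtain ⟨N, hN⟩ := key (ε / 2) (half_pos hε)
    have := (Tate.tendsto_coeff (u N)).eventually (gt_mem_nhds hε)
    filter_upwards [this] with m hm
    rw [dist_zero_right, norm_norm, hF]
    have e : c m = MvPowerSeries.coeff m (u N).1 - (MvPowerSeries.coeff m (u N).1 - c m) := by ring
    rw [e, sub_eq_add_neg]
    refine (IsUltrametricDist.norm_add_le_max _ _).trans_lt ?_
    rw [norm_neg]
    exact (max_lt hm ((hN N le_rfl m).trans_lt (half_lt_self hε)))
  refine ⟨⟨F, hmem⟩, ?_⟩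
  rw [Metric.tendsto_atTop]
  intro ε hε
  obtain ⟨N, hN⟩ := key (ε / 2) (half_pos hε)
  refine ⟨N, fun i hi => ?_⟩
  rw [dist_eq_norm]
  refine lt_of_le_of_lt (Tate.norm_le fun m => ?_) (half_lt_self hε)
  refine le_trans (le_of_eq ?_) (hN i hi m)
  simp [hF]

/-! ### Substitution -/

section Subst

variable {R : Type*} [NormedCommRing R] [NormedAlgebra K R] [IsUltrametricDist R] [NormOneClass R]

/-- The term of index `m` of the series `f` at the point `G`. -/
def Tate.sterm (G : Fin d → R) (f : Tate K d) (m : Fin d →₀ ℕ) : R :=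
  (MvPowerSeries.coeff m f.1 : K) • m.prod fun i e => G i ^ e

theorem norm_finsupp_prod_le_one (G : Fin d → R) (hG : ∀ i, ‖G i‖ ≤ 1) (m : Fin d →₀ ℕ) :
    ‖m.prod fun i e => G i ^ e‖ ≤ 1 := by
  refine (Finset.norm_prod_le _ _).trans (Finset.prod_le_one (fun _ _ => norm_nonneg _) ?_)
  intro i _
  exact (norm_pow_le _ _).trans (pow_le_one₀ (norm_nonneg _) (hG i))

theorem Tate.norm_sterm_le (G : Fin d → R) (hG : ∀ i, ‖G i‖ ≤ 1) (f : Tate K d)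
    (m : Fin d →₀ ℕ) : ‖Tate.sterm G f m‖ ≤ ‖MvPowerSeries.coeff m f.1‖ := by
  rw [Tate.sterm, norm_smul]
  exact mul_le_of_le_one_right (norm_nonneg _) (norm_finsupp_prod_le_one G hG m)

variable [CompleteSpace R]

theorem Tate.summable_sterm (G : Fin d → R) (hG : ∀ i, ‖G i‖ ≤ 1)
    (f : Tate K d) : Summable (Tate.sterm G f) := by
  apply NonarchimedeanAddGroup.summable_of_tendsto_cofinite_zero
  rw [tendsto_zero_iff_norm_tendsto_zero]
  exact squeeze_zero (fun _ => norm_nonneg _) (fun m => Tate.norm_sterm_le G hG f m)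
    (Tate.tendsto_coeff f)

/-- Substitution of elements of norm at most one of a complete normed algebra. -/
def Tate.subst (G : Fin d → R) (hG : ∀ i, ‖G i‖ ≤ 1) : Tate K d →ₐ[K] R where
  toFun f := ∑' m, Tate.sterm G f m
  map_one' := by
    rw [tsum_eq_single 0]
    · simp [Tate.sterm]
    · intro m hm
      simp [Tate.sterm, MvPowerSeries.coeff_one, hm]
  map_zero' := by simp [Tate.sterm]
  map_add' f g := by
    rw [← (Tate.summable_sterm G hG f).tsum_add (Tate.summable_sterm G hG g)]
    exact tsum_congr fun m => by simp [Tate.sterm, add_smul]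
  map_mul' f g := by
    have : NonarchimedeanRing R :=
      { is_nonarchimedean := NonarchimedeanAddGroup.is_nonarchimedean }
    rw [(Tate.summable_sterm G hG f).tsum_mul_tsum_eq_tsum_sum_antidiagonal
      (Tate.summable_sterm G hG g)
      ((Tate.summable_sterm G hG f).mul_of_nonarchimedean (Tate.summable_sterm G hG g))]
    refine tsum_congr fun m => ?_
    classical
    simp only [Tate.sterm, MulMemClass.coe_mul, MvPowerSeries.coeff_mul]
    rw [Finset.sum_smul]
    refine Finset.sum_congr rfl fun x hx => ?_
    rw [← Finset.HasAntidiagonal.mem_antidiagonal.mp hx,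
      Finsupp.prod_add_index' (fun i => pow_zero _) (fun i a b => pow_add _ _ _),
      smul_mul_smul_comm]
  commutes' a := by
    rw [tsum_eq_single 0]
    · simp [Tate.sterm, MvPowerSeries.algebraMap_apply, Algebra.smul_def]
    · intro m hm
      classical
      simp [Tate.sterm, MvPowerSeries.algebraMap_apply, MvPowerSeries.coeff_C, hm]

theorem Tate.subst_X (G : Fin d → R) (hG : ∀ i, ‖G i‖ ≤ 1) (i : Fin d) :
    Tate.subst (K := K) G hG (Tate.X K i) = G i := by
  classical
  change ∑' m, Tate.sterm G (Tate.X K i) m = G i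
  rw [tsum_eq_single (Finsupp.single i 1)]
  · simp [Tate.sterm, Tate.X]
  · intro m hm
    simp [Tate.sterm, Tate.X, MvPowerSeries.coeff_X, hm]

theorem Tate.norm_subst_le (G : Fin d → R) (hG : ∀ i, ‖G i‖ ≤ 1) (f : Tate K d) :
    ‖Tate.subst G hG f‖ ≤ ‖f‖ :=
  IsUltrametricDist.norm_tsum_le_of_forall_le_of_nonneg (norm_nonneg f) fun m =>
    (Tate.norm_sterm_le G hG f m).trans (Tate.norm_coeff_le f m)

end Subst

instance : NormedAlgebra K C where
  norm_smul_le a x := by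
    rw [Algebra.smul_def, norm_mul]
    rfl

section Eval

variable [CompleteSpace C]

theorem Tate.term_eq_sterm (P : Fin d → C) (f : Tate K d) :
    Tate.term P f = Tate.sterm P f := by
  funext m
  rw [Tate.term, Tate.sterm, Algebra.smul_def]
  rfl

theorem Tate.eval_eq_subst (P : Fin d → C) (hP : ∀ i, ‖P i‖ ≤ 1) (f : Tate K d) :
    Tate.eval P hP f = Tate.subst P hP f := by
  change ∑' m, Tate.term P f m = ∑' m, Tate.sterm P f m
  rw [Tate.term_eq_sterm]

theorem Tate.norm_eval_le (P : Fin d → C) (hP : ∀ i, ‖P i‖ ≤ 1) (f : Tate K d) :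
    ‖Tate.eval P hP f‖ ≤ ‖f‖ := by
  rw [Tate.eval_eq_subst]
  exact Tate.norm_subst_le P hP f

/-- Evaluation does not increase norms, hence is continuous and can be moved inside the series.
Substitution thereby becomes a map on points. -/
theorem Tate.eval_subst [CompleteSpace K] (G : Fin d → Tate K d) (hG : ∀ i, ‖G i‖ ≤ 1)
    (P : Fin d → C) (hP : ∀ i, ‖P i‖ ≤ 1) (hGP : ∀ i, ‖Tate.eval P hP (G i)‖ ≤ 1)
    (f : Tate K d) :
    haveI : CompleteSpace (Tate K d) := Tate.completeSpace inferInstance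
    Tate.eval P hP (Tate.subst G hG f) = Tate.eval (fun i => Tate.eval P hP (G i)) hGP f := by
  have : CompleteSpace (Tate K d) := Tate.completeSpace inferInstance
  have hcont : Continuous (Tate.eval (K := K) P hP) :=
    AddMonoidHomClass.continuous_of_bound (Tate.eval (K := K) P hP) 1 fun f => by
      simpa using Tate.norm_eval_le P hP f
  rw [Tate.eval_eq_subst (fun i => Tate.eval P hP (G i))]
  change Tate.eval P hP (∑' m, Tate.sterm G f m) = ∑' m, Tate.sterm _ f m
  rw [(Tate.summable_sterm G hG f).map_tsum _ hcont]
  refine tsum_congr fun m => ?_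
  rw [Tate.sterm, Tate.sterm, map_smul, map_finsuppProd]
  simp

theorem norm_pow_sub_pow_le {R : Type*} [NormedCommRing R] [IsUltrametricDist R] [NormOneClass R]
    {x y : R} (hx : ‖x‖ ≤ 1) (hy : ‖y‖ ≤ 1) (e : ℕ) : ‖x ^ e - y ^ e‖ ≤ ‖x - y‖ := by
  induction e with
  | zero => simp
  | succ e ih =>
    have : x ^ (e + 1) - y ^ (e + 1) = x ^ e * (x - y) + (x ^ e - y ^ e) * y := by ring
    rw [this]
    refine (IsUltrametricDist.norm_add_le_max _ _).trans (max_le ?_ ?_)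
    · refine (norm_mul_le _ _).trans (mul_le_of_le_one_left (norm_nonneg _) ?_)
      exact (norm_pow_le _ _).trans (pow_le_one₀ (norm_nonneg _) hx)
    · exact (norm_mul_le _ _).trans ((mul_le_of_le_one_right (norm_nonneg _) hy).trans ih)

theorem norm_prod_sub_prod_le {ι : Type*} (s : Finset ι) {x y : ι → C} {δ : ℝ} (hδ : 0 ≤ δ)
    (hx : ∀ i, ‖x i‖ ≤ 1) (hy : ∀ i, ‖y i‖ ≤ 1) (h : ∀ i, ‖x i - y i‖ ≤ δ) :
    ‖∏ i ∈ s, x i - ∏ i ∈ s, y i‖ ≤ δ := by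
  classical
  induction s using Finset.induction_on with
  | empty => simpa using hδ
  | insert a s ha ih =>
    rw [Finset.prod_insert ha, Finset.prod_insert ha]
    have : x a * ∏ i ∈ s, x i - y a * ∏ i ∈ s, y i
      = x a * (∏ i ∈ s, x i - ∏ i ∈ s, y i) + (x a - y a) * ∏ i ∈ s, y i := by ring
    rw [this]
    refine (IsUltrametricDist.norm_add_le_max _ _).trans (max_le ?_ ?_)
    · rw [norm_mul]
      exact (mul_le_of_le_one_left (norm_nonneg _) (hx a)).trans ih
    · rw [norm_mul]
      refine (mul_le_of_le_one_right (norm_nonneg _) ?_).trans (h a)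
      rw [norm_prod]
      exact Finset.prod_le_one (fun _ _ => norm_nonneg _) fun i _ => hy i

/-- Monomials are 1-Lipschitz on the closed unit polydisc by telescoping products. The resulting
Lipschitz constant `‖f‖` makes a perturbation of norm less than one contracting. -/
theorem Tate.norm_eval_sub_le (f : Tate K d) {P P' : Fin d → C} (hP : ∀ i, ‖P i‖ ≤ 1)
    (hP' : ∀ i, ‖P' i‖ ≤ 1) {δ : ℝ} (hδ : 0 ≤ δ) (h : ∀ i, ‖P i - P' i‖ ≤ δ) :
    ‖Tate.eval P hP f - Tate.eval P' hP' f‖ ≤ ‖f‖ * δ := by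
  change ‖∑' m, Tate.term P f m - ∑' m, Tate.term P' f m‖ ≤ _
  rw [← (Tate.summable_term P hP f).tsum_sub (Tate.summable_term P' hP' f)]
  refine IsUltrametricDist.norm_tsum_le_of_forall_le_of_nonneg
    (mul_nonneg (norm_nonneg f) hδ) fun m => ?_
  rw [Tate.term, Tate.term, ← mul_sub, norm_mul]
  refine mul_le_mul (Tate.norm_coeff_le f m) ?_ (norm_nonneg _) (norm_nonneg _)
  refine norm_prod_sub_prod_le (ι := Fin d) m.support (x := fun i => P i ^ m i)
    (y := fun i => P' i ^ m i) hδ ?_ ?_ ?_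
  · exact fun i => by simpa using pow_le_one₀ (norm_nonneg _) (hP i)
  · exact fun i => by simpa using pow_le_one₀ (norm_nonneg _) (hP' i)
  · exact fun i => (norm_pow_sub_pow_le (hP i) (hP' i) _).trans (h i)

end Eval

/-- A strictly convergent power series is a polynomial up to a small error. -/
theorem Tate.exists_mvPolynomial (f : Tate K d) {δ : ℝ} (hδ : 0 < δ) :
    ∃ p : MvPolynomial (Fin d) K, (∀ m, ‖MvPolynomial.coeff m p‖ ≤ ‖f‖) ∧
      ‖f - MvPolynomial.aeval (Tate.X K) p‖ ≤ δ := by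
  classical
  have hfin := (Tate.tendsto_coeff f).eventually (gt_mem_nhds hδ)
  rw [eventually_cofinite] at hfin
  -- Truncation: only the finitely many coefficients of norm at least `δ` are kept.
  let p : MvPolynomial (Fin d) K :=
    ∑ m ∈ hfin.toFinset, MvPolynomial.monomial m (MvPowerSeries.coeff m f.1)
  have hp : ∀ m, MvPolynomial.coeff m p =
      if m ∈ hfin.toFinset then MvPowerSeries.coeff m f.1 else 0 := fun m => by
    simp only [p, MvPolynomial.coeff_sum, MvPolynomial.coeff_monomial, Finset.sum_ite_eq']
  refine ⟨p, fun m => ?_, Tate.norm_le fun m => ?_⟩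
  · rw [hp]
    split_ifs
    · exact Tate.norm_coeff_le f m
    · simp
  · have h1 : ((MvPolynomial.aeval (Tate.X K) p : Tate K d) : MvPowerSeries (Fin d) K)
        = (p : MvPowerSeries (Fin d) K) := by
      have : (Tate K d).val.comp (MvPolynomial.aeval (Tate.X K))
          = MvPolynomial.coeToMvPowerSeries.algHom (R := K) (σ := Fin d) K := by
        apply MvPolynomial.algHom_ext
        intro i
        simp [Tate.X]
      simpa using congrArg (fun h => h p) this
    have h2 : MvPowerSeries.coeff m (f - MvPolynomial.aeval (Tate.X K) p).1
        = MvPowerSeries.coeff m f.1 - MvPolynomial.coeff m p := by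
      rw [← MvPolynomial.coeff_coe, ← h1]
      simp
    rw [h2, hp]
    split_ifs with hm
    · simpa using hδ.le
    · rw [sub_zero]
      rw [hfin.mem_toFinset] at hm
      simpa using (not_not.mp hm).le

end TateNorm

section Ultra

variable {S : Type*} [SeminormedAddCommGroup S] [IsUltrametricDist S] {x y : S} {r : ℝ}

theorem norm_add_le_of_le' (hx : ‖x‖ ≤ r) (hy : ‖y‖ ≤ r) : ‖x + y‖ ≤ r :=
  (IsUltrametricDist.norm_add_le_max x y).trans (max_le hx hy)

theorem norm_add_lt_of_lt' (hx : ‖x‖ < r) (hy : ‖y‖ < r) : ‖x + y‖ < r :=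
  (IsUltrametricDist.norm_add_le_max x y).trans_lt (max_lt hx hy)

theorem norm_sub_le_of_le' (hx : ‖x‖ ≤ r) (hy : ‖y‖ ≤ r) : ‖x - y‖ ≤ r := by
  rw [sub_eq_add_neg]
  exact norm_add_le_of_le' hx (by rwa [norm_neg])

theorem norm_sub_lt_of_lt' (hx : ‖x‖ < r) (hy : ‖y‖ < r) : ‖x - y‖ < r := by
  rw [sub_eq_add_neg]
  exact norm_add_lt_of_lt' hx (by rwa [norm_neg])

theorem norm_eq_of_sub_lt (h : ‖x - y‖ < ‖y‖) : ‖x‖ = ‖y‖ := by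
  have e : x = (x - y) + y := by abel
  rw [e, IsUltrametricDist.norm_add_eq_max_of_norm_ne_norm h.ne, max_eq_right h.le]

end Ultra

/-! ### Bounding coefficients by values at points with distinct reductions -/

section Coeff

variable {C : Type*} [NormedField C] [IsUltrametricDist C]

/-- A polynomial that is small at sufficiently many points at mutual distance one has small
coefficients. -/
theorem norm_coeff_lt_of_norm_eval_lt {δ : ℝ} (hδ : 0 < δ) (n : ℕ) (p : Polynomial C)
    (hp : p.degree < n) (S : Finset C) (hS : n ≤ S.card) (hS1 : ∀ x ∈ S, ‖x‖ ≤ 1)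
    (hS2 : ∀ x ∈ S, ∀ y ∈ S, x ≠ y → ‖x - y‖ = 1) (h : ∀ x ∈ S, ‖p.eval x‖ < δ) (j : ℕ) :
    ‖p.coeff j‖ < δ := by
  classical
  induction n generalizing p S j with
  | zero =>
    have : p = 0 := by
      rw [← Polynomial.degree_eq_bot]
      exact Nat.WithBot.lt_zero_iff.mp (by simpa using hp)
    simpa [this] using hδ
  | succ n ih =>
    obtain ⟨x0, hx0⟩ : S.Nonempty := Finset.card_pos.mp (by omega)
    -- Divided differences: at the other points `x - x0` has norm one, so `q` is as small there as
    -- `p` is, and its degree has dropped.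
    set q := p /ₘ (Polynomial.X - Polynomial.C x0) with hq
    have e : p = (Polynomial.X - Polynomial.C x0) * q + Polynomial.C (p.eval x0) := by
      conv_lhs => rw [← Polynomial.modByMonic_add_div p (Polynomial.X - Polynomial.C x0)]
      rw [Polynomial.modByMonic_X_sub_C_eq_C_eval, add_comm]
    have hqd : q.degree < n := by
      by_cases hp0 : p = 0
      · rw [hq, hp0, Polynomial.zero_divByMonic, Polynomial.degree_zero]
        exact WithBot.bot_lt_coe n
      · have := Polynomial.degree_divByMonic_lt p (Polynomial.X - Polynomial.C x0) hp0 (by simp)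
        refine this.trans_le ?_
        rw [Polynomial.degree_eq_natDegree hp0] at hp ⊢
        have : p.natDegree < n + 1 := by exact_mod_cast hp
        exact_mod_cast Nat.lt_succ_iff.mp this
    have hqc : ∀ j, ‖q.coeff j‖ < δ := by
      refine ih q hqd (S.erase x0) (by rw [Finset.card_erase_of_mem hx0]; omega)
        (fun x hx => hS1 x (Finset.mem_of_mem_erase hx))
        (fun x hx y hy => hS2 x (Finset.mem_of_mem_erase hx) y (Finset.mem_of_mem_erase hy)) ?_
      intro x hx
      have hx' := Finset.mem_erase.mp hx
      have h1 : (x - x0) * q.eval x = p.eval x - p.eval x0 := by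
        conv_rhs => rw [e]
        simp
      have h2 : ‖q.eval x‖ = ‖p.eval x - p.eval x0‖ := by
        rw [← h1, norm_mul, hS2 x hx'.2 x0 hx0 hx'.1, one_mul]
      rw [h2]
      exact norm_sub_lt_of_lt' (h x hx'.2) (h x0 hx0)
    rw [e]
    have hX : ∀ j, ‖(Polynomial.X * q).coeff j‖ < δ := by
      rintro (_ | j)
      · simpa using hδ
      · simpa using hqc j
    rw [sub_mul, Polynomial.coeff_add, Polynomial.coeff_sub, Polynomial.coeff_C_mul]
    refine norm_add_lt_of_lt' (norm_sub_lt_of_lt' (hX j) ?_) ?_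
    · rw [norm_mul]
      exact (mul_le_of_le_one_left (norm_nonneg _) (hS1 x0 hx0)).trans_lt (hqc j)
    · rw [Polynomial.coeff_C]
      split_ifs
      · exact h x0 hx0
      · simpa using hδ

theorem norm_eq_zero_or_one_of_pow_eq_self {t : C} {N : ℕ} (hN : 2 ≤ N) (h : t ^ N = t) :
    t = 0 ∨ ‖t‖ = 1 := by
  by_cases h0 : t = 0
  · exact Or.inl h0
  · right
    have h1 : t ^ (N - 1) = 1 := by
      have : t * t ^ (N - 1) = t * 1 := by rw [← pow_succ', Nat.sub_add_cancel (by omega), h, mul_one]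
      exact mul_left_cancel₀ h0 this
    have h2 : ‖t‖ ^ (N - 1) = 1 := by rw [← norm_pow, h1, norm_one]
    exact (pow_eq_one_iff_of_nonneg (norm_nonneg _) (by omega)).mp h2

theorem norm_le_one_of_pow_eq_self {t : C} {N : ℕ} (hN : 2 ≤ N) (h : t ^ N = t) : ‖t‖ ≤ 1 := by
  rcases norm_eq_zero_or_one_of_pow_eq_self hN h with h | h
  · simp [h]
  · exact h.le

/-- This is the field with `p^e` elements inside `C`: the polynomial is separable, and the
difference of two roots is again a root, hence of norm one if nonzero. Sets of this kind serve as
test points for `norm_coeff_lt_of_norm_eval_lt`. -/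
theorem exists_finset_pow_eq_self [IsAlgClosed C] (p : ℕ) [Fact p.Prime] [CharP C p] (e : ℕ)
    (he : e ≠ 0) : ∃ S : Finset C, S.card = p ^ e ∧ (∀ t, t ∈ S ↔ t ^ p ^ e = t) ∧
      (∀ t ∈ S, ‖t‖ ≤ 1) ∧ (∀ s ∈ S, ∀ t ∈ S, s ≠ t → ‖s - t‖ = 1) := by
  classical
  have hp : 1 < p := (Fact.out : p.Prime).one_lt
  have hN : 2 ≤ p ^ e := hp.trans_le (Nat.le_self_pow he p)
  set f : Polynomial C := Polynomial.X ^ p ^ e - Polynomial.X with hf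
  have hd : f.natDegree = p ^ e := FiniteField.X_pow_card_pow_sub_X_natDegree_eq C he hp
  have hf0 : f ≠ 0 := fun h => by
    rw [h, Polynomial.natDegree_zero] at hd
    omega
  have hcard := Polynomial.card_rootSet_eq_natDegree (K := C)
    (galois_poly_separable (K := C) p (p ^ e) (dvd_pow_self p he)) (IsAlgClosed.splits _)
  have hmem : ∀ t, t ∈ (f.rootSet C).toFinset ↔ t ^ p ^ e = t := fun t => by
    rw [Set.mem_toFinset, Polynomial.mem_rootSet]
    have : Polynomial.aeval t f = t ^ p ^ e - t := by simp [hf]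
    rw [this, sub_eq_zero]
    exact and_iff_right hf0
  refine ⟨(f.rootSet C).toFinset, ?_, hmem, ?_, ?_⟩
  · rw [Set.toFinset_card, hcard, hd]
  · exact fun t ht => norm_le_one_of_pow_eq_self hN ((hmem t).mp ht)
  · intro s hs t ht hst
    have : (s - t) ^ p ^ e = s - t := by
      rw [sub_pow_char_pow, (hmem s).mp hs, (hmem t).mp ht]
    exact (norm_eq_zero_or_one_of_pow_eq_self hN this).resolve_left (sub_ne_zero.mpr hst)

end Coeff

theorem aeval_intPoly_map {R S : Type*} [Ring R] [Ring S] [Algebra ℤ R] [Algebra ℤ S] (f : R →+* S)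
    {x : R} {y : S} (h : f x = y) (g : Polynomial ℤ) :
    f (Polynomial.aeval x g) = Polynomial.aeval y g := by
  rw [Polynomial.aeval_def, Polynomial.aeval_def, Polynomial.hom_eval₂, h]
  congr 1
  exact RingHom.ext_int _ _

/-! ### Points near the solutions of the model equations -/

section Chart

variable {C : Type*} [NormedField C] [IsUltrametricDist C] [CompleteSpace C]
  {K : Subfield C}

/-- The value in the coordinates `X` and `Y` of a polynomial in two variables. -/
def evT (K : Subfield C) : Polynomial (Polynomial K) →+* Tate K 3 :=
  Polynomial.eval₂RingHom (Polynomial.eval₂RingHom (algebraMap K (Tate K 3)) (Tate.X K 2))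
    (Tate.X K 1)

/-- The polynomial in one variable obtained by specializing the second variable. -/
def specY (K : Subfield C) (y : C) : Polynomial (Polynomial K) →+* Polynomial C :=
  Polynomial.mapRingHom (Polynomial.eval₂RingHom (algebraMap K C) y)

theorem eval_evT (P : Fin 3 → C) (hP : ∀ i, ‖P i‖ ≤ 1) (r : Polynomial (Polynomial K)) :
    Tate.eval P hP (evT K r) = (specY K (P 2) r).eval (P 1) := by
  have : (Tate.eval (K := K) P hP).toRingHom.comp (evT K)
      = (Polynomial.evalRingHom (P 1)).comp (specY K (P 2)) := by
    refine Polynomial.ringHom_ext' (Polynomial.ringHom_ext' ?_ ?_) ?_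
    · ext a
      simp [evT, specY]
    · simp [evT, specY, Tate.eval_X]
    · simp [evT, specY, Tate.eval_X]
  exact congrArg (fun h => h r) this

/-- The equations `f1 = f2 = 0` with `Y = y` fixed say that `(u_0, X)` is a fixed point of `Φ`. The
linear term `X` of the Artin-Schreier equation is what allows solving for `X`: the remaining term
`X^{p^e}` is an additive contraction near `x0`, and the errors `s1`, `s2` are Lipschitz with
constant `ε < 1`. -/
theorem exists_point_of_approx {p : ℕ} [Fact p.Prime] [CharP C p] {e : ℕ} (he : e ≠ 0)
    {f1 f2 s1 s2 : Tate K 3} {cc g : Polynomial ℤ}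
    (hf1 : f1 = Tate.X K 1 - Tate.X K 1 ^ p ^ e + Polynomial.aeval (Tate.X K 2) cc + s1)
    (hf2 : f2 = Tate.X K 0 - Polynomial.aeval (Tate.X K 2) g + s2)
    {ε : ℝ} (hε : ε < 1) (hs1 : ‖s1‖ ≤ ε) (hs2 : ‖s2‖ ≤ ε)
    {x0 y : C} (hx0 : ‖x0‖ ≤ 1) (hy : ‖y‖ ≤ 1)
    (h0 : x0 ^ p ^ e - x0 - Polynomial.aeval y cc = 0) :
    ∃ P : Fin 3 → C, ∃ hP : ∀ i, ‖P i‖ ≤ 1, Tate.eval P hP f1 = 0 ∧ Tate.eval P hP f2 = 0 ∧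
      P 2 = y ∧ ‖P 1 - x0‖ ≤ ε := by
  have hε0 : 0 ≤ ε := (norm_nonneg _).trans hs1
  have hN : 2 ≤ p ^ e := (Fact.out : p.Prime).two_le.trans (Nat.le_self_pow he p)
  have hpoly : ∀ g : Polynomial ℤ, ‖Polynomial.aeval y g‖ ≤ 1 := fun g => by
    rw [Polynomial.aeval_eq_sum_range]
    refine IsUltrametricDist.norm_sum_le_of_forall_le_of_nonneg zero_le_one fun i _ => ?_
    rw [zsmul_eq_mul, norm_mul, norm_pow]
    refine mul_le_one₀ ?_ (by positivity) (pow_le_one₀ (norm_nonneg _) hy)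
    exact IsUltrametricDist.norm_intCast_le_one C _
  let V : C × C → Fin 3 → C := fun z => ![z.1, z.2, y]
  let s : Set (C × C) := {z | ‖z.1‖ ≤ 1 ∧ ‖z.2 - x0‖ ≤ ε}
  have hV : ∀ z ∈ s, ∀ i, ‖V z i‖ ≤ 1 := fun z hz i => by
    fin_cases i
    · exact hz.1
    · change ‖z.2‖ ≤ 1
      rw [← sub_add_cancel z.2 x0]
      exact norm_add_le_of_le' (hz.2.trans hε.le) hx0
    · exact hy
  let Φ : C × C → C × C := fun z =>
    (Polynomial.aeval y g - ∑' m, Tate.term (V z) s2 m,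
      z.2 ^ p ^ e - Polynomial.aeval y cc - ∑' m, Tate.term (V z) s1 m)
  have hts : ∀ t : Tate K 3, ‖t‖ ≤ ε → ∀ z ∈ s, ‖∑' m, Tate.term (V z) t m‖ ≤ ε :=
    fun t ht z hz => (Tate.norm_eval_le (V z) (hV z hz) t).trans ht
  have hmaps : Set.MapsTo Φ s s := by
    intro z hz
    refine ⟨norm_sub_le_of_le' (hpoly g) ((hts s2 hs2 z hz).trans hε.le), ?_⟩
    have e1 : (Φ z).2 - x0 = (z.2 - x0) ^ p ^ e - ∑' m, Tate.term (V z) s1 m := by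
      rw [sub_pow_char_pow]
      linear_combination h0
    rw [e1]
    refine norm_sub_le_of_le' ?_ (hts s1 hs1 z hz)
    rw [norm_pow]
    exact (pow_le_of_le_one (norm_nonneg _) (hz.2.trans hε.le) (by omega)).trans hz.2
  have hcomplete : IsComplete s := by
    refine IsClosed.isComplete ?_
    exact (isClosed_le continuous_fst.norm continuous_const).inter
      (isClosed_le (continuous_snd.sub continuous_const).norm continuous_const)
  have hcontr : ContractingWith ⟨ε, hε0⟩ (hmaps.restrict Φ s s) := by
    refine ⟨by exact_mod_cast hε, LipschitzWith.of_dist_le_mul ?_⟩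
    rintro ⟨z, hz⟩ ⟨z', hz'⟩
    change dist (Φ z) (Φ z') ≤ ε * dist z z'
    have hd : ∀ i, ‖V z i - V z' i‖ ≤ dist z z' := fun i => by
      rw [Prod.dist_eq, dist_eq_norm, dist_eq_norm]
      fin_cases i
      · exact le_max_left _ _
      · exact le_max_right _ _
      · change ‖y - y‖ ≤ _
        simp
    have hsub : ∀ t : Tate K 3, ‖t‖ ≤ ε →
        ‖∑' m, Tate.term (V z) t m - ∑' m, Tate.term (V z') t m‖ ≤ ε * dist z z' := fun t ht =>
      (Tate.norm_eval_sub_le t (hV z hz) (hV z' hz') dist_nonneg hd).trans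
        (mul_le_mul_of_nonneg_right ht dist_nonneg)
    rw [Prod.dist_eq, dist_eq_norm, dist_eq_norm]
    refine max_le ?_ ?_
    · have : (Φ z).1 - (Φ z').1
        = -(∑' m, Tate.term (V z) s2 m - ∑' m, Tate.term (V z') s2 m) := by ring
      rw [this, norm_neg]
      exact hsub s2 hs2
    · have : (Φ z).2 - (Φ z').2 = (z.2 - z'.2) ^ p ^ e
        - (∑' m, Tate.term (V z) s1 m - ∑' m, Tate.term (V z') s1 m) := by
        rw [sub_pow_char_pow]; ring
      rw [this]
      refine norm_sub_le_of_le' ?_ (hsub s1 hs1)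
      have hzz : ‖z.2 - z'.2‖ ≤ ε := by
        have : z.2 - z'.2 = (z.2 - x0) - (z'.2 - x0) := by ring
        rw [this]
        exact norm_sub_le_of_le' hz.2 hz'.2
      rw [norm_pow]
      -- Both points lie within `ε` of `x0`, so one factor of a square already supplies the
      -- contraction constant.
      calc ‖z.2 - z'.2‖ ^ p ^ e ≤ ‖z.2 - z'.2‖ ^ 2 :=
            pow_le_pow_of_le_one (norm_nonneg _) (hzz.trans hε.le) hN
        _ = ‖z.2 - z'.2‖ * ‖z.2 - z'.2‖ := sq _
        _ ≤ ε * dist z z' := mul_le_mul hzz (by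
            rw [Prod.dist_eq, ← dist_eq_norm]; exact le_max_right _ _) (norm_nonneg _) hε0
  obtain ⟨z, hz, hfix, -⟩ := hcontr.exists_fixedPoint' hcomplete hmaps
    (x := (0, x0)) ⟨by simp, by simpa using hε0⟩ (edist_ne_top _ _)
  have hfix1 : (Φ z).1 = z.1 := congrArg Prod.fst hfix
  have hfix2 : (Φ z).2 = z.2 := congrArg Prod.snd hfix
  have haev : ∀ g : Polynomial ℤ, Tate.eval (V z) (hV z hz) (Polynomial.aeval (Tate.X K 2) g)
      = Polynomial.aeval y g := fun g => by
    exact aeval_intPoly_map (Tate.eval (K := K) (V z) (hV z hz)).toRingHom (Tate.eval_X _ _ 2) g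
  refine ⟨V z, hV z hz, ?_, ?_, rfl, hz.2⟩
  · rw [hf1, map_add, map_add, map_sub, map_pow, haev, Tate.eval_X]
    change z.2 - z.2 ^ p ^ e + Polynomial.aeval y cc + ∑' m, Tate.term (V z) s1 m = 0
    linear_combination -hfix2
  · rw [hf2, map_add, map_sub, haev, Tate.eval_X]
    change z.1 - Polynomial.aeval y g + ∑' m, Tate.term (V z) s2 m = 0
    linear_combination -hfix1

end Chart

/-! ### Polynomial normal forms modulo the chart equations -/

section ChartThm

variable {C : Type*} [NormedField C] [IsUltrametricDist C] [CompleteSpace C] {K : Subfield C}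

/-- The ideal `I` describes, up to a small perturbation, the curve `X^{p^e} - X = cc(Y)`, with
`u_0 = g(Y)`. -/
structure IsChart (I : Ideal (Tate K 3)) (p e : ℕ) (cc g : Polynomial ℤ) (ε : ℝ)
    (f1 f2 s1 s2 : Tate K 3) : Prop where
  pos : e ≠ 0
  eq1 : f1 = Tate.X K 1 - Tate.X K 1 ^ p ^ e + Polynomial.aeval (Tate.X K 2) cc + s1
  eq2 : f2 = Tate.X K 0 - Polynomial.aeval (Tate.X K 2) g + s2
  lt_one : ε < 1
  norm1 : ‖s1‖ ≤ ε
  norm2 : ‖s2‖ ≤ ε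
  mem1 : f1 ∈ I
  mem2 : f2 ∈ I
  point : ∀ (P : Fin 3 → C) (hP : ∀ i, ‖P i‖ ≤ 1),
    Tate.eval P hP f1 = 0 → Tate.eval P hP f2 = 0 → P ∈ Points I

variable {I : Ideal (Tate K 3)} {p e : ℕ} {cc g : Polynomial ℤ} {ε : ℝ} {f1 f2 s1 s2 : Tate K 3}

theorem evalAt_mk (P : Points I) (f : Tate K 3) :
    evalAt P (AffAlg.mk I f) = Tate.eval P.1 P.2.choose f := rfl

theorem specY_coeff_coeff (y : C) (r : Polynomial (Polynomial K)) (j : ℕ) :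
    (specY K y r).coeff j = (((r.coeff j).map (algebraMap K C))).eval y := by
  rw [specY, Polynomial.coe_mapRingHom, Polynomial.coeff_map, Polynomial.coe_eval₂RingHom,
    Polynomial.eval_map]

/-- The supremum norm of a polynomial in normal form is at least its Gauss norm. -/
theorem IsChart.exists_norm_coeff_le [IsAlgClosed C] [Fact p.Prime] [CharP C p]
    (h : IsChart I p e cc g ε f1 f2 s1 s2) (r : Polynomial (Polynomial K)) (hr : r.degree < (p ^ e : ℕ))
    (j i : ℕ) : ∃ P : Points I, ‖((r.coeff j).coeff i : K)‖ ≤ ‖evalAt P (AffAlg.mk I (evT K r))‖ := by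
  classical
  have hroot : ∀ y : C, ∃ x0 : C, x0 ^ p ^ e - x0 - Polynomial.aeval y cc = 0 := fun y => by
    have hN : 1 < p ^ e := Nat.one_lt_pow h.pos (Fact.out : p.Prime).one_lt
    have hd : (Polynomial.X ^ p ^ e - (Polynomial.X + Polynomial.C (Polynomial.aeval y cc))
        : Polynomial C).degree = (p ^ e : ℕ) := by
      apply Polynomial.degree_sub_eq_left_of_degree_lt ?_ |>.trans (Polynomial.degree_X_pow _)
      rw [Polynomial.degree_X_pow, Polynomial.degree_X_add_C]
      exact_mod_cast hN
    obtain ⟨x, hx⟩ := IsAlgClosed.exists_root _ (by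
      rw [hd]; exact_mod_cast (by omega : p ^ e ≠ 0))
    refine ⟨x, ?_⟩
    rw [Polynomial.IsRoot] at hx
    simpa [sub_sub] using hx
  have hpoly : ∀ y : C, ‖y‖ ≤ 1 → ‖Polynomial.aeval y cc‖ ≤ 1 := fun y hy => by
    rw [Polynomial.aeval_eq_sum_range]
    refine IsUltrametricDist.norm_sum_le_of_forall_le_of_nonneg zero_le_one fun i _ => ?_
    rw [zsmul_eq_mul, norm_mul, norm_pow]
    refine mul_le_one₀ ?_ (by positivity) (pow_le_one₀ (norm_nonneg _) hy)
    exact IsUltrametricDist.norm_intCast_le_one C _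
  have hx0 : ∀ y x0 : C, ‖y‖ ≤ 1 → x0 ^ p ^ e - x0 - Polynomial.aeval y cc = 0 → ‖x0‖ ≤ 1 := by
    intro y x0 hy hx
    by_contra! hlt
    have h1 : ‖x0‖ < ‖x0‖ ^ p ^ e := by
      conv_lhs => rw [← pow_one ‖x0‖]
      exact pow_lt_pow_right₀ hlt (Nat.one_lt_pow h.pos (Fact.out : p.Prime).one_lt)
    have e1 : x0 ^ p ^ e = x0 + Polynomial.aeval y cc := by linear_combination hx
    have := norm_add_le_of_le' (r := ‖x0‖) (le_refl ‖x0‖) ((hpoly y hy).trans hlt.le)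
    rw [← e1, norm_pow] at this
    exact absurd this (not_le.mpr h1)
  obtain ⟨E, hEc, hE, hE1, hE2⟩ := exists_finset_pow_eq_self (C := C) p e h.pos
  -- Over each `y` the model has the solutions `x0 + t` with `t` in the field of `p^e` elements;
  -- lifting all of them gives `p^e` points of the fibre, pairwise at distance one.
  have hpts : ∀ y : C, ‖y‖ ≤ 1 → ∃ S : Finset C, S.card = p ^ e ∧ (∀ x ∈ S, ‖x‖ ≤ 1) ∧
      (∀ x ∈ S, ∀ x' ∈ S, x ≠ x' → ‖x - x'‖ = 1) ∧
      ∀ x ∈ S, ∃ P : Points I, P.1 1 = x ∧ P.1 2 = y := by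
    intro y hy
    obtain ⟨x0, hx⟩ := hroot y
    have hxy := hx0 y x0 hy hx
    have : ∀ t ∈ E, ∃ P : Fin 3 → C, ∃ hP : ∀ i, ‖P i‖ ≤ 1,
        Tate.eval P hP f1 = 0 ∧ Tate.eval P hP f2 = 0 ∧ P 2 = y ∧ ‖P 1 - (x0 + t)‖ ≤ ε := by
      intro t ht
      refine exists_point_of_approx h.pos h.eq1 h.eq2 h.lt_one h.norm1 h.norm2
        (norm_add_le_of_le' hxy (hE1 t ht)) hy ?_
      rw [add_pow_char_pow, (hE t).mp ht]
      linear_combination hx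
    choose! P hP h1 h2 h3 h4 using this
    -- The lifts move the solutions by at most `ε < 1`, which does not change distances equal to
    -- one.
    have hdist : ∀ s ∈ E, ∀ t ∈ E, s ≠ t → ‖P s 1 - P t 1‖ = 1 := by
      intro s hs t ht hst
      have h5 : P s 1 - P t 1 - (s - t) = (P s 1 - (x0 + s)) - (P t 1 - (x0 + t)) := by ring
      have h6 : ‖P s 1 - P t 1 - (s - t)‖ < ‖s - t‖ := by
        rw [h5, hE2 s hs t ht hst]
        exact (norm_sub_le_of_le' (h4 s hs) (h4 t ht)).trans_lt h.lt_one
      rw [norm_eq_of_sub_lt h6, hE2 s hs t ht hst]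
    have hinj : Set.InjOn (fun t => P t 1) E := fun s hs t ht hst => by
      by_contra hne
      have := hdist s hs t ht hne
      rw [show P s 1 = P t 1 from hst] at this
      simp at this
    refine ⟨E.image fun t => P t 1, by rw [Finset.card_image_of_injOn hinj, hEc], ?_, ?_, ?_⟩
    · simp only [Finset.forall_mem_image]
      exact fun t ht => hP t ht 1
    · simp only [Finset.forall_mem_image]
      intro s hs t ht hst
      exact hdist s hs t ht fun h => hst (by rw [h])
    · simp only [Finset.forall_mem_image]
      intro t ht
      exact ⟨⟨P t, h.point (P t) (hP t ht) (h1 t ht) (h2 t ht)⟩, rfl, h3 t ht⟩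
  by_contra! hlt
  have hval : ∀ P : Points I, evalAt P (AffAlg.mk I (evT K r))
      = (specY K (P.1 2) r).eval (P.1 1) := fun P => by
    rw [evalAt_mk, eval_evT]
  have hδ : 0 < ‖((r.coeff j).coeff i : K)‖ := by
    obtain ⟨S, hS, -, -, hS'⟩ := hpts 0 (by simp)
    obtain ⟨x, hx⟩ : S.Nonempty := Finset.card_pos.mp (by
      rw [hS]; exact pow_pos (Fact.out : p.Prime).pos _)
    obtain ⟨P, -⟩ := hS' x hx
    exact (norm_nonneg _).trans_lt (hlt P)
  -- First application of `norm_coeff_lt_of_norm_eval_lt`, in the variable `X`: the `X`-degree is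
  -- below the number of points of the fibre.
  have hcoef : ∀ y : C, ‖y‖ ≤ 1 →
      ‖((r.coeff j).map (algebraMap K C)).eval y‖ < ‖((r.coeff j).coeff i : K)‖ := by
    intro y hy
    obtain ⟨S, hS, hS1, hS2, hS3⟩ := hpts y hy
    rw [← specY_coeff_coeff]
    refine norm_coeff_lt_of_norm_eval_lt hδ (p ^ e) (specY K y r) ?_ S hS.ge hS1 hS2 ?_ j
    · exact (Polynomial.degree_map_le).trans_lt hr
    · intro x hx
      obtain ⟨P, rfl, rfl⟩ := hS3 x hx
      rw [← hval]
      exact hlt P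
  -- Second application, in the variable `Y`. Here any point of the disc is available, and `p^d ≥ d`
  -- exceeds the degree.
  set d := (r.coeff j).natDegree + 1 with hd
  obtain ⟨S, hS, -, hS1, hS2⟩ := exists_finset_pow_eq_self (C := C) p d (by omega)
  have := norm_coeff_lt_of_norm_eval_lt hδ d ((r.coeff j).map (algebraMap K C))
    (Polynomial.degree_map_le.trans_lt (Polynomial.degree_le_natDegree.trans_lt
      (by exact_mod_cast Nat.lt_succ_self _))) S
    (by rw [hS]; exact (Nat.lt_pow_self (Fact.out : p.Prime).one_lt).le) hS1 hS2
    (fun x hx => hcoef x (hS1 x hx)) i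
  rw [Polynomial.coeff_map] at this
  exact absurd this (lt_irrefl _)

/-- The polynomial defining the curve, over the valuation ring. -/
def chartPoly (R : Type*) [CommRing R] (N : ℕ) (cc : Polynomial ℤ) : Polynomial (Polynomial R) :=
  Polynomial.X ^ N - (Polynomial.X + Polynomial.C (cc.map (Int.castRingHom R)))

theorem chartPoly_degree_lt (R : Type*) [CommRing R] [Nontrivial R] {N : ℕ} (hN : 1 < N)
    (cc : Polynomial ℤ) :
    (Polynomial.X + Polynomial.C (cc.map (Int.castRingHom R)) : Polynomial (Polynomial R)).degree
      < N := by
  rw [Polynomial.degree_X_add_C]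
  exact_mod_cast hN

theorem chartPoly_monic (R : Type*) [CommRing R] [Nontrivial R] {N : ℕ} (hN : 1 < N)
    (cc : Polynomial ℤ) : (chartPoly R N cc).Monic :=
  Polynomial.monic_X_pow_sub (chartPoly_degree_lt R hN cc)

theorem chartPoly_degree (R : Type*) [CommRing R] [Nontrivial R] {N : ℕ} (hN : 1 < N)
    (cc : Polynomial ℤ) : (chartPoly R N cc).degree = N := by
  rw [chartPoly, Polynomial.degree_sub_eq_left_of_degree_lt, Polynomial.degree_X_pow]
  rw [Polynomial.degree_X_pow]
  exact chartPoly_degree_lt R hN cc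

theorem chartPoly_map {R S : Type*} [CommRing R] [CommRing S] (f : R →+* S) (N : ℕ)
    (cc : Polynomial ℤ) :
    (chartPoly R N cc).map (Polynomial.mapRingHom f) = chartPoly S N cc := by
  have : f.comp (Int.castRingHom R) = Int.castRingHom S := RingHom.ext_int _ _
  simp [chartPoly, Polynomial.map_map, this]

/-- The inclusion of the polynomials with integral coefficients. -/
def intPoly (K : Subfield C) :
    Polynomial (Polynomial (intRing K)) →+* Polynomial (Polynomial K) :=
  Polynomial.mapRingHom (Polynomial.mapRingHom (intRing K).subtype)

theorem norm_evT_le (r : Polynomial (Polynomial K)) {δ : ℝ} (hδ : 0 ≤ δ)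
    (hr : ∀ j i, ‖((r.coeff j).coeff i : K)‖ ≤ δ) : ‖evT K r‖ ≤ δ := by
  have hX : ∀ (i : Fin 3) (k : ℕ), ‖Tate.X K i ^ k‖ ≤ 1 := fun i k =>
    (norm_pow_le _ _).trans (pow_le_one₀ (norm_nonneg _) (Tate.norm_X_le _))
  have h1 : ∀ j, ‖Polynomial.eval₂ (algebraMap K (Tate K 3)) (Tate.X K 2) (r.coeff j)‖ ≤ δ := by
    intro j
    rw [Polynomial.eval₂_eq_sum_range]
    refine IsUltrametricDist.norm_sum_le_of_forall_le_of_nonneg hδ fun i _ => ?_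
    refine (norm_mul_le _ _).trans ?_
    rw [norm_algebraMap', ← mul_one δ]
    exact mul_le_mul (hr j i) (hX _ _) (norm_nonneg _) hδ
  rw [evT, Polynomial.coe_eval₂RingHom, Polynomial.eval₂_eq_sum_range]
  refine IsUltrametricDist.norm_sum_le_of_forall_le_of_nonneg hδ fun i _ => ?_
  refine (norm_mul_le _ _).trans ?_
  rw [← mul_one δ]
  exact mul_le_mul (h1 i) (hX _ _) (norm_nonneg _) hδ

theorem intPoly_coeff_coeff (r : Polynomial (Polynomial (intRing K))) (j i : ℕ) :
    ((intPoly K r).coeff j).coeff i = (((r.coeff j).coeff i : intRing K) : K) := by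
  simp [intPoly]

theorem norm_evT_intPoly_le (r : Polynomial (Polynomial (intRing K))) :
    ‖evT K (intPoly K r)‖ ≤ 1 :=
  norm_evT_le _ zero_le_one fun j i => by
    rw [intPoly_coeff_coeff]
    exact ((r.coeff j).coeff i).2

theorem evT_chartPoly (N : ℕ) (cc : Polynomial ℤ) :
    evT K (intPoly K (chartPoly (intRing K) N cc))
      = Tate.X K 1 ^ N - (Tate.X K 1 + Polynomial.aeval (Tate.X K 2) cc) := by
  have : intPoly K (chartPoly (intRing K) N cc) = chartPoly K N cc := chartPoly_map _ _ _
  rw [this, chartPoly, map_sub, map_add, map_pow]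
  have hX : evT K Polynomial.X = Tate.X K 1 := by simp [evT]
  have hc : evT K (Polynomial.C (cc.map (Int.castRingHom K)))
      = Polynomial.aeval (Tate.X K 2) cc := by
    rw [evT, Polynomial.coe_eval₂RingHom, Polynomial.eval₂_C, Polynomial.coe_eval₂RingHom,
      Polynomial.eval₂_map, Polynomial.aeval_def]
    congr 1
    exact RingHom.ext_int _ _
  rw [hX, hc]

/-- The elements that are polynomials in normal form up to multiples of the equations and a
small error. -/
theorem IsChart.exists_approx (h : IsChart I p e cc g ε f1 f2 s1 s2) (hp : p.Prime) (hε : 0 < ε)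
    (F : Tate K 3) (hF : ‖F‖ ≤ 1) :
    ∃ (Q1 Q2 : Tate K 3) (r : Polynomial (Polynomial (intRing K))), ‖Q1‖ ≤ 1 ∧ ‖Q2‖ ≤ 1 ∧
      r.degree < (p ^ e : ℕ) ∧ ‖F - Q1 * f1 - Q2 * f2 - evT K (intPoly K r)‖ ≤ ε := by
  have hN : 1 < p ^ e := Nat.one_lt_pow h.pos hp.one_lt
  have hmul : ∀ {a b : Tate K 3} {s : ℝ}, 0 ≤ s → ‖a‖ ≤ 1 → ‖b‖ ≤ s → ‖a * b‖ ≤ s :=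
    fun {a b s} hs ha hb => (norm_mul_le _ _).trans
      ((mul_le_mul ha hb (norm_nonneg _) zero_le_one).trans (one_mul s).le)
  -- The degree bound can be arranged afterwards by dividing by the monic polynomial `W`. Since `W`
  -- evaluates to `s1 - f1`, the quotient goes into `Q1` at the cost of an error `s1` of norm at
  -- most `ε`.
  suffices hS : ∃ (Q1 Q2 : Tate K 3) (r : Polynomial (Polynomial (intRing K))), ‖Q1‖ ≤ 1 ∧
      ‖Q2‖ ≤ 1 ∧ ‖F - Q1 * f1 - Q2 * f2 - evT K (intPoly K r)‖ ≤ ε by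
    obtain ⟨Q1, Q2, r, h1, h2, h3⟩ := hS
    set W := chartPoly (intRing K) (p ^ e) cc with hW
    have hm : W.Monic := chartPoly_monic _ hN _
    refine ⟨Q1 - evT K (intPoly K (r /ₘ W)), Q2, r %ₘ W,
      norm_sub_le_of_le' h1 (norm_evT_intPoly_le _), h2, ?_, ?_⟩
    · rw [← chartPoly_degree (intRing K) hN cc]
      exact Polynomial.degree_modByMonic_lt _ hm
    · have e1 : evT K (intPoly K r) = evT K (intPoly K (r %ₘ W))
          + (s1 - f1) * evT K (intPoly K (r /ₘ W)) := by
        conv_lhs => rw [← Polynomial.modByMonic_add_div r W]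
        rw [map_add, map_add, map_mul, map_mul, evT_chartPoly, h.eq1]
        ring
      have e2 : F - (Q1 - evT K (intPoly K (r /ₘ W))) * f1 - Q2 * f2 - evT K (intPoly K (r %ₘ W))
          = (F - Q1 * f1 - Q2 * f2 - evT K (intPoly K r)) + evT K (intPoly K (r /ₘ W)) * s1 := by
        rw [e1]; ring
      rw [e2]
      exact norm_add_le_of_le' h3 (hmul hε.le (norm_evT_intPoly_le _) h.norm1)
  -- Approximable elements of the unit ball form a subring, so it suffices to treat integral
  -- constants, the three variables and elements of norm at most `ε`.
  let S : Subring (Tate K 3) :=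
    { carrier := {F | ‖F‖ ≤ 1 ∧ ∃ (Q1 Q2 : Tate K 3) (r : Polynomial (Polynomial (intRing K))),
        ‖Q1‖ ≤ 1 ∧ ‖Q2‖ ≤ 1 ∧ ‖F - Q1 * f1 - Q2 * f2 - evT K (intPoly K r)‖ ≤ ε}
      zero_mem' := ⟨by simp, 0, 0, 0, by simp, by simp, by simpa using hε.le⟩
      one_mem' := ⟨by simp, 0, 0, 1, by simp, by simp, by simpa using hε.le⟩
      add_mem' := by
        rintro a b ⟨ha, Q1, Q2, r, h1, h2, h3⟩ ⟨hb, Q1', Q2', r', h1', h2', h3'⟩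
        refine ⟨norm_add_le_of_le' ha hb, Q1 + Q1', Q2 + Q2', r + r', norm_add_le_of_le' h1 h1',
          norm_add_le_of_le' h2 h2', ?_⟩
        have := norm_add_le_of_le' h3 h3'
        refine (congrArg norm ?_).le.trans this
        rw [map_add, map_add]; ring
      neg_mem' := by
        rintro a ⟨ha, Q1, Q2, r, h1, h2, h3⟩
        refine ⟨by rwa [norm_neg], -Q1, -Q2, -r, by rwa [norm_neg], by rwa [norm_neg], ?_⟩
        rw [← norm_neg]
        refine (congrArg norm ?_).le.trans h3
        rw [map_neg (intPoly K), map_neg (evT K)]; ring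
      mul_mem' := by
        rintro a b ⟨ha, Q1, Q2, r, h1, h2, h3⟩ ⟨hb, Q1', Q2', r', h1', h2', h3'⟩
        have hr := norm_evT_intPoly_le r
        refine ⟨hmul zero_le_one ha hb, b * Q1 + evT K (intPoly K r) * Q1',
          b * Q2 + evT K (intPoly K r) * Q2', r * r',
          norm_add_le_of_le' (hmul zero_le_one hb h1) (hmul zero_le_one hr h1'),
          norm_add_le_of_le' (hmul zero_le_one hb h2) (hmul zero_le_one hr h2'), ?_⟩
        have := norm_add_le_of_le' (hmul hε.le hb h3) (hmul hε.le hr h3')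
        refine (congrArg norm ?_).le.trans this
        rw [map_mul, map_mul]; ring }
  have hconst : ∀ a : intRing K, algebraMap K (Tate K 3) a ∈ S := fun a => by
    refine ⟨(norm_algebraMap' (Tate K 3) _).le.trans a.2, 0, 0, Polynomial.C (Polynomial.C a),
      by simp, by simp, ?_⟩
    simpa [evT, intPoly] using hε.le
  have hX1 : Tate.X K 1 ∈ S := by
    refine ⟨Tate.norm_X_le _, 0, 0, Polynomial.X, by simp, by simp, ?_⟩
    simpa [evT, intPoly] using hε.le
  have hX2 : Tate.X K 2 ∈ S := by
    refine ⟨Tate.norm_X_le _, 0, 0, Polynomial.C Polynomial.X, by simp, by simp, ?_⟩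
    simpa [evT, intPoly] using hε.le
  -- The second equation eliminates `u_0`: up to `s2` it equals `g(Y) + f2`, whence the coefficient
  -- `Q2 = 1`.
  have hX0 : Tate.X K 0 ∈ S := by
    refine ⟨Tate.norm_X_le _, 0, 1, Polynomial.C (g.map (Int.castRingHom _)),
      by simp, by simp, ?_⟩
    have hg : evT K (intPoly K (Polynomial.C (g.map (Int.castRingHom _))))
        = Polynomial.aeval (Tate.X K 2) g := by
      rw [intPoly, Polynomial.coe_mapRingHom, Polynomial.map_C, evT, Polynomial.coe_eval₂RingHom,
        Polynomial.eval₂_C, Polynomial.coe_eval₂RingHom, Polynomial.coe_mapRingHom,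
        Polynomial.eval₂_map, Polynomial.eval₂_map, Polynomial.aeval_def]
      congr 1
      exact RingHom.ext_int _ _
    rw [hg, h.eq2, ← norm_neg]
    refine (congrArg norm ?_).le.trans h.norm2
    ring
  have hX : ∀ i, Tate.X K i ∈ S := fun i => by
    fin_cases i
    · exact hX0
    · exact hX1
    · exact hX2
  obtain ⟨P, hP, hFP⟩ := Tate.exists_mvPolynomial F hε
  have hPS : MvPolynomial.aeval (Tate.X K) P ∈ S := by
    rw [MvPolynomial.aeval_def, MvPolynomial.eval₂_eq]
    refine S.sum_mem fun m _ => S.mul_mem (hconst ⟨_, (hP m).trans hF⟩) (S.prod_mem fun i _ =>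
      S.pow_mem (hX i) _)
  have hE : F - MvPolynomial.aeval (Tate.X K) P ∈ S :=
    ⟨norm_sub_le_of_le' hF hPS.1, 0, 0, 0, by simp, by simp, by simpa using hFP⟩
  have := S.add_mem hE hPS
  rw [sub_add_cancel] at this
  exact this.2

end ChartThm

/-! ### Functions vanishing at all points, and functions bounded by one -/

section ChartVanish

variable {C : Type*} [NormedField C] [IsUltrametricDist C] [CompleteSpace C] {K : Subfield C}
  {I : Ideal (Tate K 3)} {p e : ℕ} {cc g : Polynomial ℤ} {ε : ℝ} {f1 f2 s1 s2 : Tate K 3}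

theorem norm_evalAt_mk_le (P : Points I) (f : Tate K 3) : ‖evalAt P (AffAlg.mk I f)‖ ≤ ‖f‖ :=
  Tate.norm_eval_le P.1 P.2.choose f

theorem AffAlg.mk_surjective (I : Ideal (Tate K 3)) : Function.Surjective (AffAlg.mk I) :=
  Ideal.Quotient.mk_surjective

theorem AffAlg.mk_eq_zero {f : Tate K 3} (hf : f ∈ I) : AffAlg.mk I f = 0 :=
  Ideal.Quotient.eq_zero_iff_mem.mpr hf

theorem intPoly_degree (r : Polynomial (Polynomial (intRing K))) :
    (intPoly K r).degree ≤ r.degree :=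
  Polynomial.degree_map_le

/-- After scaling, the normal form of `F` agrees at every point with minus the approximation error,
so its supremum norm is at most `ε`. By `IsChart.exists_norm_coeff_le` its Gauss norm is then at
most `ε` as well. Thus `F` becomes smaller by the factor `ε` modulo `(f1, f2)`. -/
theorem IsChart.exists_step [IsAlgClosed C] [Fact p.Prime] [CharP C p]
    (h : IsChart I p e cc g ε f1 f2 s1 s2) (hε : 0 < ε) (F : Tate K 3)
    (hF : ∀ P : Points I, evalAt P (AffAlg.mk I F) = 0) :
    ∃ Q1 Q2 : Tate K 3, ‖Q1‖ ≤ ‖F‖ ∧ ‖Q2‖ ≤ ‖F‖ ∧ ‖F - (Q1 * f1 + Q2 * f2)‖ ≤ ε * ‖F‖ := by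
  by_cases hF0 : F = 0
  · exact ⟨0, 0, by simp, by simp, by simp [hF0]⟩
  obtain ⟨m, hm⟩ := Tate.exists_norm_eq F
  set c : K := MvPowerSeries.coeff m F.1
  have hc : 0 < ‖c‖ := hm ▸ norm_pos_iff.mpr hF0
  have hc0 : c ≠ 0 := norm_pos_iff.mp hc
  have hF1 : ‖c⁻¹ • F‖ ≤ 1 := by
    rw [norm_smul, norm_inv, ← hm, inv_mul_cancel₀ hc.ne']
  obtain ⟨Q1, Q2, r, h1, h2, hr, h3⟩ := h.exists_approx Fact.out hε _ hF1
  have hr' : ‖evT K (intPoly K r)‖ ≤ ε := by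
    refine norm_evT_le _ hε.le fun j i => ?_
    obtain ⟨P, hP⟩ := h.exists_norm_coeff_le (intPoly K r) ((intPoly_degree r).trans_lt hr) j i
    refine hP.trans ?_
    have e1 : evalAt P (AffAlg.mk I (evT K (intPoly K r)))
        = -evalAt P (AffAlg.mk I (c⁻¹ • F - Q1 * f1 - Q2 * f2 - evT K (intPoly K r))) := by
      simp only [map_sub, map_mul, map_smul, hF P, AffAlg.mk_eq_zero h.mem1,
        AffAlg.mk_eq_zero h.mem2]
      simp
    rw [e1, norm_neg]
    exact (norm_evalAt_mk_le P _).trans h3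
  have hQ : ∀ {Q : Tate K 3}, ‖Q‖ ≤ 1 → ‖c • Q‖ ≤ ‖F‖ := fun {Q} hQ => by
    rw [norm_smul, ← hm]
    exact mul_le_of_le_one_right (norm_nonneg _) hQ
  refine ⟨c • Q1, c • Q2, hQ h1, hQ h2, ?_⟩
  have e2 : F - (c • Q1 * f1 + c • Q2 * f2)
      = c • ((c⁻¹ • F - Q1 * f1 - Q2 * f2 - evT K (intPoly K r)) + evT K (intPoly K r)) := by
    rw [sub_add_cancel, smul_sub, smul_sub, smul_inv_smul₀ hc0, smul_mul_assoc, smul_mul_assoc]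
    ring
  rw [e2, norm_smul, mul_comm, ← hm]
  exact mul_le_mul_of_nonneg_right (norm_add_le_of_le' h3 hr') (norm_nonneg _)

/-- A function that vanishes at all points is zero. -/
theorem IsChart.mem_of_vanish [IsAlgClosed C] [CompleteSpace K] [Fact p.Prime] [CharP C p]
    (h : IsChart I p e cc g ε f1 f2 s1 s2) (hε : 0 < ε) (F : Tate K 3)
    (hF : ∀ P : Points I, evalAt P (AffAlg.mk I F) = 0) : F ∈ I := by
  have : CompleteSpace (Tate K 3) := Tate.completeSpace inferInstance
  let V := {F : Tate K 3 // ∀ P : Points I, evalAt P (AffAlg.mk I F) = 0}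
  have hstep := fun F : V => h.exists_step hε F.1 F.2
  choose Q1 Q2 hQ1 hQ2 hQ using hstep
  -- Subtracting an element of the ideal preserves vanishing, so the step can be iterated. The
  -- multipliers decay geometrically and sum to an exact expression of `F` in terms of `f1` and
  -- `f2`.
  let nxt : V → V := fun F => ⟨F.1 - (Q1 F * f1 + Q2 F * f2), fun P => by
    simp only [map_sub, map_add, map_mul, F.2 P, AffAlg.mk_eq_zero h.mem1,
        AffAlg.mk_eq_zero h.mem2]
    simp⟩
  let u : ℕ → V := fun n => nxt^[n] ⟨F, hF⟩
  have hu : ∀ n, (u (n + 1)).1 = (u n).1 - (Q1 (u n) * f1 + Q2 (u n) * f2) := fun n => by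
    simp only [u, Function.iterate_succ_apply']
    rfl
  have hnorm : ∀ n, ‖(u n).1‖ ≤ ‖F‖ * ε ^ n := fun n => by
    induction n with
    | zero => simp [u]
    | succ n ih =>
      rw [hu]
      refine (hQ (u n)).trans ?_
      calc ε * ‖(u n).1‖ ≤ ε * (‖F‖ * ε ^ n) := mul_le_mul_of_nonneg_left ih hε.le
        _ = _ := by ring
  have hgeo : Summable fun n => ‖F‖ * ε ^ n :=
    (summable_geometric_of_lt_one hε.le h.lt_one).mul_left _
  have hs1 : Summable fun n => Q1 (u n) :=
    Summable.of_norm_bounded hgeo fun n => (hQ1 _).trans (hnorm n)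
  have hs2 : Summable fun n => Q2 (u n) :=
    Summable.of_norm_bounded hgeo fun n => (hQ2 _).trans (hnorm n)
  have hsum : ∀ n, ∑ i ∈ Finset.range n, (Q1 (u i) * f1 + Q2 (u i) * f2) = F - (u n).1 := by
    intro n
    induction n with
    | zero => simp [u]
    | succ n ih => rw [Finset.sum_range_succ, ih, hu]; ring
  have hlim : Tendsto (fun n => F - (u n).1) atTop (𝓝 (F - 0)) := by
    refine tendsto_const_nhds.sub ?_
    rw [tendsto_zero_iff_norm_tendsto_zero]
    refine squeeze_zero (fun _ => norm_nonneg _) hnorm ?_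
    rw [← mul_zero ‖F‖]
    exact (tendsto_pow_atTop_nhds_zero_of_lt_one hε.le h.lt_one).const_mul _
  have hlim2 := ((hs1.hasSum.mul_right f1).add (hs2.hasSum.mul_right f2)).tendsto_sum_nat
  simp_rw [hsum] at hlim2
  have := tendsto_nhds_unique hlim hlim2
  rw [sub_zero] at this
  rw [this]
  exact I.add_mem (I.mul_mem_left _ h.mem1) (I.mul_mem_left _ h.mem2)

/-- The error is rescaled to norm one by a coefficient attaining its Gauss norm and approximated
again; each round gains a factor `ε`. -/
theorem IsChart.exists_approx_pow (h : IsChart I p e cc g ε f1 f2 s1 s2) (hp : p.Prime)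
    (hε : 0 < ε) (N : ℕ) (F : Tate K 3) (hF : ‖F‖ ≤ 1) :
    ∃ G ∈ I, ∃ r : Polynomial (Polynomial K), r.degree < (p ^ e : ℕ) ∧
      ‖F - G - evT K r‖ ≤ ε ^ N := by
  have hbot : ((⊥ : WithBot ℕ)) < (p ^ e : ℕ) := WithBot.bot_lt_coe _
  induction N with
  | zero => exact ⟨0, I.zero_mem, 0, by simpa using hbot, by simpa using hF⟩
  | succ N ih =>
    obtain ⟨G, hG, r, hr, hE⟩ := ih
    set E := F - G - evT K r with hEdef
    by_cases hE0 : E = 0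
    · exact ⟨G, hG, r, hr, by rw [← hEdef, hE0, norm_zero]; positivity⟩
    obtain ⟨m, hm⟩ := Tate.exists_norm_eq E
    set c : K := MvPowerSeries.coeff m E.1
    have hc : 0 < ‖c‖ := hm ▸ norm_pos_iff.mpr hE0
    have hc0 : c ≠ 0 := norm_pos_iff.mp hc
    have hF1 : ‖c⁻¹ • E‖ ≤ 1 := by
      rw [norm_smul, norm_inv, ← hm, inv_mul_cancel₀ hc.ne']
    obtain ⟨Q1, Q2, r', h1, h2, hr', h3⟩ := h.exists_approx hp hε _ hF1
    refine ⟨G + c • (Q1 * f1 + Q2 * f2), I.add_mem hG ?_,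
      r + Polynomial.C (Polynomial.C c) * intPoly K r', ?_, ?_⟩
    · rw [Algebra.smul_def]
      exact I.mul_mem_left _ (I.add_mem (I.mul_mem_left _ h.mem1) (I.mul_mem_left _ h.mem2))
    · refine (Polynomial.degree_add_le _ _).trans_lt (max_lt hr ?_)
      rw [← Polynomial.smul_eq_C_mul]
      exact (Polynomial.degree_smul_le _ _).trans_lt ((intPoly_degree r').trans_lt hr')
    · have e1 : evT K (Polynomial.C (Polynomial.C c)) = algebraMap K (Tate K 3) c := by
        simp [evT]
      have e2 : F - (G + c • (Q1 * f1 + Q2 * f2))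
          - evT K (r + Polynomial.C (Polynomial.C c) * intPoly K r')
          = c • (c⁻¹ • E - Q1 * f1 - Q2 * f2 - evT K (intPoly K r')) := by
        rw [map_add, map_mul, e1, ← Algebra.smul_def, smul_sub, smul_sub, smul_sub,
          smul_inv_smul₀ hc0, smul_add, hEdef]
        ring
      rw [e2, norm_smul, pow_succ]
      exact mul_le_mul (hm.le.trans hE) h3 (norm_nonneg _) (by positivity)

/-- A function of supremum norm at most one is an integral polynomial up to a small error. -/
theorem IsChart.exists_intPoly [IsAlgClosed C] [Fact p.Prime] [CharP C p]
    (h : IsChart I p e cc g ε f1 f2 s1 s2) (hε : 0 < ε) (F : Tate K 3)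
    (hF : ∀ P : Points I, ‖evalAt P (AffAlg.mk I F)‖ ≤ 1) :
    ∃ G ∈ I, ∃ r : Polynomial (Polynomial (intRing K)), ‖F - G - evT K (intPoly K r)‖ ≤ ε := by
  have hbot : ((⊥ : WithBot ℕ)) < (p ^ e : ℕ) := WithBot.bot_lt_coe _
  obtain ⟨G, hG, r, hr, hE⟩ : ∃ G ∈ I, ∃ r : Polynomial (Polynomial K), r.degree < (p ^ e : ℕ) ∧
      ‖F - G - evT K r‖ ≤ ε := by
    by_cases hF0 : F = 0
    · exact ⟨0, I.zero_mem, 0, by simpa using hbot, by simpa [hF0] using hε.le⟩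
    obtain ⟨m, hm⟩ := Tate.exists_norm_eq F
    set c : K := MvPowerSeries.coeff m F.1
    have hc : 0 < ‖c‖ := hm ▸ norm_pos_iff.mpr hF0
    have hc0 : c ≠ 0 := norm_pos_iff.mp hc
    -- The supremum norm of `F` is at most one but its Gauss norm `‖c‖` may be large, so enough
    -- rounds are taken to make `‖c‖ ε^N` smaller than `ε`.
    obtain ⟨N, hN⟩ := exists_pow_lt_of_lt_one (div_pos hε hc) h.lt_one
    have hF1 : ‖c⁻¹ • F‖ ≤ 1 := by
      rw [norm_smul, norm_inv, ← hm, inv_mul_cancel₀ hc.ne']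
    obtain ⟨G, hG, r, hr, hE⟩ := h.exists_approx_pow Fact.out hε N _ hF1
    refine ⟨c • G, ?_, Polynomial.C (Polynomial.C c) * r, ?_, ?_⟩
    · rw [Algebra.smul_def]
      exact I.mul_mem_left _ hG
    · rw [← Polynomial.smul_eq_C_mul]
      exact (Polynomial.degree_smul_le _ _).trans_lt hr
    · have e1 : evT K (Polynomial.C (Polynomial.C c)) = algebraMap K (Tate K 3) c := by
        simp [evT]
      have e2 : F - c • G - evT K (Polynomial.C (Polynomial.C c) * r)
          = c • (c⁻¹ • F - G - evT K r) := by
        rw [map_mul, e1, ← Algebra.smul_def, smul_sub, smul_sub, smul_inv_smul₀ hc0]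
      rw [e2, norm_smul]
      calc ‖c‖ * ‖c⁻¹ • F - G - evT K r‖ ≤ ‖c‖ * (ε / ‖c‖) :=
            mul_le_mul_of_nonneg_left (hE.trans hN.le) hc.le
        _ = ε := by field_simp
  -- At the points the normal form differs from `F` by at most `ε`, hence it is bounded by one
  -- there, and its coefficients are integral.
  have hcoef : ∀ j i, ‖((r.coeff j).coeff i : K)‖ ≤ 1 := fun j i => by
    obtain ⟨P, hP⟩ := h.exists_norm_coeff_le r hr j i
    refine hP.trans ?_
    have e1 : evalAt P (AffAlg.mk I (evT K r))
        = evalAt P (AffAlg.mk I F) - evalAt P (AffAlg.mk I (F - G - evT K r)) := by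
      simp only [map_sub, AffAlg.mk_eq_zero hG]
      simp
    rw [e1]
    exact norm_sub_le_of_le' (hF P) ((norm_evalAt_mk_le P _).trans (hE.trans h.lt_one.le))
  have hl : r ∈ Polynomial.lifts (Polynomial.mapRingHom (intRing K).subtype) := by
    rw [Polynomial.lifts_iff_coeff_lifts]
    intro j
    have : r.coeff j ∈ Polynomial.lifts (intRing K).subtype := by
      rw [Polynomial.lifts_iff_coeff_lifts]
      exact fun i => ⟨⟨_, hcoef j i⟩, rfl⟩
    exact (Polynomial.mem_lifts _).mp this
  obtain ⟨r', hr'⟩ := (Polynomial.mem_lifts _).mp hl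
  refine ⟨G, hG, r', ?_⟩
  have : intPoly K r' = r := hr'
  rwa [this]

end ChartVanish

/-! ### The canonical reduction of a chart -/

section ChartIso

variable {C : Type*} [NormedField C] [IsUltrametricDist C] [CompleteSpace C] {K : Subfield C}
  {I : Ideal (Tate K 3)} {p e : ℕ} {cc g : Polynomial ℤ} {ε : ℝ} {f1 f2 s1 s2 : Tate K 3}

/-- The class in the reduction of an element of the Tate algebra of Gauss norm at most one. -/
def redMk (I : Ideal (Tate K 3)) (f : Tate K 3) (hf : ‖f‖ ≤ 1) : Reduction I :=
  Ideal.Quotient.mk (topNil I) ⟨AffAlg.mk I f, fun P => (norm_evalAt_mk_le P f).trans hf⟩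

/-- The map from integral polynomials to the reduction. -/
def redPoly (I : Ideal (Tate K 3)) : Polynomial (Polynomial (intRing K)) →+* Reduction I :=
  (Ideal.Quotient.mk (topNil I)).comp
    (((AffAlg.mk I).toRingHom.comp ((evT K).comp (intPoly K))).codRestrict (powerBdd I)
      fun r P => (norm_evalAt_mk_le P _).trans (norm_evT_intPoly_le r))

theorem redPoly_eq_zero {r : Polynomial (Polynomial (intRing K))} :
    redPoly I r = 0 ↔ ∃ δ : ℝ, δ < 1 ∧
      ∀ P : Points I, ‖evalAt P (AffAlg.mk I (evT K (intPoly K r)))‖ ≤ δ :=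
  Ideal.Quotient.eq_zero_iff_mem

/-- Polynomials over a polynomial ring as polynomials in two variables. -/
def toMv (k : Type*) [CommRing k] : Polynomial (Polynomial k) →+* MvPolynomial (Fin 2) k :=
  Polynomial.eval₂RingHom (Polynomial.eval₂RingHom MvPolynomial.C (MvPolynomial.X 1))
    (MvPolynomial.X 0)

theorem toMv_surjective (k : Type*) [CommRing k] : Function.Surjective (toMv k) := by
  intro q
  induction q using MvPolynomial.induction_on with
  | C a => exact ⟨Polynomial.C (Polynomial.C a), by simp [toMv]⟩
  | add a b ha hb =>
    obtain ⟨a', rfl⟩ := ha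
    obtain ⟨b', rfl⟩ := hb
    exact ⟨a' + b', map_add _ _ _⟩
  | mul_X a i ha =>
    obtain ⟨a', rfl⟩ := ha
    fin_cases i
    · exact ⟨a' * Polynomial.X, by rw [map_mul]; congr 1; simp [toMv]⟩
    · exact ⟨a' * Polynomial.C Polynomial.X, by rw [map_mul]; congr 1; simp [toMv]⟩

theorem redPoly_eq_aeval (r : Polynomial (Polynomial (intRing K))) :
    redPoly I r = MvPolynomial.aeval ![redCoord I 1, redCoord I 2]
      (toMv (Residue K) (r.map (Polynomial.mapRingHom (IsLocalRing.residue (intRing K))))) := by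
  have : redPoly I = ((MvPolynomial.aeval ![redCoord I 1, redCoord I 2] :
      MvPolynomial (Fin 2) (Residue K) →ₐ[Residue K] Reduction I).toRingHom.comp
      (toMv (Residue K))).comp
      (Polynomial.mapRingHom (Polynomial.mapRingHom (IsLocalRing.residue (intRing K)))) := by
    refine Polynomial.ringHom_ext' (Polynomial.ringHom_ext' ?_ ?_) ?_
    · ext a
      have h1 : redPoly I (Polynomial.C (Polynomial.C a))
          = algebraMap (Residue K) (Reduction I) (IsLocalRing.residue (intRing K) a) := by
        refine congrArg (Ideal.Quotient.mk (topNil I)) (Subtype.ext ?_)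
        change AffAlg.mk I (evT K (intPoly K (Polynomial.C (Polynomial.C a)))) = algebraMap K (AffAlg I) a
        rw [← (AffAlg.mk I).commutes]
        congr 1
        simp [evT, intPoly]
      simpa [toMv] using h1
    · have h1 : redPoly I (Polynomial.C Polynomial.X) = redCoord I 2 := by
        refine congrArg (Ideal.Quotient.mk (topNil I)) (Subtype.ext ?_)
        change AffAlg.mk I (evT K (intPoly K (Polynomial.C Polynomial.X))) = AffAlg.mk I (Tate.X K 2)
        congr 1
        simp [evT, intPoly]
      simpa [toMv] using h1
    · have h1 : redPoly I Polynomial.X = redCoord I 1 := by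
        refine congrArg (Ideal.Quotient.mk (topNil I)) (Subtype.ext ?_)
        change AffAlg.mk I (evT K (intPoly K Polynomial.X)) = AffAlg.mk I (Tate.X K 1)
        congr 1
        simp [evT, intPoly]
      simpa [toMv] using h1
  exact congrArg (fun h => h r) this

/-- An error of Gauss norm at most `ε < 1` lies in `A°°`, so `IsChart.exists_intPoly` represents
each class of the reduction by an integral polynomial in `X` and `Y`. -/
theorem IsChart.aeval_surjective [IsAlgClosed C] [Fact p.Prime] [CharP C p]
    (h : IsChart I p e cc g ε f1 f2 s1 s2) (hε : 0 < ε) :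
    Function.Surjective (MvPolynomial.aeval ![redCoord I 1, redCoord I 2] :
      MvPolynomial (Fin 2) (Residue K) →ₐ[Residue K] Reduction I) := by
  intro z
  obtain ⟨⟨a, ha⟩, rfl⟩ := Ideal.Quotient.mk_surjective z
  obtain ⟨F, rfl⟩ := AffAlg.mk_surjective I a
  obtain ⟨G, hG, r, hr⟩ := h.exists_intPoly hε F ha
  refine ⟨_, (redPoly_eq_aeval r).symm.trans (Eq.symm ?_)⟩
  refine Ideal.Quotient.eq.mpr ⟨ε, h.lt_one, fun P => ?_⟩
  have : AffAlg.mk I F - AffAlg.mk I (evT K (intPoly K r))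
      = AffAlg.mk I (F - G - evT K (intPoly K r)) := by
    simp only [map_sub, AffAlg.mk_eq_zero hG, sub_zero]
  change ‖evalAt P (AffAlg.mk I F - AffAlg.mk I (evT K (intPoly K r)))‖ ≤ ε
  rw [this]
  exact (norm_evalAt_mk_le P _).trans hr

theorem toMv_chartPoly (k : Type*) [CommRing k] (N : ℕ) (cc : Polynomial ℤ) :
    toMv k (chartPoly k N cc) = MvPolynomial.X 0 ^ N - MvPolynomial.X 0
      - Polynomial.eval₂ (Int.castRingHom _) (MvPolynomial.X 1) cc := by
  have hc : toMv k (Polynomial.C (cc.map (Int.castRingHom k)))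
      = Polynomial.eval₂ (Int.castRingHom _) (MvPolynomial.X 1) cc := by
    rw [toMv, Polynomial.coe_eval₂RingHom, Polynomial.eval₂_C, Polynomial.coe_eval₂RingHom,
      Polynomial.eval₂_map]
    congr 1
  have hX : toMv k Polynomial.X = MvPolynomial.X 0 := by simp [toMv]
  rw [chartPoly, map_sub, map_add, map_pow, hX, hc, sub_sub]

/-- An integral polynomial whose class vanishes is divided by the monic equation. The remainder has
supremum norm less than one, hence coefficients in the maximal ideal, so that modulo this ideal the
polynomial is a multiple of the equation. -/
theorem IsChart.ker_aeval [IsAlgClosed C] [Fact p.Prime] [CharP C p]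
    (h : IsChart I p e cc g ε f1 f2 s1 s2) :
    RingHom.ker (MvPolynomial.aeval ![redCoord I 1, redCoord I 2] :
      MvPolynomial (Fin 2) (Residue K) →ₐ[Residue K] Reduction I)
      = Ideal.span {MvPolynomial.X 0 ^ p ^ e - MvPolynomial.X 0
      - Polynomial.eval₂ (Int.castRingHom _) (MvPolynomial.X 1) cc} := by
  have hN : 1 < p ^ e := Nat.one_lt_pow h.pos (Fact.out : p.Prime).one_lt
  set W := chartPoly (intRing K) (p ^ e) cc with hW
  have hm : W.Monic := chartPoly_monic _ hN _
  have hW0 : redPoly I W = 0 := by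
    refine redPoly_eq_zero.mpr ⟨ε, h.lt_one, fun P => ?_⟩
    have : evT K (intPoly K W) = s1 - f1 := by
      rw [hW, evT_chartPoly, h.eq1]; ring
    rw [this, map_sub, AffAlg.mk_eq_zero h.mem1, sub_zero]
    exact (norm_evalAt_mk_le P _).trans h.norm1
  have hWmap : W.map (Polynomial.mapRingHom (IsLocalRing.residue (intRing K)))
      = chartPoly (Residue K) (p ^ e) cc := chartPoly_map _ _ _
  rw [← toMv_chartPoly]
  apply le_antisymm
  · intro q hq
    rw [RingHom.mem_ker] at hq
    obtain ⟨R, rfl⟩ := toMv_surjective _ q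
    obtain ⟨r, rfl⟩ := Polynomial.map_surjective
      (Polynomial.mapRingHom (IsLocalRing.residue (intRing K)))
      (Polynomial.map_surjective _ IsLocalRing.residue_surjective) R
    have hq' : redPoly I r = 0 := (redPoly_eq_aeval r).trans hq
    have hmod : redPoly I (r %ₘ W) = 0 := by
      have := congrArg (redPoly I) (Polynomial.modByMonic_add_div r W)
      rwa [map_add, map_mul, hW0, zero_mul, add_zero, hq'] at this
    obtain ⟨δ, hδ, hP⟩ := redPoly_eq_zero.mp hmod
    have hdeg : (intPoly K (r %ₘ W)).degree < (p ^ e : ℕ) := by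
      refine (intPoly_degree _).trans_lt ?_
      rw [← chartPoly_degree (intRing K) hN cc]
      exact Polynomial.degree_modByMonic_lt _ hm
    have hmap0 : (r %ₘ W).map (Polynomial.mapRingHom (IsLocalRing.residue (intRing K))) = 0 := by
      ext j i
      rw [Polynomial.coeff_map, Polynomial.coe_mapRingHom, Polynomial.coeff_map,
        Polynomial.coeff_zero, Polynomial.coeff_zero, IsLocalRing.residue_eq_zero_iff]
      refine (Valuation.mem_maximalIdeal_iff _ NormedField.valuation).mpr ?_
      obtain ⟨P, hP'⟩ := h.exists_norm_coeff_le _ hdeg j i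
      rw [intPoly_coeff_coeff] at hP'
      exact (hP'.trans (hP P)).trans_lt hδ
    rw [← Polynomial.modByMonic_add_div r W, Polynomial.map_add, hmap0, zero_add,
      Polynomial.map_mul, hWmap, map_mul]
    exact Ideal.mul_mem_right _ _ (Ideal.mem_span_singleton_self _)
  · rw [Ideal.span_le, Set.singleton_subset_iff, SetLike.mem_coe, RingHom.mem_ker, ← hWmap]
    exact (redPoly_eq_aeval W).symm.trans hW0

/-- The canonical reduction of a chart. -/
theorem IsChart.exists_algEquiv [IsAlgClosed C] [Fact p.Prime] [CharP C p]
    (h : IsChart I p e cc g ε f1 f2 s1 s2) (hε : 0 < ε) (J : Ideal (MvPolynomial (Fin 2) (Residue K)))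
    (hJ : J = Ideal.span {MvPolynomial.X 0 ^ p ^ e - MvPolynomial.X 0
      - Polynomial.eval₂ (Int.castRingHom _) (MvPolynomial.X 1) cc}) :
    ∃ E : (MvPolynomial (Fin 2) (Residue K) ⧸ J) ≃ₐ[Residue K] Reduction I,
      E (Ideal.Quotient.mk _ (MvPolynomial.X 0)) = redCoord I 1 ∧
      E (Ideal.Quotient.mk _ (MvPolynomial.X 1)) = redCoord I 2 := by
  refine ⟨(Ideal.quotientEquivAlgOfEq (Residue K) (hJ.trans h.ker_aeval.symm)).trans
    (Ideal.quotientKerAlgEquivOfSurjective (h.aeval_surjective hε)), ?_, ?_⟩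
  · refine Eq.trans (b := MvPolynomial.aeval ![redCoord I 1, redCoord I 2]
      (MvPolynomial.X (R := Residue K) 0)) rfl ?_
    simp
  · refine Eq.trans (b := MvPolynomial.aeval ![redCoord I 1, redCoord I 2]
      (MvPolynomial.X (R := Residue K) 1)) rfl ?_
    simp

end ChartIso

/-! ### Pull-backs on affinoid algebras and their reductions -/

section Pullback

variable {C : Type*} [NormedField C] [IsUltrametricDist C] [CompleteSpace C] {K : Subfield C}
  {I : Ideal (Tate K 3)} {p e : ℕ} {cc g : Polynomial ℤ} {ε : ℝ} {f1 f2 s1 s2 : Tate K 3}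

/-- Substitution that preserves the ideal descends to the quotient; the image of a point has the
values of the `G i` as coordinates, and it satisfies the equations because substituted equations
stay in the ideal. -/
theorem exists_endomorphism [CompleteSpace K] [CompleteSpace (Tate K 3)] (G : Fin 3 → Tate K 3)
    (hG : ∀ i, ‖G i‖ ≤ 1)
    (hI : ∀ f ∈ I, Tate.subst G hG f ∈ I) :
    ∃ φ : AffAlg I →ₐ[K] AffAlg I, (∀ i, φ (AffAlg.mk I (Tate.X K i)) = AffAlg.mk I (G i)) ∧
      ∀ P : Points I, ∃ P' : Points I, (∀ i, P'.1 i = evalAt P (AffAlg.mk I (G i))) ∧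
        ∀ f, evalAt P (φ f) = evalAt P' f := by
  let φ : AffAlg I →ₐ[K] AffAlg I :=
    Ideal.Quotient.liftₐ I ((AffAlg.mk I).comp (Tate.subst G hG)) fun f hf =>
      AffAlg.mk_eq_zero (hI f hf)
  have hφ : ∀ f, φ (AffAlg.mk I f) = AffAlg.mk I (Tate.subst G hG f) := fun f => rfl
  refine ⟨φ, fun i => by rw [hφ, Tate.subst_X], fun P => ?_⟩
  have hP' : ∀ i, ‖Tate.eval P.1 P.2.choose (G i)‖ ≤ 1 :=
    fun i => (Tate.norm_eval_le P.1 P.2.choose (G i)).trans (hG i)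
  refine ⟨⟨fun i => Tate.eval P.1 P.2.choose (G i), hP', fun f hf => ?_⟩, fun i => rfl, fun f => ?_⟩
  · rw [← Tate.eval_subst G hG P.1 P.2.choose hP' f]
    exact P.2.choose_spec _ (hI f hf)
  · obtain ⟨F, rfl⟩ := AffAlg.mk_surjective I f
    rw [hφ]
    exact Tate.eval_subst G hG P.1 P.2.choose hP' F

/-- Injectivity of `ψ` on the points determines the image point, so two pull-backs agree at all
points, and `IsChart.mem_of_vanish` turns this into equality of algebra maps. -/
theorem IsChart.pullback_unique [IsAlgClosed C] [CompleteSpace K] [Fact p.Prime] [CharP C p]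
    (h : IsChart I p e cc g ε f1 f2 s1 s2) (hε : 0 < ε) {ψ ρ : (Fin 3 → C) → (Fin 3 → C)}
    (hψ : Set.InjOn ψ (Points I)) {φ φ' : AffAlg I →ₐ[K] AffAlg I}
    (hφ : IsPullback ψ ρ φ) (hφ' : IsPullback ψ ρ φ') : φ' = φ := by
  ext f
  obtain ⟨F, hF⟩ := AffAlg.mk_surjective I (φ' f - φ f)
  have : F ∈ I := by
    refine h.mem_of_vanish hε F fun P => ?_
    obtain ⟨P1, h1, h1'⟩ := hφ P
    obtain ⟨P2, h2, h2'⟩ := hφ' P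
    have : P1 = P2 := Subtype.ext (hψ P1.2 P2.2 (h1.trans h2.symm))
    rw [hF, map_sub, h1', h2', this, sub_self]
  rw [AffAlg.mk_eq_zero this] at hF
  exact (sub_eq_zero.mp hF.symm)

/-- A pull-back takes its values among the values of the original function, so it cannot increase
the supremum norm and preserves both `A°` and `A°°`. -/
theorem exists_reduction (φ : AffAlg I →ₐ[K] AffAlg I)
    (hφ : ∀ P : Points I, ∃ P' : Points I, ∀ f, evalAt P (φ f) = evalAt P' f) :
    ∃ φbar : Reduction I →ₐ[Residue K] Reduction I, IsReductionOf φ φbar := by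
  have hmem : ∀ f : powerBdd I, φ f ∈ powerBdd I := fun f P => by
    obtain ⟨P', hP'⟩ := hφ P
    rw [hP']
    exact f.2 P'
  let φ0 : powerBdd I →+* powerBdd I :=
    (φ.toRingHom.comp (powerBdd I).subtype).codRestrict (powerBdd I) hmem
  have hnil : ∀ f ∈ topNil I, (Ideal.Quotient.mk (topNil I)).comp φ0 f = 0 := fun f hf => by
    refine Ideal.Quotient.eq_zero_iff_mem.mpr ?_
    obtain ⟨r, hr, hf⟩ := hf
    refine ⟨r, hr, fun P => ?_⟩
    obtain ⟨P', hP'⟩ := hφ P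
    change ‖evalAt P (φ f)‖ ≤ r
    rw [hP']
    exact hf P'
  let φ1 : Reduction I →+* Reduction I :=
    Ideal.Quotient.lift (topNil I) ((Ideal.Quotient.mk (topNil I)).comp φ0) hnil
  refine ⟨{ φ1 with commutes' := ?_ }, fun f => ⟨hmem f, rfl⟩⟩
  intro a
  obtain ⟨a, rfl⟩ := IsLocalRing.residue_surjective a
  refine congrArg (Ideal.Quotient.mk (topNil I)) (Subtype.ext ?_)
  exact φ.commutes (a : K)

theorem redMk_congr {f f' : Tate K 3} (hf : ‖f‖ ≤ 1) (hf' : ‖f'‖ ≤ 1) (h : ‖f - f'‖ < 1) :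
    redMk I f hf = redMk I f' hf' := by
  refine Ideal.Quotient.eq.mpr ⟨_, h, fun P => ?_⟩
  change ‖evalAt P (AffAlg.mk I f - AffAlg.mk I f')‖ ≤ _
  rw [← map_sub]
  exact norm_evalAt_mk_le P _

theorem IsReductionOf.map_redCoord {φ : AffAlg I →ₐ[K] AffAlg I}
    {φbar : Reduction I →ₐ[Residue K] Reduction I} (h : IsReductionOf φ φbar) {i : Fin 3}
    {f : Tate K 3} (hf : ‖f‖ ≤ 1) (hφ : φ (AffAlg.mk I (Tate.X K i)) = AffAlg.mk I f) :
    φbar (redCoord I i) = redMk I f hf := by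
  obtain ⟨h1, h2⟩ := h _
  refine h2.trans ?_
  exact congrArg (Ideal.Quotient.mk (topNil I)) (Subtype.ext hφ)

theorem algebraMap_residue (a : intRing K) :
    algebraMap (Residue K) (Reduction I) (IsLocalRing.residue (intRing K) a)
      = redMk I (algebraMap K (Tate K 3) a) ((norm_algebraMap' (Tate K 3) _).le.trans a.2) :=
  rfl

theorem redCoord_eq (i : Fin 3) : redCoord I i = redMk I (Tate.X K i) (Tate.norm_X_le i) := rfl

theorem redMk_add {f f' : Tate K 3} (hf : ‖f‖ ≤ 1) (hf' : ‖f'‖ ≤ 1) :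
    redMk I f hf + redMk I f' hf' = redMk I (f + f') (norm_add_le_of_le' hf hf') :=
  congrArg (Ideal.Quotient.mk (topNil I)) (Subtype.ext (map_add (AffAlg.mk I) f f').symm)

theorem norm_mul_le_one' {R : Type*} [SeminormedRing R] {a b : R} (ha : ‖a‖ ≤ 1) (hb : ‖b‖ ≤ 1) :
    ‖a * b‖ ≤ 1 :=
  (norm_mul_le _ _).trans (mul_le_one₀ ha (norm_nonneg _) hb)

theorem redMk_mul {f f' : Tate K 3} (hf : ‖f‖ ≤ 1) (hf' : ‖f'‖ ≤ 1) :
    redMk I f hf * redMk I f' hf' = redMk I (f * f') (norm_mul_le_one' hf hf') :=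
  congrArg (Ideal.Quotient.mk (topNil I)) (Subtype.ext (map_mul (AffAlg.mk I) f f').symm)

theorem redMk_pow {f : Tate K 3} (hf : ‖f‖ ≤ 1) (k : ℕ) :
    redMk I f hf ^ k
      = redMk I (f ^ k) ((norm_pow_le _ _).trans (pow_le_one₀ (norm_nonneg _) hf)) :=
  congrArg (Ideal.Quotient.mk (topNil I)) (Subtype.ext (map_pow (AffAlg.mk I) f k).symm)

theorem residue_smul_redMk (a : intRing K) {f : Tate K 3} (hf : ‖f‖ ≤ 1) :
    IsLocalRing.residue (intRing K) a • redMk I f hf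
      = redMk I ((a : K) • f) ((norm_smul_le _ _).trans (mul_le_one₀ a.2 (norm_nonneg _) hf)) := by
  rw [Algebra.smul_def, algebraMap_residue, redMk_mul]
  congr 1
  exact (Algebra.smul_def _ _).symm

end Pullback

/-- The standing assumptions on the constants. -/
structure LTData {k : Type*} [NormedField k] (p q n : ℕ) (ϖ ζ w : k) : Prop where
  prime : p.Prime
  char : CharP k p
  pow : ∃ f, f ≠ 0 ∧ q = p ^ f
  two_le : 2 ≤ n
  ne : ϖ ≠ 0
  lt : ‖ϖ‖ < 1
  zeta : ζ ^ q ^ 2 = ζ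
  zeta_ne : ζ ^ q ≠ ζ
  tors : (mulUnif q ϖ 0)^[n] w = 0
  prim : (mulUnif q ϖ 0)^[n - 1] w ≠ 0

/-! ### The additive operator `x ↦ x^{q²} + ϖ x` and its torsion points -/

section Lin

variable {k R : Type*} [NormedField k] [NormedCommRing R] [NormedAlgebra k R] {p q n : ℕ}
  {ϖ ζ w : k}

/-- The linear operator `x ↦ x^{q²} + ϖ x`. -/
def lin (q : ℕ) (ϖ : k) (x : R) : R := x ^ q ^ 2 + ϖ • x

theorem mulUnif_zero_eq_lin (q : ℕ) (ϖ x : k) : mulUnif q ϖ 0 x = lin q ϖ x := by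
  simp [mulUnif, lin]

theorem mulUnif_zero (q : ℕ) (hq : q ≠ 0) (ϖ x : k) : mulUnif q ϖ x 0 = 0 := by
  simp [mulUnif, hq]

end Lin

namespace LTData

variable {k R : Type*} [NormedField k] [NormedCommRing R] [NormedAlgebra k R]
  {p q n : ℕ} {ϖ ζ w : k}

theorem two_le_q (h : LTData p q n ϖ ζ w) : 2 ≤ q := by
  obtain ⟨f, hf, rfl⟩ := h.pow
  exact h.prime.two_le.trans (Nat.le_self_pow hf p)

theorem charP (h : LTData p q n ϖ ζ w) (R : Type*) [NormedCommRing R] [NormOneClass R]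
    [NormedAlgebra k R] : CharP R p := by
  have := h.char
  have : Nontrivial R := NormOneClass.nontrivial
  exact charP_of_injective_algebraMap (algebraMap k R).injective p

theorem add_pow (h : LTData p q n ϖ ζ w) [NormOneClass R] (x y : R) (j : ℕ) :
    (x + y) ^ q ^ j = x ^ q ^ j + y ^ q ^ j := by
  have := h.charP R
  have := Fact.mk h.prime
  obtain ⟨f, hf, rfl⟩ := h.pow
  rw [← pow_mul]
  exact add_pow_char_pow x y p _

theorem sub_pow (h : LTData p q n ϖ ζ w) [NormOneClass R] (x y : R) (j : ℕ) :
    (x - y) ^ q ^ j = x ^ q ^ j - y ^ q ^ j := by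
  have := h.charP R
  have := Fact.mk h.prime
  obtain ⟨f, hf, rfl⟩ := h.pow
  rw [← pow_mul]
  exact sub_pow_char_pow x y _

theorem add_pow_q (h : LTData p q n ϖ ζ w) [NormOneClass R] (x y : R) :
    (x + y) ^ q = x ^ q + y ^ q := by
  simpa using h.add_pow x y 1

theorem sub_pow_q (h : LTData p q n ϖ ζ w) [NormOneClass R] (x y : R) :
    (x - y) ^ q = x ^ q - y ^ q := by
  simpa using h.sub_pow x y 1

theorem neg_pow_q (h : LTData p q n ϖ ζ w) [NormOneClass R] (x : R) :
    (-x) ^ q = -x ^ q := by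
  have := h.sub_pow_q 0 x
  rwa [zero_sub, zero_pow (by have := h.two_le_q; omega), zero_sub] at this

theorem lin_add (h : LTData p q n ϖ ζ w) [NormOneClass R] (x y : R) :
    lin q ϖ (x + y) = lin q ϖ x + lin q ϖ y := by
  rw [lin, lin, lin, h.add_pow, smul_add]; ring

theorem lin_zero (h : LTData p q n ϖ ζ w) : lin q ϖ (0 : R) = 0 := by
  have := h.two_le_q
  rw [lin, smul_zero, add_zero, zero_pow (by positivity)]

theorem iter_zero (h : LTData p q n ϖ ζ w) (j : ℕ) : (lin q ϖ)^[j] (0 : R) = 0 :=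
  Function.iterate_fixed h.lin_zero j

theorem iter_add (h : LTData p q n ϖ ζ w) [NormOneClass R] (j : ℕ) (x y : R) :
    (lin q ϖ)^[j] (x + y) = (lin q ϖ)^[j] x + (lin q ϖ)^[j] y := by
  induction j generalizing x y with
  | zero => rfl
  | succ j ih => rw [Function.iterate_succ_apply, h.lin_add, ih]; rfl

theorem iter_sub (h : LTData p q n ϖ ζ w) [NormOneClass R] (j : ℕ) (x y : R) :
    (lin q ϖ)^[j] (x - y) = (lin q ϖ)^[j] x - (lin q ϖ)^[j] y := by
  have := h.iter_add j (x - y) y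
  rw [sub_add_cancel] at this
  rw [this, add_sub_cancel_right]

theorem iter_sum (h : LTData p q n ϖ ζ w) [NormOneClass R] (j : ℕ) {ι : Type*} (s : Finset ι)
    (f : ι → R) : (lin q ϖ)^[j] (∑ i ∈ s, f i) = ∑ i ∈ s, (lin q ϖ)^[j] (f i) := by
  classical
  induction s using Finset.induction_on with
  | empty => simpa using h.iter_zero j
  | insert a s ha ih => rw [Finset.sum_insert ha, Finset.sum_insert ha, h.iter_add, ih]

theorem lin_algebraMap (x : k) : lin q ϖ (algebraMap k R x) = algebraMap k R (lin q ϖ x) := by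
  simp [lin, Algebra.smul_def]

theorem iter_algebraMap (j : ℕ) (x : k) :
    (lin q ϖ)^[j] (algebraMap k R x) = algebraMap k R ((lin q ϖ)^[j] x) := by
  induction j generalizing x with
  | zero => rfl
  | succ j ih => rw [Function.iterate_succ_apply, lin_algebraMap, ih]; rfl

/-! ### The torsion points -/

theorem torsionPt_eq (q n : ℕ) (ϖ w : k) (i : ℕ) :
    torsionPt q n ϖ w i = (lin q ϖ)^[n - i] w := by
  have : mulUnif q ϖ 0 = lin q ϖ := funext fun x => mulUnif_zero_eq_lin q ϖ x
  rw [torsionPt, this]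

theorem lin_torsionPt {i : ℕ} (hi : i + 1 ≤ n) :
    lin q ϖ (torsionPt q n ϖ w (i + 1)) = torsionPt q n ϖ w i := by
  rw [torsionPt_eq, torsionPt_eq, ← Function.iterate_succ_apply' (lin q ϖ)]
  congr 1
  omega

theorem torsionPt_zero (h : LTData p q n ϖ ζ w) : torsionPt q n ϖ w 0 = 0 := h.tors

theorem torsionPt_one_ne (h : LTData p q n ϖ ζ w) : torsionPt q n ϖ w 1 ≠ 0 := h.prim

theorem torsionPt_self : torsionPt q n ϖ w n = w := by
  simp [torsionPt]

/-- This is `[ϖ](ϖ_1) = 0`. It also fixes the size of `ϖ_1`, through `‖ϖ_1‖ ^ (q² - 1) = ‖ϖ‖`. -/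
theorem torsionPt_one_pow (h : LTData p q n ϖ ζ w) :
    torsionPt q n ϖ w 1 ^ q ^ 2 = -(ϖ * torsionPt q n ϖ w 1) := by
  have := lin_torsionPt (q := q) (ϖ := ϖ) (w := w) (i := 0) (by have := h.two_le; omega : 0 + 1 ≤ n)
  rw [h.torsionPt_zero, lin, smul_eq_mul] at this
  exact eq_neg_of_add_eq_zero_left this

theorem norm_pos (h : LTData p q n ϖ ζ w) : 0 < ‖ϖ‖ := norm_pos_iff.mpr h.ne

theorem delta_pos (h : LTData p q n ϖ ζ w) : 0 < ‖torsionPt q n ϖ w 1‖ :=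
  norm_pos_iff.mpr h.torsionPt_one_ne

theorem delta_pow_sq (h : LTData p q n ϖ ζ w) :
    ‖torsionPt q n ϖ w 1‖ ^ q ^ 2 = ‖ϖ‖ * ‖torsionPt q n ϖ w 1‖ := by
  rw [← norm_pow, h.torsionPt_one_pow, norm_neg, norm_mul]

theorem delta_pow (h : LTData p q n ϖ ζ w) :
    ‖torsionPt q n ϖ w 1‖ ^ (q ^ 2 - 1) = ‖ϖ‖ := by
  have h1 := h.delta_pow_sq
  have hq : q ^ 2 = (q ^ 2 - 1) + 1 := by have := h.two_le_q; have : 0 < q ^ 2 := by positivity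
                                          omega
  rw [hq, pow_succ] at h1
  exact mul_right_cancel₀ h.delta_pos.ne' h1

theorem delta_lt_one (h : LTData p q n ϖ ζ w) : ‖torsionPt q n ϖ w 1‖ < 1 := by
  by_contra! hle
  have := one_le_pow₀ hle (n := q ^ 2 - 1)
  rw [h.delta_pow] at this
  exact absurd this (not_le.mpr h.lt)

theorem norm_lt_delta_pow (h : LTData p q n ϖ ζ w) : ‖ϖ‖ < ‖torsionPt q n ϖ w 1‖ ^ q := by
  conv_lhs => rw [← h.delta_pow]
  refine pow_lt_pow_right_of_lt_one₀ h.delta_pos h.delta_lt_one ?_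
  have := h.two_le_q
  have : q * 2 ≤ q ^ 2 := by rw [sq]; exact Nat.mul_le_mul_left q this
  omega

theorem norm_lt_delta (h : LTData p q n ϖ ζ w) : ‖ϖ‖ < ‖torsionPt q n ϖ w 1‖ :=
  h.norm_lt_delta_pow.trans_le (pow_le_of_le_one h.delta_pos.le h.delta_lt_one.le
    (by have := h.two_le_q; omega))

variable [IsUltrametricDist k]

/-- A Newton polygon argument for `x^{q²} + ϖ x = ϖ_{i+1}`: the right side has norm strictly between
`‖ϖ‖` and one, which forces `‖x‖ < 1` and makes `ϖ x` negligible, so that `‖x‖^{q²}` equals the norm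
of the right side. -/
theorem norm_torsionPt (h : LTData p q n ϖ ζ w) (i : ℕ) (hi : i + 1 ≤ n) :
    ‖ϖ‖ < ‖torsionPt q n ϖ w (i + 1)‖ ∧ ‖torsionPt q n ϖ w (i + 1)‖ < 1 ∧
      (i ≠ 0 → ‖torsionPt q n ϖ w (i + 1)‖ ^ q ^ 2 = ‖torsionPt q n ϖ w i‖) := by
  have hq := h.two_le_q
  have hq2 : 1 < q ^ 2 := Nat.one_lt_pow (by norm_num) (by omega)
  induction i with
  | zero => exact ⟨h.norm_lt_delta, h.delta_lt_one, fun h => absurd rfl h⟩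
  | succ i ih =>
    obtain ⟨h1, h2, -⟩ := ih (by omega)
    have e := lin_torsionPt (q := q) (ϖ := ϖ) (w := w) hi
    set x := torsionPt q n ϖ w (i + 1 + 1) with hx
    rw [lin, smul_eq_mul] at e
    have hx1 : ‖x‖ < 1 := by
      by_contra! hle
      have h3 : ‖ϖ * x‖ < ‖x ^ q ^ 2‖ := by
        rw [norm_mul, norm_pow]
        calc ‖ϖ‖ * ‖x‖ < 1 * ‖x‖ := mul_lt_mul_of_pos_right h.lt (by linarith)
          _ = ‖x‖ ^ 1 := by ring
          _ ≤ ‖x‖ ^ q ^ 2 := pow_le_pow_right₀ hle hq2.le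
      have h4 := IsUltrametricDist.norm_add_eq_max_of_norm_ne_norm h3.ne'
      rw [e, max_eq_left h3.le, norm_pow] at h4
      have := one_le_pow₀ hle (n := q ^ 2)
      linarith
    have h3 : ‖x‖ ^ q ^ 2 = ‖torsionPt q n ϖ w (i + 1)‖ := by
      rw [← norm_pow]
      refine norm_eq_of_sub_lt ?_
      rw [← e]
      have : x ^ q ^ 2 - (x ^ q ^ 2 + ϖ * x) = -(ϖ * x) := by ring
      rw [this, norm_neg, e, norm_mul]
      exact (mul_le_of_le_one_right (norm_nonneg _) hx1.le).trans_lt h1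
    refine ⟨?_, hx1, fun _ => h3⟩
    rw [← h3] at h1
    exact h1.trans_le (pow_le_of_le_one (norm_nonneg _) hx1.le (by omega))

theorem torsionPt_lt_succ (h : LTData p q n ϖ ζ w) {i : ℕ} (hi : i + 1 ≤ n) :
    ‖torsionPt q n ϖ w i‖ < ‖torsionPt q n ϖ w (i + 1)‖ := by
  obtain ⟨h1, h2, h3⟩ := h.norm_torsionPt i hi
  have hq := h.two_le_q
  rcases Nat.eq_zero_or_pos i with rfl | h0
  · rw [h.torsionPt_zero, norm_zero]
    exact h.delta_pos
  · rw [← h3 h0.ne']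
    exact pow_lt_self_of_lt_one₀ ((norm_nonneg _).trans_lt h1) h2
      (Nat.one_lt_pow (by norm_num) (by omega))

theorem torsionPt_mono (h : LTData p q n ϖ ζ w) {i j : ℕ} (hij : i ≤ j) (hj : j ≤ n) :
    ‖torsionPt q n ϖ w i‖ ≤ ‖torsionPt q n ϖ w j‖ := by
  induction j, hij using Nat.le_induction with
  | base => exact le_rfl
  | succ j hij ih => exact (ih (by omega)).trans (h.torsionPt_lt_succ hj).le

theorem torsionPt_le_one (h : LTData p q n ϖ ζ w) {j : ℕ} (hj : j ≤ n) :
    ‖torsionPt q n ϖ w j‖ ≤ 1 := by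
  have : 1 ≤ n := by have := h.two_le; omega
  obtain ⟨n', rfl⟩ := Nat.exists_eq_add_of_le' this
  exact (h.torsionPt_mono hj le_rfl).trans (h.norm_torsionPt n' le_rfl).2.1.le

theorem norm_torsionPt_pow (h : LTData p q n ϖ ζ w) {i : ℕ} (hi : i + 1 ≤ n) :
    ‖torsionPt q n ϖ w (i + 1)‖ ^ q ^ (2 * i) = ‖torsionPt q n ϖ w 1‖ := by
  induction i with
  | zero => simp
  | succ i ih =>
    have := (h.norm_torsionPt (i + 1) hi).2.2 (by omega)
    rw [← ih (by omega), ← this, ← pow_mul, ← pow_add]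
    congr 2
    ring

/-! ### The scaling constants -/

/-- The scaling factor of the coordinate `u_0`. -/
def scaleU (q n : ℕ) (ϖ w : k) : k :=
  if Odd n then ϖ ^ ((n + 1) / 2 - 1) * torsionPt q n ϖ w 1 ^ (q * (q - 1)) else ϖ ^ ((n + 1) / 2)

/-- The exponent in the scaling factor of the coordinate `Y`. -/
def expS (q n : ℕ) : ℕ := if Odd n then 1 else q

/-- The scaling factor of the coordinate `Y`. -/
def scaleS (q n : ℕ) (ϖ w : k) : k := torsionPt q n ϖ w (n / 2 + 1) ^ expS q n

/-- The index `n / 2 + 1` is `m` for `n` odd and `m + 1` for `n` even. With the exponent `expS`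
separated, both parities can be estimated together. -/
theorem scaleS_eq (q n : ℕ) (ϖ w : k) : scaleS q n ϖ w = if Odd n then
    torsionPt q n ϖ w ((n + 1) / 2) else torsionPt q n ϖ w ((n + 1) / 2 + 1) ^ q := by
  rw [scaleS, expS]
  split_ifs with h
  · rw [pow_one]
    congr 1
    obtain ⟨r, rfl⟩ := h
    omega
  · rw [Nat.not_odd_iff_even] at h
    obtain ⟨r, rfl⟩ := h
    congr 2
    omega

theorem expS_cases (q n : ℕ) : expS q n = 1 ∨ expS q n = q := by
  rw [expS]; split_ifs <;> simp

theorem expS_eq_pow (q n : ℕ) : ∃ a, expS q n = q ^ a := by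
  rcases expS_cases q n with h | h
  · exact ⟨0, by simp [h]⟩
  · exact ⟨1, by simp [h]⟩

theorem delta_pow_expS_le (h : LTData p q n ϖ ζ w) :
    ‖torsionPt q n ϖ w 1‖ ^ expS q n ≤ ‖torsionPt q n ϖ w 1‖ := by
  refine pow_le_of_le_one h.delta_pos.le h.delta_lt_one.le ?_
  have := h.two_le_q
  rcases expS_cases q n with h | h <;> omega

theorem norm_lt_delta_pow_expS (h : LTData p q n ϖ ζ w) :
    ‖ϖ‖ < ‖torsionPt q n ϖ w 1‖ ^ expS q n := by
  rcases expS_cases q n with h' | h' <;> rw [h']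
  · simpa using h.norm_lt_delta
  · exact h.norm_lt_delta_pow

/-- This encodes `v(u) = m - 1/(q+1)` without real exponents, since `(q - 1)/(q² - 1) = 1/(q + 1)`.
-/
theorem norm_scaleU_odd (h : LTData p q n ϖ ζ w) (ho : Odd n) :
    ‖scaleU q n ϖ w‖ * ‖torsionPt q n ϖ w 1‖ ^ (q - 1) = ‖ϖ‖ ^ ((n + 1) / 2) := by
  have hq := h.two_le_q
  rw [scaleU, if_pos ho, norm_mul, norm_pow, norm_pow, mul_assoc, ← pow_add]
  have e1 : q * (q - 1) + (q - 1) = q ^ 2 - 1 := by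
    obtain ⟨r, rfl⟩ := Nat.exists_eq_add_of_le' (show 1 ≤ q by omega)
    rw [Nat.add_sub_cancel]
    have : (r + 1) ^ 2 = (r + 1) * r + r + 1 := by ring
    omega
  rw [e1, h.delta_pow, ← pow_succ]
  congr 1
  have := h.two_le
  omega

/-- The exponent `q(q-1)` in the scaling of `u` is chosen to complete `ϖ_1^q` to `ϖ_1^{q²}`, so that
the term in `u_0` of the second coordinate has the same leading coefficient, up to sign, as the term
in `y`. -/
theorem scaleU_mul_odd (h : LTData p q n ϖ ζ w) (ho : Odd n) :
    scaleU q n ϖ w * torsionPt q n ϖ w 1 ^ q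
      = -(ϖ ^ ((n + 1) / 2) * torsionPt q n ϖ w 1) := by
  have hq := h.two_le_q
  have e1 : q * (q - 1) + q = q ^ 2 := by
    obtain ⟨r, rfl⟩ := Nat.exists_eq_add_of_le' (show 1 ≤ q by omega)
    rw [Nat.add_sub_cancel]
    ring
  have e2 : (n + 1) / 2 = (n + 1) / 2 - 1 + 1 := by have := h.two_le; omega
  rw [scaleU, if_pos ho, mul_assoc, ← pow_add, e1, h.torsionPt_one_pow]
  conv_rhs => rw [e2, pow_succ]
  ring

theorem norm_scaleU_even (ho : ¬ Odd n) : ‖scaleU q n ϖ w‖ = ‖ϖ‖ ^ ((n + 1) / 2) := by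
  rw [scaleU, if_neg ho, norm_pow]

theorem norm_scaleU_lt_odd (h : LTData p q n ϖ ζ w) (ho : Odd n) :
    ‖scaleU q n ϖ w‖ < ‖ϖ‖ ^ ((n + 1) / 2 - 1) * ‖torsionPt q n ϖ w 1‖ := by
  have h1 := h.norm_scaleU_odd ho
  have hq := h.two_le_q
  have hd := pow_pos h.delta_pos (q - 1)
  rw [← mul_lt_mul_iff_left₀ hd, h1]
  have e2 : (n + 1) / 2 = (n + 1) / 2 - 1 + 1 := by have := h.two_le; omega
  have e3 : q - 1 + 1 = q := by omega
  have h2 := h.norm_lt_delta_pow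
  have e4 := pow_succ ‖torsionPt q n ϖ w 1‖ (q - 1)
  rw [e3] at e4
  rw [e4] at h2
  calc ‖ϖ‖ ^ ((n + 1) / 2) = ‖ϖ‖ ^ ((n + 1) / 2 - 1) * ‖ϖ‖ := by
        conv_lhs => rw [e2, pow_succ]
    _ < ‖ϖ‖ ^ ((n + 1) / 2 - 1) * (‖torsionPt q n ϖ w 1‖ ^ (q - 1) * ‖torsionPt q n ϖ w 1‖) :=
        mul_lt_mul_of_pos_left h2 (pow_pos h.norm_pos _)
    _ = _ := by ring

theorem norm_scaleU_le (h : LTData p q n ϖ ζ w) :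
    ‖scaleU q n ϖ w‖ ≤ ‖ϖ‖ ^ ((n + 1) / 2 - 1) * ‖torsionPt q n ϖ w 1‖ := by
  by_cases ho : Odd n
  · exact (h.norm_scaleU_lt_odd ho).le
  · rw [norm_scaleU_even ho]
    have e2 : (n + 1) / 2 = (n + 1) / 2 - 1 + 1 := by have := h.two_le; omega
    conv_lhs => rw [e2, pow_succ]
    exact mul_le_mul_of_nonneg_left h.norm_lt_delta.le (pow_nonneg (norm_nonneg _) _)

theorem norm_scaleU_le_norm (h : LTData p q n ϖ ζ w) : ‖scaleU q n ϖ w‖ ≤ ‖ϖ‖ := by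
  have hn := h.two_le
  by_cases ho : Odd n
  · refine (h.norm_scaleU_le).trans ?_
    refine (mul_le_of_le_one_right (by positivity) h.delta_lt_one.le).trans ?_
    refine pow_le_of_le_one (norm_nonneg _) h.lt.le ?_
    obtain ⟨r, rfl⟩ := ho
    omega
  · rw [norm_scaleU_even ho]
    exact pow_le_of_le_one (norm_nonneg _) h.lt.le (by omega)

/-- The right side is the size of the leading term of `B_n`; every contribution of `u` with an extra
factor `ϖ` is therefore negligible there. -/
theorem norm_mul_norm_scaleU_lt (h : LTData p q n ϖ ζ w) :
    ‖ϖ‖ * ‖scaleU q n ϖ w‖ < ‖ϖ‖ ^ ((n + 1) / 2) * ‖torsionPt q n ϖ w 1‖ ^ expS q n := by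
  by_cases ho : Odd n
  · rw [expS, if_pos ho, pow_one]
    have e2 : (n + 1) / 2 = (n + 1) / 2 - 1 + 1 := by have := h.two_le; omega
    have := mul_lt_mul_of_pos_left (h.norm_scaleU_lt_odd ho) h.norm_pos
    refine this.trans_eq ?_
    conv_rhs => rw [e2, pow_succ]
    ring
  · rw [norm_scaleU_even ho, mul_comm]
    exact mul_lt_mul_of_pos_left h.norm_lt_delta_pow_expS (pow_pos h.norm_pos _)

/-- Each descent in the torsion tower is a `q²`-th power on norms. There are `n / 2` of them, and in
even level the exponent `q` of the scaling replaces half a descent, which gives `q^{n-1}` in both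
cases. -/
theorem norm_scaleS_pow (h : LTData p q n ϖ ζ w) :
    ‖scaleS q n ϖ w‖ ^ q ^ (n - 1) = ‖torsionPt q n ϖ w 1‖ := by
  have hn := h.two_le
  rw [scaleS, norm_pow, ← pow_mul, ← h.norm_torsionPt_pow (i := n / 2) (by omega)]
  congr 1
  rw [expS]
  split_ifs with ho
  · rw [one_mul]
    congr 1
    obtain ⟨r, rfl⟩ := ho
    omega
  · rw [← pow_succ']
    congr 1
    rw [Nat.not_odd_iff_even] at ho
    obtain ⟨r, rfl⟩ := ho
    omega

theorem norm_scaleS_pos (h : LTData p q n ϖ ζ w) : 0 < ‖scaleS q n ϖ w‖ := by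
  have hn := h.two_le
  rw [scaleS, norm_pow]
  exact pow_pos ((norm_nonneg _).trans_lt (h.norm_torsionPt (n / 2) (by omega)).1) _

theorem norm_scaleS_lt_one (h : LTData p q n ϖ ζ w) : ‖scaleS q n ϖ w‖ < 1 := by
  by_contra! hle
  have := one_le_pow₀ hle (n := q ^ (n - 1))
  rw [h.norm_scaleS_pow] at this
  exact absurd this (not_le.mpr h.delta_lt_one)

theorem delta_lt_norm_scaleS (h : LTData p q n ϖ ζ w) :
    ‖torsionPt q n ϖ w 1‖ < ‖scaleS q n ϖ w‖ := by
  have hn := h.two_le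
  have hq := h.two_le_q
  rw [← h.norm_scaleS_pow]
  exact pow_lt_self_of_lt_one₀ h.norm_scaleS_pos h.norm_scaleS_lt_one
    (Nat.one_lt_pow (by omega) (by omega))

/-- For even `n` the points `τ_i` with `i ≤ m` are smaller than the radius. -/
theorem torsionPt_lt_scaleS_even (h : LTData p q n ϖ ζ w) (ho : ¬ Odd n) {i : ℕ}
    (hi : i ≤ (n + 1) / 2) : ‖torsionPt q n ϖ w i‖ < ‖scaleS q n ϖ w‖ := by
  have hn := h.two_le
  have hq := h.two_le_q
  rw [Nat.not_odd_iff_even] at ho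
  refine (h.torsionPt_mono hi (by omega)).trans_lt ?_
  have e1 : (n + 1) / 2 = n / 2 := by obtain ⟨r, rfl⟩ := ho; omega
  have h1 := h.norm_torsionPt (n / 2) (by omega)
  rw [e1, ← h1.2.2 (by omega), scaleS, expS, if_neg (by rwa [Nat.not_odd_iff_even]), norm_pow]
  refine pow_lt_pow_right_of_lt_one₀ ((norm_nonneg _).trans_lt h1.1) h1.2.1 ?_
  rw [sq]
  nlinarith

theorem torsionPt_lt_scaleS_odd (h : LTData p q n ϖ ζ w) (ho : Odd n) {i : ℕ}
    (hi : i < (n + 1) / 2) : ‖torsionPt q n ϖ w i‖ < ‖scaleS q n ϖ w‖ := by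
  have hn := h.two_le
  rw [scaleS_eq, if_pos ho]
  refine (h.torsionPt_lt_succ (by omega)).trans_le (h.torsionPt_mono (by omega) (by omega))

theorem torsionPt_le_scaleS (h : LTData p q n ϖ ζ w) {i : ℕ}
    (hi : i ≤ (n + 1) / 2) : ‖torsionPt q n ϖ w i‖ ≤ ‖scaleS q n ϖ w‖ := by
  have hn := h.two_le
  by_cases ho : Odd n
  · rw [scaleS_eq, if_pos ho]
    exact h.torsionPt_mono hi (by omega)
  · exact (h.torsionPt_lt_scaleS_even ho hi).le

end LTData

/-- One step of multiplication by the uniformizer in the diagonal coordinates. -/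
def stepAB {k R : Type*} [NormedField k] [NormedCommRing R] [NormedAlgebra k R] (q : ℕ) (ϖ : k)
    (u : R) (z : R × R) : R × R :=
  (lin q ϖ z.1 + u * z.2 ^ q, lin q ϖ z.2 + u * z.1 ^ q)

theorem norm_sum_lt' {S ι : Type*} [SeminormedAddCommGroup S] [IsUltrametricDist S] {r : ℝ}
    (hr : 0 < r) (s : Finset ι) (f : ι → S) (h : ∀ i ∈ s, ‖f i‖ < r) : ‖∑ i ∈ s, f i‖ < r := by
  classical
  induction s using Finset.induction_on with
  | empty => simpa using hr
  | insert a s ha ih =>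
    rw [Finset.sum_insert ha]
    exact norm_add_lt_of_lt' (h a (Finset.mem_insert_self a s))
      (ih fun i hi => h i (Finset.mem_insert_of_mem hi))

namespace LTData

variable {k R : Type*} [NormedField k] [IsUltrametricDist k] [NormedCommRing R]
  [NormedAlgebra k R] [NormOneClass R] [IsUltrametricDist R]
  {p q n : ℕ} {ϖ ζ w : k}

/-! ### Estimates for the linear operator -/

theorem norm_iter_le (h : LTData p q n ϖ ζ w) (j : ℕ) {x : R} (hx : ‖x‖ ≤ 1) :
    ‖(lin q ϖ)^[j] x‖ ≤ ‖x‖ := by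
  induction j with
  | zero => exact le_rfl
  | succ j ih =>
    rw [Function.iterate_succ_apply']
    have hq := h.two_le_q
    refine norm_add_le_of_le' ?_ ?_
    · exact (norm_pow_le _ _).trans ((pow_le_of_le_one (norm_nonneg _) (ih.trans hx)
        (by positivity)).trans ih)
    · rw [norm_smul]
      exact (mul_le_of_le_one_left (norm_nonneg _) h.lt.le).trans ih

/-- Since `‖ϖ_1‖ ^ (q² - 1) = ‖ϖ‖`, the radius `‖ϖ_1‖` is where `x^{q²}` and `ϖ x` have equal size;
inside it every step of the operator gains a factor `‖ϖ‖`. -/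
theorem norm_pow_sq_le (h : LTData p q n ϖ ζ w) {x : R} {d : ℝ} (hxd : ‖x‖ ≤ d)
    (hd : d ≤ ‖torsionPt q n ϖ w 1‖) : ‖x ^ q ^ 2‖ ≤ ‖ϖ‖ * d := by
  have hq := h.two_le_q
  have e : q ^ 2 = (q ^ 2 - 1) + 1 := by
    have : 0 < q ^ 2 := by positivity
    omega
  have hd0 := (norm_nonneg x).trans hxd
  refine (norm_pow_le _ _).trans ((pow_le_pow_left₀ (norm_nonneg _) hxd _).trans ?_)
  rw [e, pow_succ]
  refine mul_le_mul_of_nonneg_right ?_ hd0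
  rw [← h.delta_pow]
  exact pow_le_pow_left₀ hd0 hd _

theorem norm_iter_le_pow (h : LTData p q n ϖ ζ w) (j : ℕ) {x : R} {d : ℝ} (hxd : ‖x‖ ≤ d)
    (hd : d ≤ ‖torsionPt q n ϖ w 1‖) : ‖(lin q ϖ)^[j] x‖ ≤ ‖ϖ‖ ^ j * d := by
  induction j with
  | zero => simpa using hxd
  | succ j ih =>
    have hd0 := (norm_nonneg x).trans hxd
    rw [Function.iterate_succ_apply', pow_succ', mul_assoc]
    refine norm_add_le_of_le' (h.norm_pow_sq_le ih ?_) ?_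
    · exact (mul_le_of_le_one_left hd0 (pow_le_one₀ (norm_nonneg _) h.lt.le)).trans hd
    · rw [norm_smul]
      exact mul_le_mul_of_nonneg_left ih (norm_nonneg _)

/-- On the smaller radius `‖ϖ_1‖^q` the power `x^{q²}` gains `‖ϖ‖^q`, and `q ≥ 2` makes it
negligible against `ϖ x`. -/
theorem norm_pow_sq_le' (h : LTData p q n ϖ ζ w) {x : R} {d : ℝ} (hxd : ‖x‖ ≤ d)
    (hd : d ≤ ‖torsionPt q n ϖ w 1‖ ^ q) : ‖x ^ q ^ 2‖ ≤ ‖ϖ‖ ^ 2 * d := by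
  have hq := h.two_le_q
  have e : q ^ 2 = (q ^ 2 - 1) + 1 := by
    have : 0 < q ^ 2 := by positivity
    omega
  have hd0 := (norm_nonneg x).trans hxd
  refine (norm_pow_le _ _).trans ((pow_le_pow_left₀ (norm_nonneg _) hxd _).trans ?_)
  rw [e, pow_succ]
  refine mul_le_mul_of_nonneg_right ?_ hd0
  calc d ^ (q ^ 2 - 1) ≤ (‖torsionPt q n ϖ w 1‖ ^ q) ^ (q ^ 2 - 1) := pow_le_pow_left₀ hd0 hd _
    _ = ‖ϖ‖ ^ q := by rw [← pow_mul, mul_comm, pow_mul, h.delta_pow]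
    _ ≤ ‖ϖ‖ ^ 2 := pow_le_pow_of_le_one (norm_nonneg _) h.lt.le hq

theorem delta_pow_q_le (h : LTData p q n ϖ ζ w) :
    ‖torsionPt q n ϖ w 1‖ ^ q ≤ ‖torsionPt q n ϖ w 1‖ :=
  pow_le_of_le_one h.delta_pos.le h.delta_lt_one.le (by have := h.two_le_q; omega)

/-- Well inside the critical radius the operator is multiplication by `ϖ` up to relative error
`‖ϖ‖`, by `norm_pow_sq_le'` and additivity. -/
theorem norm_iter_sub_le (h : LTData p q n ϖ ζ w) (j : ℕ) {x : R} {d : ℝ} (hxd : ‖x‖ ≤ d)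
    (hd : d ≤ ‖torsionPt q n ϖ w 1‖ ^ q) :
    ‖(lin q ϖ)^[j] x - ϖ ^ j • x‖ ≤ ‖ϖ‖ ^ (j + 1) * d := by
  have hd0 := (norm_nonneg x).trans hxd
  induction j generalizing x d with
  | zero => simpa using mul_nonneg (norm_nonneg ϖ) hd0
  | succ j ih =>
    have e : (lin q ϖ)^[j + 1] x - ϖ ^ (j + 1) • x
        = ((lin q ϖ)^[j] (ϖ • x) - ϖ ^ j • (ϖ • x)) + (lin q ϖ)^[j] (x ^ q ^ 2) := by
      rw [Function.iterate_succ_apply, lin, h.iter_add, pow_succ ϖ j, mul_smul]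
      abel
    rw [e]
    have h1 : ‖ϖ • x‖ ≤ ‖ϖ‖ * d := by
      rw [norm_smul]; exact mul_le_mul_of_nonneg_left hxd (norm_nonneg _)
    have h2 : ‖ϖ‖ * d ≤ d := mul_le_of_le_one_left hd0 h.lt.le
    have h3 : ‖ϖ‖ ^ 2 * d ≤ d :=
      mul_le_of_le_one_left hd0 (pow_le_one₀ (norm_nonneg _) h.lt.le)
    refine norm_add_le_of_le' ?_ ?_
    · refine (ih h1 (h2.trans hd) ((norm_nonneg _).trans h1)).trans_eq ?_
      ring
    · refine (h.norm_iter_le_pow j (h.norm_pow_sq_le' hxd hd)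
        (h3.trans (hd.trans h.delta_pow_q_le))).trans_eq ?_
      ring

theorem norm_smul_le_of (a : k) {x : R} (hx : ‖x‖ ≤ 1) : ‖a • x‖ ≤ ‖a‖ := by
  rw [norm_smul]
  exact mul_le_of_le_one_right (norm_nonneg _) hx

theorem norm_pow_le_one' {x : R} (hx : ‖x‖ ≤ 1) (j : ℕ) : ‖x ^ j‖ ≤ 1 :=
  (norm_pow_le _ _).trans (pow_le_one₀ (norm_nonneg _) hx)

/-- An exact identity, from `ϖ_1^{q²} = -ϖ ϖ_1`. At the critical radius both terms of the operator
count, and this is where `X - X^{q²}` comes from. -/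
theorem lin_torsionPt_one_smul (h : LTData p q n ϖ ζ w) (x : R) :
    lin q ϖ (torsionPt q n ϖ w 1 • x)
      = (ϖ * torsionPt q n ϖ w 1) • (x - x ^ q ^ 2) := by
  rw [lin, smul_pow, h.torsionPt_one_pow, smul_sub, smul_smul, neg_smul]
  ring

/-- The first application produces `x - x^{q²}` exactly and lands in radius `‖ϖ‖ ‖ϖ_1‖ < ‖ϖ_1‖^q`,
where the remaining applications amount to multiplication by `ϖ`. -/
theorem norm_iter_torsionPt_one (h : LTData p q n ϖ ζ w) {j : ℕ} (hj : 1 ≤ j) {x : R}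
    (hx : ‖x‖ ≤ 1) :
    ‖(lin q ϖ)^[j] (torsionPt q n ϖ w 1 • x)
      - (ϖ ^ j * torsionPt q n ϖ w 1) • (x - x ^ q ^ 2)‖
      < ‖ϖ‖ ^ j * ‖torsionPt q n ϖ w 1‖ := by
  obtain ⟨j, rfl⟩ := Nat.exists_eq_add_of_le' hj
  rw [Function.iterate_succ_apply, h.lin_torsionPt_one_smul]
  have h1 : ‖(ϖ * torsionPt q n ϖ w 1) • (x - x ^ q ^ 2)‖ ≤ ‖ϖ‖ * ‖torsionPt q n ϖ w 1‖ := by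
    rw [← norm_mul]
    exact norm_smul_le_of _ (norm_sub_le_of_le' hx (norm_pow_le_one' hx _))
  have h2 : ‖ϖ‖ * ‖torsionPt q n ϖ w 1‖ ≤ ‖torsionPt q n ϖ w 1‖ ^ q :=
    (mul_le_of_le_one_right (norm_nonneg _) h.delta_lt_one.le).trans h.norm_lt_delta_pow.le
  have h3 := h.norm_iter_sub_le j h1 h2
  rw [smul_smul, ← mul_assoc, ← pow_succ] at h3
  refine h3.trans_lt ?_
  rw [← mul_assoc]
  refine mul_lt_mul_of_pos_right ?_ h.delta_pos
  exact mul_lt_of_lt_one_right (pow_pos h.norm_pos _) h.lt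

/-- Above the critical radius `ϖ x` is negligible and the operator is a Frobenius that moves one
step down the torsion tower. The exponent `q^a` covers both `ϖ_i` and `ϖ_i^q`, as required by the
two parities. -/
theorem norm_lin_smul_sub (h : LTData p q n ϖ ζ w) {i : ℕ} (hi : i + 1 ≤ n) (a : ℕ) {y : R}
    (hy : ‖y‖ ≤ 1) :
    ‖lin q ϖ (torsionPt q n ϖ w (i + 1) ^ q ^ a • y)
      - torsionPt q n ϖ w i ^ q ^ a • y ^ q ^ 2‖ ≤ ‖ϖ‖ := by
  have hq := h.two_le_q
  have hτ := h.torsionPt_le_one hi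
  have e : torsionPt q n ϖ w i ^ q ^ a = (torsionPt q n ϖ w (i + 1) ^ q ^ a) ^ q ^ 2
      + (ϖ * torsionPt q n ϖ w (i + 1)) ^ q ^ a := by
    rw [← lin_torsionPt hi, lin, smul_eq_mul, h.add_pow, ← pow_mul, ← pow_mul, mul_comm (q ^ 2)]
  rw [lin, smul_pow, e, add_smul]
  have e2 : ∀ a b c : R, a + b - (a + c) = b - c := fun a b c => by ring
  rw [e2]
  refine norm_sub_le_of_le' ?_ ?_
  · refine norm_smul_le_of _ ((norm_smul_le_of _ hy).trans ?_)
    rw [norm_pow]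
    exact pow_le_one₀ (norm_nonneg _) hτ
  · refine (norm_smul_le_of _ (norm_pow_le_one' hy _)).trans ?_
    rw [norm_pow, norm_mul]
    refine (pow_le_of_le_one (by positivity) ?_ (by positivity)).trans ?_
    · exact mul_le_one₀ h.lt.le (norm_nonneg _) hτ
    · exact mul_le_of_le_one_right (norm_nonneg _) hτ

/-- Iterates of the linear operator act on multiples of torsion points like Frobenius. -/
theorem norm_iter_smul_sub (h : LTData p q n ϖ ζ w) (a j : ℕ) {i : ℕ} (hi : i + j ≤ n) {y : R}
    (hy : ‖y‖ ≤ 1) :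
    ‖(lin q ϖ)^[j] (torsionPt q n ϖ w (i + j) ^ q ^ a • y)
      - torsionPt q n ϖ w i ^ q ^ a • y ^ q ^ (2 * j)‖ ≤ ‖ϖ‖ := by
  induction j generalizing y with
  | zero => simp
  | succ j ih =>
    have h1 := h.norm_lin_smul_sub (i := i + j) hi a hy
    have h2 := ih (by omega) (y := y ^ q ^ 2) (norm_pow_le_one' hy _)
    rw [Function.iterate_succ_apply]
    have e : (lin q ϖ)^[j] (lin q ϖ (torsionPt q n ϖ w (i + (j + 1)) ^ q ^ a • y))
        = (lin q ϖ)^[j] (lin q ϖ (torsionPt q n ϖ w (i + (j + 1)) ^ q ^ a • y)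
          - torsionPt q n ϖ w (i + j) ^ q ^ a • y ^ q ^ 2)
        + (lin q ϖ)^[j] (torsionPt q n ϖ w (i + j) ^ q ^ a • y ^ q ^ 2) := by
      rw [← h.iter_add, sub_add_cancel]
    rw [e, add_sub_assoc]
    refine norm_add_le_of_le' ((h.norm_iter_le j (h1.trans h.lt.le)).trans h1) ?_
    refine (congrArg norm ?_).le.trans h2
    rw [← pow_mul, ← pow_add]
    congr 4
    ring

/-! ### The orbit in the diagonal coordinates -/

/-- Variation of constants: as the linear operator is additive, each term `u B_i^q` is carried
separately through the remaining steps. -/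
theorem fst_iter (h : LTData p q n ϖ ζ w) (u : R) (z : R × R) (j : ℕ) :
    ((stepAB q ϖ u)^[j] z).1 = (lin q ϖ)^[j] z.1
      + ∑ i ∈ Finset.range j, (lin q ϖ)^[j - 1 - i] (u * ((stepAB q ϖ u)^[i] z).2 ^ q) := by
  induction j with
  | zero => simp
  | succ j ih =>
    rw [Function.iterate_succ_apply']
    conv_lhs => rw [stepAB]
    simp only
    rw [ih, h.lin_add, ← Function.iterate_succ_apply' (lin q ϖ) j, Finset.sum_range_succ]
    have e : lin q ϖ (∑ i ∈ Finset.range j,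
        (lin q ϖ)^[j - 1 - i] (u * ((stepAB q ϖ u)^[i] z).2 ^ q))
        = ∑ i ∈ Finset.range j,
        (lin q ϖ)^[j + 1 - 1 - i] (u * ((stepAB q ϖ u)^[i] z).2 ^ q) := by
      have := h.iter_sum 1 (Finset.range j)
        fun i => (lin q ϖ)^[j - 1 - i] (u * ((stepAB q ϖ u)^[i] z).2 ^ q)
      rw [Function.iterate_one] at this
      rw [this]
      refine Finset.sum_congr rfl fun i hi => ?_
      rw [← Function.iterate_succ_apply' (lin q ϖ) (j - 1 - i)]
      congr 1
      have := Finset.mem_range.mp hi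
      omega
    rw [e]
    have e2 : j + 1 - 1 - j = 0 := by omega
    rw [e2, Function.iterate_zero, id]
    ring

theorem stepAB_swap (u : R) (z : R × R) :
    stepAB q ϖ u z.swap = (stepAB q ϖ u z).swap := rfl

/-- The recursion is symmetric under exchange of `A` and `B`, so statements about the first
coordinate transfer to the second. -/
theorem iter_stepAB_swap (u : R) (z : R × R) (j : ℕ) :
    (stepAB q ϖ u)^[j] z.swap = ((stepAB q ϖ u)^[j] z).swap := by
  induction j with
  | zero => rfl
  | succ j ih =>
    rw [Function.iterate_succ_apply', ih, stepAB_swap, Function.iterate_succ_apply']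

theorem snd_iter (h : LTData p q n ϖ ζ w) (u : R) (z : R × R) (j : ℕ) :
    ((stepAB q ϖ u)^[j] z).2 = (lin q ϖ)^[j] z.2
      + ∑ i ∈ Finset.range j, (lin q ϖ)^[j - 1 - i] (u * ((stepAB q ϖ u)^[i] z).1 ^ q) := by
  have := h.fst_iter u z.swap j
  simp only [iter_stepAB_swap] at this
  exact this

/-- The diagonal coordinates of the point with normalized coordinates `(u_0, x, y)`. -/
def startAB (q n : ℕ) (ϖ w : k) (x y : R) : R × R :=
  (algebraMap k R w + torsionPt q n ϖ w 1 • x, scaleS q n ϖ w • y - torsionPt q n ϖ w 1 • x)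

/-- The diagonal coordinates after `j` multiplications by the uniformizer. -/
def orbit (q n : ℕ) (ϖ w : k) (u₀ x y : R) (j : ℕ) : R × R :=
  (stepAB q ϖ (scaleU q n ϖ w • u₀))^[j] (startAB q n ϖ w x y)

section Orbit

variable {u₀ x y : R}

theorem norm_orbit_le_one (h : LTData p q n ϖ ζ w) (hu : ‖u₀‖ ≤ 1) (hx : ‖x‖ ≤ 1)
    (hy : ‖y‖ ≤ 1) (j : ℕ) :
    ‖(orbit q n ϖ w u₀ x y j).1‖ ≤ 1 ∧ ‖(orbit q n ϖ w u₀ x y j).2‖ ≤ 1 := by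
  have hq := h.two_le_q
  induction j with
  | zero =>
    have h1 : ‖torsionPt q n ϖ w 1 • x‖ ≤ 1 := (norm_smul_le_of _ hx).trans h.delta_lt_one.le
    refine ⟨norm_add_le_of_le' ?_ h1, norm_sub_le_of_le' ?_ h1⟩
    · rw [norm_algebraMap', ← torsionPt_self (q := q) (n := n) (ϖ := ϖ) (w := w)]
      exact h.torsionPt_le_one le_rfl
    · exact (norm_smul_le_of _ hy).trans h.norm_scaleS_lt_one.le
  | succ j ih =>
    have hu' : ‖scaleU q n ϖ w • u₀‖ ≤ 1 :=
      (norm_smul_le_of _ hu).trans (h.norm_scaleU_le_norm.trans h.lt.le)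
    rw [orbit, Function.iterate_succ_apply']
    have hl : ∀ {x : R}, ‖x‖ ≤ 1 → ‖lin q ϖ x‖ ≤ 1 := fun {x} hx =>
      (h.norm_iter_le 1 hx).trans hx
    exact ⟨norm_add_le_of_le' (hl ih.1) (norm_mul_le_one' hu' (norm_pow_le_one' ih.2 _)),
      norm_add_le_of_le' (hl ih.2) (norm_mul_le_one' hu' (norm_pow_le_one' ih.1 _))⟩

theorem norm_u_mul_le (hu : ‖u₀‖ ≤ 1) (z : R) :
    ‖scaleU q n ϖ w • u₀ * z‖ ≤ ‖scaleU q n ϖ w‖ * ‖z‖ := by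
  refine (norm_mul_le _ _).trans ?_
  exact mul_le_mul_of_nonneg_right (norm_smul_le_of _ hu) (norm_nonneg _)

theorem norm_iter_u_mul_le (h : LTData p q n ϖ ζ w) (hu : ‖u₀‖ ≤ 1) (j : ℕ) {z : R} {d : ℝ}
    (hz : ‖z‖ ≤ d) (hd1 : d ≤ 1) :
    ‖(lin q ϖ)^[j] (scaleU q n ϖ w • u₀ * z)‖ ≤ ‖ϖ‖ ^ j * (‖scaleU q n ϖ w‖ * d) := by
  refine h.norm_iter_le_pow j ((norm_u_mul_le hu z).trans
    (mul_le_mul_of_nonneg_left hz (norm_nonneg _))) ?_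
  refine (mul_le_of_le_one_right (norm_nonneg _) hd1).trans ?_
  exact h.norm_scaleU_le_norm.trans h.norm_lt_delta.le

theorem norm_sum_u_le (h : LTData p q n ϖ ζ w) (hu : ‖u₀‖ ≤ 1) (j : ℕ) (f : ℕ → R)
    (hf : ∀ i, ‖f i‖ ≤ 1) :
    ‖∑ i ∈ Finset.range j, (lin q ϖ)^[j - 1 - i] (scaleU q n ϖ w • u₀ * f i ^ q)‖
      ≤ ‖scaleU q n ϖ w‖ := by
  refine IsUltrametricDist.norm_sum_le_of_forall_le_of_nonneg (norm_nonneg _) fun i _ => ?_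
  refine (h.norm_iter_u_mul_le hu _ (norm_pow_le_one' (hf i) q) le_rfl).trans ?_
  rw [mul_one]
  exact mul_le_of_le_one_left (norm_nonneg _) (pow_le_one₀ (norm_nonneg _) h.lt.le)

theorem orbit_fst_eq (h : LTData p q n ϖ ζ w) {j : ℕ} (hj : j ≤ n) :
    (orbit q n ϖ w u₀ x y j).1 = algebraMap k R (torsionPt q n ϖ w (n - j))
      + (lin q ϖ)^[j] (torsionPt q n ϖ w 1 • x)
      + ∑ i ∈ Finset.range j, (lin q ϖ)^[j - 1 - i]
        (scaleU q n ϖ w • u₀ * (orbit q n ϖ w u₀ x y i).2 ^ q) := by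
  rw [orbit, h.fst_iter, startAB, h.iter_add, iter_algebraMap, torsionPt_eq q n ϖ w (n - j),
    Nat.sub_sub_self hj]
  rfl

theorem orbit_snd_eq (h : LTData p q n ϖ ζ w) (j : ℕ) :
    (orbit q n ϖ w u₀ x y j).2 = (lin q ϖ)^[j] (scaleS q n ϖ w • y)
      - (lin q ϖ)^[j] (torsionPt q n ϖ w 1 • x)
      + ∑ i ∈ Finset.range j, (lin q ϖ)^[j - 1 - i]
        (scaleU q n ϖ w • u₀ * (orbit q n ϖ w u₀ x y i).1 ^ q) := by
  rw [orbit, h.snd_iter, startAB, h.iter_sub]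
  rfl

theorem norm_iter_tau_le (h : LTData p q n ϖ ζ w) (hx : ‖x‖ ≤ 1) (j : ℕ) :
    ‖(lin q ϖ)^[j] (torsionPt q n ϖ w 1 • x)‖ ≤ ‖ϖ‖ ^ j * ‖torsionPt q n ϖ w 1‖ :=
  h.norm_iter_le_pow j (norm_smul_le_of _ hx) le_rfl

/-- The linear part of the orbit of `A` is `ϖ_{n-j}` plus the image of `ϖ_1 x`, and the terms in `u`
are bounded by the scaling of `u`, hence by `‖ϖ‖`. -/
theorem norm_orbit_fst_sub_le (h : LTData p q n ϖ ζ w) (hu : ‖u₀‖ ≤ 1) (hx : ‖x‖ ≤ 1)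
    (hy : ‖y‖ ≤ 1) {j : ℕ} (hj : j ≤ n) :
    ‖(orbit q n ϖ w u₀ x y j).1 - algebraMap k R (torsionPt q n ϖ w (n - j))‖
      ≤ max ‖ϖ‖ (‖ϖ‖ ^ j * ‖torsionPt q n ϖ w 1‖) := by
  rw [h.orbit_fst_eq hj, add_assoc, add_sub_cancel_left]
  refine norm_add_le_of_le' ((h.norm_iter_tau_le hx j).trans (le_max_right _ _)) ?_
  exact (h.norm_sum_u_le hu j _ fun i => (h.norm_orbit_le_one hu hx hy i).2).trans
    (h.norm_scaleU_le_norm.trans (le_max_left _ _))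

theorem norm_orbit_fst_sub_le_delta (h : LTData p q n ϖ ζ w) (hu : ‖u₀‖ ≤ 1) (hx : ‖x‖ ≤ 1)
    (hy : ‖y‖ ≤ 1) {j : ℕ} (hj : j ≤ n) :
    ‖(orbit q n ϖ w u₀ x y j).1 - algebraMap k R (torsionPt q n ϖ w (n - j))‖
      ≤ ‖torsionPt q n ϖ w 1‖ :=
  (h.norm_orbit_fst_sub_le hu hx hy hj).trans (max_le h.norm_lt_delta.le
    (mul_le_of_le_one_left (norm_nonneg _) (pow_le_one₀ (norm_nonneg _) h.lt.le)))

theorem pow_mul_delta_le (h : LTData p q n ϖ ζ w) {j : ℕ} (hj : 1 ≤ j) :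
    ‖ϖ‖ ^ j * ‖torsionPt q n ϖ w 1‖ ≤ ‖ϖ‖ :=
  (mul_le_of_le_one_right (by positivity) h.delta_lt_one.le).trans
    (pow_le_of_le_one (norm_nonneg _) h.lt.le (by omega))

theorem norm_orbit_fst_sub_le_norm (h : LTData p q n ϖ ζ w) (hu : ‖u₀‖ ≤ 1) (hx : ‖x‖ ≤ 1)
    (hy : ‖y‖ ≤ 1) {j : ℕ} (hj : j ≤ n) (hj1 : 1 ≤ j) :
    ‖(orbit q n ϖ w u₀ x y j).1 - algebraMap k R (torsionPt q n ϖ w (n - j))‖ ≤ ‖ϖ‖ :=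
  (h.norm_orbit_fst_sub_le hu hx hy hj).trans (max_le le_rfl (h.pow_mul_delta_le hj1))

theorem norm_orbit_snd_le (h : LTData p q n ϖ ζ w) (hu : ‖u₀‖ ≤ 1) (hx : ‖x‖ ≤ 1)
    (hy : ‖y‖ ≤ 1) (j : ℕ) : ‖(orbit q n ϖ w u₀ x y j).2‖ ≤ ‖scaleS q n ϖ w‖ := by
  have hδs := h.delta_lt_norm_scaleS.le
  rw [h.orbit_snd_eq j]
  refine norm_add_le_of_le' (norm_sub_le_of_le' ?_ ?_) ?_
  · have := norm_smul_le_of (scaleS q n ϖ w) hy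
    exact (h.norm_iter_le j (this.trans h.norm_scaleS_lt_one.le)).trans this
  · refine (h.norm_iter_tau_le hx j).trans (le_trans ?_ hδs)
    exact mul_le_of_le_one_left (norm_nonneg _) (pow_le_one₀ (norm_nonneg _) h.lt.le)
  · exact (h.norm_sum_u_le hu j _ fun i => (h.norm_orbit_le_one hu hx hy i).1).trans
      (h.norm_scaleU_le_norm.trans (h.norm_lt_delta.le.trans hδs))

theorem norm_iter_scaleS_sub (h : LTData p q n ϖ ζ w) (hy : ‖y‖ ≤ 1) {i j : ℕ}
    (hij : i + j = n / 2 + 1) :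
    ‖(lin q ϖ)^[j] (scaleS q n ϖ w • y)
      - torsionPt q n ϖ w i ^ expS q n • y ^ q ^ (2 * j)‖ ≤ ‖ϖ‖ := by
  obtain ⟨a, ha⟩ := expS_eq_pow q n
  have hn := h.two_le
  rw [scaleS, ← hij, ha]
  exact h.norm_iter_smul_sub a j (by omega) hy

/-- The term `s y` descends the torsion tower by Frobenius steps, as in `norm_iter_smul_sub`, and
reaches the level of `ϖ_1` after `n / 2` steps. Everything else is bounded by the right side. -/
theorem norm_orbit_snd_sub_le (h : LTData p q n ϖ ζ w) (hu : ‖u₀‖ ≤ 1) (hx : ‖x‖ ≤ 1)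
    (hy : ‖y‖ ≤ 1) {i j : ℕ} (hij : i + j = n / 2 + 1) :
    ‖(orbit q n ϖ w u₀ x y j).2 - torsionPt q n ϖ w i ^ expS q n • y ^ q ^ (2 * j)‖
      ≤ max ‖ϖ‖ (‖ϖ‖ ^ j * ‖torsionPt q n ϖ w 1‖) := by
  rw [h.orbit_snd_eq j]
  have e : ∀ a b c d : R, a - b + c - d = (a - d) - b + c := fun a b c d => by ring
  rw [e]
  refine norm_add_le_of_le' (norm_sub_le_of_le' ?_ ?_) ?_
  · exact (h.norm_iter_scaleS_sub hy hij).trans (le_max_left _ _)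
  · exact (h.norm_iter_tau_le hx j).trans (le_max_right _ _)
  · exact (h.norm_sum_u_le hu j _ fun i => (h.norm_orbit_le_one hu hx hy i).1).trans
      (h.norm_scaleU_le_norm.trans (le_max_left _ _))

theorem norm_iter_scaleS_le (h : LTData p q n ϖ ζ w) (hy : ‖y‖ ≤ 1) (j : ℕ) :
    ‖(lin q ϖ)^[n / 2 + j] (scaleS q n ϖ w • y)‖ ≤ ‖ϖ‖ ^ j * ‖torsionPt q n ϖ w 1‖ := by
  rw [Nat.add_comm, Function.iterate_add_apply]
  refine h.norm_iter_le_pow j ?_ le_rfl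
  rw [← sub_add_cancel ((lin q ϖ)^[n / 2] (scaleS q n ϖ w • y))
    (torsionPt q n ϖ w 1 ^ expS q n • y ^ q ^ (2 * (n / 2)))]
  refine norm_add_le_of_le' ((h.norm_iter_scaleS_sub hy (Nat.add_comm _ _)).trans
    h.norm_lt_delta.le) ?_
  refine (norm_smul_le_of _ (norm_pow_le_one' hy _)).trans ?_
  rw [norm_pow]
  exact h.delta_pow_expS_le

/-- After `n / 2` steps `B` is inside the critical radius, so the linear part gains `‖ϖ‖` at each
further step; the terms in `u` are small enough from the start. -/
theorem norm_orbit_snd_le_pow (h : LTData p q n ϖ ζ w) (hu : ‖u₀‖ ≤ 1) (hx : ‖x‖ ≤ 1)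
    (hy : ‖y‖ ≤ 1) {j : ℕ} (hj : n / 2 + j + 1 ≤ n) :
    ‖(orbit q n ϖ w u₀ x y (n / 2 + j)).2‖ ≤ ‖ϖ‖ ^ j * ‖torsionPt q n ϖ w 1‖ := by
  have hpow : ∀ i, j ≤ i → ‖ϖ‖ ^ i * ‖torsionPt q n ϖ w 1‖ ≤ ‖ϖ‖ ^ j * ‖torsionPt q n ϖ w 1‖ :=
    fun i hi => mul_le_mul_of_nonneg_right
      (pow_le_pow_of_le_one (norm_nonneg _) h.lt.le hi) (norm_nonneg _)
  rw [h.orbit_snd_eq]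
  refine norm_add_le_of_le' (norm_sub_le_of_le' (h.norm_iter_scaleS_le hy j) ?_) ?_
  · exact (h.norm_iter_tau_le hx _).trans (hpow _ (by omega))
  · refine (h.norm_sum_u_le hu _ _ fun i => (h.norm_orbit_le_one hu hx hy i).1).trans ?_
    exact h.norm_scaleU_le.trans (hpow _ (by omega))

theorem norm_orbit_snd_le_delta (h : LTData p q n ϖ ζ w) (hu : ‖u₀‖ ≤ 1) (hx : ‖x‖ ≤ 1)
    (hy : ‖y‖ ≤ 1) {j : ℕ} (hj : n / 2 ≤ j) (hjn : j + 1 ≤ n) :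
    ‖(orbit q n ϖ w u₀ x y j).2‖ ≤ ‖torsionPt q n ϖ w 1‖ := by
  obtain ⟨i, rfl⟩ := Nat.exists_eq_add_of_le hj
  exact (h.norm_orbit_snd_le_pow hu hx hy hjn).trans
    (mul_le_of_le_one_left (norm_nonneg _) (pow_le_one₀ (norm_nonneg _) h.lt.le))

end Orbit

end LTData

namespace LTData

variable {k R : Type*} [NormedField k] [IsUltrametricDist k] [NormedCommRing R]
  [NormedAlgebra k R] [NormOneClass R] [IsUltrametricDist R]
  {p q n : ℕ} {ϖ ζ w : k}

section Constants

/-- The compatibility between the scalings of `u` and of `Y`: it gives the contribution of `u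
B_{n/2}^q` to the first coordinate the same leading coefficient as the term in `x`. -/
theorem scaleU_mul_pow (h : LTData p q n ϖ ζ w) :
    scaleU q n ϖ w * (torsionPt q n ϖ w 1 ^ expS q n) ^ q
      = -(ϖ ^ (n / 2 + 1) * torsionPt q n ϖ w 1) := by
  by_cases ho : Odd n
  · rw [expS, if_pos ho, pow_one, h.scaleU_mul_odd ho]
    obtain ⟨r, rfl⟩ := ho
    congr 3
    omega
  · rw [expS, if_neg ho, ← pow_mul, ← sq, h.torsionPt_one_pow, scaleU, if_neg ho]
    rw [Nat.not_odd_iff_even] at ho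
    have : (n + 1) / 2 = n / 2 := by obtain ⟨r, rfl⟩ := ho; omega
    rw [this]
    ring

theorem norm_scaleU_mul_lt (h : LTData p q n ϖ ζ w) :
    ‖scaleU q n ϖ w‖ * ‖ϖ‖ < ‖ϖ‖ ^ (n / 2) * ‖torsionPt q n ϖ w 1‖ := by
  by_cases ho : Odd n
  · have h1 := h.norm_scaleU_lt_odd ho
    have : (n + 1) / 2 - 1 = n / 2 := by obtain ⟨r, rfl⟩ := ho; omega
    rw [this] at h1
    exact (mul_le_of_le_one_right (norm_nonneg _) h.lt.le).trans_lt h1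
  · rw [norm_scaleU_even ho]
    rw [Nat.not_odd_iff_even] at ho
    have : (n + 1) / 2 = n / 2 := by obtain ⟨r, rfl⟩ := ho; omega
    rw [this]
    exact mul_lt_mul_of_pos_left h.norm_lt_delta (pow_pos h.norm_pos _)

theorem norm_scaleU_mul_delta_lt (h : LTData p q n ϖ ζ w) :
    ‖scaleU q n ϖ w‖ * ‖torsionPt q n ϖ w 1‖ < ‖ϖ‖ ^ (n / 2) := by
  by_cases ho : Odd n
  · have h1 := h.norm_scaleU_lt_odd ho
    have : (n + 1) / 2 - 1 = n / 2 := by obtain ⟨r, rfl⟩ := ho; omega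
    rw [this] at h1
    refine (mul_le_of_le_one_right (norm_nonneg _) h.delta_lt_one.le).trans_lt (h1.trans_le ?_)
    exact mul_le_of_le_one_right (by positivity) h.delta_lt_one.le
  · rw [norm_scaleU_even ho]
    rw [Nat.not_odd_iff_even] at ho
    have : (n + 1) / 2 = n / 2 := by obtain ⟨r, rfl⟩ := ho; omega
    rw [this]
    exact mul_lt_of_lt_one_right (pow_pos h.norm_pos _) h.delta_lt_one

end Constants

variable {u₀ x y : R}

/-! ### The second coordinate after `n` steps -/

/-- The first `n / 2` steps turn `s y` into a multiple of a power of `ϖ_1`, and the other `(n + 1) /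
2` steps are left unevaluated because their effect depends on the parity. Among the terms in `u`
only the last one survives, where `A_{n-1}` is close to `ϖ_1`. -/
theorem norm_orbit_snd_n (h : LTData p q n ϖ ζ w) (hu : ‖u₀‖ ≤ 1) (hx : ‖x‖ ≤ 1)
    (hy : ‖y‖ ≤ 1) :
    ‖(orbit q n ϖ w u₀ x y n).2 - ((lin q ϖ)^[(n + 1) / 2]
        (torsionPt q n ϖ w 1 ^ expS q n • y ^ q ^ (2 * (n / 2)))
        + (scaleU q n ϖ w * torsionPt q n ϖ w 1 ^ q) • u₀)‖
      < ‖ϖ‖ ^ ((n + 1) / 2) * ‖torsionPt q n ϖ w 1‖ ^ expS q n := by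
  have hn := h.two_le
  have hq := h.two_le_q
  set m := (n + 1) / 2 with hm
  have hkm : m + n / 2 = n := by omega
  set τ := torsionPt q n ϖ w 1 with hτ
  set t := τ ^ expS q n • y ^ q ^ (2 * (n / 2)) with ht
  have hlt : ‖ϖ‖ ^ (m + 1) < ‖ϖ‖ ^ m * ‖τ‖ ^ expS q n := by
    rw [pow_succ]
    exact mul_lt_mul_of_pos_left h.norm_lt_delta_pow_expS (pow_pos h.norm_pos _)
  obtain ⟨n', hn'⟩ := Nat.exists_eq_add_of_le' (show 1 ≤ n by omega)
  have hsum := h.orbit_snd_eq (u₀ := u₀) (x := x) (y := y) n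
  have hr : Finset.range n = Finset.range (n' + 1) := by rw [hn']
  -- The last summand `i = n - 1` undergoes no further step; every earlier one acquires a factor
  -- `ϖ`.
  rw [hr, Finset.sum_range_succ, show n - 1 - n' = 0 by omega, Function.iterate_zero, id] at hsum
  have e1 : (lin q ϖ)^[n] (scaleS q n ϖ w • y)
      = (lin q ϖ)^[m] ((lin q ϖ)^[n / 2] (scaleS q n ϖ w • y) - t) + (lin q ϖ)^[m] t := by
    rw [← h.iter_add, sub_add_cancel, ← Function.iterate_add_apply, hkm]
  have e2 : scaleU q n ϖ w • u₀ * (orbit q n ϖ w u₀ x y n').1 ^ q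
      = scaleU q n ϖ w • u₀ * ((orbit q n ϖ w u₀ x y n').1 - algebraMap k R τ) ^ q
        + (scaleU q n ϖ w * τ ^ q) • u₀ := by
    rw [h.sub_pow_q, Algebra.smul_def, Algebra.smul_def, map_mul, map_pow]
    ring
  rw [hsum, e1, e2]
  have e3 : ∀ a b c d e f : R, a + b - c + (d + (e + f)) - (b + f) = a - c + d + e :=
    fun a b c d e f => by ring
  rw [e3]
  refine norm_add_lt_of_lt' (norm_add_lt_of_lt' (norm_sub_lt_of_lt' ?_ ?_) ?_) ?_
  · refine lt_of_le_of_lt ?_ hlt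
    rw [pow_succ]
    exact h.norm_iter_le_pow m (h.norm_iter_scaleS_sub hy (Nat.add_comm _ _)) h.norm_lt_delta.le
  · refine (h.norm_iter_tau_le hx n).trans_lt (lt_of_le_of_lt ?_ hlt)
    refine (mul_le_of_le_one_right (by positivity) h.delta_lt_one.le).trans ?_
    exact pow_le_pow_of_le_one (norm_nonneg _) h.lt.le (by omega)
  · refine lt_of_le_of_lt ?_ h.norm_mul_norm_scaleU_lt
    refine IsUltrametricDist.norm_sum_le_of_forall_le_of_nonneg (by positivity) fun i hi => ?_
    have hi' := Finset.mem_range.mp hi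
    refine (h.norm_iter_u_mul_le hu _ (norm_pow_le_one' (h.norm_orbit_le_one hu hx hy i).1 q)
      le_rfl).trans ?_
    rw [mul_one]
    refine mul_le_mul_of_nonneg_right ?_ (norm_nonneg _)
    exact pow_le_of_le_one (norm_nonneg _) h.lt.le (by omega)
  · refine lt_of_le_of_lt ?_ h.norm_mul_norm_scaleU_lt
    refine (norm_u_mul_le hu _).trans ?_
    rw [mul_comm]
    refine mul_le_mul_of_nonneg_right ?_ (norm_nonneg _)
    have h1 := h.norm_orbit_fst_sub_le_norm hu hx hy (j := n') (by omega) (by omega)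
    rw [show n - n' = 1 by omega] at h1
    refine (norm_pow_le _ _).trans ((pow_le_pow_left₀ (norm_nonneg _) h1 q).trans ?_)
    exact pow_le_of_le_one (norm_nonneg _) h.lt.le (by omega)

/-- For `n` odd the descent ends on the critical radius, so the remaining steps produce the
Artin-Schreier expression in `y`. -/
theorem norm_orbit_snd_odd (h : LTData p q n ϖ ζ w) (ho : Odd n) (hu : ‖u₀‖ ≤ 1)
    (hx : ‖x‖ ≤ 1) (hy : ‖y‖ ≤ 1) :
    ‖(orbit q n ϖ w u₀ x y n).2 - (ϖ ^ ((n + 1) / 2) * torsionPt q n ϖ w 1) •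
        (y ^ q ^ (2 * (n / 2)) - (y ^ q ^ (2 * (n / 2))) ^ q ^ 2 - u₀)‖
      < ‖ϖ‖ ^ ((n + 1) / 2) * ‖torsionPt q n ϖ w 1‖ := by
  have hn := h.two_le
  have h1 := h.norm_orbit_snd_n hu hx hy
  rw [expS, if_pos ho, pow_one, pow_one, h.scaleU_mul_odd ho] at h1
  have h2 := h.norm_iter_torsionPt_one (j := (n + 1) / 2) (by omega)
    (norm_pow_le_one' hy (q ^ (2 * (n / 2))))
  refine (congrArg norm ?_).le.trans_lt (norm_add_lt_of_lt' h1 h2)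
  simp only [smul_sub, neg_smul]
  ring

/-- For `n` even the descent ends at `ϖ_1^q`, inside the critical radius, and the remaining steps
just multiply by `ϖ`. -/
theorem norm_orbit_snd_even (h : LTData p q n ϖ ζ w) (ho : ¬ Odd n) (hu : ‖u₀‖ ≤ 1)
    (hx : ‖x‖ ≤ 1) (hy : ‖y‖ ≤ 1) :
    ‖(orbit q n ϖ w u₀ x y n).2 - (ϖ ^ ((n + 1) / 2) * torsionPt q n ϖ w 1 ^ q) •
        (y ^ q ^ (2 * (n / 2)) + u₀)‖
      < ‖ϖ‖ ^ ((n + 1) / 2) * ‖torsionPt q n ϖ w 1‖ ^ q := by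
  have h1 := h.norm_orbit_snd_n hu hx hy
  rw [expS, if_neg ho, scaleU, if_neg ho] at h1
  have h3 : ‖torsionPt q n ϖ w 1 ^ q • y ^ q ^ (2 * (n / 2))‖ ≤ ‖torsionPt q n ϖ w 1‖ ^ q := by
    rw [← norm_pow]
    exact norm_smul_le_of _ (norm_pow_le_one' hy _)
  have h2 := h.norm_iter_sub_le ((n + 1) / 2) h3 le_rfl
  have h4 : ‖ϖ‖ ^ ((n + 1) / 2 + 1) * ‖torsionPt q n ϖ w 1‖ ^ q
      < ‖ϖ‖ ^ ((n + 1) / 2) * ‖torsionPt q n ϖ w 1‖ ^ q := by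
    refine mul_lt_mul_of_pos_right ?_ (pow_pos h.delta_pos _)
    rw [pow_succ]
    exact mul_lt_of_lt_one_right (pow_pos h.norm_pos _) h.lt
  refine (congrArg norm ?_).le.trans_lt (norm_add_lt_of_lt' h1 (h2.trans_lt h4))
  simp only [smul_add, smul_smul]
  ring

/-! ### The first coordinate after `n` steps -/

/-- The contribution of the second coordinate after `i` steps to the first coordinate after `n`
steps. -/
def contrib (q n : ℕ) (ϖ w : k) (u₀ x y : R) (i : ℕ) : R :=
  (lin q ϖ)^[n - 1 - i] (scaleU q n ϖ w • u₀ * (orbit q n ϖ w u₀ x y i).2 ^ q)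

/-- Beyond `n / 2` the coordinate `B_i` is of size at most `‖ϖ‖^{i - n/2} ‖ϖ_1‖`; raising it to the
power `q ≥ 2` gains more than the missing applications of the operator lose. -/
theorem norm_contrib_high (h : LTData p q n ϖ ζ w) (hu : ‖u₀‖ ≤ 1) (hx : ‖x‖ ≤ 1)
    (hy : ‖y‖ ≤ 1) {i : ℕ} (hi : n / 2 < i) (hin : i < n) :
    ‖contrib q n ϖ w u₀ x y i‖ < ‖ϖ‖ ^ n * ‖torsionPt q n ϖ w 1‖ := by
  have hq := h.two_le_q
  obtain ⟨j, rfl⟩ := Nat.exists_eq_add_of_lt hi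
  have h1 := h.norm_orbit_snd_le_pow hu hx hy (j := j + 1) (by omega)
  set δ := ‖torsionPt q n ϖ w 1‖ with hδ
  have hδ0 : 0 < δ := h.delta_pos
  have hδ1 : δ < 1 := h.delta_lt_one
  have hc := h.norm_pos
  have h2 : ‖(orbit q n ϖ w u₀ x y (n / 2 + j + 1)).2 ^ q‖ ≤ ‖ϖ‖ ^ (j + 1) * ‖ϖ‖ * (δ * δ) := by
    refine (norm_pow_le _ _).trans ((pow_le_pow_left₀ (norm_nonneg _) h1 q).trans ?_)
    have h3 : ‖ϖ‖ ^ (j + 1) ≤ ‖ϖ‖ := pow_le_of_le_one hc.le h.lt.le (by omega)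
    have h4 : ‖ϖ‖ ^ (j + 1) * δ ≤ 1 :=
      mul_le_one₀ (pow_le_one₀ hc.le h.lt.le) hδ0.le hδ1.le
    refine (pow_le_pow_of_le_one (by positivity) h4 hq).trans ?_
    calc (‖ϖ‖ ^ (j + 1) * δ) ^ 2 = ‖ϖ‖ ^ (j + 1) * ‖ϖ‖ ^ (j + 1) * (δ * δ) := by ring
      _ ≤ ‖ϖ‖ ^ (j + 1) * ‖ϖ‖ * (δ * δ) := by gcongr
  have h5 : ‖ϖ‖ ^ (j + 1) * ‖ϖ‖ * (δ * δ) ≤ 1 := by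
    have : ‖ϖ‖ ^ (j + 1) ≤ 1 := pow_le_one₀ hc.le h.lt.le
    exact mul_le_one₀ (mul_le_one₀ this hc.le h.lt.le) (by positivity)
      (mul_le_one₀ hδ1.le hδ0.le hδ1.le)
  refine (h.norm_iter_u_mul_le hu _ h2 h5).trans_lt ?_
  have h6 := h.norm_scaleU_mul_delta_lt
  calc ‖ϖ‖ ^ (n - 1 - (n / 2 + j + 1)) * (‖scaleU q n ϖ w‖ * (‖ϖ‖ ^ (j + 1) * ‖ϖ‖ * (δ * δ)))
      = (‖ϖ‖ ^ (n - 1 - (n / 2 + j + 1)) * ‖ϖ‖ ^ (j + 2) * δ) * (‖scaleU q n ϖ w‖ * δ) := by ring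
    _ < (‖ϖ‖ ^ (n - 1 - (n / 2 + j + 1)) * ‖ϖ‖ ^ (j + 2) * δ) * ‖ϖ‖ ^ (n / 2) :=
        mul_lt_mul_of_pos_left h6 (by positivity)
    _ = ‖ϖ‖ ^ (n - 1 - (n / 2 + j + 1) + (j + 2) + n / 2) * δ := by rw [pow_add, pow_add]; ring
    _ = ‖ϖ‖ ^ n * δ := by congr 2; omega

/-- For small `i` many steps remain, each gaining `‖ϖ‖`, and the trivial bound on `B_i` suffices
once the scaling of `u` is small enough. -/
theorem norm_contrib_low (h : LTData p q n ϖ ζ w) (hu : ‖u₀‖ ≤ 1) (hx : ‖x‖ ≤ 1)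
    (hy : ‖y‖ ≤ 1) {i : ℕ} (hin : i < n)
    (hU : ‖scaleU q n ϖ w‖ < ‖ϖ‖ ^ (i + 1) * ‖torsionPt q n ϖ w 1‖) :
    ‖contrib q n ϖ w u₀ x y i‖ < ‖ϖ‖ ^ n * ‖torsionPt q n ϖ w 1‖ := by
  refine (h.norm_iter_u_mul_le hu _ (norm_pow_le_one' (h.norm_orbit_le_one hu hx hy i).2 q)
    le_rfl).trans_lt ?_
  rw [mul_one]
  refine (mul_lt_mul_of_pos_left hU (pow_pos h.norm_pos _)).trans_eq ?_
  rw [← mul_assoc, ← pow_add]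
  congr 2
  omega

/-- The main interaction term: `B_{n/2}` is close to `ϖ_1^{expS} y'`, `scaleU_mul_pow` evaluates its
product with `u`, and the remaining `n - 1 - n/2` steps multiply by `ϖ`. -/
theorem norm_contrib_half (h : LTData p q n ϖ ζ w) (hu : ‖u₀‖ ≤ 1) (hx : ‖x‖ ≤ 1)
    (hy : ‖y‖ ≤ 1) :
    ‖contrib q n ϖ w u₀ x y (n / 2) + (ϖ ^ n * torsionPt q n ϖ w 1) •
      (u₀ * (y ^ q ^ (2 * (n / 2))) ^ q)‖ < ‖ϖ‖ ^ n * ‖torsionPt q n ϖ w 1‖ := by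
  have hn := h.two_le
  have hq := h.two_le_q
  set τ := torsionPt q n ϖ w 1 with hτ
  set y' := y ^ q ^ (2 * (n / 2)) with hy'
  have hy1 : ‖y'‖ ≤ 1 := norm_pow_le_one' hy _
  have h1 := (h.norm_orbit_snd_sub_le hu hx hy (i := 1) (j := n / 2) (Nat.add_comm _ _)).trans
    (max_le le_rfl (h.pow_mul_delta_le (by omega)))
  set E := (orbit q n ϖ w u₀ x y (n / 2)).2 - τ ^ expS q n • y' with hE
  set x0 : R := (-(ϖ ^ (n / 2 + 1) * τ)) • (u₀ * y' ^ q) with hx0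
  have e1 : scaleU q n ϖ w • u₀ * (orbit q n ϖ w u₀ x y (n / 2)).2 ^ q
      = x0 + scaleU q n ϖ w • u₀ * E ^ q := by
    rw [hE, h.sub_pow_q, smul_pow, hx0, ← h.scaleU_mul_pow, ← hτ, mul_sub, smul_mul_smul_comm]
    ring
  have hx0n : ‖x0‖ ≤ ‖ϖ‖ ^ (n / 2 + 1) * ‖τ‖ := by
    refine (norm_smul_le_of _ (norm_mul_le_one' hu (norm_pow_le_one' hy1 _))).trans_eq ?_
    rw [norm_neg, norm_mul, norm_pow]
  have hx0d : ‖ϖ‖ ^ (n / 2 + 1) * ‖τ‖ ≤ ‖τ‖ ^ q :=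
    (h.pow_mul_delta_le (by omega)).trans h.norm_lt_delta_pow.le
  have h2 := h.norm_iter_sub_le (n - 1 - n / 2) hx0n hx0d
  have h3 : ‖(lin q ϖ)^[n - 1 - n / 2] (scaleU q n ϖ w • u₀ * E ^ q)‖
      ≤ ‖ϖ‖ ^ (n - 1 - n / 2) * (‖scaleU q n ϖ w‖ * ‖ϖ‖ ^ 2) := by
    refine h.norm_iter_u_mul_le hu _ ?_ (pow_le_one₀ (norm_nonneg _) h.lt.le)
    refine (norm_pow_le _ _).trans ((pow_le_pow_left₀ (norm_nonneg _) h1 q).trans ?_)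
    exact pow_le_pow_of_le_one (norm_nonneg _) h.lt.le hq
  have e2 : contrib q n ϖ w u₀ x y (n / 2) + (ϖ ^ n * τ) • (u₀ * y' ^ q)
      = ((lin q ϖ)^[n - 1 - n / 2] x0 - ϖ ^ (n - 1 - n / 2) • x0)
        + (lin q ϖ)^[n - 1 - n / 2] (scaleU q n ϖ w • u₀ * E ^ q) := by
    have : ϖ ^ (n - 1 - n / 2) * -(ϖ ^ (n / 2 + 1) * τ) = -(ϖ ^ n * τ) := by
      rw [mul_neg, ← mul_assoc, ← pow_add]
      congr 3
      omega
    have hx : ϖ ^ (n - 1 - n / 2) • x0 = -((ϖ ^ n * τ) • (u₀ * y' ^ q)) := by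
      rw [hx0, smul_smul, this, neg_smul]
    rw [contrib, e1, h.iter_add, hx]
    abel
  rw [e2]
  refine norm_add_lt_of_lt' (h2.trans_lt ?_) (h3.trans_lt ?_)
  · rw [← mul_assoc, ← pow_add]
    refine mul_lt_mul_of_pos_right ?_ h.delta_pos
    exact pow_lt_pow_right_of_lt_one₀ h.norm_pos h.lt (by omega)
  · have h6 := h.norm_scaleU_mul_lt
    calc ‖ϖ‖ ^ (n - 1 - n / 2) * (‖scaleU q n ϖ w‖ * ‖ϖ‖ ^ 2)
        = (‖ϖ‖ ^ (n - 1 - n / 2) * ‖ϖ‖) * (‖scaleU q n ϖ w‖ * ‖ϖ‖) := by ring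
      _ < (‖ϖ‖ ^ (n - 1 - n / 2) * ‖ϖ‖) * (‖ϖ‖ ^ (n / 2) * ‖τ‖) :=
          mul_lt_mul_of_pos_left h6 (mul_pos (pow_pos h.norm_pos _) h.norm_pos)
      _ = ‖ϖ‖ ^ (n - 1 - n / 2 + 1 + n / 2) * ‖τ‖ := by rw [pow_add, pow_add, pow_one]; ring
      _ = ‖ϖ‖ ^ n * ‖τ‖ := by congr 2; omega

/-- In even level there is a second interaction term, one step earlier, where `B` is close to `ϖ_2^q
y'` and `ϖ_2^{q²} = ϖ_1 - ϖ ϖ_2`. It enters with the opposite sign. -/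
theorem norm_contrib_half_pred (h : LTData p q n ϖ ζ w) (ho : ¬ Odd n) (hu : ‖u₀‖ ≤ 1)
    (hx : ‖x‖ ≤ 1) (hy : ‖y‖ ≤ 1) :
    ‖contrib q n ϖ w u₀ x y (n / 2 - 1) - (ϖ ^ n * torsionPt q n ϖ w 1) •
      (u₀ * (y ^ q ^ (2 * (n / 2 - 1))) ^ q)‖ < ‖ϖ‖ ^ n * ‖torsionPt q n ϖ w 1‖ := by
  have hn := h.two_le
  have hq := h.two_le_q
  have hk : (n + 1) / 2 = n / 2 := by
    rw [Nat.not_odd_iff_even] at ho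
    obtain ⟨r, rfl⟩ := ho; omega
  have hkk : n / 2 + n / 2 = n := by omega
  set τ := torsionPt q n ϖ w 1 with hτ
  set y' := y ^ q ^ (2 * (n / 2 - 1)) with hy'
  have hy1 : ‖y'‖ ≤ 1 := norm_pow_le_one' hy _
  have h1 := (h.norm_orbit_snd_sub_le hu hx hy (i := 2) (j := n / 2 - 1) (by omega)).trans
    (max_le h.norm_lt_delta.le (mul_le_of_le_one_left (norm_nonneg _)
      (pow_le_one₀ (norm_nonneg _) h.lt.le)))
  rw [expS, if_neg ho] at h1
  set E := (orbit q n ϖ w u₀ x y (n / 2 - 1)).2 - torsionPt q n ϖ w 2 ^ q • y' with hE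
  set x0 : R := (ϖ ^ (n / 2) * τ) • (u₀ * y' ^ q) with hx0
  set x1 : R := (ϖ ^ (n / 2 + 1) * torsionPt q n ϖ w 2) • (u₀ * y' ^ q) with hx1
  have e0 : (torsionPt q n ϖ w 2 ^ q) ^ q = τ - ϖ * torsionPt q n ϖ w 2 := by
    have := lin_torsionPt (q := q) (ϖ := ϖ) (w := w) (i := 1) (by omega : 1 + 1 ≤ n)
    rw [lin, smul_eq_mul] at this
    rw [← pow_mul, ← sq, hτ, ← this]
    ring
  have e1 : scaleU q n ϖ w • u₀ * (orbit q n ϖ w u₀ x y (n / 2 - 1)).2 ^ q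
      = x0 + (scaleU q n ϖ w • u₀ * E ^ q - x1) := by
    have : x0 - x1 = (scaleU q n ϖ w * (torsionPt q n ϖ w 2 ^ q) ^ q) • (u₀ * y' ^ q) := by
      rw [hx0, hx1, ← sub_smul, e0, scaleU, if_neg ho, hk]
      congr 1
      ring
    rw [← smul_mul_smul_comm] at this
    rw [hE, h.sub_pow_q, smul_pow, mul_sub, ← this]
    ring
  have hx0n : ‖x0‖ ≤ ‖ϖ‖ ^ (n / 2) * ‖τ‖ := by
    refine (norm_smul_le_of _ (norm_mul_le_one' hu (norm_pow_le_one' hy1 _))).trans_eq ?_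
    rw [norm_mul, norm_pow]
  have hx0d : ‖ϖ‖ ^ (n / 2) * ‖τ‖ ≤ ‖τ‖ ^ q :=
    (h.pow_mul_delta_le (by omega)).trans h.norm_lt_delta_pow.le
  have h2 := h.norm_iter_sub_le (n / 2) hx0n hx0d
  have hx1n : ‖x1‖ ≤ ‖ϖ‖ ^ (n / 2) * ‖τ‖ ^ q := by
    refine (norm_smul_le_of _ (norm_mul_le_one' hu (norm_pow_le_one' hy1 _))).trans ?_
    rw [norm_mul, norm_pow, pow_succ, mul_assoc]
    refine mul_le_mul_of_nonneg_left ?_ (by positivity)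
    exact (mul_le_of_le_one_right (norm_nonneg _) (h.torsionPt_le_one (by omega))).trans
      h.norm_lt_delta_pow.le
  have hUE : ‖scaleU q n ϖ w • u₀ * E ^ q‖ ≤ ‖ϖ‖ ^ (n / 2) * ‖τ‖ ^ q := by
    refine (norm_u_mul_le hu _).trans ?_
    rw [norm_scaleU_even ho, hk]
    refine mul_le_mul_of_nonneg_left ?_ (by positivity)
    exact (norm_pow_le _ _).trans (pow_le_pow_left₀ (norm_nonneg _) h1 q)
  have h3 : ‖(lin q ϖ)^[n / 2] (scaleU q n ϖ w • u₀ * E ^ q - x1)‖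
      ≤ ‖ϖ‖ ^ (n / 2) * (‖ϖ‖ ^ (n / 2) * ‖τ‖ ^ q) := by
    refine h.norm_iter_le_pow _ (norm_sub_le_of_le' hUE hx1n) ?_
    exact (mul_le_of_le_one_left (by positivity) (pow_le_one₀ (norm_nonneg _) h.lt.le)).trans
      h.delta_pow_q_le
  have e2 : contrib q n ϖ w u₀ x y (n / 2 - 1) - (ϖ ^ n * τ) • (u₀ * y' ^ q)
      = ((lin q ϖ)^[n / 2] x0 - ϖ ^ (n / 2) • x0)
        + (lin q ϖ)^[n / 2] (scaleU q n ϖ w • u₀ * E ^ q - x1) := by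
    rw [contrib, e1, show n - 1 - (n / 2 - 1) = n / 2 by omega, h.iter_add, hx0, smul_smul,
      ← mul_assoc, ← pow_add, hkk]
    ring
  rw [e2]
  refine norm_add_lt_of_lt' (h2.trans_lt ?_) (h3.trans_lt ?_)
  · rw [← mul_assoc, ← pow_add]
    refine mul_lt_mul_of_pos_right ?_ h.delta_pos
    exact pow_lt_pow_right_of_lt_one₀ h.norm_pos h.lt (by omega)
  · rw [← mul_assoc, ← pow_add, hkk]
    refine mul_lt_mul_of_pos_left ?_ (pow_pos h.norm_pos _)
    exact pow_lt_self_of_lt_one₀ h.delta_pos h.delta_lt_one (by omega)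

theorem orbit_fst_n (h : LTData p q n ϖ ζ w) :
    (orbit q n ϖ w u₀ x y n).1 = (lin q ϖ)^[n] (torsionPt q n ϖ w 1 • x)
      + ∑ i ∈ Finset.range n, contrib q n ϖ w u₀ x y i := by
  rw [h.orbit_fst_eq le_rfl, Nat.sub_self, h.torsionPt_zero, map_zero, zero_add]
  rfl

theorem norm_orbit_fst_odd (h : LTData p q n ϖ ζ w) (ho : Odd n) (hu : ‖u₀‖ ≤ 1)
    (hx : ‖x‖ ≤ 1) (hy : ‖y‖ ≤ 1) :
    ‖(orbit q n ϖ w u₀ x y n).1 - (ϖ ^ n * torsionPt q n ϖ w 1) •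
        (x - x ^ q ^ 2 - u₀ * (y ^ q ^ (2 * (n / 2))) ^ q)‖
      < ‖ϖ‖ ^ n * ‖torsionPt q n ϖ w 1‖ := by
  have hn := h.two_le
  have hmem : n / 2 ∈ Finset.range n := Finset.mem_range.mpr (by omega)
  have h1 := h.norm_iter_torsionPt_one (j := n) (by omega) hx
  have h2 := h.norm_contrib_half hu hx hy
  have h3 : ‖∑ i ∈ (Finset.range n).erase (n / 2), contrib q n ϖ w u₀ x y i‖
      < ‖ϖ‖ ^ n * ‖torsionPt q n ϖ w 1‖ := by
    refine norm_sum_lt' (mul_pos (pow_pos h.norm_pos _) h.delta_pos) _ _ fun i hi => ?_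
    obtain ⟨hi1, hi2⟩ := Finset.mem_erase.mp hi
    have hi3 := Finset.mem_range.mp hi2
    rcases lt_or_gt_of_ne hi1 with hlt | hgt
    · refine h.norm_contrib_low hu hx hy hi3 ((h.norm_scaleU_lt_odd ho).trans_le ?_)
      refine mul_le_mul_of_nonneg_right ?_ (norm_nonneg _)
      refine pow_le_pow_of_le_one (norm_nonneg _) h.lt.le ?_
      obtain ⟨r, rfl⟩ := ho
      omega
    · exact h.norm_contrib_high hu hx hy hgt hi3
  rw [h.orbit_fst_n, ← Finset.add_sum_erase _ _ hmem]
  refine (congrArg norm ?_).le.trans_lt (norm_add_lt_of_lt' (norm_add_lt_of_lt' h1 h2) h3)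
  simp only [smul_sub]
  ring

/-- Here `u` has size `‖ϖ‖^m`, so `norm_contrib_low` applies only below `n / 2 - 1`, and the indices
`n / 2 - 1` and `n / 2` both contribute. -/
theorem norm_orbit_fst_even (h : LTData p q n ϖ ζ w) (ho : ¬ Odd n) (hu : ‖u₀‖ ≤ 1)
    (hx : ‖x‖ ≤ 1) (hy : ‖y‖ ≤ 1) :
    ‖(orbit q n ϖ w u₀ x y n).1 - (ϖ ^ n * torsionPt q n ϖ w 1) •
        (x - x ^ q ^ 2 + (u₀ * (y ^ q ^ (2 * (n / 2 - 1))) ^ q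
          - u₀ * (y ^ q ^ (2 * (n / 2))) ^ q))‖
      < ‖ϖ‖ ^ n * ‖torsionPt q n ϖ w 1‖ := by
  have hn := h.two_le
  have hmem : n / 2 ∈ Finset.range n := Finset.mem_range.mpr (by omega)
  have hmem' : n / 2 - 1 ∈ (Finset.range n).erase (n / 2) :=
    Finset.mem_erase.mpr ⟨by omega, Finset.mem_range.mpr (by omega)⟩
  have h1 := h.norm_iter_torsionPt_one (j := n) (by omega) hx
  have h2 := h.norm_contrib_half hu hx hy
  have h2' := h.norm_contrib_half_pred ho hu hx hy
  have h3 : ‖∑ i ∈ ((Finset.range n).erase (n / 2)).erase (n / 2 - 1),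
      contrib q n ϖ w u₀ x y i‖ < ‖ϖ‖ ^ n * ‖torsionPt q n ϖ w 1‖ := by
    refine norm_sum_lt' (mul_pos (pow_pos h.norm_pos _) h.delta_pos) _ _ fun i hi => ?_
    obtain ⟨hi0, hi⟩ := Finset.mem_erase.mp hi
    obtain ⟨hi1, hi2⟩ := Finset.mem_erase.mp hi
    have hi3 := Finset.mem_range.mp hi2
    rcases lt_or_gt_of_ne hi1 with hlt | hgt
    · refine h.norm_contrib_low hu hx hy hi3 ?_
      rw [norm_scaleU_even ho]
      refine lt_of_le_of_lt (b := ‖ϖ‖ ^ (i + 1) * ‖ϖ‖) ?_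
        (mul_lt_mul_of_pos_left h.norm_lt_delta (pow_pos h.norm_pos _))
      rw [← pow_succ]
      refine pow_le_pow_of_le_one (norm_nonneg _) h.lt.le ?_
      omega
    · exact h.norm_contrib_high hu hx hy hgt hi3
  rw [h.orbit_fst_n, ← Finset.add_sum_erase _ _ hmem, ← Finset.add_sum_erase _ _ hmem']
  refine (congrArg norm ?_).le.trans_lt
    (norm_add_lt_of_lt' (norm_add_lt_of_lt' (norm_add_lt_of_lt' h1 h2) h2') h3)
  simp only [smul_sub, smul_add]
  ring

end LTData

/-- The point with the given diagonal coordinates. -/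
def diagPt {R : Type*} [CommRing R] (q : ℕ) (ζ u : R) (z : R × R) : Fin 3 → R :=
  ![u, z.1 + z.2, ζ * z.1 + ζ ^ q * z.2]

namespace LTData

/-! ### The curve in diagonal coordinates -/

section Algebra

variable {k R : Type*} [NormedField k] [NormedCommRing R] [NormedAlgebra k R] [NormOneClass R]
  {p q n : ℕ} {ϖ ζ w : k}

/-- Taking `t = 1` and `t = ζ` gives `X_n` and `Y_n`. The `q`-power in `[ϖ]_u` exchanges `t` and
`t^q`, so the term with `u` couples the two coordinates, whereas the `q²`-power respects them. -/
theorem mulUnif_diag (h : LTData p q n ϖ ζ w) {t : R} (ht : t ^ q ^ 2 = t) (u : R) (z : R × R) :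
    mulUnif q (algebraMap k R ϖ) u (t * z.1 + t ^ q * z.2)
      = t * (stepAB q ϖ u z).1 + t ^ q * (stepAB q ϖ u z).2 := by
  have h2 : (t ^ q) ^ q = t := by rw [← pow_mul, ← sq, ht]
  have h3 : (t ^ q) ^ q ^ 2 = t ^ q := by rw [← pow_mul, mul_comm, pow_mul, ht]
  simp only [mulUnif, stepAB, lin, h.add_pow, h.add_pow_q, mul_pow, ht, h2, h3, Algebra.smul_def]
  ring

theorem iter_mulUnif_diag (h : LTData p q n ϖ ζ w) {t : R} (ht : t ^ q ^ 2 = t) (u : R)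
    (z : R × R) (j : ℕ) :
    (mulUnif q (algebraMap k R ϖ) u)^[j] (t * z.1 + t ^ q * z.2)
      = t * ((stepAB q ϖ u)^[j] z).1 + t ^ q * ((stepAB q ϖ u)^[j] z).2 := by
  induction j generalizing z with
  | zero => rfl
  | succ j ih => rw [Function.iterate_succ_apply, h.mulUnif_diag ht, ih]; rfl

theorem iter_mulUnif_add (h : LTData p q n ϖ ζ w) (u : R) (z : R × R) (j : ℕ) :
    (mulUnif q (algebraMap k R ϖ) u)^[j] (z.1 + z.2)
      = ((stepAB q ϖ u)^[j] z).1 + ((stepAB q ϖ u)^[j] z).2 := by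
  simpa using h.iter_mulUnif_diag (t := (1 : R)) (one_pow _) u z j

theorem algebraMap_zeta (h : LTData p q n ϖ ζ w) :
    algebraMap k R ζ ^ q ^ 2 = algebraMap k R ζ := by
  rw [← map_pow, h.zeta]

theorem iter_mulUnif_zeta (h : LTData p q n ϖ ζ w) (u : R) (z : R × R) (j : ℕ) :
    (mulUnif q (algebraMap k R ϖ) u)^[j] (algebraMap k R ζ * z.1 + algebraMap k R ζ ^ q * z.2)
      = algebraMap k R ζ * ((stepAB q ϖ u)^[j] z).1
        + algebraMap k R ζ ^ q * ((stepAB q ϖ u)^[j] z).2 :=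
  h.iter_mulUnif_diag h.algebraMap_zeta u z j

theorem mu_diag (h : LTData p q n ϖ ζ w) (z : R × R) :
    mu q (z.1 + z.2) (algebraMap k R ζ * z.1 + algebraMap k R ζ ^ q * z.2)
      = -(algebraMap k R (ζ ^ q - ζ) * (z.1 ^ (q + 1) - z.2 ^ (q + 1))) := by
  have h2 : (algebraMap k R ζ ^ q) ^ q = algebraMap k R ζ := by
    rw [← pow_mul, ← sq, h.algebraMap_zeta]
  simp only [mu, h.add_pow_q, mul_pow, h2, map_sub, map_pow]
  ring

/-- In `(A^{q+1} - B^{q+1})^q` the vanishing of the next step replaces `A^{q²}` and `B^{q²}`; both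
replacements create the same mixed term `u A^q B^q`, which cancels. Consequently the determinant
equation follows from torsion as soon as `μ ≠ 0`. -/
theorem mu_diag_pow (h : LTData p q n ϖ ζ w) (u : R) (z : R × R) (hz : stepAB q ϖ u z = 0) :
    mu q (z.1 + z.2) (algebraMap k R ζ * z.1 + algebraMap k R ζ ^ q * z.2) ^ q
      = algebraMap k R ϖ
        * mu q (z.1 + z.2) (algebraMap k R ζ * z.1 + algebraMap k R ζ ^ q * z.2) := by
  have hA : z.1 ^ q ^ 2 = -(algebraMap k R ϖ * z.1 + u * z.2 ^ q) := by
    have := congrArg Prod.fst hz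
    simp only [stepAB, lin, Algebra.smul_def, Prod.fst_zero] at this
    linear_combination this
  have hB : z.2 ^ q ^ 2 = -(algebraMap k R ϖ * z.2 + u * z.1 ^ q) := by
    have := congrArg Prod.snd hz
    simp only [stepAB, lin, Algebra.smul_def, Prod.snd_zero] at this
    linear_combination this
  have h2 : (algebraMap k R ζ ^ q) ^ q = algebraMap k R ζ := by
    rw [← pow_mul, ← sq, h.algebraMap_zeta]
  have hp : ∀ a : R, (a ^ (q + 1)) ^ q = a ^ q ^ 2 * a ^ q := fun a => by
    rw [← pow_mul, ← pow_add]; congr 1; ring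
  rw [h.mu_diag, h.neg_pow_q, mul_pow, map_sub, h.sub_pow_q, h.sub_pow_q, map_pow, hp, hp, hA, hB,
    h2]
  ring

theorem torsionPt_algebraMap (i : ℕ) : torsionPt q n (algebraMap k R ϖ) (algebraMap k R w) i
    = algebraMap k R (torsionPt q n ϖ w i) := by
  have : ∀ (j : ℕ) (x : k), (mulUnif q (algebraMap k R ϖ) 0)^[j] (algebraMap k R x)
      = algebraMap k R ((mulUnif q ϖ 0)^[j] x) := fun j => by
    induction j with
    | zero => exact fun x => rfl
    | succ j ih =>
      intro x
      rw [Function.iterate_succ_apply, Function.iterate_succ_apply, ← ih]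
      simp [mulUnif]
  exact this _ _

theorem coords_eq_diagPt [IsUltrametricDist k] (v : Fin 3 → R) :
    coords q n (algebraMap k R ϖ) (algebraMap k R ζ) (algebraMap k R w) v
      = diagPt q (algebraMap k R ζ) (scaleU q n ϖ w • v 0) (startAB q n ϖ w (v 1) (v 2)) := by
  simp only [coords, diagPt, startAB, torsionPt_algebraMap, scaleU, scaleS_eq, Algebra.smul_def]
  split_ifs
  all_goals
    funext i
    fin_cases i
    · simp
    · simp
    · simp
      ring

theorem drinfeldEqs_diagPt (h : LTData p q n ϖ ζ w) (u : R) (z : R × R) :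
    drinfeldEqs q n (algebraMap k R ϖ) (diagPt q (algebraMap k R ζ) u z)
      = {((stepAB q ϖ u)^[n] z).1 + ((stepAB q ϖ u)^[n] z).2,
        algebraMap k R ζ * ((stepAB q ϖ u)^[n] z).1
          + algebraMap k R ζ ^ q * ((stepAB q ϖ u)^[n] z).2,
        mu q (((stepAB q ϖ u)^[n - 1] z).1 + ((stepAB q ϖ u)^[n - 1] z).2)
          (algebraMap k R ζ * ((stepAB q ϖ u)^[n - 1] z).1
          + algebraMap k R ζ ^ q * ((stepAB q ϖ u)^[n - 1] z).2) ^ (q - 1) - algebraMap k R ϖ} := by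
  simp only [drinfeldEqs, diagPt, Matrix.cons_val_zero, Matrix.cons_val_one, Matrix.cons_val]
  rw [h.iter_mulUnif_add, h.iter_mulUnif_zeta, h.iter_mulUnif_add, h.iter_mulUnif_zeta]

end Algebra

/-! ### The points of the affinoid in diagonal and normalized coordinates -/

section Field

variable {C : Type*} [NormedField C] [IsUltrametricDist C] {p q n : ℕ} {ϖ ζ w : C}

theorem zeta_sub_ne (h : LTData p q n ϖ ζ w) : ζ ^ q - ζ ≠ 0 := sub_ne_zero.mpr h.zeta_ne

theorem eq_zero_of_add_of_zeta (h : LTData p q n ϖ ζ w) {a b : C} (h1 : a + b = 0)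
    (h2 : ζ * a + ζ ^ q * b = 0) : a = 0 ∧ b = 0 := by
  have hb : (ζ ^ q - ζ) * b = 0 := by linear_combination h2 - ζ * h1
  have hb := (mul_eq_zero.mp hb).resolve_left h.zeta_sub_ne
  exact ⟨by rw [← h1, hb, add_zero], hb⟩

theorem norm_zeta (h : LTData p q n ϖ ζ w) : ‖ζ‖ = 1 := by
  have hq := h.two_le_q
  refine (norm_eq_zero_or_one_of_pow_eq_self (N := q ^ 2) (by nlinarith) h.zeta).resolve_left
    fun h0 => h.zeta_ne ?_
  rw [h0, zero_pow (by omega)]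

theorem norm_zeta_sub (h : LTData p q n ϖ ζ w) : ‖ζ ^ q - ζ‖ = 1 := by
  have hq := h.two_le_q
  refine (norm_eq_zero_or_one_of_pow_eq_self (N := q ^ 2) (by nlinarith) ?_).resolve_left
    h.zeta_sub_ne
  rw [h.sub_pow, ← pow_mul, mul_comm q, pow_mul, h.zeta]

/-- The constants of the affinoid satisfy the valuation identities. -/
theorem norm_rpow_inv (h : LTData p q n ϖ ζ w) :
    ‖ϖ‖ ^ (1 / ((q : ℝ) ^ 2 - 1)) = ‖torsionPt q n ϖ w 1‖ := by
  have hq := h.two_le_q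
  have h4 : 2 ^ 2 ≤ q ^ 2 := Nat.pow_le_pow_left hq 2
  have e : ((q : ℝ) ^ 2 - 1) = ((q ^ 2 - 1 : ℕ) : ℝ) := by
    rw [Nat.cast_sub (by omega)]; simp
  rw [e, one_div]
  conv_lhs => rw [← h.delta_pow]
  exact Real.pow_rpow_inv_natCast (norm_nonneg _) (by omega)

theorem norm_rpow_scaleS (h : LTData p q n ϖ ζ w) :
    ‖ϖ‖ ^ (1 / ((q : ℝ) ^ 2 - 1) / (q : ℝ) ^ (n - 1)) = ‖scaleS q n ϖ w‖ := by
  have hq := h.two_le_q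
  have e : ((q : ℝ) ^ (n - 1))⁻¹ = ((q ^ (n - 1) : ℕ) : ℝ)⁻¹ := by simp
  rw [div_eq_mul_inv, Real.rpow_mul (norm_nonneg _), h.norm_rpow_inv, e]
  conv_lhs => rw [← h.norm_scaleS_pow]
  exact Real.pow_rpow_inv_natCast (norm_nonneg _) (by positivity)

/-- Identifies the radius prescribed for `u` with the norm of its scaling constant, so that the
condition on `u` becomes `‖u_0‖ ≤ 1`. -/
theorem norm_rpow_scaleU (h : LTData p q n ϖ ζ w) :
    ‖ϖ‖ ^ (if Odd n then (((n + 1) / 2 : ℕ) : ℝ) - 1 / ((q : ℝ) + 1)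
      else (((n + 1) / 2 : ℕ) : ℝ)) = ‖scaleU q n ϖ w‖ := by
  have hq := h.two_le_q
  split_ifs with ho
  · have h1 := h.norm_scaleU_odd ho
    have hq1 : (1 : ℝ) < q := by exact_mod_cast hq
    rw [Real.rpow_sub h.norm_pos, Real.rpow_natCast, div_eq_iff (by
      exact (Real.rpow_pos_of_pos h.norm_pos _).ne'), ← h1]
    congr 1
    rw [← h.norm_rpow_inv, ← Real.rpow_natCast, ← Real.rpow_mul (norm_nonneg _)]
    congr 1
    rw [Nat.cast_sub (by omega), Nat.cast_one]
    have h2 : (q : ℝ) ^ 2 - 1 ≠ 0 := by nlinarith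
    have h3 : (q : ℝ) + 1 ≠ 0 := by linarith
    field_simp
    ring
  · rw [Real.rpow_natCast, norm_scaleU_even ho]

theorem norm_scaleU_pos (h : LTData p q n ϖ ζ w) : 0 < ‖scaleU q n ϖ w‖ := by
  rw [← h.norm_rpow_scaleU]
  exact Real.rpow_pos_of_pos h.norm_pos _

theorem norm_w_lt_one (h : LTData p q n ϖ ζ w) : ‖w‖ < 1 := by
  obtain ⟨m, rfl⟩ := Nat.exists_eq_add_of_le' (show 1 ≤ n by have := h.two_le; omega)
  have := (h.norm_torsionPt m le_rfl).2.1
  rwa [torsionPt_self] at this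

/-- Ensures `A^{q+1} ≠ B^{q+1}` one step before zero. For `n ≥ 3` the steps beyond `n / 2` supply a
factor `‖ϖ‖`; for `n = 2` there is no such step, but there the leading term of `B` has size at most
`‖ϖ_1‖^q`. -/
theorem norm_orbit_snd_pred_lt (h : LTData p q n ϖ ζ w) {u₀ x y : C} (hu : ‖u₀‖ ≤ 1)
    (hx : ‖x‖ ≤ 1) (hy : ‖y‖ ≤ 1) :
    ‖(orbit q n ϖ w u₀ x y (n - 1)).2‖ < ‖torsionPt q n ϖ w 1‖ := by
  have hn := h.two_le
  have hq := h.two_le_q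
  rcases hn.eq_or_lt with rfl | h3
  · have h1 := h.norm_orbit_snd_sub_le hu hx hy (i := 1) (j := 1) (by norm_num)
    rw [pow_one, max_eq_left (mul_le_of_le_one_right (norm_nonneg _) h.delta_lt_one.le), expS,
      if_neg (by decide)] at h1
    have h2 : ‖torsionPt q 2 ϖ w 1 ^ q • y ^ q ^ (2 * 1)‖ < ‖torsionPt q 2 ϖ w 1‖ := by
      refine (norm_smul_le_of _ (norm_pow_le_one' hy _)).trans_lt ?_
      rw [norm_pow]
      exact pow_lt_self_of_lt_one₀ h.delta_pos h.delta_lt_one (by omega)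
    have := norm_add_lt_of_lt' (h1.trans_lt h.norm_lt_delta) h2
    rwa [sub_add_cancel] at this
  · have h1 := h.norm_orbit_snd_le_pow hu hx hy (j := n - 1 - n / 2) (by omega)
    rw [show n / 2 + (n - 1 - n / 2) = n - 1 by omega] at h1
    refine h1.trans_lt (mul_lt_of_lt_one_left h.delta_pos ?_)
    exact pow_lt_one₀ (norm_nonneg _) h.lt (by omega)

theorem mu_orbit_ne_zero (h : LTData p q n ϖ ζ w) {u₀ x y : C} (hu : ‖u₀‖ ≤ 1)
    (hx : ‖x‖ ≤ 1) (hy : ‖y‖ ≤ 1) :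
    mu q ((orbit q n ϖ w u₀ x y (n - 1)).1 + (orbit q n ϖ w u₀ x y (n - 1)).2)
      (ζ * (orbit q n ϖ w u₀ x y (n - 1)).1 + ζ ^ q * (orbit q n ϖ w u₀ x y (n - 1)).2) ≠ 0 := by
  have hn := h.two_le
  have e := h.mu_diag (R := C) (orbit q n ϖ w u₀ x y (n - 1))
  rw [Algebra.algebraMap_self, RingHom.id_apply] at e
  rw [e, neg_ne_zero, RingHom.id_apply]
  refine mul_ne_zero h.zeta_sub_ne (sub_ne_zero.mpr fun h0 => ?_)
  have h1 := h.norm_orbit_fst_sub_le_norm hu hx hy (j := n - 1) (by omega) (by omega)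
  rw [show n - (n - 1) = 1 by omega] at h1
  have h2 := norm_eq_of_sub_lt (h1.trans_lt h.norm_lt_delta)
  have h3 := h.norm_orbit_snd_pred_lt hu hx hy
  have h4 := congrArg norm h0
  rw [norm_pow, norm_pow, h2] at h4
  exact absurd h4 (pow_lt_pow_left₀ h3 (norm_nonneg _) (by omega)).ne'

/-- Only torsion has to be assumed: the determinant equation is `μ^q = ϖ μ` of `mu_diag_pow` after
cancellation of the factor `μ`, nonzero by `mu_orbit_ne_zero`. -/
theorem diagPt_mem_curve (h : LTData p q n ϖ ζ w) {u : C} {z : C × C}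
    (hu : ‖u‖ ≤ ‖scaleU q n ϖ w‖) (hA : ‖z.1 - w‖ ≤ ‖torsionPt q n ϖ w 1‖)
    (hB : ‖z.2‖ ≤ ‖scaleS q n ϖ w‖) (hz : (stepAB q ϖ u)^[n] z = 0) :
    diagPt q ζ u z ∈ curve q n ϖ := by
  have hn := h.two_le
  have hq := h.two_le_q
  have hU := norm_pos_iff.mp h.norm_scaleU_pos
  have hS := norm_pos_iff.mp h.norm_scaleS_pos
  have hτ := h.torsionPt_one_ne
  have hA1 : ‖z.1‖ < 1 := by
    have := norm_add_lt_of_lt' (hA.trans_lt h.delta_lt_one) h.norm_w_lt_one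
    rwa [sub_add_cancel] at this
  have hB1 := hB.trans_lt h.norm_scaleS_lt_one
  refine ⟨fun i => ?_, ?_⟩
  · fin_cases i
    · exact hu.trans_lt (h.norm_scaleU_le_norm.trans_lt h.lt)
    · exact norm_add_lt_of_lt' hA1 hB1
    · refine norm_add_lt_of_lt' ?_ ?_
      · rwa [norm_mul, h.norm_zeta, one_mul]
      · rwa [norm_mul, norm_pow, h.norm_zeta, one_pow, one_mul]
  · have e := h.drinfeldEqs_diagPt (R := C) u z
    simp only [Algebra.algebraMap_self, RingHom.id_apply] at e
    rw [e, hz]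
    set u₀ := u / scaleU q n ϖ w
    set x := (z.1 - w) / torsionPt q n ϖ w 1
    set y := (z.2 + (z.1 - w)) / scaleS q n ϖ w
    have hu₀ : ‖u₀‖ ≤ 1 := by rw [norm_div]; exact div_le_one_of_le₀ hu (norm_nonneg _)
    have hx : ‖x‖ ≤ 1 := by rw [norm_div]; exact div_le_one_of_le₀ hA (norm_nonneg _)
    have hy : ‖y‖ ≤ 1 := by
      rw [norm_div]
      exact div_le_one_of_le₀ (norm_add_le_of_le' hB (hA.trans h.delta_lt_norm_scaleS.le))
        (norm_nonneg _)
    have ho : ∀ j, orbit q n ϖ w u₀ x y j = (stepAB q ϖ u)^[j] z := fun j => by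
      have e1 : scaleU q n ϖ w • u₀ = u := mul_div_cancel₀ u hU
      have e2 : startAB q n ϖ w x y = z := by
        have e3 : torsionPt q n ϖ w 1 • x = z.1 - w := mul_div_cancel₀ _ hτ
        have e4 : scaleS q n ϖ w • y = z.2 + (z.1 - w) := mul_div_cancel₀ _ hS
        simp only [startAB, e3, e4, Algebra.algebraMap_self, RingHom.id_apply]
        exact Prod.ext (by ring) (by ring)
      rw [orbit, e1, e2]
    have h0 : stepAB q ϖ u ((stepAB q ϖ u)^[n - 1] z) = 0 := by
      rw [← Function.iterate_succ_apply' (stepAB q ϖ u), Nat.succ_eq_add_one,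
        Nat.sub_add_cancel (by omega), hz]
    have h1 := h.mu_diag_pow u _ h0
    have h2 := h.mu_orbit_ne_zero hu₀ hx hy
    rw [ho] at h2
    simp only [Algebra.algebraMap_self, RingHom.id_apply] at h1
    rintro f (rfl | rfl | rfl)
    · simp
    · simp
    · rw [sub_eq_zero]
      refine mul_right_cancel₀ h2 ?_
      rw [← h1, ← pow_succ, Nat.sub_add_cancel (by omega)]

/-- The affinoid in terms of the diagonal coordinates. -/
theorem mem_affinoid_iff (h : LTData p q n ϖ ζ w) {P : Fin 3 → C} :
    P ∈ affinoid q n ϖ ζ w ↔ ∃ u z, P = diagPt q ζ u z ∧ ‖u‖ ≤ ‖scaleU q n ϖ w‖ ∧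
      ‖z.1 - w‖ ≤ ‖torsionPt q n ϖ w 1‖ ∧ ‖z.2‖ ≤ ‖scaleS q n ϖ w‖ ∧
      (stepAB q ϖ u)^[n] z = 0 := by
  have hδ := h.delta_lt_norm_scaleS.le
  simp only [affinoid, Set.mem_ofPred_eq, h.norm_rpow_scaleU, h.norm_rpow_scaleS, h.norm_rpow_inv]
  constructor
  · rintro ⟨hP, hu, hS, hU⟩
    have hζ := h.zeta_sub_ne
    set z : C × C := ((ζ ^ q * P 1 - P 2) / (ζ ^ q - ζ), (P 2 - ζ * P 1) / (ζ ^ q - ζ)) with hz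
    have eP : P = diagPt q ζ (P 0) z := by
      funext i
      fin_cases i
      · rfl
      · simp only [diagPt, hz]
        simp
        field_simp
        ring
      · simp only [diagPt, hz]
        simp
        field_simp
        ring
    have e1 : (ζ ^ q - ζ) * (z.1 - w) = ζ ^ q * (P 1 - w) - (P 2 - ζ * w) := by
      rw [hz]; field_simp; ring
    have hA : ‖z.1 - w‖ ≤ ‖torsionPt q n ϖ w 1‖ := by
      rw [← e1, norm_mul, h.norm_zeta_sub, one_mul] at hU
      exact hU
    have e2 : z.2 = (P 1 - w) - (z.1 - w) := by
      rw [show P 1 = z.1 + z.2 from congrFun eP 1]; ring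
    refine ⟨P 0, z, eP, hu, hA, ?_, ?_⟩
    · rw [e2]
      exact norm_sub_le_of_le' hS (hA.trans hδ)
    · have e := h.drinfeldEqs_diagPt (R := C) (P 0) z
      simp only [Algebra.algebraMap_self, RingHom.id_apply] at e
      rw [← eP] at e
      have h1 := hP.2
      rw [e] at h1
      obtain ⟨h2, h3⟩ := h.eq_zero_of_add_of_zeta (h1 _ (Or.inl rfl)) (h1 _ (Or.inr (Or.inl rfl)))
      exact Prod.ext h2 h3
  · rintro ⟨u, z, rfl, hu, hA, hB, hz⟩
    refine ⟨h.diagPt_mem_curve hu hA hB hz, hu, ?_, ?_⟩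
    · have : diagPt q ζ u z 1 - w = (z.1 - w) + z.2 := by simp [diagPt]; ring
      rw [this]
      exact norm_add_le_of_le' (hA.trans hδ) hB
    · have : ζ ^ q * (diagPt q ζ u z 1 - w) - (diagPt q ζ u z 2 - ζ * w)
          = (ζ ^ q - ζ) * (z.1 - w) := by simp [diagPt]; ring
      rw [this, norm_mul, h.norm_zeta_sub, one_mul]
      exact hA

theorem coords_injective (h : LTData p q n ϖ ζ w) :
    Function.Injective (coords q n ϖ ζ w : (Fin 3 → C) → Fin 3 → C) := by
  intro v v' hv
  have e := coords_eq_diagPt (R := C) (q := q) (n := n) (ϖ := ϖ) (ζ := ζ) (w := w)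
  simp only [Algebra.algebraMap_self, RingHom.id_apply] at e
  rw [e, e] at hv
  have h0 := congrFun hv 0
  have h1 := congrFun hv 1
  have h2 := congrFun hv 2
  simp only [diagPt, startAB, Matrix.cons_val_zero, Matrix.cons_val_one, Matrix.cons_val,
    Algebra.algebraMap_self, RingHom.id_apply, smul_eq_mul] at h0 h1 h2
  have e0 := mul_left_cancel₀ (norm_pos_iff.mp h.norm_scaleU_pos) h0
  have e2 : v 2 = v' 2 := by
    refine mul_left_cancel₀ (norm_pos_iff.mp h.norm_scaleS_pos) ?_
    linear_combination h1
  rw [e2] at h2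
  have e1 : v 1 = v' 1 := by
    refine mul_left_cancel₀ (mul_ne_zero h.zeta_sub_ne h.torsionPt_one_ne) ?_
    linear_combination -h2
  funext i
  fin_cases i
  · exact e0
  · exact e1
  · exact e2

theorem coords_bijOn (h : LTData p q n ϖ ζ w) :
    Set.BijOn (coords q n ϖ ζ w)
      {v : Fin 3 → C | (∀ i, ‖v i‖ ≤ 1) ∧ orbit q n ϖ w (v 0) (v 1) (v 2) n = 0}
      (affinoid q n ϖ ζ w) := by
  have e := coords_eq_diagPt (R := C) (q := q) (n := n) (ϖ := ϖ) (ζ := ζ) (w := w)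
  simp only [Algebra.algebraMap_self, RingHom.id_apply] at e
  have hδ := h.delta_lt_norm_scaleS.le
  refine ⟨fun v hv => ?_, h.coords_injective.injOn, fun P hP => ?_⟩
  · refine h.mem_affinoid_iff.mpr ⟨_, _, e v, norm_smul_le_of _ (hv.1 0), ?_, ?_, hv.2⟩
    · simp only [startAB, Algebra.algebraMap_self, RingHom.id_apply, add_sub_cancel_left]
      exact norm_smul_le_of _ (hv.1 1)
    · exact norm_sub_le_of_le' (norm_smul_le_of _ (hv.1 2))
        ((norm_smul_le_of _ (hv.1 1)).trans hδ)
  · obtain ⟨u, z, rfl, hu, hA, hB, hz⟩ := h.mem_affinoid_iff.mp hP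
    have e1 : scaleU q n ϖ w • (u / scaleU q n ϖ w) = u :=
      mul_div_cancel₀ u (norm_pos_iff.mp h.norm_scaleU_pos)
    have e2 : startAB q n ϖ w ((z.1 - w) / torsionPt q n ϖ w 1)
        ((z.2 + (z.1 - w)) / scaleS q n ϖ w) = z := by
      have e3 : torsionPt q n ϖ w 1 • ((z.1 - w) / torsionPt q n ϖ w 1) = z.1 - w :=
        mul_div_cancel₀ _ h.torsionPt_one_ne
      have e4 : scaleS q n ϖ w • ((z.2 + (z.1 - w)) / scaleS q n ϖ w) = z.2 + (z.1 - w) :=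
        mul_div_cancel₀ _ (norm_pos_iff.mp h.norm_scaleS_pos)
      simp only [startAB, e3, e4, Algebra.algebraMap_self, RingHom.id_apply]
      exact Prod.ext (by ring) (by ring)
    refine ⟨![u / scaleU q n ϖ w, (z.1 - w) / torsionPt q n ϖ w 1,
      (z.2 + (z.1 - w)) / scaleS q n ϖ w], ⟨fun i => ?_, ?_⟩, ?_⟩
    · fin_cases i
      · exact (norm_div _ _).trans_le (div_le_one_of_le₀ hu (norm_nonneg _))
      · exact (norm_div _ _).trans_le (div_le_one_of_le₀ hA (norm_nonneg _))
      · exact (norm_div _ _).trans_le (div_le_one_of_le₀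
          (norm_add_le_of_le' hB (hA.trans hδ)) (norm_nonneg _))
    · simp only [Matrix.cons_val_zero, Matrix.cons_val_one, Matrix.cons_val]
      rw [orbit, e1, e2, hz]
    · rw [e]
      simp only [Matrix.cons_val_zero, Matrix.cons_val_one, Matrix.cons_val]
      rw [e1, e2]

end Field

end LTData

section Functoriality

variable {R S : Type*} [CommRing R] [CommRing S] (φ : R →+* S) (q n : ℕ)

theorem map_mulUnif (ϖ u x : R) : φ (mulUnif q ϖ u x) = mulUnif q (φ ϖ) (φ u) (φ x) := by
  simp [mulUnif]

theorem map_iter_mulUnif (ϖ u x : R) (j : ℕ) :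
    φ ((mulUnif q ϖ u)^[j] x) = (mulUnif q (φ ϖ) (φ u))^[j] (φ x) :=
  (Function.Semiconj.iterate_right (f := φ) (map_mulUnif φ q ϖ u) j).eq x

theorem map_torsionPt (ϖ w : R) (i : ℕ) :
    φ (torsionPt q n ϖ w i) = torsionPt q n (φ ϖ) (φ w) i := by
  rw [torsionPt, map_iter_mulUnif, map_zero]
  rfl

theorem map_mu (x y : R) : φ (mu q x y) = mu q (φ x) (φ y) := by
  simp [mu]

theorem image_drinfeldEqs (ϖ : R) (P : Fin 3 → R) :
    φ '' drinfeldEqs q n ϖ P = drinfeldEqs q n (φ ϖ) fun i => φ (P i) := by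
  simp only [drinfeldEqs, Set.image_insert_eq, Set.image_singleton, map_sub, map_pow, map_mu,
    map_iter_mulUnif]

theorem map_coords (ϖ ζ w : R) (v : Fin 3 → R) (i : Fin 3) :
    φ (coords q n ϖ ζ w v i) = coords q n (φ ϖ) (φ ζ) (φ w) (fun i => φ (v i)) i := by
  simp only [coords]
  split_ifs
  all_goals
    fin_cases i
    all_goals simp [map_torsionPt]

end Functoriality

section Subfield

variable {C : Type*} [NormedField C] {K : Subfield C} {p q n : ℕ} {ϖ ζ w : K}

theorem LTData.coe (h : LTData p q n ϖ ζ w) : LTData p q n (ϖ : C) (ζ : C) (w : C) where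
  prime := h.prime
  char := by
    have := h.char
    exact charP_of_injective_algebraMap (algebraMap K C).injective p
  pow := h.pow
  two_le := h.two_le
  ne := by simpa using h.ne
  lt := h.lt
  zeta := congrArg (Subtype.val) h.zeta
  zeta_ne := fun h0 => h.zeta_ne (Subtype.ext h0)
  tors := by
    have := map_iter_mulUnif K.subtype q ϖ 0 w n
    rw [h.tors, map_zero] at this
    exact this.symm
  prim := by
    have := map_iter_mulUnif K.subtype q ϖ 0 w (n - 1)
    rw [map_zero] at this
    exact fun h0 => h.prim (Subtype.ext (this.trans h0))

theorem LTData.of_coe (h : LTData p q n (ϖ : C) (ζ : C) (w : C)) : LTData p q n ϖ ζ w where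
  prime := h.prime
  char := by
    have := h.char
    exact (RingHom.charP_iff (algebraMap K C) (algebraMap K C).injective p).mpr this
  pow := h.pow
  two_le := h.two_le
  ne := by simpa using h.ne
  lt := h.lt
  zeta := Subtype.ext h.zeta
  zeta_ne := fun h0 => h.zeta_ne (congrArg Subtype.val h0)
  tors := by
    have := map_iter_mulUnif K.subtype q ϖ 0 w n
    rw [map_zero] at this
    exact Subtype.ext (this.trans h.tors)
  prim := fun h0 => by
    have := map_iter_mulUnif K.subtype q ϖ 0 w (n - 1)
    rw [map_zero, h0, map_zero] at this
    exact h.prim this.symm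

end Subfield

/-! ### The points of the affinoid algebra -/

section PointsAff

variable {C : Type*} [NormedField C] [IsUltrametricDist C] [CompleteSpace C] {K : Subfield C}
  {p q n : ℕ} {ϖ ζ w : K}

theorem mem_points_affIdeal {P : Fin 3 → C} :
    P ∈ Points (affIdeal q n ϖ ζ w) ↔ (∀ i, ‖P i‖ ≤ 1) ∧
      ∀ f ∈ drinfeldEqs q n (ϖ : C) (coords q n (ϖ : C) (ζ : C) (w : C) P), f = 0 := by
  have key : ∀ hP : ∀ i, ‖P i‖ ≤ 1, (Tate.eval (K := K) P hP).toRingHom ''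
      (drinfeldEqs q n (algebraMap K (Tate K 3) ϖ) (coords q n (algebraMap K (Tate K 3) ϖ)
        (algebraMap K (Tate K 3) ζ) (algebraMap K (Tate K 3) w) (Tate.X K)))
      = drinfeldEqs q n (ϖ : C) (coords q n (ϖ : C) (ζ : C) (w : C) P) := fun hP => by
    have hc : ∀ a : K, (Tate.eval (K := K) P hP).toRingHom (algebraMap K (Tate K 3) a) = (a : C) :=
      fun a => (Tate.eval (K := K) P hP).commutes a
    rw [image_drinfeldEqs, hc]
    congr 1
    funext i
    rw [map_coords, hc, hc, hc]
    congr 1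
    funext i
    exact Tate.eval_X P hP i
  constructor
  · rintro ⟨hP, h0⟩
    refine ⟨hP, fun f hf => ?_⟩
    rw [← key hP] at hf
    obtain ⟨f', hf', rfl⟩ := hf
    exact h0 f' (Ideal.subset_span hf')
  · rintro ⟨hP, h0⟩
    refine ⟨hP, fun f hf => ?_⟩
    have : affIdeal q n ϖ ζ w ≤ RingHom.ker (Tate.eval (K := K) P hP).toRingHom := by
      refine Ideal.span_le.mpr fun f hf => ?_
      refine h0 _ ?_
      rw [← key hP]
      exact ⟨f, hf, rfl⟩
    exact this hf

/-- The determinant equation, although a generator of the ideal, imposes no further condition on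
points of the unit polydisc. -/
theorem LTData.points_affIdeal (h : LTData p q n ϖ ζ w) :
    Points (affIdeal q n ϖ ζ w)
      = {v : Fin 3 → C | (∀ i, ‖v i‖ ≤ 1) ∧
        orbit q n (ϖ : C) (w : C) (v 0) (v 1) (v 2) n = 0} := by
  ext v
  rw [mem_points_affIdeal]
  refine and_congr_right fun hv => ⟨fun h0 => ?_, fun h0 => ?_⟩
  · have e := coords_eq_diagPt (R := C) (q := q) (n := n) (ϖ := (ϖ : C)) (ζ := (ζ : C))
      (w := (w : C)) v
    have e' := h.coe.drinfeldEqs_diagPt (R := C) (scaleU q n (ϖ : C) (w : C) • v 0)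
      (startAB q n (ϖ : C) (w : C) (v 1) (v 2))
    simp only [Algebra.algebraMap_self, RingHom.id_apply] at e e'
    rw [e, e'] at h0
    obtain ⟨h2, h3⟩ := h.coe.eq_zero_of_add_of_zeta (h0 _ (Or.inl rfl)) (h0 _ (Or.inr (Or.inl rfl)))
    exact Prod.ext h2 h3
  · exact (h.coe.coords_bijOn.mapsTo ⟨hv, h0⟩).1.2

theorem LTData.bijOn_points (h : LTData p q n ϖ ζ w) :
    Set.BijOn (coords q n (ϖ : C) (ζ : C) (w : C)) (Points (affIdeal q n ϖ ζ w))
      (affinoid q n (ϖ : C) (ζ : C) (w : C)) := by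
  rw [h.points_affIdeal]
  exact h.coe.coords_bijOn

theorem LTData.coe_scaleU : ((scaleU q n ϖ w : K) : C) = scaleU q n (ϖ : C) (w : C) := by
  have := map_torsionPt K.subtype q n ϖ w 1
  simp only [Subfield.subtype_apply] at this
  simp only [scaleU]
  split_ifs <;> simp [this]

theorem LTData.coe_scaleS : ((scaleS q n ϖ w : K) : C) = scaleS q n (ϖ : C) (w : C) := by
  have := map_torsionPt K.subtype q n ϖ w (n / 2 + 1)
  simp only [Subfield.subtype_apply] at this
  simp [scaleS, this]

theorem eval_orbit (P : Fin 3 → C) (hP : ∀ i, ‖P i‖ ≤ 1) (u x y : Tate K 3) (j : ℕ) :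
    (Tate.eval P hP (LTData.orbit q n ϖ w u x y j).1, Tate.eval P hP (LTData.orbit q n ϖ w u x y j).2)
      = LTData.orbit q n (ϖ : C) (w : C) (Tate.eval P hP u) (Tate.eval P hP x)
        (Tate.eval P hP y) j := by
  have hs : ∀ (a : K) (f : Tate K 3), Tate.eval P hP (a • f) = (a : C) • Tate.eval P hP f :=
    fun a f => map_smul (Tate.eval P hP) a f
  have hl : ∀ f : Tate K 3, Tate.eval P hP (lin q ϖ f) = lin q (ϖ : C) (Tate.eval P hP f) :=
    fun f => by simp only [lin, map_add, map_pow, hs]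
  have hw : Tate.eval P hP (algebraMap K (Tate K 3) w) = (w : C) := (Tate.eval P hP).commutes w
  have hτ : ((torsionPt q n ϖ w 1 : K) : C) = torsionPt q n (ϖ : C) (w : C) 1 :=
    map_torsionPt K.subtype q n ϖ w 1
  induction j with
  | zero =>
    simp only [LTData.orbit, Function.iterate_zero, id, LTData.startAB, map_add, map_sub, hs, hw, hτ,
      LTData.coe_scaleS]
    rfl
  | succ j ih =>
    have ih1 := congrArg Prod.fst ih
    have ih2 := congrArg Prod.snd ih
    simp only at ih1 ih2
    simp only [LTData.orbit, Function.iterate_succ_apply'] at ih1 ih2 ⊢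
    rw [stepAB, stepAB, ← ih1, ← ih2, ← LTData.coe_scaleU]
    simp only [map_add, map_mul, map_pow, hl, hs]

end PointsAff

/-! ### The affinoid as a perturbed Artin-Schreier curve -/

section Chart

variable {C : Type*} [NormedField C] [IsUltrametricDist C] [CompleteSpace C] {K : Subfield C}
  {p q n : ℕ} {ϖ ζ w : K}

/-- The polynomial in `Y` of the equation of the reduction. -/
def curvePoly (q n : ℕ) : Polynomial ℤ :=
  (Polynomial.X ^ (q * (q + 1)) - Polynomial.X ^ (q + 1)) ^ q ^ (n - 1)

theorem curveEq_eq (k : Type*) [CommRing k] (q n : ℕ) :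
    curveEq k q n = MvPolynomial.X 0 ^ q ^ 2 - MvPolynomial.X 0
      - Polynomial.eval₂ (Int.castRingHom _) (MvPolynomial.X 1) (curvePoly q n) := by
  rw [curveEq, curvePoly, ← Polynomial.coe_eval₂RingHom, map_pow, map_sub, map_pow, map_pow,
    Polynomial.coe_eval₂RingHom, Polynomial.eval₂_X]

namespace LTData

/-- The first two generators are the combinations of `A_n` and `B_n` with coefficients `1, 1` and
`ζ, ζ^q`, a system of invertible determinant `ζ^q - ζ`. -/
theorem orbit_mem_affIdeal (h : LTData p q n ϖ ζ w) :
    (orbit q n ϖ w (Tate.X K 0) (Tate.X K 1) (Tate.X K (d := 3) 2) n).1 ∈ affIdeal q n ϖ ζ w ∧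
    (orbit q n ϖ w (Tate.X K 0) (Tate.X K 1) (Tate.X K (d := 3) 2) n).2 ∈ affIdeal q n ϖ ζ w := by
  have hI : drinfeldEqs q n (algebraMap K (Tate K 3) ϖ) (coords q n (algebraMap K (Tate K 3) ϖ)
      (algebraMap K (Tate K 3) ζ) (algebraMap K (Tate K 3) w) (Tate.X K))
      ⊆ affIdeal q n ϖ ζ w := Ideal.subset_span
  rw [coords_eq_diagPt, h.drinfeldEqs_diagPt] at hI
  set z := orbit q n ϖ w (Tate.X K 0) (Tate.X K 1) (Tate.X K (d := 3) 2) n with hz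
  have h1 : z.1 + z.2 ∈ affIdeal q n ϖ ζ w := hI (Or.inl rfl)
  have h2 : algebraMap K (Tate K 3) ζ * z.1 + algebraMap K (Tate K 3) ζ ^ q * z.2
    ∈ affIdeal q n ϖ ζ w := hI (Or.inr (Or.inl rfl))
  have h3 : z.2 ∈ affIdeal q n ϖ ζ w := by
    have e : z.2 = algebraMap K (Tate K 3) (ζ ^ q - ζ)⁻¹ * ((algebraMap K (Tate K 3) ζ * z.1
        + algebraMap K (Tate K 3) ζ ^ q * z.2) - algebraMap K (Tate K 3) ζ * (z.1 + z.2)) := by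
      have h4 : algebraMap K (Tate K 3) (ζ ^ q - ζ)⁻¹ * algebraMap K (Tate K 3) (ζ ^ q - ζ) = 1 := by
        rw [← map_mul, inv_mul_cancel₀ (sub_ne_zero.mpr h.zeta_ne), map_one]
      rw [map_sub, map_pow] at h4
      linear_combination -z.2 * h4
    rw [e]
    exact Ideal.mul_mem_left _ _ (Ideal.sub_mem _ h2 (Ideal.mul_mem_left _ _ h1))
  refine ⟨?_, h3⟩
  have := Ideal.sub_mem _ h1 h3
  rwa [add_sub_cancel_right] at this

theorem norm_inv_smul_sub_lt {k R : Type*} [NormedField k] [NormedCommRing R] [NormedAlgebra k R]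
    {a : k} {f t : R} (h : ‖f - a • t‖ < ‖a‖) : ‖a⁻¹ • f - t‖ < 1 := by
  have ha : a ≠ 0 := norm_pos_iff.mp ((norm_nonneg _).trans_lt h)
  have e : a⁻¹ • f - t = a⁻¹ • (f - a • t) := by
    rw [smul_sub, smul_smul, inv_mul_cancel₀ ha, one_smul]
  rw [e, norm_smul, norm_inv, inv_mul_lt_one₀ (norm_pos_iff.mpr ha)]
  exact h

theorem pow_curvePoly (h : LTData p q n ϖ ζ w) (y : Tate K 3) :
    Polynomial.aeval y (curvePoly q n)
      = (y ^ q ^ (n - 1)) ^ (q * (q + 1)) - (y ^ q ^ (n - 1)) ^ (q + 1) := by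
  simp only [curvePoly, map_pow, map_sub, Polynomial.aeval_X, h.sub_pow]
  rw [← pow_mul, ← pow_mul, ← pow_mul, ← pow_mul, mul_comm, mul_comm (q + 1)]

theorem isChart_of_mem (h : LTData p q n ϖ ζ w) {g : Polynomial ℤ} {f1 f2 : Tate K 3}
    (hs1 : ‖f1 - (Tate.X K 1 - Tate.X K 1 ^ q ^ 2
      + Polynomial.aeval (Tate.X K 2) (curvePoly q n))‖ < 1)
    (hs2 : ‖f2 - (Tate.X K 0 - Polynomial.aeval (Tate.X K 2) g)‖ < 1)
    (h1 : f1 ∈ affIdeal q n ϖ ζ w) (h2 : f2 ∈ affIdeal q n ϖ ζ w)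
    (hP : ∀ (P : Fin 3 → C) (hP : ∀ i, ‖P i‖ ≤ 1), Tate.eval P hP f1 = 0 →
      Tate.eval P hP f2 = 0 →
      Tate.eval P hP (orbit q n ϖ w (Tate.X K 0) (Tate.X K 1) (Tate.X K 2) n).1 = 0 ∧
      Tate.eval P hP (orbit q n ϖ w (Tate.X K 0) (Tate.X K 1) (Tate.X K 2) n).2 = 0) :
    ∃ (e : ℕ) (g : Polynomial ℤ) (ε : ℝ) (f1 f2 s1 s2 : Tate K 3), p ^ e = q ^ 2 ∧ 0 < ε ∧
      IsChart (affIdeal q n ϖ ζ w) p e (curvePoly q n) g ε f1 f2 s1 s2 := by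
  obtain ⟨f, hf, hq⟩ := h.pow
  have he : p ^ (f * 2) = q ^ 2 := by rw [hq, ← pow_mul]
  -- The value `1 / 2` keeps `ε` positive even if both errors vanish.
  refine ⟨f * 2, g, max (1 / 2) (max ‖f1 - (Tate.X K 1 - Tate.X K 1 ^ q ^ 2
    + Polynomial.aeval (Tate.X K 2) (curvePoly q n))‖
    ‖f2 - (Tate.X K 0 - Polynomial.aeval (Tate.X K 2) g)‖), f1, f2, f1 - (Tate.X K 1
    - Tate.X K 1 ^ q ^ 2 + Polynomial.aeval (Tate.X K 2) (curvePoly q n)),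
    f2 - (Tate.X K 0 - Polynomial.aeval (Tate.X K 2) g), he,
    lt_max_of_lt_left (by norm_num), ?_⟩
  refine
    { pos := by omega
      eq1 := ?_
      eq2 := ?_
      lt_one := max_lt (by norm_num) (max_lt hs1 hs2)
      norm1 := (le_max_left _ _).trans (le_max_right _ _)
      norm2 := (le_max_right _ _).trans (le_max_right _ _)
      mem1 := h1
      mem2 := h2
      point := fun P hP' h3 h4 => ?_ }
  · rw [he]; ring
  · ring
  · rw [h.points_affIdeal]
    refine ⟨hP', ?_⟩
    have := eval_orbit (q := q) (n := n) (ϖ := ϖ) (w := w) P hP' (Tate.X K 0) (Tate.X K 1)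
      (Tate.X K 2) n
    rw [Tate.eval_X, Tate.eval_X, Tate.eval_X] at this
    rw [← this]
    obtain ⟨h5, h6⟩ := hP P hP' h3 h4
    exact Prod.ext h5 h6

/-- Dividing `A_n` and `B_n` by their leading coefficients leaves two equations in `x`, `y`, `u_0`
up to errors of Gauss norm less than one. The second is linear in `u_0`, and a multiple of it
removes `u_0` from the first. -/
theorem exists_isChart (h : LTData p q n ϖ ζ w) :
    ∃ (e : ℕ) (g : Polynomial ℤ) (ε : ℝ) (f1 f2 s1 s2 : Tate K 3), p ^ e = q ^ 2 ∧ 0 < ε ∧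
      IsChart (affIdeal q n ϖ ζ w) p e (curvePoly q n) g ε f1 f2 s1 s2 := by
  have hn := h.two_le
  obtain ⟨hA, hB⟩ := h.orbit_mem_affIdeal
  have hu := Tate.norm_X_le (K := K) (d := 3) 0
  have hx := Tate.norm_X_le (K := K) (d := 3) 1
  have hy := Tate.norm_X_le (K := K) (d := 3) 2
  set τ := torsionPt q n ϖ w 1 with hτ
  have hτ0 : τ ≠ 0 := h.torsionPt_one_ne
  set A := (orbit q n ϖ w (Tate.X K 0) (Tate.X K 1) (Tate.X K (d := 3) 2) n).1 with hAd
  set B := (orbit q n ϖ w (Tate.X K 0) (Tate.X K 1) (Tate.X K (d := 3) 2) n).2 with hBd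
  set Y : Tate K 3 := Tate.X K 2 with hY
  have ha : ϖ ^ n * τ ≠ 0 := mul_ne_zero (pow_ne_zero _ h.ne) hτ0
  have hsm : ∀ (a : K) (f : Tate K 3), f ∈ affIdeal q n ϖ ζ w → a • f ∈ affIdeal q n ϖ ζ w :=
    fun a f hf => by rw [Algebra.smul_def]; exact Ideal.mul_mem_left _ _ hf
  have hev : ∀ (P : Fin 3 → C) (hP : ∀ i, ‖P i‖ ≤ 1) (a : K) (f : Tate K 3), a ≠ 0 →
      Tate.eval P hP (a • f) = 0 → Tate.eval P hP f = 0 := fun P hP a f ha h0 => by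
    rw [map_smul] at h0
    exact (smul_eq_zero.mp h0).resolve_left ha
  by_cases ho : Odd n
  · have e1 := h.norm_orbit_fst_odd ho hu hx hy
    have e2 := h.norm_orbit_snd_odd ho hu hx hy
    rw [← hτ, ← norm_pow, ← norm_mul] at e1 e2
    have hk : 2 * (n / 2) = n - 1 := by obtain ⟨r, rfl⟩ := ho; omega
    rw [hk] at e1 e2
    set y' := Y ^ q ^ (n - 1) with hy'
    have hy1 : ‖y'‖ ≤ 1 := norm_pow_le_one' hy _
    have hb : ϖ ^ ((n + 1) / 2) * τ ≠ 0 := mul_ne_zero (pow_ne_zero _ h.ne) hτ0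
    have e1' := norm_inv_smul_sub_lt e1
    have e2' := norm_inv_smul_sub_lt e2
    set f2 := -((ϖ ^ ((n + 1) / 2) * τ)⁻¹ • B) with hf2
    have hs2 : ‖f2 - (Tate.X K 0 - (y' - y' ^ q ^ 2))‖ < 1 := by
      rw [← norm_neg]
      refine (congrArg norm ?_).le.trans_lt e2'
      rw [hf2]; ring
    have hf2m : f2 ∈ affIdeal q n ϖ ζ w := Ideal.neg_mem_iff _ |>.mpr (hsm _ _ hB)
    -- Here `f2` is close to `u_0 - (y' - y'^{q²})`. Adding `f2 y'^q` replaces `u_0` in the first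
    -- equation and yields `y'^{q(q+1)} - y'^{q+1}`.
    refine h.isChart_of_mem (g := Polynomial.X ^ q ^ (n - 1) - (Polynomial.X ^ q ^ (n - 1)) ^ q ^ 2)
      (f1 := (ϖ ^ n * τ)⁻¹ • A + f2 * y' ^ q) (f2 := f2) ?_ ?_ ?_ hf2m ?_
    · have := norm_add_lt_of_lt' e1' ((norm_mul_le _ _).trans_lt
        (mul_lt_one_of_nonneg_of_lt_one_left (norm_nonneg _) hs2 (norm_pow_le_one' hy1 q)))
      refine (congrArg norm ?_).le.trans_lt this
      rw [h.pow_curvePoly]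
      ring
    · refine (congrArg norm ?_).le.trans_lt hs2
      simp [hy', hY]
    · exact Ideal.add_mem _ (hsm _ _ hA) (Ideal.mul_mem_right _ _ hf2m)
    · intro P hP h3 h4
      rw [map_add, map_mul, h4, zero_mul, add_zero] at h3
      rw [map_neg, neg_eq_zero] at h4
      exact ⟨hev P hP _ _ (inv_ne_zero ha) h3, hev P hP _ _ (inv_ne_zero hb) h4⟩
  · have e1 := h.norm_orbit_fst_even ho hu hx hy
    have e2 := h.norm_orbit_snd_even ho hu hx hy
    rw [← hτ, ← norm_pow, ← norm_mul] at e1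
    rw [← hτ, ← norm_pow, ← norm_pow, ← norm_mul] at e2
    rw [Nat.not_odd_iff_even] at ho
    obtain ⟨r, hr⟩ := ho
    have hk : 2 * (n / 2) = n - 1 + 1 := by omega
    have hk' : (Y ^ q ^ (2 * (n / 2 - 1))) ^ q = Y ^ q ^ (n - 1) := by
      rw [← pow_mul, ← pow_succ]
      congr 2
      omega
    rw [hk', hk, pow_succ, pow_mul] at e1
    rw [hk, pow_succ, pow_mul] at e2
    set y' := Y ^ q ^ (n - 1) with hy'
    have hy1 : ‖y'‖ ≤ 1 := norm_pow_le_one' hy _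
    have hb : ϖ ^ ((n + 1) / 2) * τ ^ q ≠ 0 := mul_ne_zero (pow_ne_zero _ h.ne) (pow_ne_zero _ hτ0)
    have e1' := norm_inv_smul_sub_lt e1
    have e2' := norm_inv_smul_sub_lt e2
    set f2 := (ϖ ^ ((n + 1) / 2) * τ ^ q)⁻¹ • B with hf2
    have hf2m : f2 ∈ affIdeal q n ϖ ζ w := hsm _ _ hB
    -- Here `f2` is close to `u_0 + y'^q` and `u_0` enters the first equation with factor `y' -
    -- y'^{q²}`; elimination leads to the same polynomial in `y'`.
    refine h.isChart_of_mem (g := -(Polynomial.X ^ q ^ (n - 1)) ^ q)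
      (f1 := (ϖ ^ n * τ)⁻¹ • A - f2 * (y' - (y' ^ q) ^ q)) (f2 := f2) ?_ ?_ ?_ hf2m ?_
    · have hG : ‖y' - (y' ^ q) ^ q‖ ≤ 1 :=
        norm_sub_le_of_le' hy1 (norm_pow_le_one' (norm_pow_le_one' hy1 q) q)
      have := norm_sub_lt_of_lt' e1' ((norm_mul_le _ _).trans_lt
        (mul_lt_one_of_nonneg_of_lt_one_left (norm_nonneg _) e2' hG))
      refine (congrArg norm ?_).le.trans_lt this
      rw [h.pow_curvePoly]
      ring
    · refine (congrArg norm ?_).le.trans_lt e2'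
      simp [hy', hY]
      ring
    · exact Ideal.sub_mem _ (hsm _ _ hA) (Ideal.mul_mem_right _ _ hf2m)
    · intro P hP h3 h4
      rw [map_sub, map_mul, h4, zero_mul, sub_zero] at h3
      exact ⟨hev P hP _ _ (inv_ne_zero ha) h3, hev P hP _ _ (inv_ne_zero hb) h4⟩

end LTData

end Chart

/-! ### Teichmüller representatives in the local field -/

section LocalField

variable {C : Type*} [NormedField C] [IsUltrametricDist C] {F : Subfield C} {ϖ : C}

theorem residue_eq_iff {K : Subfield C} (x y : intRing K) :
    IsLocalRing.residue (intRing K) x = IsLocalRing.residue (intRing K) y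
      ↔ ‖((x : K) : C) - ((y : K) : C)‖ < 1 := by
  rw [← sub_eq_zero, ← map_sub, IsLocalRing.residue_eq_zero_iff]
  exact Valuation.mem_maximalIdeal_iff _ NormedField.valuation

theorem completeSpace_of_locallyCompact [LocallyCompactSpace F] : CompleteSpace F :=
  IsRightUniformAddGroup.completeSpace_of_weaklyLocallyCompactSpace

/-- The closed unit ball is compact, hence covered by finitely many open unit balls, and these are
residue classes. -/
theorem finite_residue [LocallyCompactSpace F] (hϖ : IsUniformizer F ϖ) : Finite (Residue F) := by
  let _ : NontriviallyNormedField F :=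
    { (inferInstance : NormedField F) with
      non_trivial := ⟨⟨ϖ⁻¹, F.inv_mem hϖ.1⟩, by
        change 1 < ‖ϖ⁻¹‖
        rw [norm_inv]
        exact (one_lt_inv₀ (norm_pos_iff.mpr hϖ.2.1)).mpr hϖ.2.2.1⟩ }
  have : ProperSpace F := .of_nontriviallyNormedField_of_weaklyLocallyCompactSpace F
  have hc := (isCompact_closedBall (0 : F) 1).totallyBounded
  obtain ⟨t, hts, ht, hcov⟩ := Metric.finite_approx_of_totallyBounded hc 1 one_pos
  have hfin : (Set.range fun y : t => IsLocalRing.residue (intRing F)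
      ⟨y.1, mem_closedBall_zero_iff.mp (hts y.2)⟩).Finite := by
    have : Finite t := ht
    exact Set.finite_range _
  refine Set.finite_univ_iff.mp (hfin.subset fun r _ => ?_)
  obtain ⟨x, rfl⟩ := IsLocalRing.residue_surjective r
  have hx : (x : F) ∈ Metric.closedBall (0 : F) 1 := mem_closedBall_zero_iff.mpr x.2
  obtain ⟨y, hy, hxy⟩ := Set.mem_iUnion₂.mp (hcov hx)
  refine ⟨⟨y, hy⟩, (residue_eq_iff _ _).mpr ?_⟩
  rw [Metric.mem_ball, dist_comm, dist_eq_norm] at hxy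
  exact hxy

theorem charP_residue {p : ℕ} [Fact p.Prime] [CharP C p] : CharP (Residue F) p := by
  rw [CharP.charP_iff_prime_eq_zero Fact.out]
  have : ((p : intRing F) : F) = 0 := Subtype.ext (by simp)
  have h2 : (p : intRing F) = 0 := Subtype.ext this
  rw [← map_natCast (IsLocalRing.residue (intRing F)), h2, map_zero]

theorem card_residue_eq_pow [LocallyCompactSpace F] {p : ℕ} [Fact p.Prime] [CharP C p]
    (hϖ : IsUniformizer F ϖ) : ∃ f, f ≠ 0 ∧ Nat.card (Residue F) = p ^ f := by
  have := finite_residue hϖ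
  have := Fintype.ofFinite (Residue F)
  have := charP_residue (F := F) (p := p)
  obtain ⟨f, _, hf⟩ := FiniteField.card (Residue F) p
  exact ⟨f, f.ne_zero, by rw [Nat.card_eq_fintype_card, hf]⟩

theorem norm_pow_card_sub_lt [LocallyCompactSpace F] (hϖ : IsUniformizer F ϖ) {a : C} (ha : a ∈ F)
    (ha1 : ‖a‖ ≤ 1) : ‖a ^ Nat.card (Residue F) - a‖ < 1 := by
  have := finite_residue hϖ
  have := Fintype.ofFinite (Residue F)
  let x : intRing F := ⟨⟨a, ha⟩, ha1⟩
  have h := FiniteField.pow_card (IsLocalRing.residue (intRing F) x)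
  rw [← map_pow, ← Nat.card_eq_fintype_card] at h
  exact (residue_eq_iff _ _).mp h

/-- The sequence `a^{q^j}` converges, as its increments are `(a^q - a)^{q^j}` in characteristic `p`
and `‖a^q - a‖ < 1`. The limit lies in `F` by completeness and is fixed by the `q`-power map. -/
theorem exists_fixed_near [LocallyCompactSpace F] {p : ℕ} [Fact p.Prime] [CharP C p]
    (hϖ : IsUniformizer F ϖ) {a : C} (ha : a ∈ F) (ha1 : ‖a‖ ≤ 1) :
    ∃ t ∈ F, t ^ Nat.card (Residue F) = t ∧ ‖a - t‖ < 1 := by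
  have hr := norm_pow_card_sub_lt hϖ ha ha1
  obtain ⟨f, hf, hq⟩ := card_residue_eq_pow (p := p) hϖ
  set q := Nat.card (Residue F) with hqd
  have hq2 : 2 ≤ q := by rw [hq]; exact (Fact.out : p.Prime).two_le.trans (Nat.le_self_pow hf p)
  have hsub : ∀ (x y : C) (j : ℕ), (x - y) ^ q ^ j = x ^ q ^ j - y ^ q ^ j := fun x y j => by
    rw [hq, ← pow_mul]; exact sub_pow_char_pow x y _
  set s : ℕ → F := fun j => (⟨a, ha⟩ : F) ^ q ^ j with hs
  have hstep : ∀ j, ‖s (j + 1) - s j‖ ≤ ‖a ^ q - a‖ ^ q ^ j := fun j => by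
    refine le_of_eq (Eq.trans ?_ (norm_pow (a ^ q - a) (q ^ j)))
    rw [hsub, ← pow_mul, ← pow_succ']
    rfl
  have hle : ∀ j, ‖a ^ q - a‖ ^ q ^ j ≤ ‖a ^ q - a‖ := fun j =>
    pow_le_of_le_one (norm_nonneg _) hr.le (pow_pos (by omega) _).ne'
  have := completeSpace_of_locallyCompact (F := F)
  have hcs : CauchySeq s := by
    refine NonarchimedeanAddGroup.cauchySeq_of_tendsto_sub_nhds_zero ?_
    rw [tendsto_zero_iff_norm_tendsto_zero]
    refine squeeze_zero (fun _ => norm_nonneg _) hstep ?_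
    refine (tendsto_pow_atTop_nhds_zero_of_lt_one (norm_nonneg _) hr).comp ?_
    exact tendsto_pow_atTop_atTop_of_one_lt (by omega)
  obtain ⟨t, ht⟩ := cauchySeq_tendsto_of_complete hcs
  have hmem : ∀ j, ‖s j - ⟨a, ha⟩‖ ≤ ‖a ^ q - a‖ := fun j => by
    induction j with
    | zero => simp [hs]
    | succ j ih =>
      have := norm_add_le_of_le' ((hstep j).trans (hle j)) ih
      rwa [sub_add_sub_cancel] at this
  refine ⟨t, t.2, ?_, ?_⟩
  · have h1 : Tendsto (fun j => s j ^ q) atTop (𝓝 (t ^ q)) := ht.pow q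
    have h2 : Tendsto (fun j => s (j + 1)) atTop (𝓝 t) := ht.comp (tendsto_add_atTop_nat 1)
    have h3 : (fun j => s j ^ q) = fun j => s (j + 1) := funext fun j => by
      rw [hs]; simp only [← pow_mul, ← pow_succ]
    rw [h3] at h1
    exact congrArg Subtype.val (tendsto_nhds_unique h1 h2)
  · have h1 : ‖t - ⟨a, ha⟩‖ ≤ ‖a ^ q - a‖ :=
      le_of_tendsto (ht.sub_const _).norm (Eventually.of_forall hmem)
    rw [norm_sub_rev]
    exact h1.trans_lt hr

/-- A counting argument: the `q` residue classes already provide `q` roots of `x^q - x` in `F`, and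
the polynomial has no others. -/
theorem mem_of_pow_card_eq [LocallyCompactSpace F] {p : ℕ} [Fact p.Prime] [CharP C p]
    (hϖ : IsUniformizer F ϖ) {x : C} (hx : x ^ Nat.card (Residue F) = x) : x ∈ F := by
  classical
  have := finite_residue hϖ
  have := Fintype.ofFinite (Residue F)
  have hq2 : 1 < Nat.card (Residue F) := Finite.one_lt_card
  have hex : ∀ r : Residue F, ∃ t : intRing F, ((t : F) : C) ^ Nat.card (Residue F) = t ∧
      IsLocalRing.residue (intRing F) t = r := fun r => by
    obtain ⟨y, rfl⟩ := IsLocalRing.residue_surjective r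
    obtain ⟨t, htF, ht, hyt⟩ := exists_fixed_near (p := p) hϖ y.1.2 y.2
    have ht1 : ‖t‖ ≤ 1 := norm_le_one_of_pow_eq_self hq2 ht
    refine ⟨⟨⟨t, htF⟩, ht1⟩, ht, (residue_eq_iff _ _).mpr ?_⟩
    rw [norm_sub_rev]
    exact hyt
  choose T hT1 hT2 using hex
  have hinj : Function.Injective fun r => ((T r : F) : C) := fun r r' h => by
    rw [← hT2 r, ← hT2 r']
    congr 1
    exact Subtype.ext (Subtype.ext h)
  set P : Polynomial C := Polynomial.X ^ Nat.card (Residue F) - Polynomial.X with hP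
  have hP0 : P ≠ 0 := FiniteField.X_pow_card_sub_X_ne_zero C hq2
  have hdeg : P.natDegree = Nat.card (Residue F) := FiniteField.X_pow_card_sub_X_natDegree_eq C hq2
  have hroot : ∀ y : C, y ∈ P.roots.toFinset ↔ y ^ Nat.card (Residue F) = y := fun y => by
    rw [Multiset.mem_toFinset, Polynomial.mem_roots hP0, Polynomial.IsRoot, hP]
    simp [sub_eq_zero]
  set S : Finset C := Finset.univ.image fun r => ((T r : F) : C) with hS
  have hSP : S ⊆ P.roots.toFinset := fun y hy => by
    obtain ⟨r, -, rfl⟩ := Finset.mem_image.mp hy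
    exact (hroot _).mpr (hT1 r)
  have hcard : P.roots.toFinset.card ≤ S.card := by
    rw [hS, Finset.card_image_of_injective _ hinj, Finset.card_univ, ← Nat.card_eq_fintype_card]
    exact (Multiset.toFinset_card_le _).trans ((Polynomial.card_roots' P).trans hdeg.le)
  have := Finset.eq_of_subset_of_card_le hSP hcard
  have hxS : x ∈ S := by rw [this]; exact (hroot x).mpr hx
  obtain ⟨r, -, rfl⟩ := Finset.mem_image.mp hxS
  exact (T r).1.2

end LocalField

/-- A subfield `F` of `C` with uniformizer `ϖ`, of which the residue field consists of the solutions
of `x^q = x`, together with a generator `ζ` of the unramified quadratic extension. -/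
structure UnramData {C : Type*} [NormedField C] (p q : ℕ) (F : Subfield C) (ϖ ζ : C) : Prop where
  prime : p.Prime
  char : CharP C p
  pow : ∃ f, f ≠ 0 ∧ q = p ^ f
  unif : IsUniformizer F ϖ
  mem : ∀ x : C, x ^ q = x → x ∈ F
  near : ∀ a ∈ F, ‖a‖ ≤ 1 → ∃ t ∈ F, t ^ q = t ∧ ‖a - t‖ < 1
  zeta : ζ ^ q ^ 2 = ζ
  zeta_not_mem : ζ ∉ F

namespace UnramData

variable {C : Type*} [NormedField C] [IsUltrametricDist C] {p q : ℕ} {F : Subfield C} {ϖ ζ : C}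

/-! ### The unramified quadratic extension -/

section Basic

theorem two_le_q (h : UnramData p q F ϖ ζ) : 2 ≤ q := by
  obtain ⟨f, hf, rfl⟩ := h.pow
  exact h.prime.two_le.trans (Nat.le_self_pow hf p)

theorem add_pow (h : UnramData p q F ϖ ζ) (x y : C) (j : ℕ) :
    (x + y) ^ q ^ j = x ^ q ^ j + y ^ q ^ j := by
  have := h.char
  have := Fact.mk h.prime
  obtain ⟨f, hf, rfl⟩ := h.pow
  rw [← pow_mul]
  exact add_pow_char_pow x y p _

theorem sub_pow (h : UnramData p q F ϖ ζ) (x y : C) (j : ℕ) :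
    (x - y) ^ q ^ j = x ^ q ^ j - y ^ q ^ j := by
  have := h.char
  have := Fact.mk h.prime
  obtain ⟨f, hf, rfl⟩ := h.pow
  rw [← pow_mul]
  exact sub_pow_char_pow x y _

theorem add_pow_q (h : UnramData p q F ϖ ζ) (x y : C) : (x + y) ^ q = x ^ q + y ^ q := by
  simpa using h.add_pow x y 1

theorem zeta_ne (h : UnramData p q F ϖ ζ) : ζ ^ q ≠ ζ := fun h0 => h.zeta_not_mem (h.mem _ h0)

theorem pow_sq_of_pow {t : C} (ht : t ^ q = t) : t ^ q ^ 2 = t := by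
  rw [sq, pow_mul, ht, ht]

/-- Allows every statement about `ζ` to be applied to its conjugate `ζ^q`. -/
theorem conj (h : UnramData p q F ϖ ζ) : UnramData p q F ϖ (ζ ^ q) :=
  { h with
    zeta := by rw [← pow_mul, mul_comm, pow_mul, h.zeta]
    zeta_not_mem := fun h0 => h.zeta_not_mem (by
      have := F.pow_mem h0 q
      rwa [← pow_mul, ← sq, h.zeta] at this) }

theorem eq_of_norm_lt (h : UnramData p q F ϖ ζ) {t t' : C} (ht : t ^ q ^ 2 = t)
    (ht' : t' ^ q ^ 2 = t') (hlt : ‖t - t'‖ < 1) : t = t' := by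
  have hq := h.two_le_q
  rw [← sub_eq_zero]
  rcases norm_eq_zero_or_one_of_pow_eq_self (N := q ^ 2) (t := t - t') (by nlinarith)
    (by rw [h.sub_pow, ht, ht']) with h0 | h1
  · exact h0
  · exact absurd h1 hlt.ne

theorem norm_le_one_of_fixed (h : UnramData p q F ϖ ζ) {t : C} (ht : t ^ q ^ 2 = t) : ‖t‖ ≤ 1 := by
  have hq := h.two_le_q
  exact norm_le_one_of_pow_eq_self (N := q ^ 2) (by nlinarith) ht

theorem norm_zeta (h : UnramData p q F ϖ ζ) : ‖ζ‖ = 1 := by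
  have hq := h.two_le_q
  refine (norm_eq_zero_or_one_of_pow_eq_self (N := q ^ 2) (by nlinarith) h.zeta).resolve_left
    fun h0 => h.zeta_ne ?_
  rw [h0, zero_pow (by omega)]

theorem coeff_unique (h : UnramData p q F ϖ ζ) {a b a' b' : C} (ha : a ∈ F) (hb : b ∈ F)
    (ha' : a' ∈ F) (hb' : b' ∈ F) (e : a + b * ζ = a' + b' * ζ) : a = a' ∧ b = b' := by
  have hbb : b = b' := by
    by_contra hne
    refine h.zeta_not_mem ?_
    have hne' : b - b' ≠ 0 := sub_ne_zero.mpr hne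
    have : ζ = (a' - a) / (b - b') := by
      rw [eq_div_iff hne']; linear_combination e
    rw [this]
    exact F.div_mem (F.sub_mem ha' ha) (F.sub_mem hb hb')
  exact ⟨by rw [hbb] at e; exact add_right_cancel e, hbb⟩

theorem mem_adj_iff (h : UnramData p q F ϖ ζ) {x : C} :
    x ∈ adj F ζ ↔ ∃ a ∈ F, ∃ b ∈ F, x = a + b * ζ := by
  have hζζ : ζ ^ q + ζ ∈ F := h.mem _ (by
    rw [h.add_pow_q, ← pow_mul, ← sq, h.zeta, add_comm])
  have hζn : ζ ^ (q + 1) ∈ F := h.mem _ (by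
    rw [← pow_mul, mul_comm, mul_add, ← sq, mul_one, pow_add, h.zeta, ← pow_succ'])
  constructor
  · intro hx
    let S : Subfield C :=
      { carrier := {x | ∃ a ∈ F, ∃ b ∈ F, x = a + b * ζ}
        zero_mem' := ⟨0, F.zero_mem, 0, F.zero_mem, by ring⟩
        one_mem' := ⟨1, F.one_mem, 0, F.zero_mem, by ring⟩
        add_mem' := by
          rintro _ _ ⟨a, ha, b, hb, rfl⟩ ⟨a', ha', b', hb', rfl⟩
          exact ⟨_, F.add_mem ha ha', _, F.add_mem hb hb', by ring⟩
        neg_mem' := by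
          rintro _ ⟨a, ha, b, hb, rfl⟩
          exact ⟨_, F.neg_mem ha, _, F.neg_mem hb, by ring⟩
        mul_mem' := by
          rintro _ _ ⟨a, ha, b, hb, rfl⟩ ⟨a', ha', b', hb', rfl⟩
          refine ⟨a * a' - b * b' * ζ ^ (q + 1), F.sub_mem (F.mul_mem ha ha')
            (F.mul_mem (F.mul_mem hb hb') hζn), a * b' + b * a' + b * b' * (ζ ^ q + ζ),
            F.add_mem (F.add_mem (F.mul_mem ha hb') (F.mul_mem hb ha'))
              (F.mul_mem (F.mul_mem hb hb') hζζ), by ring⟩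
        inv_mem' := by
          rintro _ ⟨a, ha, b, hb, rfl⟩
          -- The norm of `a + b ζ`: it lies in `F`, and the inverse is the conjugate divided by it.
          have hN : a ^ 2 + a * b * (ζ ^ q + ζ) + b ^ 2 * ζ ^ (q + 1) ∈ F :=
            F.add_mem (F.add_mem (F.pow_mem ha 2) (F.mul_mem (F.mul_mem ha hb) hζζ))
              (F.mul_mem (F.pow_mem hb 2) hζn)
          by_cases h0 : a + b * ζ = 0
          · exact ⟨0, F.zero_mem, 0, F.zero_mem, by rw [h0]; simp⟩
          have h1 : a + b * ζ ^ q ≠ 0 := fun h1 => h0 (by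
            obtain ⟨rfl, rfl⟩ := h.conj.coeff_unique ha hb F.zero_mem F.zero_mem
              (h1.trans (by ring))
            ring)
          have hN' : a ^ 2 + a * b * (ζ ^ q + ζ) + b ^ 2 * ζ ^ (q + 1)
            = (a + b * ζ) * (a + b * ζ ^ q) := by ring
          refine ⟨(a + b * (ζ ^ q + ζ)) / (a ^ 2 + a * b * (ζ ^ q + ζ) + b ^ 2 * ζ ^ (q + 1)),
            F.div_mem (F.add_mem ha (F.mul_mem hb hζζ)) hN,
            -b / (a ^ 2 + a * b * (ζ ^ q + ζ) + b ^ 2 * ζ ^ (q + 1)),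
            F.div_mem (F.neg_mem hb) hN, ?_⟩
          rw [hN']
          field_simp
          ring }
    have : adj F ζ ≤ S := Subfield.closure_le.mpr (by
      rintro y (hy | rfl)
      · exact ⟨y, hy, 0, F.zero_mem, by ring⟩
      · exact ⟨0, F.zero_mem, 1, F.one_mem, by ring⟩)
    exact this hx
  · rintro ⟨a, ha, b, hb, rfl⟩
    have hF : ∀ y ∈ F, y ∈ adj F ζ := fun y hy => Subfield.subset_closure (Or.inl hy)
    exact (adj F ζ).add_mem (hF a ha) ((adj F ζ).mul_mem (hF b hb) (mem_adj_self F ζ))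

end Basic

/-- The classes of `1` and `ζ` are independent over the residue field of `F`, because a relation
between them would lift to one between Teichmüller representatives and put `ζ` into `F`. The general
case follows on dividing by the larger coefficient. -/
theorem norm_add_mul_zeta (h : UnramData p q F ϖ ζ) {a b : C} (ha : a ∈ F) (hb : b ∈ F) :
    ‖a + b * ζ‖ = max ‖a‖ ‖b‖ := by
  have key : ∀ a ∈ F, ∀ b ∈ F, ‖a‖ ≤ 1 → ‖b‖ ≤ 1 → ‖a + b * ζ‖ < 1 → ‖a‖ < 1 ∧ ‖b‖ < 1 := by
    intro a ha b hb ha1 hb1 hlt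
    obtain ⟨s, hs, hsq, hsa⟩ := h.near a ha ha1
    obtain ⟨t, ht, htq, htb⟩ := h.near b hb hb1
    have h1 : s + t * ζ = 0 := by
      refine h.eq_of_norm_lt ?_ (zero_pow (pow_pos (by have := h.two_le_q; omega) 2).ne') ?_
      · rw [h.add_pow, mul_pow, pow_sq_of_pow hsq, pow_sq_of_pow htq, h.zeta]
      · have e : s + t * ζ - 0 = (a + b * ζ) - ((a - s) + (b - t) * ζ) := by ring
        rw [e]
        refine norm_sub_lt_of_lt' hlt (norm_add_lt_of_lt' hsa ?_)
        rwa [norm_mul, h.norm_zeta, mul_one]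
    obtain ⟨rfl, rfl⟩ := h.coeff_unique hs ht F.zero_mem F.zero_mem (h1.trans (by ring))
    exact ⟨by simpa using hsa, by simpa using htb⟩
  apply le_antisymm
  · refine (IsUltrametricDist.norm_add_le_max _ _).trans ?_
    rw [norm_mul, h.norm_zeta, mul_one]
  · by_contra! hlt
    rcases le_total ‖a‖ ‖b‖ with hab | hab
    · rw [max_eq_right hab] at hlt
      have hb0 : 0 < ‖b‖ := (norm_nonneg _).trans_lt hlt
      have hb0' : b ≠ 0 := norm_pos_iff.mp hb0
      have := (key (a / b) (F.div_mem ha hb) 1 F.one_mem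
        (by rw [norm_div]; exact div_le_one_of_le₀ hab hb0.le) (by simp) (by
          have e : a / b + 1 * ζ = (a + b * ζ) / b := by field_simp
          rw [e, norm_div]
          exact (div_lt_one hb0).mpr hlt)).2
      simp at this
    · rw [max_eq_left hab] at hlt
      have ha0 : 0 < ‖a‖ := (norm_nonneg _).trans_lt hlt
      have ha0' : a ≠ 0 := norm_pos_iff.mp ha0
      have := (key 1 F.one_mem (b / a) (F.div_mem hb ha) (by simp)
        (by rw [norm_div]; exact div_le_one_of_le₀ hab ha0.le) (by
          have e : 1 + b / a * ζ = (a + b * ζ) / a := by field_simp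
          rw [e, norm_div]
          exact (div_lt_one ha0).mpr hlt)).1
      simp at this

/-- The valuation ring of the quadratic unramified extension. -/
def ringO (F : Subfield C) (ζ : C) : Subring C where
  carrier := {x | x ∈ adj F ζ ∧ ‖x‖ ≤ 1}
  zero_mem' := ⟨Subfield.zero_mem _, by simp⟩
  one_mem' := ⟨Subfield.one_mem _, by simp⟩
  add_mem' hx hy := ⟨Subfield.add_mem _ hx.1 hy.1, norm_add_le_of_le' hx.2 hy.2⟩
  neg_mem' hx := ⟨Subfield.neg_mem _ hx.1, by rw [norm_neg]; exact hx.2⟩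
  mul_mem' hx hy := ⟨Subfield.mul_mem _ hx.1 hy.1, by
    rw [norm_mul]; exact mul_le_one₀ hx.2 (norm_nonneg _) hy.2⟩

theorem mem_adj_of_mem {x : C} (hx : x ∈ F) : x ∈ adj F ζ := Subfield.subset_closure (Or.inl hx)

theorem mem_ringO_of_mem {x : C} (hx : x ∈ F) (hx1 : ‖x‖ ≤ 1) : x ∈ ringO F ζ :=
  ⟨mem_adj_of_mem hx, hx1⟩

theorem mem_ringO_iff (h : UnramData p q F ϖ ζ) {x : C} :
    x ∈ ringO F ζ ↔ ∃ a ∈ F, ∃ b ∈ F, ‖a‖ ≤ 1 ∧ ‖b‖ ≤ 1 ∧ x = a + b * ζ := by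
  constructor
  · rintro ⟨hx, hx1⟩
    obtain ⟨a, ha, b, hb, rfl⟩ := h.mem_adj_iff.mp hx
    rw [h.norm_add_mul_zeta ha hb] at hx1
    exact ⟨a, ha, b, hb, (le_max_left _ _).trans hx1, (le_max_right _ _).trans hx1, rfl⟩
  · rintro ⟨a, ha, b, hb, ha1, hb1, rfl⟩
    exact ⟨h.mem_adj_iff.mpr ⟨a, ha, b, hb, rfl⟩, by
      rw [h.norm_add_mul_zeta ha hb]; exact max_le ha1 hb1⟩

theorem zeta_mem_ringO (h : UnramData p q F ϖ ζ) : ζ ∈ ringO F ζ :=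
  ⟨mem_adj_self F ζ, h.norm_zeta.le⟩

theorem unif_mem_ringO (h : UnramData p q F ϖ ζ) : ϖ ∈ ringO F ζ :=
  mem_ringO_of_mem h.unif.1 h.unif.2.2.1.le

/-- The solutions of `x^{q²} = x` lie in the quadratic unramified extension. -/
theorem fixed_mem_ringO (h : UnramData p q F ϖ ζ) {t : C} (ht : t ^ q ^ 2 = t) : t ∈ ringO F ζ := by
  refine ⟨?_, h.norm_le_one_of_fixed ht⟩
  have hne : ζ ^ q - ζ ≠ 0 := sub_ne_zero.mpr h.zeta_ne
  have hζ2 : (ζ ^ q) ^ q = ζ := by rw [← pow_mul, ← sq, h.zeta]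
  have ht2 : (t ^ q) ^ q = t := by rw [← pow_mul, ← sq, ht]
  have hsub : ∀ x y : C, (x - y) ^ q = x ^ q - y ^ q := fun x y => by
    simpa using h.sub_pow x y 1
  -- The solution of `t = a + b ζ` and `t^q = a + b ζ^q`; it is invariant under the `q`-power map,
  -- hence in `F`.
  set b := (t ^ q - t) / (ζ ^ q - ζ) with hb
  have hbq : b ^ q = b := by
    rw [hb, div_pow, hsub, hsub, hζ2, ht2, ← neg_sub (t ^ q), ← neg_sub (ζ ^ q), neg_div_neg_eq]
  have hbF := h.mem b hbq
  have haF : t - b * ζ ∈ F := h.mem _ (by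
    rw [hsub, mul_pow, hbq]
    have : b * (ζ ^ q - ζ) = t ^ q - t := div_mul_cancel₀ _ hne
    linear_combination -this)
  exact h.mem_adj_iff.mpr ⟨_, haF, b, hbF, by ring⟩

theorem exists_fixed_near' (h : UnramData p q F ϖ ζ) {a : C} (ha : a ∈ ringO F ζ) :
    ∃ t : C, t ^ q ^ 2 = t ∧ ‖a - t‖ < 1 := by
  obtain ⟨x, hx, y, hy, hx1, hy1, rfl⟩ := h.mem_ringO_iff.mp ha
  obtain ⟨s, hs, hsq, hsa⟩ := h.near x hx hx1
  obtain ⟨t, ht, htq, htb⟩ := h.near y hy hy1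
  refine ⟨s + t * ζ, ?_, ?_⟩
  · rw [h.add_pow, mul_pow, pow_sq_of_pow hsq, pow_sq_of_pow htq, h.zeta]
  · rw [show x + y * ζ - (s + t * ζ) = (x - s) + (y - t) * ζ by ring]
    refine norm_add_lt_of_lt' hsa ?_
    rwa [norm_mul, h.norm_zeta, mul_one]

/-- The uniformizer of `F` is a uniformizer of the quadratic unramified extension. -/
theorem norm_le_of_lt_one (h : UnramData p q F ϖ ζ) {x : C} (hx : x ∈ adj F ζ) (hx1 : ‖x‖ < 1) :
    ‖x‖ ≤ ‖ϖ‖ := by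
  obtain ⟨a, ha, b, hb, rfl⟩ := h.mem_adj_iff.mp hx
  rw [h.norm_add_mul_zeta ha hb] at hx1 ⊢
  exact max_le (h.unif.2.2.2 a ha ((le_max_left _ _).trans_lt hx1))
    (h.unif.2.2.2 b hb ((le_max_right _ _).trans_lt hx1))

theorem div_unif_mem (h : UnramData p q F ϖ ζ) {x : C} (hx : x ∈ adj F ζ) (hx1 : ‖x‖ < 1) :
    x / ϖ ∈ ringO F ζ := by
  refine ⟨Subfield.div_mem _ hx (mem_adj_of_mem h.unif.1), ?_⟩
  rw [norm_div]
  exact div_le_one_of_le₀ (h.norm_le_of_lt_one hx hx1) (norm_nonneg _)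

theorem div_unif_pow_mem (h : UnramData p q F ϖ ζ) {x : C} {j : ℕ} (hx : x ∈ adj F ζ)
    (hx1 : ‖x‖ ≤ ‖ϖ‖ ^ j) : x / ϖ ^ j ∈ ringO F ζ := by
  refine ⟨Subfield.div_mem _ hx (Subfield.pow_mem _ (mem_adj_of_mem h.unif.1) _), ?_⟩
  rw [norm_div, norm_pow]
  exact div_le_one_of_le₀ hx1 (pow_nonneg (norm_nonneg _) _)

end UnramData

theorem unramData {C : Type*} [NormedField C] [IsUltrametricDist C] {p : ℕ} [Fact p.Prime]
    [CharP C p] {F : Subfield C} [LocallyCompactSpace F] {ϖ : C} (hϖ : IsUniformizer F ϖ) {q : ℕ}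
    (hq : q = Nat.card (Residue F)) {ζ : C} (hζ : ζ ^ q ^ 2 = ζ) (hζF : ζ ∉ F) :
    UnramData p q F ϖ ζ where
  prime := Fact.out
  char := inferInstance
  pow := by rw [hq]; exact card_residue_eq_pow hϖ
  unif := hϖ
  mem x hx := by rw [hq] at hx; exact mem_of_pow_card_eq (p := p) hϖ hx
  near a ha ha1 := by rw [hq]; exact exists_fixed_near (p := p) hϖ ha ha1
  zeta := hζ
  zeta_not_mem := hζF

namespace UnramData

variable {C : Type*} [NormedField C] [IsUltrametricDist C] {p q : ℕ} {F : Subfield C} {ϖ ζ : C}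

/-! ### Digits -/

section Digits

theorem teich_eq (h : UnramData p q F ϖ ζ) {a t : C} (ht : t ^ q ^ 2 = t) (hat : ‖a - t‖ < 1) :
    teich q a = t := by
  have hex : ∃ t : C, t ^ q ^ 2 = t ∧ ‖a - t‖ < 1 := ⟨t, ht, hat⟩
  rw [teich, dif_pos hex]
  refine h.eq_of_norm_lt hex.choose_spec.1 ht ?_
  have := norm_sub_lt_of_lt' hat hex.choose_spec.2
  rwa [sub_sub_sub_cancel_left] at this

theorem teich_spec (h : UnramData p q F ϖ ζ) {a : C} (ha : a ∈ ringO F ζ) :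
    teich q a ^ q ^ 2 = teich q a ∧ ‖a - teich q a‖ < 1 := by
  obtain ⟨t, ht, hat⟩ := h.exists_fixed_near' ha
  rw [h.teich_eq ht hat]
  exact ⟨ht, hat⟩

theorem fixed_add (h : UnramData p q F ϖ ζ) {s t : C} (hs : s ^ q ^ 2 = s) (ht : t ^ q ^ 2 = t) :
    (s + t) ^ q ^ 2 = s + t := by
  rw [h.add_pow, hs, ht]

/-- In characteristic `p` the Teichmüller representatives form a field, so their sum is again one.
Digits therefore add without carries, which makes `[a]_u` additive in `a`. -/
theorem teich_add (h : UnramData p q F ϖ ζ) {a b : C} (ha : a ∈ ringO F ζ) (hb : b ∈ ringO F ζ) :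
    teich q (a + b) = teich q a + teich q b := by
  obtain ⟨h1, h2⟩ := h.teich_spec ha
  obtain ⟨h3, h4⟩ := h.teich_spec hb
  refine h.teich_eq (h.fixed_add h1 h3) ?_
  rw [add_sub_add_comm]
  exact norm_add_lt_of_lt' h2 h4

theorem teich_fixed_mul (h : UnramData p q F ϖ ζ) {a t : C} (ht : t ^ q ^ 2 = t)
    (ha : a ∈ ringO F ζ) : teich q (t * a) = t * teich q a := by
  obtain ⟨h1, h2⟩ := h.teich_spec ha
  refine h.teich_eq (by rw [mul_pow, ht, h1]) ?_
  rw [← mul_sub, norm_mul]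
  exact mul_lt_one_of_nonneg_of_lt_one_right (h.norm_le_one_of_fixed ht) (norm_nonneg _) h2

theorem teich_unif_mul (h : UnramData p q F ϖ ζ) {a : C} (ha : a ∈ ringO F ζ) :
    teich q (ϖ * a) = 0 := by
  refine h.teich_eq (zero_pow (pow_pos (by have := h.two_le_q; omega) 2).ne') ?_
  rw [sub_zero, norm_mul]
  exact mul_lt_one_of_nonneg_of_lt_one_left (norm_nonneg _) h.unif.2.2.1 ha.2

theorem teich_fixed (h : UnramData p q F ϖ ζ) {t : C} (ht : t ^ q ^ 2 = t) : teich q t = t :=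
  h.teich_eq ht (by simp)

theorem tail_mem (h : UnramData p q F ϖ ζ) {a : C} (ha : a ∈ ringO F ζ) :
    (a - teich q a) / ϖ ∈ ringO F ζ := by
  obtain ⟨h1, h2⟩ := h.teich_spec ha
  exact h.div_unif_mem (Subfield.sub_mem _ ha.1 (h.fixed_mem_ringO h1).1) h2

theorem teich_add_tail (h : UnramData p q F ϖ ζ) (a : C) :
    a = teich q a + ϖ * ((a - teich q a) / ϖ) := by
  have := h.unif.2.1
  field_simp
  ring

theorem digit_fixed (h : UnramData p q F ϖ ζ) (i : ℕ) {a : C} (ha : a ∈ ringO F ζ) :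
    digit q ϖ i a ^ q ^ 2 = digit q ϖ i a := by
  induction i generalizing a with
  | zero => exact (h.teich_spec ha).1
  | succ i ih => exact ih (h.tail_mem ha)

theorem norm_digit_le (h : UnramData p q F ϖ ζ) (i : ℕ) {a : C} (ha : a ∈ ringO F ζ) :
    ‖digit q ϖ i a‖ ≤ 1 :=
  h.norm_le_one_of_fixed (h.digit_fixed i ha)

theorem teich_of_mem (h : UnramData p q F ϖ ζ) {a : C} (ha : a ∈ F) (ha1 : ‖a‖ ≤ 1) :
    teich q a ∈ F ∧ teich q a ^ q = teich q a := by
  obtain ⟨t, htF, ht, hat⟩ := h.near a ha ha1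
  rw [h.teich_eq (pow_sq_of_pow ht) hat]
  exact ⟨htF, ht⟩

theorem digit_pow_of_mem (h : UnramData p q F ϖ ζ) (i : ℕ) {a : C} (ha : a ∈ F) (ha1 : ‖a‖ ≤ 1) :
    digit q ϖ i a ^ q = digit q ϖ i a := by
  induction i generalizing a with
  | zero => exact (h.teich_of_mem ha ha1).2
  | succ i ih =>
    exact ih (F.div_mem (F.sub_mem ha (h.teich_of_mem ha ha1).1) h.unif.1)
      (h.tail_mem (mem_ringO_of_mem ha ha1)).2

theorem digit_add (h : UnramData p q F ϖ ζ) (i : ℕ) {a b : C} (ha : a ∈ ringO F ζ)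
    (hb : b ∈ ringO F ζ) : digit q ϖ i (a + b) = digit q ϖ i a + digit q ϖ i b := by
  induction i generalizing a b with
  | zero => exact h.teich_add ha hb
  | succ i ih =>
    rw [digit, digit, digit, ← ih (h.tail_mem ha) (h.tail_mem hb), h.teich_add ha hb]
    congr 1
    ring

theorem digit_fixed_mul (h : UnramData p q F ϖ ζ) (i : ℕ) {a t : C} (ht : t ^ q ^ 2 = t)
    (ha : a ∈ ringO F ζ) : digit q ϖ i (t * a) = t * digit q ϖ i a := by
  induction i generalizing a with
  | zero => exact h.teich_fixed_mul ht ha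
  | succ i ih =>
    rw [digit, digit, ← ih (h.tail_mem ha), h.teich_fixed_mul ht ha]
    congr 1
    ring

theorem digit_succ_unif_mul (h : UnramData p q F ϖ ζ) (i : ℕ) {a : C} (ha : a ∈ ringO F ζ) :
    digit q ϖ (i + 1) (ϖ * a) = digit q ϖ i a := by
  rw [digit, h.teich_unif_mul ha, sub_zero, mul_div_cancel_left₀ _ h.unif.2.1]

theorem unif_pow_mul_mem (h : UnramData p q F ϖ ζ) (j : ℕ) {a : C} (ha : a ∈ ringO F ζ) :
    ϖ ^ j * a ∈ ringO F ζ :=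
  Subring.mul_mem _ (Subring.pow_mem _ h.unif_mem_ringO j) ha

theorem digit_unif_pow_mul (h : UnramData p q F ϖ ζ) (i j : ℕ) {a : C} (ha : a ∈ ringO F ζ) :
    digit q ϖ (i + j) (ϖ ^ j * a) = digit q ϖ i a := by
  induction j with
  | zero => simp
  | succ j ih =>
    rw [pow_succ', mul_assoc, ← Nat.add_assoc, h.digit_succ_unif_mul _ (h.unif_pow_mul_mem j ha), ih]

theorem digit_unif_pow_mul_of_lt (h : UnramData p q F ϖ ζ) {i j : ℕ} (hij : i < j) {a : C}
    (ha : a ∈ ringO F ζ) : digit q ϖ i (ϖ ^ j * a) = 0 := by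
  induction i generalizing j with
  | zero =>
    obtain ⟨j', rfl⟩ := Nat.exists_eq_add_of_lt hij
    rw [pow_succ', mul_assoc]
    exact h.teich_unif_mul (h.unif_pow_mul_mem _ ha)
  | succ i ih =>
    obtain ⟨j', rfl⟩ := Nat.exists_eq_add_of_le' (show 1 ≤ j by omega)
    rw [pow_succ', mul_assoc, h.digit_succ_unif_mul _ (h.unif_pow_mul_mem _ ha), ih (by omega)]

theorem digit_eq_zero_of_norm_le (h : UnramData p q F ϖ ζ) {i j : ℕ} (hij : i < j) {a : C}
    (ha : a ∈ adj F ζ) (ha1 : ‖a‖ ≤ ‖ϖ‖ ^ j) : digit q ϖ i a = 0 := by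
  have := h.digit_unif_pow_mul_of_lt hij (h.div_unif_pow_mem ha ha1)
  rwa [mul_div_cancel₀ _ (pow_ne_zero _ h.unif.2.1)] at this

theorem digit_zero_of_fixed (h : UnramData p q F ϖ ζ) {t : C} (ht : t ^ q ^ 2 = t) :
    digit q ϖ 0 t = t := h.teich_fixed ht

theorem digit_succ_of_fixed (h : UnramData p q F ϖ ζ) (i : ℕ) {t : C} (ht : t ^ q ^ 2 = t) :
    digit q ϖ (i + 1) t = 0 := by
  rw [digit, h.teich_fixed ht, sub_self, zero_div]
  have := h.digit_fixed_mul i (t := 0) (a := 1)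
    (zero_pow (pow_pos (by have := h.two_le_q; omega) 2).ne') (Subring.one_mem _)
  rwa [zero_mul, zero_mul] at this

theorem digit_neg (h : UnramData p q F ϖ ζ) (i : ℕ) {a : C} (ha : a ∈ ringO F ζ) :
    digit q ϖ i (-a) = -digit q ϖ i a := by
  have h1 := h.digit_add i (Subring.neg_mem _ ha) ha
  have h2 : digit q ϖ i (0 : C) = 0 := by
    have := h.digit_fixed_mul i (t := 0) (a := 1)
      (zero_pow (pow_pos (by have := h.two_le_q; omega) 2).ne') (Subring.one_mem _)
    rwa [zero_mul, zero_mul] at this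
  rw [neg_add_cancel, h2] at h1
  exact eq_neg_of_add_eq_zero_left h1.symm

theorem teich_eq_zero_iff (h : UnramData p q F ϖ ζ) {a : C} (ha : a ∈ ringO F ζ) :
    teich q a = 0 ↔ ‖a‖ < 1 := by
  obtain ⟨h1, h2⟩ := h.teich_spec ha
  constructor
  · intro h0
    rwa [h0, sub_zero] at h2
  · intro h0
    exact h.teich_eq (zero_pow (pow_pos (by have := h.two_le_q; omega) 2).ne') (by rwa [sub_zero])

end Digits

/-! ### The universal module on torsion points -/

section Smul

variable {u : C}

theorem mulUnif_add (h : UnramData p q F ϖ ζ) (x y : C) :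
    mulUnif q ϖ u (x + y) = mulUnif q ϖ u x + mulUnif q ϖ u y := by
  rw [mulUnif, mulUnif, mulUnif, h.add_pow, h.add_pow_q]; ring

theorem iter_mulUnif_zero (h : UnramData p q F ϖ ζ) (j : ℕ) : (mulUnif q ϖ u)^[j] 0 = 0 :=
  Function.iterate_fixed (mulUnif_zero q (by have := h.two_le_q; omega) _ _) j

theorem iter_mulUnif_zero' (h : UnramData p q F ϖ ζ) {j n : ℕ} (hj : n ≤ j) {x : C}
    (hx : (mulUnif q ϖ u)^[n] x = 0) : (mulUnif q ϖ u)^[j] x = 0 := by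
  obtain ⟨i, rfl⟩ := Nat.exists_eq_add_of_le' hj
  rw [Function.iterate_add_apply, hx, h.iter_mulUnif_zero]

theorem iter_mulUnif_add (h : UnramData p q F ϖ ζ) (j : ℕ) (x y : C) :
    (mulUnif q ϖ u)^[j] (x + y) = (mulUnif q ϖ u)^[j] x + (mulUnif q ϖ u)^[j] y := by
  induction j generalizing x y with
  | zero => rfl
  | succ j ih => rw [Function.iterate_succ_apply, h.mulUnif_add, ih]; rfl

theorem iter_mulUnif_sum (h : UnramData p q F ϖ ζ) (j : ℕ) {ι : Type*} (s : Finset ι) (f : ι → C) :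
    (mulUnif q ϖ u)^[j] (∑ i ∈ s, f i) = ∑ i ∈ s, (mulUnif q ϖ u)^[j] (f i) := by
  classical
  induction s using Finset.induction_on with
  | empty => simpa using h.iter_mulUnif_zero j
  | insert a s ha ih => rw [Finset.sum_insert ha, Finset.sum_insert ha, h.iter_mulUnif_add, ih]

/-- The constants that commute with `[ϖ]_u`. -/
def IsConst (q : ℕ) (u t : C) : Prop := t ^ q = t ∨ (u = 0 ∧ t ^ q ^ 2 = t)

theorem mulUnif_const_mul {t : C} (ht : IsConst q u t) (x : C) :
    mulUnif q ϖ u (t * x) = t * mulUnif q ϖ u x := by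
  rcases ht with ht | ⟨rfl, ht⟩
  · rw [mulUnif, mulUnif, mul_pow, mul_pow, ht, pow_sq_of_pow ht]; ring
  · rw [mulUnif, mulUnif, mul_pow, ht]; ring

theorem iter_mulUnif_const_mul {t : C} (ht : IsConst q u t) (j : ℕ) (x : C) :
    (mulUnif q ϖ u)^[j] (t * x) = t * (mulUnif q ϖ u)^[j] x := by
  induction j generalizing x with
  | zero => rfl
  | succ j ih => rw [Function.iterate_succ_apply, mulUnif_const_mul ht, ih]; rfl

/-- All digits of `a` commute with `[ϖ]_u`. -/
def IsScalar (q : ℕ) (ϖ u a : C) : Prop := ∀ i, IsConst q u (digit q ϖ i a)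

theorem isScalar_of_mem (h : UnramData p q F ϖ ζ) {a : C} (ha : a ∈ F) (ha1 : ‖a‖ ≤ 1) :
    IsScalar q ϖ u a := fun i => Or.inl (h.digit_pow_of_mem i ha ha1)

theorem isScalar_zero (h : UnramData p q F ϖ ζ) {a : C} (ha : a ∈ ringO F ζ) :
    IsScalar q ϖ 0 a := fun i => Or.inr ⟨rfl, h.digit_fixed i ha⟩

variable {n : ℕ} {x y : C}

/-- On `ϖ^n`-torsion the terms with `i ≥ n` vanish, so no question of convergence arises. -/
theorem smul_eq_sum (h : UnramData p q F ϖ ζ) (hx : (mulUnif q ϖ u)^[n] x = 0) (a : C) :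
    smul q ϖ u a x = ∑ i ∈ Finset.range n, digit q ϖ i a * (mulUnif q ϖ u)^[i] x := by
  refine tsum_eq_sum fun i hi => ?_
  rw [h.iter_mulUnif_zero' (by simpa using hi) hx, mul_zero]

theorem smul_add (h : UnramData p q F ϖ ζ) (hx : (mulUnif q ϖ u)^[n] x = 0)
    (hy : (mulUnif q ϖ u)^[n] y = 0) (a : C) :
    smul q ϖ u a (x + y) = smul q ϖ u a x + smul q ϖ u a y := by
  rw [h.smul_eq_sum hx, h.smul_eq_sum hy,
    h.smul_eq_sum (by rw [h.iter_mulUnif_add, hx, hy, add_zero]), ← Finset.sum_add_distrib]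
  exact Finset.sum_congr rfl fun i _ => by rw [h.iter_mulUnif_add]; ring

theorem add_smul (h : UnramData p q F ϖ ζ) (hx : (mulUnif q ϖ u)^[n] x = 0) {a b : C}
    (ha : a ∈ ringO F ζ) (hb : b ∈ ringO F ζ) :
    smul q ϖ u (a + b) x = smul q ϖ u a x + smul q ϖ u b x := by
  rw [h.smul_eq_sum hx, h.smul_eq_sum hx, h.smul_eq_sum hx, ← Finset.sum_add_distrib]
  exact Finset.sum_congr rfl fun i _ => by rw [h.digit_add i ha hb]; ring

theorem neg_smul (h : UnramData p q F ϖ ζ) (hx : (mulUnif q ϖ u)^[n] x = 0) {a : C}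
    (ha : a ∈ ringO F ζ) : smul q ϖ u (-a) x = -smul q ϖ u a x := by
  rw [h.smul_eq_sum hx, h.smul_eq_sum hx, ← Finset.sum_neg_distrib]
  exact Finset.sum_congr rfl fun i _ => by rw [h.digit_neg i ha]; ring

theorem fixed_mul_smul (h : UnramData p q F ϖ ζ) (hx : (mulUnif q ϖ u)^[n] x = 0) {a t : C}
    (ht : t ^ q ^ 2 = t) (ha : a ∈ ringO F ζ) :
    smul q ϖ u (t * a) x = t * smul q ϖ u a x := by
  rw [h.smul_eq_sum hx, h.smul_eq_sum hx, Finset.mul_sum]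
  exact Finset.sum_congr rfl fun i _ => by rw [h.digit_fixed_mul i ht ha]; ring

theorem unif_mul_smul (h : UnramData p q F ϖ ζ) (hx : (mulUnif q ϖ u)^[n] x = 0) {a : C}
    (ha : a ∈ ringO F ζ) : smul q ϖ u (ϖ * a) x = smul q ϖ u a (mulUnif q ϖ u x) := by
  have hx' : (mulUnif q ϖ u)^[n + 1] x = 0 := h.iter_mulUnif_zero' (Nat.le_succ n) hx
  rw [h.smul_eq_sum hx', h.smul_eq_sum (x := mulUnif q ϖ u x) (n := n) hx', Finset.sum_range_succ']
  have h0 : digit q ϖ 0 (ϖ * a) = 0 := h.teich_unif_mul ha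
  rw [h0, zero_mul, add_zero]
  exact Finset.sum_congr rfl fun i _ => by rw [h.digit_succ_unif_mul i ha]; rfl

theorem unif_pow_mul_smul (h : UnramData p q F ϖ ζ) (hx : (mulUnif q ϖ u)^[n] x = 0) (j : ℕ) {a : C}
    (ha : a ∈ ringO F ζ) : smul q ϖ u (ϖ ^ j * a) x = smul q ϖ u a ((mulUnif q ϖ u)^[j] x) := by
  induction j generalizing x with
  | zero => simp
  | succ j ih =>
    rw [pow_succ', mul_assoc, h.unif_mul_smul hx (h.unif_pow_mul_mem j ha), ih]
    · rfl
    · exact h.iter_mulUnif_zero' (Nat.le_succ n) hx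

theorem fixed_smul (h : UnramData p q F ϖ ζ) (hx : (mulUnif q ϖ u)^[n] x = 0) {t : C}
    (ht : t ^ q ^ 2 = t) : smul q ϖ u t x = t * x := by
  rw [h.smul_eq_sum (h.iter_mulUnif_zero' (Nat.le_succ n) hx), Finset.sum_range_succ',
    h.digit_zero_of_fixed ht, Finset.sum_eq_zero fun i _ => by
      rw [h.digit_succ_of_fixed i ht, zero_mul]]
  simp

theorem one_smul (h : UnramData p q F ϖ ζ) (hx : (mulUnif q ϖ u)^[n] x = 0) :
    smul q ϖ u 1 x = x := by
  rw [h.fixed_smul hx (one_pow _), one_mul]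

theorem zero_smul (h : UnramData p q F ϖ ζ) (hx : (mulUnif q ϖ u)^[n] x = 0) :
    smul q ϖ u 0 x = 0 := by
  rw [h.fixed_smul hx (zero_pow (pow_pos (by have := h.two_le_q; omega) 2).ne'), zero_mul]

theorem smul_eq_teich_add (h : UnramData p q F ϖ ζ) (hx : (mulUnif q ϖ u)^[n] x = 0) {a : C}
    (ha : a ∈ ringO F ζ) : smul q ϖ u a x
      = teich q a * x + smul q ϖ u ((a - teich q a) / ϖ) (mulUnif q ϖ u x) := by
  have h1 := (h.teich_spec ha).1
  conv_lhs => rw [h.teich_add_tail a]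
  rw [h.add_smul hx (h.fixed_mem_ringO h1)
    (Subring.mul_mem _ h.unif_mem_ringO (h.tail_mem ha)), h.fixed_smul hx h1,
    h.unif_mul_smul hx (h.tail_mem ha)]

theorem iter_smul (h : UnramData p q F ϖ ζ) (hx : (mulUnif q ϖ u)^[n] x = 0) {a : C}
    (ha : IsScalar q ϖ u a) (j : ℕ) :
    (mulUnif q ϖ u)^[j] (smul q ϖ u a x) = smul q ϖ u a ((mulUnif q ϖ u)^[j] x) := by
  have hx' : (mulUnif q ϖ u)^[n] ((mulUnif q ϖ u)^[j] x) = 0 := by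
    rw [← Function.iterate_add_apply]
    exact h.iter_mulUnif_zero' (Nat.le_add_right _ _) hx
  rw [h.smul_eq_sum hx, h.smul_eq_sum hx', h.iter_mulUnif_sum]
  refine Finset.sum_congr rfl fun i _ => ?_
  rw [iter_mulUnif_const_mul (ha i), ← Function.iterate_add_apply, ← Function.iterate_add_apply,
    Nat.add_comm]

theorem smul_torsion (h : UnramData p q F ϖ ζ) (hx : (mulUnif q ϖ u)^[n] x = 0) {a : C}
    (ha : IsScalar q ϖ u a) : (mulUnif q ϖ u)^[n] (smul q ϖ u a x) = 0 := by
  rw [h.iter_smul hx ha, hx, h.smul_eq_sum (n := 0) rfl]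
  simp

/-- Induction on the torsion level, splitting off the leading digit of `a`. Only the digits of `b`
have to commute with `[ϖ]_u`, since only they are moved past it. -/
theorem mul_smul (h : UnramData p q F ϖ ζ) (hx : (mulUnif q ϖ u)^[n] x = 0) {a b : C}
    (ha : a ∈ ringO F ζ) (hb : b ∈ ringO F ζ) (hbs : IsScalar q ϖ u b) :
    smul q ϖ u (a * b) x = smul q ϖ u a (smul q ϖ u b x) := by
  induction n generalizing x a with
  | zero =>
    have hx0 : (mulUnif q ϖ u)^[0] x = 0 := hx
    have hx' : x = 0 := hx
    subst hx'
    simp [h.smul_eq_sum hx0]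
  | succ n ih =>
    have ht := (h.teich_spec ha).1
    have hta := h.tail_mem ha
    have hbx := h.smul_torsion hx hbs
    have e : a * b = teich q a * b + ϖ * ((a - teich q a) / ϖ * b) := by
      conv_lhs => rw [h.teich_add_tail a]
      ring
    have hx1 : (mulUnif q ϖ u)^[n] (mulUnif q ϖ u x) = 0 := hx
    have h1 : mulUnif q ϖ u (smul q ϖ u b x) = smul q ϖ u b (mulUnif q ϖ u x) :=
      h.iter_smul hx hbs 1
    rw [h.smul_eq_teich_add hbx ha, e,
      h.add_smul hx (Subring.mul_mem _ (h.fixed_mem_ringO ht) hb)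
        (Subring.mul_mem _ h.unif_mem_ringO (Subring.mul_mem _ hta hb)),
      h.fixed_mul_smul hx ht hb, h.unif_mul_smul hx (Subring.mul_mem _ hta hb), ih hx1 hta, h1]

end Smul

end UnramData

/-! ### Dependence of the affinoid on the torsion point -/

section Affinoids

variable {C : Type*} [NormedField C] [IsUltrametricDist C] {p q n : ℕ} {ϖ ζ w w' : C}

namespace LTData

theorem norm_torsionPt_one_eq (h : LTData p q n ϖ ζ w) (h' : LTData p q n ϖ ζ w') :
    ‖torsionPt q n ϖ w 1‖ = ‖torsionPt q n ϖ w' 1‖ := by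
  rw [← h.norm_rpow_inv, ← h'.norm_rpow_inv]

theorem norm_scaleS_eq (h : LTData p q n ϖ ζ w) (h' : LTData p q n ϖ ζ w') :
    ‖scaleS q n ϖ w‖ = ‖scaleS q n ϖ w'‖ := by
  rw [← h.norm_rpow_scaleS, ← h'.norm_rpow_scaleS]

theorem norm_scaleU_eq (h : LTData p q n ϖ ζ w) (h' : LTData p q n ϖ ζ w') :
    ‖scaleU q n ϖ w‖ = ‖scaleU q n ϖ w'‖ := by
  rw [← h.norm_rpow_scaleU, ← h'.norm_rpow_scaleU]

/-- In diagonal coordinates the torsion point enters only through the centre of the disc of `A`; all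
radii depend on `‖ϖ‖` alone, and in an ultrametric disc any point is a centre. -/
theorem affinoid_subset (h : LTData p q n ϖ ζ w) (h' : LTData p q n ϖ ζ w')
    (hd : ‖w - w'‖ ≤ ‖torsionPt q n ϖ w 1‖) : affinoid q n ϖ ζ w ⊆ affinoid q n ϖ ζ w' := by
  intro P hP
  obtain ⟨u, z, rfl, hu, hA, hB, hz⟩ := h.mem_affinoid_iff.mp hP
  refine h'.mem_affinoid_iff.mpr ⟨u, z, rfl, ?_, ?_, ?_, hz⟩
  · rwa [← h.norm_scaleU_eq h']
  · rw [← h.norm_torsionPt_one_eq h', ← sub_add_sub_cancel z.1 w w']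
    exact norm_add_le_of_le' hA hd
  · rwa [← h.norm_scaleS_eq h']

theorem affinoid_eq (h : LTData p q n ϖ ζ w) (h' : LTData p q n ϖ ζ w')
    (hd : ‖w - w'‖ ≤ ‖torsionPt q n ϖ w 1‖) : affinoid q n ϖ ζ w = affinoid q n ϖ ζ w' := by
  refine (h.affinoid_subset h' hd).antisymm (h'.affinoid_subset h ?_)
  rwa [norm_sub_rev, ← h.norm_torsionPt_one_eq h']

theorem norm_sub_le_of_mem (h : LTData p q n ϖ ζ w) {P : Fin 3 → C}
    (hP : P ∈ affinoid q n ϖ ζ w) (hP' : P ∈ affinoid q n ϖ ζ w') :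
    ‖w - w'‖ ≤ ‖torsionPt q n ϖ w 1‖ := by
  have h1 := hP.2.2.2
  have h2 := hP'.2.2.2
  rw [h.norm_rpow_inv] at h1 h2
  have h3 := norm_sub_le_of_le' h2 h1
  have e : ζ ^ q * (P 1 - w') - (P 2 - ζ * w') - (ζ ^ q * (P 1 - w) - (P 2 - ζ * w))
      = (ζ ^ q - ζ) * (w - w') := by ring
  rwa [e, norm_mul, h.norm_zeta_sub, one_mul] at h3

/-- The point with complex multiplication. -/
theorem affinoid_nonempty (h : LTData p q n ϖ ζ w) : (affinoid q n ϖ ζ w).Nonempty := by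
  refine ⟨_, h.mem_affinoid_iff.mpr ⟨0, (w, 0), rfl, by simp, by simp, by simp, ?_⟩⟩
  have hw := h.tors
  have h0 : (mulUnif q ϖ 0) = lin q ϖ := funext fun x => mulUnif_zero_eq_lin q ϖ x
  rw [h0] at hw
  refine Prod.ext ?_ ?_
  · rw [h.fst_iter]
    simp [hw, h.iter_zero]
  · rw [h.snd_iter]
    simp [h.iter_zero]

end LTData

end Affinoids

namespace UnramData

variable {C : Type*} [NormedField C] [IsUltrametricDist C] {p q n : ℕ} {F : Subfield C}
  {ϖ ζ w w' : C}

theorem ltData (h : UnramData p q F ϖ ζ) (hn : 2 ≤ n) (hw : w ∈ primTorsion q n ϖ) :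
    LTData p q n ϖ ζ w where
  prime := h.prime
  char := h.char
  pow := h.pow
  two_le := hn
  ne := h.unif.2.1
  lt := h.unif.2.2.1
  zeta := h.zeta
  zeta_ne := h.zeta_ne
  tors := hw.1
  prim := hw.2

/-! ### Torsion points as a module over the quadratic unramified ring -/

section Torsion

theorem iter_torsionPt {i j : ℕ} (hi : i ≤ j) (hj : j ≤ n) :
    (mulUnif q ϖ 0)^[j - i] (torsionPt q n ϖ w j) = torsionPt q n ϖ w i := by
  rw [torsionPt, torsionPt, ← Function.iterate_add_apply]
  congr 2
  omega

theorem torsionPt_torsion (hw : w ∈ primTorsion q n ϖ) {j : ℕ} (hj : j ≤ n) :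
    (mulUnif q ϖ 0)^[j] (torsionPt q n ϖ w j) = 0 := by
  rw [torsionPt, ← Function.iterate_add_apply, Nat.add_sub_cancel' hj]
  exact hw.1

/-- Induction on the level: a multiple of the generator with the correct image under `[ϖ]` differs
from `x` by `ϖ`-torsion, and the `ϖ`-torsion consists of the multiples of `ϖ_1` by elements fixed
under the `q²`-power map. -/
theorem exists_smul_of_torsion (h : UnramData p q F ϖ ζ) (hn : 2 ≤ n)
    (hw : w ∈ primTorsion q n ϖ) {j : ℕ} (hj : j ≤ n) {x : C} (hx : (mulUnif q ϖ 0)^[j] x = 0) :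
    ∃ a ∈ ringO F ζ, x = smul q ϖ 0 a (torsionPt q n ϖ w j) := by
  have hL := h.ltData hn hw
  induction j generalizing x with
  | zero =>
    have hx' : x = 0 := hx
    exact ⟨0, Subring.zero_mem _, by rw [h.zero_smul (torsionPt_torsion hw hj), hx']⟩
  | succ j ih =>
    obtain ⟨a, ha, hax⟩ := ih (by omega) (x := mulUnif q ϖ 0 x) hx
    have hT := torsionPt_torsion hw hj
    have h1 : mulUnif q ϖ 0 (smul q ϖ 0 a (torsionPt q n ϖ w (j + 1))) = mulUnif q ϖ 0 x := by
      rw [hax]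
      refine (h.iter_smul hT (h.isScalar_zero ha) 1).trans ?_
      congr 1
      have := iter_torsionPt (q := q) (ϖ := ϖ) (w := w) (Nat.le_succ j) hj
      rwa [Nat.succ_eq_add_one, Nat.add_sub_cancel_left] at this
    set y := x - smul q ϖ 0 a (torsionPt q n ϖ w (j + 1)) with hy
    have hxy : x = y + smul q ϖ 0 a (torsionPt q n ϖ w (j + 1)) := by rw [hy]; ring
    have hy0 : mulUnif q ϖ 0 y = 0 := by
      have := h.mulUnif_add (u := 0) y (smul q ϖ 0 a (torsionPt q n ϖ w (j + 1)))
      rw [← hxy, h1] at this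
      exact right_eq_add.mp this
    set t := y / torsionPt q n ϖ w 1 with ht
    have hτ := hL.torsionPt_one_ne
    have htf : t ^ q ^ 2 = t := by
      rw [mulUnif_zero_eq_lin, lin, smul_eq_mul] at hy0
      rw [ht, div_pow, hL.torsionPt_one_pow, eq_neg_of_add_eq_zero_left hy0, neg_div_neg_eq,
        mul_div_mul_left _ _ hL.ne]
    have hyt : y = t * torsionPt q n ϖ w 1 := (div_mul_cancel₀ y hτ).symm
    have htm := h.fixed_mem_ringO htf
    refine ⟨ϖ ^ j * t + a, Subring.add_mem _ (h.unif_pow_mul_mem j htm) ha, ?_⟩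
    rw [h.add_smul hT (h.unif_pow_mul_mem j htm) ha, h.unif_pow_mul_smul hT j htm, hxy, hyt]
    congr 1
    have e := iter_torsionPt (q := q) (ϖ := ϖ) (w := w) (i := 1) (Nat.le_add_left 1 j) hj
    rw [Nat.add_sub_cancel] at e
    rw [e, h.fixed_smul (n := 1) (torsionPt_torsion hw (by omega)) htf]

theorem iter_pred_smul (h : UnramData p q F ϖ ζ) (hn : 2 ≤ n) (hw : w ∈ primTorsion q n ϖ) {a : C}
    (ha : a ∈ ringO F ζ) :
    (mulUnif q ϖ 0)^[n - 1] (smul q ϖ 0 a w) = teich q a * torsionPt q n ϖ w 1 := by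
  rw [h.iter_smul hw.1 (h.isScalar_zero ha)]
  have h1 : (mulUnif q ϖ 0)^[1] (torsionPt q n ϖ w 1) = 0 := torsionPt_torsion hw (by omega)
  have e : (mulUnif q ϖ 0)^[n - 1] w = torsionPt q n ϖ w 1 := rfl
  rw [e, h.smul_eq_sum h1]
  simp [digit]

theorem smul_mem_primTorsion (h : UnramData p q F ϖ ζ) (hn : 2 ≤ n) (hw : w ∈ primTorsion q n ϖ)
    {a : C} (ha : a ∈ adj F ζ) (ha1 : ‖a‖ = 1) : smul q ϖ 0 a w ∈ primTorsion q n ϖ := by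
  have haO : a ∈ ringO F ζ := ⟨ha, ha1.le⟩
  refine ⟨h.smul_torsion hw.1 (h.isScalar_zero haO), ?_⟩
  rw [h.iter_pred_smul hn hw haO]
  refine mul_ne_zero (fun h0 => ?_) hw.2
  exact ((h.teich_eq_zero_iff haO).mp h0).ne ha1

theorem mem_primTorsion_iff (h : UnramData p q F ϖ ζ) (hn : 2 ≤ n) (hw : w ∈ primTorsion q n ϖ) :
    w' ∈ primTorsion q n ϖ ↔ ∃ a ∈ adj F ζ, ‖a‖ = 1 ∧ w' = smul q ϖ 0 a w := by
  constructor
  · intro hw'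
    obtain ⟨a, ha, e⟩ := h.exists_smul_of_torsion hn hw le_rfl hw'.1
    rw [LTData.torsionPt_self] at e
    refine ⟨a, ha.1, le_antisymm ha.2 (not_lt.mp fun hlt => hw'.2 ?_), e⟩
    rw [e, h.iter_pred_smul hn hw ha, (h.teich_eq_zero_iff ha).mpr hlt, zero_mul]
  · rintro ⟨a, ha, ha1, rfl⟩
    exact h.smul_mem_primTorsion hn hw ha ha1

theorem norm_smul_torsionPt_le (h : UnramData p q F ϖ ζ) (hn : 2 ≤ n) (hw : w ∈ primTorsion q n ϖ)
    {a : C} (ha : a ∈ ringO F ζ) {j : ℕ} (hj : j ≤ n) :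
    ‖smul q ϖ 0 a (torsionPt q n ϖ w j)‖ ≤ ‖torsionPt q n ϖ w j‖ := by
  have hL := h.ltData hn hw
  rw [h.smul_eq_sum (torsionPt_torsion hw hj)]
  refine IsUltrametricDist.norm_sum_le_of_forall_le_of_nonneg (norm_nonneg _) fun i hi => ?_
  have hi' := Finset.mem_range.mp hi
  have e := iter_torsionPt (q := q) (ϖ := ϖ) (w := w) (show j - i ≤ j by omega) hj
  rw [show j - (j - i) = i by omega] at e
  rw [e, norm_mul]
  exact (mul_le_of_le_one_left (norm_nonneg _) (h.norm_digit_le i ha)).trans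
    (hL.torsionPt_mono (by omega) hj)

/-- If the first nonzero digit of `a` among the first `n` has index `j`, then `[a] ϖ_n` has the norm
of `ϖ_{n-j}`, because the norms increase strictly along the tower. This is at most `‖ϖ_1‖` exactly
when `j = n - 1`; if all these digits vanish, so does `[a] ϖ_n`. -/
theorem norm_smul_le_iff (h : UnramData p q F ϖ ζ) (hn : 2 ≤ n) (hw : w ∈ primTorsion q n ϖ)
    {a : C} (ha : a ∈ ringO F ζ) :
    ‖smul q ϖ 0 a w‖ ≤ ‖torsionPt q n ϖ w 1‖ ↔ ‖a‖ ≤ ‖ϖ‖ ^ (n - 1) := by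
  have hL := h.ltData hn hw
  constructor
  · intro hle
    have key : ∀ j ≤ n - 1, ‖a‖ ≤ ‖ϖ‖ ^ j := fun j => by
      induction j with
      | zero => intro; simpa using ha.2
      | succ j ih =>
        intro hj
        have haj := ih (by omega)
        set b := a / ϖ ^ j with hb
        have hbm : b ∈ ringO F ζ := h.div_unif_pow_mem ha.1 haj
        have hab : a = ϖ ^ j * b := (mul_div_cancel₀ _ (pow_ne_zero _ h.unif.2.1)).symm
        suffices ‖b‖ < 1 by
          rw [hab, norm_mul, norm_pow, pow_succ]
          exact mul_le_mul_of_nonneg_left (h.norm_le_of_lt_one hbm.1 this) (by positivity)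
        by_contra hb1
        have ht : teich q b ≠ 0 := fun h0 => hb1 ((h.teich_eq_zero_iff hbm).mp h0)
        have ht1 : ‖teich q b‖ = 1 :=
          (norm_eq_zero_or_one_of_pow_eq_self (N := q ^ 2)
            (by have := h.two_le_q; nlinarith) (h.teich_spec hbm).1).resolve_left ht
        -- Since `j + 1 ≤ n - 1`, the relevant torsion point lies at level at least two, strictly
        -- above `ϖ_1` in norm.
        obtain ⟨r, hr⟩ : ∃ r, n - j = r + 2 := ⟨n - j - 2, by omega⟩
        have e1 : (mulUnif q ϖ 0)^[j] w = torsionPt q n ϖ w (r + 2) := by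
          rw [torsionPt]; congr 2; omega
        have e2 : mulUnif q ϖ 0 (torsionPt q n ϖ w (r + 2)) = torsionPt q n ϖ w (r + 1) := by
          have := iter_torsionPt (q := q) (ϖ := ϖ) (w := w) (Nat.le_succ (r + 1))
            (show r + 1 + 1 ≤ n by omega)
          rwa [Nat.succ_eq_add_one, Nat.add_sub_cancel_left] at this
        have e3 : smul q ϖ 0 a w = teich q b * torsionPt q n ϖ w (r + 2)
            + smul q ϖ 0 ((b - teich q b) / ϖ) (torsionPt q n ϖ w (r + 1)) := by
          rw [hab, h.unif_pow_mul_smul hw.1 j hbm, e1,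
            h.smul_eq_teich_add (torsionPt_torsion hw (by omega)) hbm, e2]
        have h1 := h.norm_smul_torsionPt_le hn hw (h.tail_mem hbm) (show r + 1 ≤ n by omega)
        have h2 := hL.torsionPt_lt_succ (show r + 1 + 1 ≤ n by omega)
        have h3 : ‖smul q ϖ 0 a w‖ = ‖torsionPt q n ϖ w (r + 2)‖ := by
          rw [← one_mul ‖torsionPt q n ϖ w (r + 2)‖, ← ht1, ← norm_mul]
          refine norm_eq_of_sub_lt ?_
          rw [e3, add_sub_cancel_left, norm_mul, ht1, one_mul]
          exact h1.trans_lt h2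
        have h4 := hL.torsionPt_mono (show 1 ≤ r + 1 by omega) (by omega)
        exact absurd (h3.symm.trans_le hle) (not_le.mpr (h4.trans_lt h2))
    exact key _ le_rfl
  · intro hle
    have hbm := h.div_unif_pow_mem ha.1 hle
    have hab : a = ϖ ^ (n - 1) * (a / ϖ ^ (n - 1)) :=
      (mul_div_cancel₀ _ (pow_ne_zero _ h.unif.2.1)).symm
    rw [hab, h.unif_pow_mul_smul hw.1 _ hbm]
    exact h.norm_smul_torsionPt_le hn hw hbm (j := 1) (by omega)

theorem norm_smul_sub_le_iff (h : UnramData p q F ϖ ζ) (hn : 2 ≤ n) (hw : w ∈ primTorsion q n ϖ)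
    {a b : C} (ha : a ∈ ringO F ζ) (hb : b ∈ ringO F ζ) :
    ‖smul q ϖ 0 a w - smul q ϖ 0 b w‖ ≤ ‖torsionPt q n ϖ w 1‖ ↔ ‖a - b‖ ≤ ‖ϖ‖ ^ (n - 1) := by
  rw [← h.norm_smul_le_iff hn hw (Subring.sub_mem _ ha hb), sub_eq_add_neg a,
    h.add_smul hw.1 ha (Subring.neg_mem _ hb), h.neg_smul hw.1 hb, ← sub_eq_add_neg]

end Torsion

/-! ### The index set -/

section Index

theorem mem_index (a : unitFilt (adj F ζ) ϖ 0) :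
    (((a : (adj F ζ)ˣ) : adj F ζ) : C) ∈ adj F ζ ∧ ‖(((a : (adj F ζ)ˣ) : adj F ζ) : C)‖ = 1 :=
  ⟨((a : (adj F ζ)ˣ) : adj F ζ).2, a.2.1⟩

/-- An element of norm one of the quadratic unramified extension as an element of the unit group. -/
def mkUnit (F : Subfield C) (ϖ ζ : C) (a : C) (ha : a ∈ adj F ζ) (ha1 : ‖a‖ = 1) :
    unitFilt (adj F ζ) ϖ 0 :=
  ⟨Units.mk0 ⟨a, ha⟩ fun h0 => by
    have : a = 0 := congrArg Subtype.val h0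
    simp [this] at ha1, ha1, by
    rw [pow_zero]
    exact norm_sub_le_of_le' (ha1 : ‖a‖ = 1).le norm_one.le⟩

theorem coe_mkUnit {a : C} (ha : a ∈ adj F ζ) (ha1 : ‖a‖ = 1) :
    (((mkUnit F ϖ ζ a ha ha1 : (adj F ζ)ˣ) : adj F ζ) : C) = a := rfl

theorem index_eq_iff (a b : unitFilt (adj F ζ) ϖ 0) :
    (a : IndexSet (adj F ζ) ϖ n) = b ↔
      ‖(((a : (adj F ζ)ˣ) : adj F ζ) : C) - (((b : (adj F ζ)ˣ) : adj F ζ) : C)‖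
        ≤ ‖ϖ‖ ^ (n - 1) := by
  rw [QuotientGroup.eq, Subgroup.mem_subgroupOf]
  have e : ((((a⁻¹ * b : unitFilt (adj F ζ) ϖ 0) : (adj F ζ)ˣ) : adj F ζ) : C)
      = (((a : (adj F ζ)ˣ) : adj F ζ) : C)⁻¹ * (((b : (adj F ζ)ˣ) : adj F ζ) : C) := by
    simp
  have hm : ∀ x : unitFilt (adj F ζ) ϖ 0, (x : (adj F ζ)ˣ) ∈ unitFilt (adj F ζ) ϖ (n - 1) ↔
      ‖(((x : (adj F ζ)ˣ) : adj F ζ) : C) - 1‖ ≤ ‖ϖ‖ ^ (n - 1) :=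
    fun x => ⟨fun h => h.2, fun h => ⟨x.2.1, h⟩⟩
  rw [hm, e]
  have ha1 := (mem_index a).2
  set x := (((a : (adj F ζ)ˣ) : adj F ζ) : C)
  set y := (((b : (adj F ζ)ˣ) : adj F ζ) : C)
  have hx : x ≠ 0 := fun h0 => by simp [h0] at ha1
  have : x⁻¹ * y - 1 = -(x⁻¹ * (x - y)) := by field_simp; ring
  rw [this, norm_neg, norm_mul, norm_inv, ha1, inv_one, one_mul]

theorem affinoid_smul_eq (h : UnramData p q F ϖ ζ) (hn : 2 ≤ n) (hw : w ∈ primTorsion q n ϖ)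
    {a b : C} (ha : a ∈ adj F ζ) (ha1 : ‖a‖ = 1) (hb : b ∈ adj F ζ) (hb1 : ‖b‖ = 1)
    (hab : ‖a - b‖ ≤ ‖ϖ‖ ^ (n - 1)) :
    affinoid q n ϖ ζ (smul q ϖ 0 a w) = affinoid q n ϖ ζ (smul q ϖ 0 b w) := by
  have hLa := h.ltData hn (h.smul_mem_primTorsion hn hw ha ha1)
  have hLb := h.ltData hn (h.smul_mem_primTorsion hn hw hb hb1)
  refine hLa.affinoid_eq hLb ?_
  rw [hLa.norm_torsionPt_one_eq (h.ltData hn hw),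
    h.norm_smul_sub_le_iff hn hw ⟨ha, ha1.le⟩ ⟨hb, hb1.le⟩]
  exact hab

theorem norm_sub_le_of_affinoid (h : UnramData p q F ϖ ζ) (hn : 2 ≤ n)
    (hw : w ∈ primTorsion q n ϖ)
    {a b : C} (ha : a ∈ adj F ζ) (ha1 : ‖a‖ = 1) (hb : b ∈ adj F ζ) (hb1 : ‖b‖ = 1)
    {P : Fin 3 → C} (hPa : P ∈ affinoid q n ϖ ζ (smul q ϖ 0 a w))
    (hPb : P ∈ affinoid q n ϖ ζ (smul q ϖ 0 b w)) : ‖a - b‖ ≤ ‖ϖ‖ ^ (n - 1) := by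
  have hLa := h.ltData hn (h.smul_mem_primTorsion hn hw ha ha1)
  rw [← h.norm_smul_sub_le_iff hn hw ⟨ha, ha1.le⟩ ⟨hb, hb1.le⟩,
    ← hLa.norm_torsionPt_one_eq (h.ltData hn hw)]
  exact hLa.norm_sub_le_of_mem hPa hPb

/-- The affinoids are indexed by the classes of units. -/
theorem affinoid_index (h : UnramData p q F ϖ ζ) (hn : 2 ≤ n) (hw : w ∈ primTorsion q n ϖ)
    (a b : unitFilt (adj F ζ) ϖ 0) :
    let Xa := affinoid q n ϖ ζ (smul q ϖ 0 ((a : (adj F ζ)ˣ) : adj F ζ) w)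
    let Xb := affinoid q n ϖ ζ (smul q ϖ 0 ((b : (adj F ζ)ˣ) : adj F ζ) w)
    Xa.Nonempty ∧ ((a : IndexSet (adj F ζ) ϖ n) = b → Xa = Xb) ∧
      ((a : IndexSet (adj F ζ) ϖ n) ≠ b → Disjoint Xa Xb) := by
  obtain ⟨ha, ha1⟩ := mem_index a
  obtain ⟨hb, hb1⟩ := mem_index b
  refine ⟨(h.ltData hn (h.smul_mem_primTorsion hn hw ha ha1)).affinoid_nonempty, fun hab => ?_,
    fun hab => ?_⟩
  · exact h.affinoid_smul_eq hn hw ha ha1 hb hb1 ((index_eq_iff a b).mp hab)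
  · refine Set.disjoint_left.mpr fun P hPa hPb => hab ((index_eq_iff a b).mpr ?_)
    exact h.norm_sub_le_of_affinoid hn hw ha ha1 hb hb1 hPa hPb

theorem mem_primTorsion_iff' (h : UnramData p q F ϖ ζ) (hn : 2 ≤ n)
    (hw : w ∈ primTorsion q n ϖ) : w' ∈ primTorsion q n ϖ ↔
      ∃ a : unitFilt (adj F ζ) ϖ 0, w' = smul q ϖ 0 ((a : (adj F ζ)ˣ) : adj F ζ) w := by
  rw [h.mem_primTorsion_iff hn hw]
  constructor
  · rintro ⟨a, ha, ha1, e⟩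
    exact ⟨mkUnit F ϖ ζ a ha ha1, e⟩
  · rintro ⟨a, e⟩
    exact ⟨_, (mem_index a).1, (mem_index a).2, e⟩

end Index

end UnramData

/-! ### Matrices in coordinates adapted to the quadratic extension -/

section MatrixCoord

variable {k : Type*} [Field k] {ζ ζ' : k}

/-- The linear part of the matrix `M` in the decomposition `(1, ζ) M = α (1, ζ) + β (1, ζ')`. -/
def alphaM (ζ ζ' : k) (M : Matrix (Fin 2) (Fin 2) k) : k :=
  (ζ' - ζ)⁻¹ * (ζ' * (M 0 0 + M 1 0 * ζ) - (M 0 1 + M 1 1 * ζ))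

/-- The semilinear part of the matrix `M` in the decomposition `(1, ζ) M = α (1, ζ) + β (1, ζ')`. -/
def betaM (ζ ζ' : k) (M : Matrix (Fin 2) (Fin 2) k) : k :=
  (ζ' - ζ)⁻¹ * ((M 0 1 + M 1 1 * ζ) - ζ * (M 0 0 + M 1 0 * ζ))

theorem alphaM_add_betaM (hζ : ζ' - ζ ≠ 0) (M : Matrix (Fin 2) (Fin 2) k) :
    alphaM ζ ζ' M + betaM ζ ζ' M = M 0 0 + M 1 0 * ζ := by
  rw [alphaM, betaM]; field_simp; ring

theorem mul_alphaM_add_betaM (hζ : ζ' - ζ ≠ 0) (M : Matrix (Fin 2) (Fin 2) k) :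
    ζ * alphaM ζ ζ' M + ζ' * betaM ζ ζ' M = M 0 1 + M 1 1 * ζ := by
  rw [alphaM, betaM]; field_simp; ring

/-- Follows from `(1, ζ) M N` by expanding with `N` relative to both `(1, ζ)` and `(1, ζ')`; the
exchanged arguments give the conjugate coordinates. Modulo the product of two `β`, the map `α` is
multiplicative. -/
theorem alphaM_mul (hζ : ζ' - ζ ≠ 0) (M N : Matrix (Fin 2) (Fin 2) k) :
    alphaM ζ ζ' (M * N) = alphaM ζ ζ' M * alphaM ζ ζ' N + betaM ζ ζ' M * betaM ζ' ζ N := by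
  have hζ2 : ζ - ζ' ≠ 0 := by rw [← neg_sub]; exact neg_ne_zero.mpr hζ
  have e : (ζ - ζ')⁻¹ = -(ζ' - ζ)⁻¹ := by rw [← neg_sub ζ' ζ, inv_neg]
  simp only [alphaM, betaM, Matrix.mul_apply, Fin.sum_univ_two, e]
  field_simp
  ring

theorem betaM_mul (hζ : ζ' - ζ ≠ 0) (M N : Matrix (Fin 2) (Fin 2) k) :
    betaM ζ ζ' (M * N) = alphaM ζ ζ' M * betaM ζ ζ' N + betaM ζ ζ' M * alphaM ζ' ζ N := by
  have e : (ζ - ζ')⁻¹ = -(ζ' - ζ)⁻¹ := by rw [← neg_sub ζ' ζ, inv_neg]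
  simp only [alphaM, betaM, Matrix.mul_apply, Fin.sum_univ_two, e]
  field_simp
  ring

theorem det_eq_alphaM (hζ : ζ' - ζ ≠ 0) (M : Matrix (Fin 2) (Fin 2) k) :
    M.det = alphaM ζ ζ' M * alphaM ζ' ζ M - betaM ζ ζ' M * betaM ζ' ζ M := by
  have e : (ζ - ζ')⁻¹ = -(ζ' - ζ)⁻¹ := by rw [← neg_sub ζ' ζ, inv_neg]
  rw [Matrix.det_fin_two]
  simp only [alphaM, betaM, e]
  field_simp
  ring

theorem alphaM_add (M N : Matrix (Fin 2) (Fin 2) k) :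
    alphaM ζ ζ' (M + N) = alphaM ζ ζ' M + alphaM ζ ζ' N := by
  simp only [alphaM, Matrix.add_apply]; ring

theorem betaM_add (M N : Matrix (Fin 2) (Fin 2) k) :
    betaM ζ ζ' (M + N) = betaM ζ ζ' M + betaM ζ ζ' N := by
  simp only [betaM, Matrix.add_apply]; ring

theorem alphaM_smul (a : k) (M : Matrix (Fin 2) (Fin 2) k) :
    alphaM ζ ζ' (a • M) = a * alphaM ζ ζ' M := by
  simp only [alphaM, Matrix.smul_apply, smul_eq_mul]; ring

theorem betaM_smul (a : k) (M : Matrix (Fin 2) (Fin 2) k) :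
    betaM ζ ζ' (a • M) = a * betaM ζ ζ' M := by
  simp only [betaM, Matrix.smul_apply, smul_eq_mul]; ring

theorem alphaM_one (hζ : ζ' - ζ ≠ 0) : alphaM ζ ζ' 1 = 1 := by
  simp [alphaM, hζ]

theorem betaM_one : betaM ζ ζ' 1 = 0 := by
  simp [betaM]

theorem alphaM_adjugate (M : Matrix (Fin 2) (Fin 2) k) :
    alphaM ζ ζ' M.adjugate = alphaM ζ' ζ M := by
  have e : (ζ - ζ')⁻¹ = -(ζ' - ζ)⁻¹ := by rw [← neg_sub ζ' ζ, inv_neg]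
  simp only [alphaM, Matrix.adjugate_fin_two, e]
  simp
  ring

theorem betaM_adjugate (M : Matrix (Fin 2) (Fin 2) k) :
    betaM ζ ζ' M.adjugate = -betaM ζ ζ' M := by
  simp only [betaM, Matrix.adjugate_fin_two]
  simp
  ring

end MatrixCoord

section MatrixNormed

variable {C : Type*} [NormedField C] {q : ℕ} {ζ : C}

theorem alphaM_iota (hζ : ζ ^ q - ζ ≠ 0) (a b : C) :
    alphaM ζ (ζ ^ q) (iota q ζ a b) = a + b * ζ := by
  simp only [alphaM, iota]
  simp
  field_simp
  ring

theorem alphaM_iota' (hζ : ζ ^ q - ζ ≠ 0) (a b : C) :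
    alphaM (ζ ^ q) ζ (iota q ζ a b) = a + b * ζ ^ q := by
  have e : (ζ - ζ ^ q)⁻¹ = -(ζ ^ q - ζ)⁻¹ := by rw [← neg_sub (ζ ^ q) ζ, inv_neg]
  simp only [alphaM, iota, e]
  simp
  field_simp
  ring

theorem betaM_iota (a b : C) : betaM ζ (ζ ^ q) (iota q ζ a b) = 0 := by
  simp only [betaM, iota, mul_eq_zero]
  right
  simp
  ring

theorem betaM_iota' (a b : C) : betaM (ζ ^ q) ζ (iota q ζ a b) = 0 := by
  simp only [betaM, iota, mul_eq_zero]
  right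
  simp
  ring

theorem alphaM_gC (a b : C) : alphaM ζ (ζ ^ q) (gC q ζ a b) = 0 := by
  simp only [alphaM, gC, mul_eq_zero]
  right
  simp
  ring

theorem alphaM_gC' (a b : C) : alphaM (ζ ^ q) ζ (gC q ζ a b) = 0 := by
  simp only [alphaM, gC, mul_eq_zero]
  right
  simp
  ring

theorem betaM_gC (hζ : ζ ^ q - ζ ≠ 0) (a b : C) :
    betaM ζ (ζ ^ q) (gC q ζ a b) = a + b * ζ := by
  simp only [betaM, gC]
  simp
  field_simp
  ring

theorem betaM_gC' (hζ : ζ ^ q - ζ ≠ 0) (a b : C) :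
    betaM (ζ ^ q) ζ (gC q ζ a b) = a + b * ζ ^ q := by
  have e : (ζ - ζ ^ q)⁻¹ = -(ζ ^ q - ζ)⁻¹ := by rw [← neg_sub (ζ ^ q) ζ, inv_neg]
  simp only [betaM, gC, e]
  simp
  field_simp
  ring

end MatrixNormed

namespace UnramData

variable {C : Type*} [NormedField C] [IsUltrametricDist C] {p q n : ℕ} {F : Subfield C}
  {ϖ ζ w : C} {M N : Matrix (Fin 2) (Fin 2) C}

theorem zeta_sub_ne (h : UnramData p q F ϖ ζ) : ζ ^ q - ζ ≠ 0 := sub_ne_zero.mpr h.zeta_ne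

theorem zeta_sub_ne' (h : UnramData p q F ϖ ζ) : ζ - ζ ^ q ≠ 0 := sub_ne_zero.mpr h.zeta_ne.symm

theorem trace_mem (h : UnramData p q F ϖ ζ) : ζ + ζ ^ q ∈ F :=
  h.mem _ (by rw [h.add_pow_q, ← pow_mul, ← sq, h.zeta, add_comm])

theorem norm_mem (h : UnramData p q F ϖ ζ) : ζ ^ (q + 1) ∈ F :=
  h.mem _ (by rw [← pow_mul, mul_comm, mul_add, ← sq, mul_one, pow_add, h.zeta, ← pow_succ'])

theorem iota_mem (h : UnramData p q F ϖ ζ) {a b : C} (ha : a ∈ F) (hb : b ∈ F) (i j : Fin 2) :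
    iota q ζ a b i j ∈ F := by
  have h1 := h.trace_mem
  have h2 := h.norm_mem
  fin_cases i <;> fin_cases j
  · exact ha
  · exact F.mul_mem (F.neg_mem hb) h2
  · exact hb
  · exact F.add_mem ha (F.mul_mem hb h1)

theorem gC_mem (h : UnramData p q F ϖ ζ) {a b : C} (ha : a ∈ F) (hb : b ∈ F) (i j : Fin 2) :
    gC q ζ a b i j ∈ F := by
  have h1 := h.trace_mem
  have h2 := h.norm_mem
  fin_cases i <;> fin_cases j
  · exact ha
  · exact F.add_mem (F.mul_mem ha h1) (F.mul_mem hb h2)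
  · exact hb
  · exact F.neg_mem ha

theorem norm_gC_le (h : UnramData p q F ϖ ζ) {a b : C} (ha : ‖a‖ ≤ 1) (hb : ‖b‖ ≤ 1)
    (i j : Fin 2) : ‖gC q ζ a b i j‖ ≤ 1 := by
  have h1 : ‖ζ + ζ ^ q‖ ≤ 1 := norm_add_le_of_le' h.norm_zeta.le h.conj.norm_zeta.le
  have h2 : ‖ζ ^ (q + 1)‖ ≤ 1 := by rw [norm_pow, h.norm_zeta, one_pow]
  fin_cases i <;> fin_cases j
  · exact ha
  · exact norm_add_le_of_le' (norm_mul_le_one' ha h1) (norm_mul_le_one' hb h2)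
  · exact hb
  · exact (norm_neg a).trans_le ha

theorem gC_mem_orthC (h : UnramData p q F ϖ ζ) {a b : C} (ha : a ∈ F) (hb : b ∈ F) :
    gC q ζ a b ∈ orthC F q ζ := by
  refine ⟨h.gC_mem ha hb, fun x _ y _ => ?_⟩
  simp only [Matrix.trace, Fin.sum_univ_two, Matrix.diag, Matrix.mul_apply, iota, gC]
  simp
  ring

theorem matrix_ext (h : UnramData p q F ϖ ζ) (hM : ∀ i j, M i j ∈ F) (hN : ∀ i j, N i j ∈ F)
    (hα : alphaM ζ (ζ ^ q) M = alphaM ζ (ζ ^ q) N) (hβ : betaM ζ (ζ ^ q) M = betaM ζ (ζ ^ q) N) :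
    M = N := by
  have h1 := alphaM_add_betaM h.zeta_sub_ne M
  have h2 := mul_alphaM_add_betaM h.zeta_sub_ne M
  rw [hα, hβ, alphaM_add_betaM h.zeta_sub_ne] at h1
  rw [hα, hβ, mul_alphaM_add_betaM h.zeta_sub_ne] at h2
  obtain ⟨h3, h4⟩ := h.coeff_unique (hN 0 0) (hN 1 0) (hM 0 0) (hM 1 0) h1
  obtain ⟨h5, h6⟩ := h.coeff_unique (hN 0 1) (hN 1 1) (hM 0 1) (hM 1 1) h2
  ext i j
  fin_cases i <;> fin_cases j
  · exact h3.symm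
  · exact h5.symm
  · exact h4.symm
  · exact h6.symm

theorem zeta_pow_mem_adj (F : Subfield C) (q : ℕ) (ζ : C) : ζ ^ q ∈ adj F ζ :=
  Subfield.pow_mem _ (mem_adj_self F ζ) q

theorem alphaM_mem (hM : ∀ i j, M i j ∈ F) : alphaM ζ (ζ ^ q) M ∈ adj F ζ := by
  have hζ := mem_adj_self F ζ
  have hζ' := zeta_pow_mem_adj F q ζ
  have hm : ∀ i j, M i j ∈ adj F ζ := fun i j => mem_adj_of_mem (hM i j)
  exact mul_mem (inv_mem (sub_mem hζ' hζ)) (sub_mem (mul_mem hζ' (add_mem (hm _ _)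
    (mul_mem (hm _ _) hζ))) (add_mem (hm _ _) (mul_mem (hm _ _) hζ)))

theorem betaM_mem (hM : ∀ i j, M i j ∈ F) : betaM ζ (ζ ^ q) M ∈ adj F ζ := by
  have hζ := mem_adj_self F ζ
  have hζ' := zeta_pow_mem_adj F q ζ
  have hm : ∀ i j, M i j ∈ adj F ζ := fun i j => mem_adj_of_mem (hM i j)
  exact mul_mem (inv_mem (sub_mem hζ' hζ)) (sub_mem (add_mem (hm _ _) (mul_mem (hm _ _) hζ))
    (mul_mem hζ (add_mem (hm _ _) (mul_mem (hm _ _) hζ))))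

theorem exists_decomp (h : UnramData p q F ϖ ζ) (hM : ∀ i j, M i j ∈ F) :
    ∃ a ∈ F, ∃ b ∈ F, ∃ a' ∈ F, ∃ b' ∈ F, M = iota q ζ a b + gC q ζ a' b' := by
  obtain ⟨a, ha, b, hb, e⟩ := h.mem_adj_iff.mp (alphaM_mem (q := q) (ζ := ζ) hM)
  obtain ⟨a', ha', b', hb', e'⟩ := h.mem_adj_iff.mp (betaM_mem (q := q) (ζ := ζ) hM)
  refine ⟨a, ha, b, hb, a', ha', b', hb', h.matrix_ext hM
    (fun i j => F.add_mem (h.iota_mem ha hb i j) (h.gC_mem ha' hb' i j)) ?_ ?_⟩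
  · rw [alphaM_add, alphaM_iota h.zeta_sub_ne, alphaM_gC, add_zero, e]
  · rw [betaM_add, betaM_iota, betaM_gC h.zeta_sub_ne, zero_add, e']

/-- For entries in `F` the exchanged coordinate is the Galois conjugate `a + b ζ^q` of `a + b ζ`,
and both have norm `max ‖a‖ ‖b‖`. -/
theorem norm_alphaM_conj (h : UnramData p q F ϖ ζ) (hM : ∀ i j, M i j ∈ F) :
    ‖alphaM (ζ ^ q) ζ M‖ = ‖alphaM ζ (ζ ^ q) M‖ := by
  obtain ⟨a, ha, b, hb, a', ha', b', hb', rfl⟩ := h.exists_decomp hM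
  rw [alphaM_add, alphaM_add, alphaM_iota h.zeta_sub_ne, alphaM_iota' h.zeta_sub_ne, alphaM_gC,
    alphaM_gC', add_zero, add_zero, h.norm_add_mul_zeta ha hb, h.conj.norm_add_mul_zeta ha hb]

theorem norm_betaM_conj (h : UnramData p q F ϖ ζ) (hM : ∀ i j, M i j ∈ F) :
    ‖betaM (ζ ^ q) ζ M‖ = ‖betaM ζ (ζ ^ q) M‖ := by
  obtain ⟨a, ha, b, hb, a', ha', b', hb', rfl⟩ := h.exists_decomp hM
  rw [betaM_add, betaM_add, betaM_iota, betaM_iota', betaM_gC h.zeta_sub_ne,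
    betaM_gC' h.zeta_sub_ne, zero_add, zero_add, h.norm_add_mul_zeta ha' hb',
    h.conj.norm_add_mul_zeta ha' hb']

theorem norm_zeta_sub (h : UnramData p q F ϖ ζ) : ‖ζ ^ q - ζ‖ = 1 := by
  have hq := h.two_le_q
  refine (norm_eq_zero_or_one_of_pow_eq_self (N := q ^ 2) (by nlinarith) ?_).resolve_left
    h.zeta_sub_ne
  rw [h.sub_pow, ← pow_mul, mul_comm q, pow_mul, h.zeta]

theorem norm_alphaM_le (h : UnramData p q F ϖ ζ) (hM : ∀ i j, ‖M i j‖ ≤ 1) :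
    ‖alphaM ζ (ζ ^ q) M‖ ≤ 1 := by
  have hζ := h.norm_zeta.le
  have hζ' := h.conj.norm_zeta.le
  rw [alphaM, norm_mul, norm_inv, h.norm_zeta_sub, inv_one, one_mul]
  exact norm_sub_le_of_le' (norm_mul_le_one' hζ' (norm_add_le_of_le' (hM _ _)
    (norm_mul_le_one' (hM _ _) hζ))) (norm_add_le_of_le' (hM _ _) (norm_mul_le_one' (hM _ _) hζ))

theorem norm_betaM_le (h : UnramData p q F ϖ ζ) (hM : ∀ i j, ‖M i j‖ ≤ 1) :
    ‖betaM ζ (ζ ^ q) M‖ ≤ 1 := by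
  have hζ := h.norm_zeta.le
  rw [betaM, norm_mul, norm_inv, h.norm_zeta_sub, inv_one, one_mul]
  exact norm_sub_le_of_le' (norm_add_le_of_le' (hM _ _) (norm_mul_le_one' (hM _ _) hζ))
    (norm_mul_le_one' hζ (norm_add_le_of_le' (hM _ _) (norm_mul_le_one' (hM _ _) hζ)))

theorem norm_entry_le (h : UnramData p q F ϖ ζ) (hM : ∀ i j, M i j ∈ F)
    (hα : ‖alphaM ζ (ζ ^ q) M‖ ≤ 1) (hβ : ‖betaM ζ (ζ ^ q) M‖ ≤ 1) (i j : Fin 2) :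
    ‖M i j‖ ≤ 1 := by
  have h1 : ‖M 0 0 + M 1 0 * ζ‖ ≤ 1 := by
    rw [← alphaM_add_betaM h.zeta_sub_ne]
    exact norm_add_le_of_le' hα hβ
  have h2 : ‖M 0 1 + M 1 1 * ζ‖ ≤ 1 := by
    rw [← mul_alphaM_add_betaM h.zeta_sub_ne]
    exact norm_add_le_of_le' (norm_mul_le_one' h.norm_zeta.le hα)
      (norm_mul_le_one' h.conj.norm_zeta.le hβ)
  rw [h.norm_add_mul_zeta (hM _ _) (hM _ _)] at h1 h2
  fin_cases i <;> fin_cases j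
  · exact (le_max_left _ _).trans h1
  · exact (le_max_left _ _).trans h2
  · exact (le_max_right _ _).trans h1
  · exact (le_max_right _ _).trans h2

theorem alphaM_of_mem_orthC (hM : M ∈ orthC F q ζ) : alphaM ζ (ζ ^ q) M = 0 := by
  have h1 := hM.2 1 F.one_mem 0 F.zero_mem
  have h2 := hM.2 0 F.zero_mem 1 F.one_mem
  simp only [Matrix.trace, Fin.sum_univ_two, Matrix.diag, Matrix.mul_apply, iota] at h1 h2
  simp at h1 h2
  rw [alphaM, mul_eq_zero]
  right
  linear_combination ζ ^ q * h1 - h2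

/-- The subalgebra `F_2` is the locus `β = 0` and its complement `C_1` is the locus `α = 0`, so
membership in `H` separates into a congruence for `α` and one for `β`. All group properties are
checked in this form. -/
theorem mem_setH_iff (h : UnramData p q F ϖ ζ) : M ∈ setH F q n ϖ ζ ↔ (∀ i j, M i j ∈ F) ∧
    ‖alphaM ζ (ζ ^ q) M - 1‖ ≤ ‖ϖ‖ ^ (n - 1) ∧ ‖betaM ζ (ζ ^ q) M‖ ≤ ‖ϖ‖ ^ (n / 2) := by
  constructor
  · rintro ⟨x, hx, y, hy, c, hc, hx1, hy1, hc1, rfl⟩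
    refine ⟨fun i j => F.add_mem (F.add_mem ?_ ?_) ?_, ?_, ?_⟩
    · rw [Matrix.one_apply]
      split_ifs
      · exact F.one_mem
      · exact F.zero_mem
    · exact F.mul_mem (F.pow_mem h.unif.1 _) (h.iota_mem hx hy i j)
    · exact F.mul_mem (F.pow_mem h.unif.1 _) (hc.1 i j)
    · rw [alphaM_add, alphaM_add, alphaM_one h.zeta_sub_ne, alphaM_smul, alphaM_smul,
        alphaM_iota h.zeta_sub_ne, alphaM_of_mem_orthC hc, mul_zero, add_zero, add_sub_cancel_left,
        norm_mul, norm_pow, h.norm_add_mul_zeta hx hy]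
      exact mul_le_of_le_one_right (by positivity) (max_le hx1 hy1)
    · rw [betaM_add, betaM_add, betaM_one, betaM_smul, betaM_smul, betaM_iota, mul_zero, add_zero,
        zero_add, norm_mul, norm_pow]
      exact mul_le_of_le_one_right (by positivity) (h.norm_betaM_le hc1)
  · rintro ⟨hM, hα, hβ⟩
    have hα' : alphaM ζ (ζ ^ q) M - 1 ∈ adj F ζ :=
      sub_mem (alphaM_mem hM) (one_mem _)
    obtain ⟨x, hx, y, hy, hx1, hy1, exy⟩ := h.mem_ringO_iff.mp (h.div_unif_pow_mem hα' hα)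
    obtain ⟨a, ha, b, hb, ha1, hb1, eab⟩ := h.mem_ringO_iff.mp
      (h.div_unif_pow_mem (betaM_mem hM) hβ)
    have h0 : ∀ j, ϖ ^ j ≠ 0 := fun j => pow_ne_zero _ h.unif.2.1
    rw [div_eq_iff (h0 _)] at exy eab
    refine ⟨x, hx, y, hy, gC q ζ a b, h.gC_mem_orthC ha hb, hx1, hy1, h.norm_gC_le ha1 hb1,
      h.matrix_ext hM (fun i j => F.add_mem (F.add_mem ?_ ?_) ?_) ?_ ?_⟩
    · rw [Matrix.one_apply]
      split_ifs
      · exact F.one_mem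
      · exact F.zero_mem
    · exact F.mul_mem (F.pow_mem h.unif.1 _) (h.iota_mem hx hy i j)
    · exact F.mul_mem (F.pow_mem h.unif.1 _) (h.gC_mem ha hb i j)
    · rw [alphaM_add, alphaM_add, alphaM_one h.zeta_sub_ne, alphaM_smul, alphaM_smul,
        alphaM_iota h.zeta_sub_ne, alphaM_gC]
      linear_combination exy
    · rw [betaM_add, betaM_add, betaM_one, betaM_smul, betaM_smul, betaM_iota,
        betaM_gC h.zeta_sub_ne]
      linear_combination eab

theorem norm_pow_lt_one (h : UnramData p q F ϖ ζ) {j : ℕ} (hj : j ≠ 0) : ‖ϖ‖ ^ j < 1 :=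
  pow_lt_one₀ (norm_nonneg _) h.unif.2.2.1 hj

theorem norm_alphaM_of_mem_setH (h : UnramData p q F ϖ ζ) (hn : 2 ≤ n)
    (hM : M ∈ setH F q n ϖ ζ) : ‖alphaM ζ (ζ ^ q) M‖ = 1 := by
  have h1 := ((h.mem_setH_iff.mp hM).2.1).trans_lt (h.norm_pow_lt_one (by omega))
  rw [← norm_one (α := C)] at h1 ⊢
  exact norm_eq_of_sub_lt h1

theorem iota_mul_iota (h : UnramData p q F ϖ ζ) {a b a' b' : C} (ha : a ∈ F) (hb : b ∈ F)
    (ha' : a' ∈ F) (hb' : b' ∈ F) (e : (a + b * ζ) * (a' + b' * ζ) = 1) :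
    iota q ζ a b * iota q ζ a' b' = 1 := by
  refine h.matrix_ext (fun i j => ?_) (fun i j => ?_) ?_ ?_
  · rw [Matrix.mul_apply]
    exact F.sum_mem fun l _ => F.mul_mem (h.iota_mem ha hb _ _) (h.iota_mem ha' hb' _ _)
  · rw [Matrix.one_apply]
    split_ifs
    · exact F.one_mem
    · exact F.zero_mem
  · rw [alphaM_mul h.zeta_sub_ne, alphaM_iota h.zeta_sub_ne, alphaM_iota h.zeta_sub_ne, betaM_iota,
      zero_mul, add_zero, e, alphaM_one h.zeta_sub_ne]
  · rw [betaM_mul h.zeta_sub_ne, betaM_iota, betaM_iota, mul_zero, zero_mul, add_zero, betaM_one]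

theorem mul_entry_mem (hM : ∀ i j, M i j ∈ F) (hN : ∀ i j, N i j ∈ F) (i j : Fin 2) :
    (M * N) i j ∈ F := by
  rw [Matrix.mul_apply]
  exact F.sum_mem fun l _ => F.mul_mem (hM _ _) (hN _ _)

theorem mem_setUH_iff (h : UnramData p q F ϖ ζ) (hn : 2 ≤ n) :
    M ∈ setUH F q n ϖ ζ ↔ (∀ i j, M i j ∈ F) ∧
    ‖alphaM ζ (ζ ^ q) M‖ = 1 ∧ ‖betaM ζ (ζ ^ q) M‖ ≤ ‖ϖ‖ ^ (n / 2) := by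
  constructor
  · rintro ⟨a, ha, b, hb, hab, g, hg, rfl⟩
    obtain ⟨h1, h2, h3⟩ := h.mem_setH_iff.mp hg
    refine ⟨mul_entry_mem (h.iota_mem ha hb) h1, ?_, ?_⟩
    · rw [alphaM_mul h.zeta_sub_ne, betaM_iota, zero_mul, add_zero, alphaM_iota h.zeta_sub_ne,
        norm_mul, hab, one_mul, h.norm_alphaM_of_mem_setH hn hg]
    · rw [betaM_mul h.zeta_sub_ne, betaM_iota, zero_mul, add_zero, alphaM_iota h.zeta_sub_ne,
        norm_mul, hab, one_mul]
      exact h3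
  · rintro ⟨hM, hα, hβ⟩
    have hαm := alphaM_mem (q := q) (ζ := ζ) hM
    obtain ⟨a, ha, b, hb, e⟩ := h.mem_adj_iff.mp hαm
    obtain ⟨a', ha', b', hb', e'⟩ := h.mem_adj_iff.mp (inv_mem hαm)
    have hα0 : alphaM ζ (ζ ^ q) M ≠ 0 := norm_ne_zero_iff.mp (by rw [hα]; exact one_ne_zero)
    have h1 : (a + b * ζ) * (a' + b' * ζ) = 1 := by rw [← e, ← e', mul_inv_cancel₀ hα0]
    refine ⟨a, ha, b, hb, by rw [← e, hα], iota q ζ a' b' * M, h.mem_setH_iff.mpr ⟨?_, ?_, ?_⟩, ?_⟩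
    · exact mul_entry_mem (h.iota_mem ha' hb') hM
    · rw [alphaM_mul h.zeta_sub_ne, betaM_iota, zero_mul, add_zero, alphaM_iota h.zeta_sub_ne, ← e',
        inv_mul_cancel₀ hα0, sub_self, norm_zero]
      positivity
    · rw [betaM_mul h.zeta_sub_ne, betaM_iota, zero_mul, add_zero, alphaM_iota h.zeta_sub_ne,
        norm_mul, ← e', norm_inv, hα, inv_one, one_mul]
      exact hβ
    · rw [← Matrix.mul_assoc, h.iota_mul_iota ha hb ha' hb' h1, Matrix.one_mul]

theorem norm_det (h : UnramData p q F ϖ ζ) (hn : 2 ≤ n) (hM : M ∈ setUH F q n ϖ ζ) :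
    ‖M.det‖ = 1 := by
  obtain ⟨h1, h2, h3⟩ := (h.mem_setUH_iff hn).mp hM
  have h4 : ‖betaM ζ (ζ ^ q) M * betaM (ζ ^ q) ζ M‖ < 1 := by
    rw [norm_mul, h.norm_betaM_conj h1]
    have := h3.trans_lt (h.norm_pow_lt_one (j := n / 2) (by omega))
    exact mul_lt_one_of_nonneg_of_lt_one_left (norm_nonneg _) this this.le
  have h5 : ‖alphaM ζ (ζ ^ q) M * alphaM (ζ ^ q) ζ M‖ = 1 := by
    rw [norm_mul, h.norm_alphaM_conj h1, h2, one_mul]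
  rw [det_eq_alphaM h.zeta_sub_ne, ← h5]
  refine norm_eq_of_sub_lt ?_
  rw [sub_sub_cancel_left, norm_neg, h5]
  exact h4

/-- Rests on `2 [n/2] ≥ n - 1`. It makes `α` a homomorphism modulo `𝔭^{n-1}` and explains the
exponents in the definition of `H`. -/
theorem norm_betaM_mul_betaM_le (h : UnramData p q F ϖ ζ) (hN : ∀ i j, N i j ∈ F)
    (h1 : ‖betaM ζ (ζ ^ q) M‖ ≤ ‖ϖ‖ ^ (n / 2)) (h2 : ‖betaM ζ (ζ ^ q) N‖ ≤ ‖ϖ‖ ^ (n / 2)) :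
    ‖betaM ζ (ζ ^ q) M * betaM (ζ ^ q) ζ N‖ ≤ ‖ϖ‖ ^ (n - 1) := by
  rw [norm_mul, h.norm_betaM_conj hN]
  refine (mul_le_mul h1 h2 (norm_nonneg _) (by positivity)).trans ?_
  rw [← pow_add]
  exact pow_le_pow_of_le_one (norm_nonneg _) h.unif.2.2.1.le (by omega)

theorem norm_alphaM_mul_sub (h : UnramData p q F ϖ ζ) (hn : 2 ≤ n) (hM : M ∈ setUH F q n ϖ ζ)
    (hN : N ∈ setUH F q n ϖ ζ) :
    ‖alphaM ζ (ζ ^ q) (M * N) - alphaM ζ (ζ ^ q) M * alphaM ζ (ζ ^ q) N‖ ≤ ‖ϖ‖ ^ (n - 1) := by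
  obtain ⟨h1, h2, h3⟩ := (h.mem_setUH_iff hn).mp hM
  obtain ⟨h4, h5, h6⟩ := (h.mem_setUH_iff hn).mp hN
  rw [alphaM_mul h.zeta_sub_ne, add_sub_cancel_left]
  exact h.norm_betaM_mul_betaM_le h4 h3 h6

theorem mul_mem_setUH (h : UnramData p q F ϖ ζ) (hn : 2 ≤ n) (hM : M ∈ setUH F q n ϖ ζ)
    (hN : N ∈ setUH F q n ϖ ζ) : M * N ∈ setUH F q n ϖ ζ := by
  obtain ⟨h1, h2, h3⟩ := (h.mem_setUH_iff hn).mp hM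
  obtain ⟨h4, h5, h6⟩ := (h.mem_setUH_iff hn).mp hN
  have h7 : ‖alphaM ζ (ζ ^ q) M * alphaM ζ (ζ ^ q) N‖ = 1 := by rw [norm_mul, h2, h5, one_mul]
  refine (h.mem_setUH_iff hn).mpr ⟨mul_entry_mem h1 h4, ?_, ?_⟩
  · rw [← h7]
    refine norm_eq_of_sub_lt ?_
    rw [h7]
    exact (h.norm_alphaM_mul_sub hn hM hN).trans_lt (h.norm_pow_lt_one (by omega))
  · rw [betaM_mul h.zeta_sub_ne]
    refine norm_add_le_of_le' ?_ ?_
    · rwa [norm_mul, h2, one_mul]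
    · rwa [norm_mul, h.norm_alphaM_conj h4, h5, mul_one]

/-- The adjugate conjugates `α` and negates `β`, and the determinant has norm one. -/
theorem inv_mem_setUH (h : UnramData p q F ϖ ζ) (hn : 2 ≤ n) (hM : M ∈ setUH F q n ϖ ζ) :
    M⁻¹ ∈ setUH F q n ϖ ζ := by
  obtain ⟨h1, h2, h3⟩ := (h.mem_setUH_iff hn).mp hM
  have hd := h.norm_det hn hM
  have hdF : M.det ∈ F := by
    rw [Matrix.det_fin_two]
    exact F.sub_mem (F.mul_mem (h1 _ _) (h1 _ _)) (F.mul_mem (h1 _ _) (h1 _ _))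
  refine (h.mem_setUH_iff hn).mpr ⟨fun i j => ?_, ?_, ?_⟩
  · rw [Matrix.inv_def, Ring.inverse_eq_inv', Matrix.smul_apply, Matrix.adjugate_fin_two]
    refine F.mul_mem (F.inv_mem hdF) ?_
    fin_cases i <;> fin_cases j
    · exact h1 _ _
    · exact F.neg_mem (h1 _ _)
    · exact F.neg_mem (h1 _ _)
    · exact h1 _ _
  · rw [Matrix.inv_def, Ring.inverse_eq_inv', alphaM_smul, alphaM_adjugate, norm_mul, norm_inv, hd,
      inv_one, one_mul, h.norm_alphaM_conj h1, h2]
  · rw [Matrix.inv_def, Ring.inverse_eq_inv', betaM_smul, betaM_adjugate, norm_mul, norm_inv, hd,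
      inv_one, one_mul, norm_neg]
    exact h3

theorem mem_setH_iff_setUH (h : UnramData p q F ϖ ζ) (hn : 2 ≤ n) : M ∈ setH F q n ϖ ζ ↔
    M ∈ setUH F q n ϖ ζ ∧ ‖alphaM ζ (ζ ^ q) M - 1‖ ≤ ‖ϖ‖ ^ (n - 1) := by
  rw [h.mem_setUH_iff hn]
  constructor
  · intro hM
    have h1 := h.mem_setH_iff.mp hM
    exact ⟨⟨h1.1, h.norm_alphaM_of_mem_setH hn hM, h1.2.2⟩, h1.2.1⟩
  · rintro ⟨h1, h2⟩
    exact h.mem_setH_iff.mpr ⟨h1.1, h2, h1.2.2⟩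

theorem one_mem_setH (h : UnramData p q F ϖ ζ) : 1 ∈ setH F q n ϖ ζ := by
  refine h.mem_setH_iff.mpr ⟨fun i j => ?_, ?_, ?_⟩
  · rw [Matrix.one_apply]
    split_ifs
    · exact F.one_mem
    · exact F.zero_mem
  · rw [alphaM_one h.zeta_sub_ne, sub_self, norm_zero]
    positivity
  · rw [betaM_one, norm_zero]
    positivity

theorem norm_entry_le_of_mem (h : UnramData p q F ϖ ζ) (hn : 2 ≤ n) (hM : M ∈ setUH F q n ϖ ζ)
    (i j : Fin 2) : ‖M i j‖ ≤ 1 := by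
  obtain ⟨h1, h2, h3⟩ := (h.mem_setUH_iff hn).mp hM
  exact h.norm_entry_le h1 h2.le (h3.trans (pow_le_one₀ (norm_nonneg _) h.unif.2.2.1.le)) i j

end UnramData

namespace UnramData

variable {C : Type*} [NormedField C] [IsUltrametricDist C] {p q n : ℕ} {F : Subfield C}
  {ϖ ζ w : C} {M N : Matrix (Fin 2) (Fin 2) C}

/-! ### The action of matrices on the curve -/

section CurveAction

variable {P : Fin 3 → C}

theorem curve_torsion (hP : P ∈ curve q n ϖ) :
    (mulUnif q ϖ (P 0))^[n] (P 1) = 0 ∧ (mulUnif q ϖ (P 0))^[n] (P 2) = 0 :=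
  ⟨hP.2 _ (Or.inl rfl), hP.2 _ (Or.inr (Or.inl rfl))⟩

theorem rightAct_one (h : UnramData p q F ϖ ζ) (hP : P ∈ curve q n ϖ) :
    rightAct q ϖ 1 P = P := by
  obtain ⟨h1, h2⟩ := curve_torsion hP
  funext i
  fin_cases i
  · rfl
  · simp [rightAct, h.one_smul h1, h.zero_smul h2]
  · simp [rightAct, h.one_smul h2, h.zero_smul h1]

theorem rightAct_mul (h : UnramData p q F ϖ ζ) (hP : P ∈ curve q n ϖ)
    (hM : ∀ i j, M i j ∈ F ∧ ‖M i j‖ ≤ 1) (hN : ∀ i j, N i j ∈ F ∧ ‖N i j‖ ≤ 1) :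
    rightAct q ϖ (M * N) P = rightAct q ϖ N (rightAct q ϖ M P) := by
  obtain ⟨h1, h2⟩ := curve_torsion hP
  have hMO : ∀ i j, M i j ∈ ringO F ζ := fun i j => mem_ringO_of_mem (hM i j).1 (hM i j).2
  have hNO : ∀ i j, N i j ∈ ringO F ζ := fun i j => mem_ringO_of_mem (hN i j).1 (hN i j).2
  have hMs : ∀ i j, IsScalar q ϖ (P 0) (M i j) := fun i j => h.isScalar_of_mem (hM i j).1 (hM i j).2
  have key : ∀ j, smul q ϖ (P 0) ((M * N) 0 j) (P 1) + smul q ϖ (P 0) ((M * N) 1 j) (P 2)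
      = smul q ϖ (P 0) (N 0 j) (smul q ϖ (P 0) (M 0 0) (P 1) + smul q ϖ (P 0) (M 1 0) (P 2))
        + smul q ϖ (P 0) (N 1 j)
          (smul q ϖ (P 0) (M 0 1) (P 1) + smul q ϖ (P 0) (M 1 1) (P 2)) := fun j => by
    rw [Matrix.mul_apply, Matrix.mul_apply, Fin.sum_univ_two, Fin.sum_univ_two,
      h.smul_add (h.smul_torsion h1 (hMs 0 0)) (h.smul_torsion h2 (hMs 1 0)),
      h.smul_add (h.smul_torsion h1 (hMs 0 1)) (h.smul_torsion h2 (hMs 1 1)),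
      ← h.mul_smul h1 (hNO _ _) (hMO _ _) (hMs _ _), ← h.mul_smul h2 (hNO _ _) (hMO _ _) (hMs _ _),
      ← h.mul_smul h1 (hNO _ _) (hMO _ _) (hMs _ _), ← h.mul_smul h2 (hNO _ _) (hMO _ _) (hMs _ _),
      h.add_smul h1 (Subring.mul_mem _ (hMO _ _) (hNO _ _)) (Subring.mul_mem _ (hMO _ _) (hNO _ _)),
      h.add_smul h2 (Subring.mul_mem _ (hMO _ _) (hNO _ _)) (Subring.mul_mem _ (hMO _ _) (hNO _ _)),
      mul_comm (N 0 j), mul_comm (N 0 j), mul_comm (N 1 j), mul_comm (N 1 j)]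
    ring
  funext i
  fin_cases i
  · rfl
  · exact key 0
  · exact key 1

theorem norm_iter_mulUnif_le {u x : C} (hq : q ≠ 0) (hϖ : ‖ϖ‖ ≤ 1) (hu : ‖u‖ ≤ 1) (hx : ‖x‖ ≤ 1)
    (i : ℕ) : ‖(mulUnif q ϖ u)^[i] x‖ ≤ ‖x‖ := by
  induction i with
  | zero => exact le_rfl
  | succ i ih =>
    rw [Function.iterate_succ_apply']
    set y := (mulUnif q ϖ u)^[i] x
    have hy := ih.trans hx
    refine le_trans ?_ ih
    have hp : ∀ j ≠ 0, ‖y ^ j‖ ≤ ‖y‖ := fun j hj => by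
      rw [norm_pow]; exact pow_le_of_le_one (norm_nonneg _) hy hj
    refine norm_add_le_of_le' (norm_add_le_of_le' (hp _ (pow_ne_zero 2 hq)) ?_) ?_
    · rw [norm_mul]
      exact (mul_le_of_le_one_left (norm_nonneg _) hu).trans (hp q hq)
    · rw [norm_mul]
      exact mul_le_of_le_one_left (norm_nonneg _) hϖ

theorem norm_smul_le (h : UnramData p q F ϖ ζ) {u x a : C} (hu : ‖u‖ ≤ 1) (hx1 : ‖x‖ ≤ 1)
    (hx : (mulUnif q ϖ u)^[n] x = 0) (ha : a ∈ ringO F ζ) : ‖smul q ϖ u a x‖ ≤ ‖x‖ := by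
  have hq := h.two_le_q
  rw [h.smul_eq_sum hx]
  refine IsUltrametricDist.norm_sum_le_of_forall_le_of_nonneg (norm_nonneg _) fun i _ => ?_
  rw [norm_mul]
  exact (mul_le_of_le_one_left (norm_nonneg _) (h.norm_digit_le i ha)).trans
    (norm_iter_mulUnif_le (by omega) h.unif.2.2.1.le hu hx1 i)

theorem iter_pred_smul' (h : UnramData p q F ϖ ζ) (hn : n ≠ 0) {u x a : C}
    (hx : (mulUnif q ϖ u)^[n] x = 0) (ha : IsScalar q ϖ u a) :
    (mulUnif q ϖ u)^[n - 1] (smul q ϖ u a x) = teich q a * (mulUnif q ϖ u)^[n - 1] x := by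
  obtain ⟨m, rfl⟩ := Nat.exists_eq_succ_of_ne_zero hn
  rw [h.iter_smul hx ha, Nat.succ_sub_one]
  rw [Function.iterate_succ_apply'] at hx
  have h1 : (mulUnif q ϖ u)^[1] ((mulUnif q ϖ u)^[m] x) = 0 := hx
  rw [h.smul_eq_sum h1]
  simp [digit]

theorem mu_linear (h : UnramData p q F ϖ ζ) {a b c d : C} (ha : a ^ q = a) (hb : b ^ q = b)
    (hc : c ^ q = c) (hd : d ^ q = d) (x y : C) :
    mu q (a * x + c * y) (b * x + d * y) = (a * d - b * c) * mu q x y := by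
  rw [mu, mu, h.add_pow_q, h.add_pow_q]
  simp only [mul_pow, ha, hb, hc, hd]
  ring

/-- On the `ϖ`-torsion a matrix acts through its leading digits, which lie in `𝔽_q`; hence `μ` is
multiplied by their determinant `e`, a nonzero element of `𝔽_q`, and `e^{q-1} = 1` preserves the
determinant equation. -/
theorem rightAct_mem_curve (h : UnramData p q F ϖ ζ) (hn : 2 ≤ n) (hP : P ∈ curve q n ϖ)
    (hM : M ∈ setUH F q n ϖ ζ) : rightAct q ϖ M P ∈ curve q n ϖ := by
  have hq := h.two_le_q
  obtain ⟨h1, h2⟩ := curve_torsion hP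
  have hMF := ((h.mem_setUH_iff hn).mp hM).1
  have hM1 := h.norm_entry_le_of_mem hn hM
  have hMO : ∀ i j, M i j ∈ ringO F ζ := fun i j => mem_ringO_of_mem (hMF i j) (hM1 i j)
  have hMs : ∀ i j, IsScalar q ϖ (P 0) (M i j) := fun i j => h.isScalar_of_mem (hMF i j) (hM1 i j)
  have htors : ∀ j, (mulUnif q ϖ (P 0))^[n]
      (smul q ϖ (P 0) (M 0 j) (P 1) + smul q ϖ (P 0) (M 1 j) (P 2)) = 0 := fun j => by
    rw [h.iter_mulUnif_add, h.smul_torsion h1 (hMs 0 j), h.smul_torsion h2 (hMs 1 j), add_zero]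
  have hnorm : ∀ j, ‖smul q ϖ (P 0) (M 0 j) (P 1) + smul q ϖ (P 0) (M 1 j) (P 2)‖ < 1 := fun j =>
    norm_add_lt_of_lt'
      ((h.norm_smul_le (hP.1 0).le (hP.1 1).le h1 (hMO 0 j)).trans_lt (hP.1 1))
      ((h.norm_smul_le (hP.1 0).le (hP.1 2).le h2 (hMO 1 j)).trans_lt (hP.1 2))
  refine ⟨fun i => ?_, ?_⟩
  · fin_cases i
    · exact hP.1 0
    · exact hnorm 0
    · exact hnorm 1
  · have htq : ∀ i j, teich q (M i j) ^ q = teich q (M i j) := fun i j =>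
      (h.teich_of_mem (hMF i j) (hM1 i j)).2
    have hts : ∀ i j, ‖M i j - teich q (M i j)‖ < 1 := fun i j => (h.teich_spec (hMO i j)).2
    set e := teich q (M 0 0) * teich q (M 1 1) - teich q (M 0 1) * teich q (M 1 0) with he
    have heq : e ^ q = e := by
      have := h.sub_pow (teich q (M 0 0) * teich q (M 1 1)) (teich q (M 0 1) * teich q (M 1 0)) 1
      rw [pow_one] at this
      rw [he, this, mul_pow, mul_pow, htq, htq, htq, htq]
    have ht1 : ∀ i j, ‖teich q (M i j)‖ ≤ 1 := fun i j =>
      h.norm_le_one_of_fixed (h.teich_spec (hMO i j)).1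
    have hed : ‖e - M.det‖ < 1 := by
      have hmul : ∀ a b c d : C, ‖a‖ ≤ 1 → ‖d‖ ≤ 1 → ‖c - a‖ < 1 → ‖d - b‖ < 1 →
          ‖a * b - c * d‖ < 1 := fun a b c d ha hd hca hdb => by
        rw [show a * b - c * d = -(a * (d - b) + (c - a) * d) by ring, norm_neg]
        refine norm_add_lt_of_lt' ?_ ?_
        · rw [norm_mul]
          exact mul_lt_one_of_nonneg_of_lt_one_right ha (norm_nonneg _) hdb
        · rw [norm_mul]
          exact mul_lt_one_of_nonneg_of_lt_one_left (norm_nonneg _) hca hd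
      rw [Matrix.det_fin_two, he, sub_sub_sub_comm]
      exact norm_sub_lt_of_lt' (hmul _ _ _ _ (ht1 _ _) (hM1 _ _) (hts _ _) (hts _ _))
        (hmul _ _ _ _ (ht1 _ _) (hM1 _ _) (hts _ _) (hts _ _))
    have he0 : e ≠ 0 := fun h0 => by
      rw [h0, zero_sub, norm_neg, h.norm_det hn hM] at hed
      exact lt_irrefl _ hed
    have he1 : e ^ (q - 1) = 1 := by
      refine mul_right_cancel₀ he0 ?_
      rw [← pow_succ, Nat.sub_add_cancel (by omega), heq, one_mul]
    rintro f (rfl | rfl | rfl)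
    · exact htors 0
    · exact htors 1
    · have hmu := hP.2 _ (Or.inr (Or.inr rfl))
      rw [sub_eq_zero] at hmu
      have hp : ∀ j, (mulUnif q ϖ (P 0))^[n - 1]
          (smul q ϖ (P 0) (M 0 j) (P 1) + smul q ϖ (P 0) (M 1 j) (P 2))
          = teich q (M 0 j) * (mulUnif q ϖ (P 0))^[n - 1] (P 1)
            + teich q (M 1 j) * (mulUnif q ϖ (P 0))^[n - 1] (P 2) := fun j => by
        rw [h.iter_mulUnif_add, h.iter_pred_smul' (by omega) h1 (hMs 0 j),
          h.iter_pred_smul' (by omega) h2 (hMs 1 j)]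
      change mu q ((mulUnif q ϖ (P 0))^[n - 1]
          (smul q ϖ (P 0) (M 0 0) (P 1) + smul q ϖ (P 0) (M 1 0) (P 2)))
        ((mulUnif q ϖ (P 0))^[n - 1]
          (smul q ϖ (P 0) (M 0 1) (P 1) + smul q ϖ (P 0) (M 1 1) (P 2))) ^ (q - 1) - ϖ = 0
      rw [hp, hp, h.mu_linear (htq _ _) (htq _ _) (htq _ _) (htq _ _), mul_pow, ← he, he1, one_mul,
        hmu, sub_self]

end CurveAction

/-! ### The action in diagonal coordinates -/

section DiagAction

open LTData

/-- The diagonal coordinates of the image of a point under a matrix. -/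
def actAB {R : Type*} [CommRing R] (n : ℕ) (a b a' b' : ℕ → R) (z : ℕ → R × R) : R × R :=
  (∑ i ∈ Finset.range n, (a i * (z i).1 + b' i * (z i).2),
    ∑ i ∈ Finset.range n, (b i * (z i).1 + a' i * (z i).2))

/-- The coordinate `α` is a linear combination of the entries with coefficients fixed by the
`q²`-power map, and taking digits is linear over such constants. -/
theorem digit_alphaM (h : UnramData p q F ϖ ζ) (hM : ∀ i j, M i j ∈ F ∧ ‖M i j‖ ≤ 1) (i : ℕ) :
    digit q ϖ i (alphaM ζ (ζ ^ q) M) = alphaM ζ (ζ ^ q) (M.map (digit q ϖ i)) := by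
  have hMO : ∀ i j, M i j ∈ ringO F ζ := fun i j => mem_ringO_of_mem (hM i j).1 (hM i j).2
  have hζO := h.zeta_mem_ringO
  have hζO' : ζ ^ q ∈ ringO F ζ := Subring.pow_mem _ hζO q
  have hi : ((ζ ^ q - ζ)⁻¹) ^ q ^ 2 = (ζ ^ q - ζ)⁻¹ := by
    rw [inv_pow, h.sub_pow, h.conj.zeta, h.zeta]
  have hm : ∀ a b, M a b * ζ ∈ ringO F ζ := fun a b => Subring.mul_mem _ (hMO a b) hζO
  have h1 : ∀ a b, M a b + M 1 b * ζ ∈ ringO F ζ := fun a b => Subring.add_mem _ (hMO _ _) (hm _ _)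
  have e : ∀ a b, digit q ϖ i (M a b + M 1 b * ζ)
      = digit q ϖ i (M a b) + digit q ϖ i (M 1 b) * ζ := fun a b => by
    rw [h.digit_add i (hMO _ _) (hm _ _), mul_comm (M 1 b), h.digit_fixed_mul i h.zeta (hMO _ _),
      mul_comm ζ]
  have h2 : ζ ^ q * (M 0 0 + M 1 0 * ζ) ∈ ringO F ζ := Subring.mul_mem _ hζO' (h1 _ _)
  have h3 : digit q ϖ i (ζ ^ q * (M 0 0 + M 1 0 * ζ) - (M 0 1 + M 1 1 * ζ))
      = ζ ^ q * digit q ϖ i (M 0 0 + M 1 0 * ζ) - digit q ϖ i (M 0 1 + M 1 1 * ζ) := by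
    rw [sub_eq_add_neg, h.digit_add i h2 (Subring.neg_mem _ (h1 0 1)), h.digit_neg i (h1 0 1),
      h.digit_fixed_mul i h.conj.zeta (h1 0 0), ← sub_eq_add_neg]
  rw [alphaM, alphaM, h.digit_fixed_mul i hi (Subring.sub_mem _ h2 (h1 0 1)), h3, e 0 0, e 0 1]
  simp only [Matrix.map_apply]

theorem digit_betaM (h : UnramData p q F ϖ ζ) (hM : ∀ i j, M i j ∈ F ∧ ‖M i j‖ ≤ 1) (i : ℕ) :
    digit q ϖ i (betaM ζ (ζ ^ q) M) = betaM ζ (ζ ^ q) (M.map (digit q ϖ i)) := by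
  have hMO : ∀ i j, M i j ∈ ringO F ζ := fun i j => mem_ringO_of_mem (hM i j).1 (hM i j).2
  have hζO := h.zeta_mem_ringO
  have hα : alphaM ζ (ζ ^ q) M ∈ ringO F ζ :=
    ⟨alphaM_mem fun i j => (hM i j).1, h.norm_alphaM_le fun i j => (hM i j).2⟩
  have e : betaM ζ (ζ ^ q) M = (M 0 0 + ζ * M 1 0) + -alphaM ζ (ζ ^ q) M := by
    rw [mul_comm ζ, ← alphaM_add_betaM h.zeta_sub_ne]; ring
  have e' := alphaM_add_betaM h.zeta_sub_ne (M.map (digit q ϖ i))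
  rw [e, h.digit_add i (Subring.add_mem _ (hMO _ _) (Subring.mul_mem _ hζO (hMO _ _)))
    (Subring.neg_mem _ hα), h.digit_neg i hα,
    h.digit_add i (hMO _ _) (Subring.mul_mem _ hζO (hMO _ _)), h.digit_fixed_mul i h.zeta (hMO _ _),
    h.digit_alphaM hM]
  simp only [Matrix.map_apply] at e'
  linear_combination -e'

theorem alphaM_pow (h : UnramData p q F ϖ ζ) (hM : ∀ i j, M i j ^ q = M i j) :
    alphaM ζ (ζ ^ q) M ^ q = alphaM (ζ ^ q) ζ M := by
  have hsub : ∀ x y : C, (x - y) ^ q = x ^ q - y ^ q := fun x y => by simpa using h.sub_pow x y 1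
  have hζ2 : (ζ ^ q) ^ q = ζ := by rw [← pow_mul, ← sq, h.zeta]
  rw [alphaM, alphaM, mul_pow, inv_pow, hsub, hsub, mul_pow, h.add_pow_q, h.add_pow_q, mul_pow,
    mul_pow, hM, hM, hM, hM, hζ2]

theorem betaM_pow (h : UnramData p q F ϖ ζ) (hM : ∀ i j, M i j ^ q = M i j) :
    betaM ζ (ζ ^ q) M ^ q = betaM (ζ ^ q) ζ M := by
  have hsub : ∀ x y : C, (x - y) ^ q = x ^ q - y ^ q := fun x y => by simpa using h.sub_pow x y 1
  have hζ2 : (ζ ^ q) ^ q = ζ := by rw [← pow_mul, ← sq, h.zeta]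
  rw [betaM, betaM, mul_pow, inv_pow, hsub, hsub, mul_pow, h.add_pow_q, h.add_pow_q, mul_pow,
    mul_pow, hM, hM, hM, hM, hζ2]

/-- For each digit matrix one uses its decomposition on `(1, ζ)` for the part with `A_i` and the
conjugate one on `(1, ζ^q)` for the part with `B_i`. The conjugate digits are `q`-th powers because
the digits of the entries lie in `𝔽_q`. -/
theorem rightAct_diagPt (h : UnramData p q F ϖ ζ) (hL : LTData p q n ϖ ζ w)
    (hM : ∀ i j, M i j ∈ F ∧ ‖M i j‖ ≤ 1) {u : C} {z : C × C} (hz : (stepAB q ϖ u)^[n] z = 0) :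
    rightAct q ϖ M (diagPt q ζ u z) = diagPt q ζ u (actAB n
      (fun i => digit q ϖ i (alphaM ζ (ζ ^ q) M)) (fun i => digit q ϖ i (betaM ζ (ζ ^ q) M))
      (fun i => digit q ϖ i (alphaM ζ (ζ ^ q) M) ^ q) (fun i => digit q ϖ i (betaM ζ (ζ ^ q) M) ^ q)
      (fun i => (stepAB q ϖ u)^[i] z)) := by
  have e1 := fun j => hL.iter_mulUnif_add (R := C) u z j
  have e2 := fun j => hL.iter_mulUnif_zeta (R := C) u z j
  simp only [Algebra.algebraMap_self, RingHom.id_apply] at e1 e2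
  have t1 : (mulUnif q ϖ u)^[n] (z.1 + z.2) = 0 := by rw [e1, hz]; simp
  have t2 : (mulUnif q ϖ u)^[n] (ζ * z.1 + ζ ^ q * z.2) = 0 := by rw [e2, hz]; simp
  have hD : ∀ i a b, (M.map (digit q ϖ i)) a b ^ q = (M.map (digit q ϖ i)) a b := fun i a b =>
    h.digit_pow_of_mem i (hM a b).1 (hM a b).2
  simp only [h.digit_alphaM hM, h.digit_betaM hM, h.alphaM_pow (hD _), h.betaM_pow (hD _)]
  funext j
  fin_cases j
  · rfl
  · simp only [rightAct, diagPt, actAB]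
    simp only [Fin.mk_one, Matrix.cons_val_zero, Matrix.cons_val_one, Matrix.cons_val]
    rw [h.smul_eq_sum t1, h.smul_eq_sum t2, ← Finset.sum_add_distrib, ← Finset.sum_add_distrib]
    refine Finset.sum_congr rfl fun i _ => ?_
    have h1 := alphaM_add_betaM h.zeta_sub_ne (M.map (digit q ϖ i))
    have h2 := alphaM_add_betaM h.zeta_sub_ne' (M.map (digit q ϖ i))
    simp only [Matrix.map_apply] at h1 h2
    rw [e1, e2]
    linear_combination -((stepAB q ϖ u)^[i] z).1 * h1 - ((stepAB q ϖ u)^[i] z).2 * h2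
  · simp only [rightAct, diagPt, actAB]
    simp only [Fin.reduceFinMk, Matrix.cons_val_zero, Matrix.cons_val_one, Matrix.cons_val]
    rw [h.smul_eq_sum t1, h.smul_eq_sum t2, ← Finset.sum_add_distrib, Finset.mul_sum,
      Finset.mul_sum, ← Finset.sum_add_distrib]
    refine Finset.sum_congr rfl fun i _ => ?_
    have h1 := mul_alphaM_add_betaM h.zeta_sub_ne (M.map (digit q ϖ i))
    have h2 := mul_alphaM_add_betaM h.zeta_sub_ne' (M.map (digit q ϖ i))
    simp only [Matrix.map_apply] at h1 h2
    rw [e1, e2]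
    linear_combination -((stepAB q ϖ u)^[i] z).1 * h1 - ((stepAB q ϖ u)^[i] z).2 * h2

theorem norm_fixed_pow_le (h : UnramData p q F ϖ ζ) (i j : ℕ) {a : C} (ha : a ∈ ringO F ζ) :
    ‖digit q ϖ i a ^ j‖ ≤ 1 := by
  rw [norm_pow]
  exact pow_le_one₀ (norm_nonneg _) (h.norm_digit_le i ha)

/-- The matrices in `U^0 H` permute the affinoids. -/
theorem rightAct_mem_affinoid (h : UnramData p q F ϖ ζ) (hn : 2 ≤ n) (hw : w ∈ primTorsion q n ϖ)
    (hM : M ∈ setUH F q n ϖ ζ) {P : Fin 3 → C} (hP : P ∈ affinoid q n ϖ ζ w) :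
    rightAct q ϖ M P ∈ affinoid q n ϖ ζ (smul q ϖ 0 (alphaM ζ (ζ ^ q) M) w) := by
  have hL := h.ltData hn hw
  obtain ⟨hMF, hα, hβ⟩ := (h.mem_setUH_iff hn).mp hM
  have hM1 := h.norm_entry_le_of_mem hn hM
  have hαO : alphaM ζ (ζ ^ q) M ∈ ringO F ζ := ⟨alphaM_mem hMF, hα.le⟩
  have hβO : betaM ζ (ζ ^ q) M ∈ ringO F ζ := ⟨betaM_mem hMF, h.norm_betaM_le hM1⟩
  have hw' := h.smul_mem_primTorsion hn hw hαO.1 hα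
  have hL' := h.ltData hn hw'
  have hcur := h.rightAct_mem_curve hn hP.1 hM
  obtain ⟨v, ⟨hv, hv0⟩, rfl⟩ := hL.coords_bijOn.surjOn hP
  have ec := LTData.coords_eq_diagPt (R := C) (q := q) (n := n) (ϖ := ϖ) (ζ := ζ) (w := w) v
  simp only [Algebra.algebraMap_self, RingHom.id_apply] at ec
  rw [ec] at hcur ⊢
  have hu := norm_smul_le_of (scaleU q n ϖ w) (hv 0)
  have horb : ∀ i, (stepAB q ϖ (scaleU q n ϖ w • v 0))^[i] (startAB q n ϖ w (v 1) (v 2))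
    = orbit q n ϖ w (v 0) (v 1) (v 2) i := fun i => rfl
  rw [h.rightAct_diagPt hL (fun i j => ⟨hMF i j, hM1 i j⟩) hv0] at hcur ⊢
  simp only [horb] at hcur ⊢
  set O := orbit q n ϖ w (v 0) (v 1) (v 2) with hO
  have hβ0 : ∀ i < n / 2, digit q ϖ i (betaM ζ (ζ ^ q) M) = 0 := fun i hi =>
    h.digit_eq_zero_of_norm_le hi hβO.1 hβ
  have hq := h.two_le_q
  have hB : ∀ i < n, n / 2 ≤ i → ‖(O i).2‖ ≤ ‖torsionPt q n ϖ w 1‖ := fun i hi hi' =>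
    hL.norm_orbit_snd_le_delta (hv 0) (hv 1) (hv 2) hi' hi
  have hA : ∀ i < n, ‖(O i).1 - torsionPt q n ϖ w (n - i)‖ ≤ ‖torsionPt q n ϖ w 1‖ := fun i hi =>
    hL.norm_orbit_fst_sub_le_delta (hv 0) (hv 1) (hv 2) hi.le
  have hδ := hL.delta_lt_norm_scaleS.le
  refine hL'.mem_affinoid_iff.mpr ⟨_, _, rfl, ?_, ?_, ?_, ?_⟩
  · rwa [hL'.norm_scaleU_eq hL]
  -- The new centre `[α] ϖ_n = ∑ α_i ϖ_{n-i}` is compared with `∑ α_i A_i` term by term. The digits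
  -- of `β` vanish below `n / 2`, and from there on `B_i` is at most `‖ϖ_1‖`.
  · rw [hL'.norm_torsionPt_one_eq hL, h.smul_eq_sum hw.1, actAB, ← Finset.sum_sub_distrib]
    refine IsUltrametricDist.norm_sum_le_of_forall_le_of_nonneg (norm_nonneg _) fun i hi => ?_
    have hi' := Finset.mem_range.mp hi
    have e3 : (mulUnif q ϖ 0)^[i] w = torsionPt q n ϖ w (n - i) := by
      rw [torsionPt]; congr 2; omega
    rw [e3, add_sub_right_comm, ← mul_sub]
    refine norm_add_le_of_le' ?_ ?_
    · rw [norm_mul]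
      exact (mul_le_of_le_one_left (norm_nonneg _) (h.norm_digit_le i hαO)).trans (hA i hi')
    · rcases lt_or_ge i (n / 2) with hlt | hge
      · rw [hβ0 i hlt, zero_pow (by omega), zero_mul, norm_zero]
        exact norm_nonneg _
      · rw [norm_mul]
        exact (mul_le_of_le_one_left (norm_nonneg _) (h.norm_fixed_pow_le i q hβO)).trans
          (hB i hi' hge)
  -- Where `β_i` may be nonzero, `A_i` is close to `ϖ_{n-i}` with `n - i ≤ m`, and these torsion
  -- points are bounded by the radius of `B`.
  · rw [hL'.norm_scaleS_eq hL, actAB]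
    change ‖∑ i ∈ Finset.range n, _‖ ≤ _
    refine IsUltrametricDist.norm_sum_le_of_forall_le_of_nonneg (norm_nonneg _) fun i hi => ?_
    have hi' := Finset.mem_range.mp hi
    refine norm_add_le_of_le' ?_ ?_
    · rcases lt_or_ge i (n / 2) with hlt | hge
      · rw [hβ0 i hlt, zero_mul, norm_zero]
        exact norm_nonneg _
      · rw [norm_mul]
        refine (mul_le_of_le_one_left (norm_nonneg _) (h.norm_digit_le i hβO)).trans ?_
        have := norm_add_le_of_le' ((hA i hi').trans hδ)
          (hL.torsionPt_le_scaleS (i := n - i) (by omega))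
        rwa [sub_add_cancel] at this
    · rw [norm_mul]
      exact (mul_le_of_le_one_left (norm_nonneg _) (h.norm_fixed_pow_le i q hαO)).trans
        (hL.norm_orbit_snd_le (hv 0) (hv 1) (hv 2) i)
  -- Torsion of the image is read off from its membership in the curve, already established, so the
  -- recursion need not be run on the new coordinates.
  · set u := scaleU q n ϖ w • v 0
    have e := hL.drinfeldEqs_diagPt (R := C) u
    simp only [Algebra.algebraMap_self, RingHom.id_apply] at e
    have h0 := hcur.2
    have hu0 : ∀ z : C × C, diagPt q ζ u z 0 = u := fun z => rfl
    rw [e] at h0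
    obtain ⟨h2, h3⟩ := hL.eq_zero_of_add_of_zeta (h0 _ (Or.inl rfl)) (h0 _ (Or.inr (Or.inl rfl)))
    exact Prod.ext h2 h3

end DiagAction

end UnramData

namespace UnramData

variable {C : Type*} [NormedField C] [IsUltrametricDist C] {p q n : ℕ} {F : Subfield C}
  {ϖ ζ w : C}

/-! ### The groups and the action on the index set -/

theorem isUnit_of_mem_setUH (h : UnramData p q F ϖ ζ) (hn : 2 ≤ n) {M : Matrix (Fin 2) (Fin 2) C}
    (hM : M ∈ setUH F q n ϖ ζ) : IsUnit M := by
  rw [Matrix.isUnit_iff_isUnit_det, isUnit_iff_ne_zero, ← norm_ne_zero_iff, h.norm_det hn hM]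
  exact one_ne_zero

/-- The group `U^0 H`. -/
def groupUH (h : UnramData p q F ϖ ζ) (hn : 2 ≤ n) : Subgroup (GL (Fin 2) C) where
  carrier := {g | (g : Matrix (Fin 2) (Fin 2) C) ∈ setUH F q n ϖ ζ}
  mul_mem' {g g'} hg hg' := h.mul_mem_setUH hn hg hg'
  one_mem' := ((h.mem_setH_iff_setUH hn).mp h.one_mem_setH).1
  inv_mem' {g} hg := by
    have := h.inv_mem_setUH hn hg
    rwa [← Matrix.coe_units_inv] at this

/-- The class of the `F_2`-component of a matrix in `U^0 H`. -/
def indexChar (h : UnramData p q F ϖ ζ) (hn : 2 ≤ n) :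
    h.groupUH hn →* IndexSet (adj F ζ) ϖ n where
  toFun g := (mkUnit F ϖ ζ (alphaM ζ (ζ ^ q) (g : GL (Fin 2) C))
    (alphaM_mem ((h.mem_setUH_iff hn).mp g.2).1) ((h.mem_setUH_iff hn).mp g.2).2.1 :)
  map_one' := by
    rw [← QuotientGroup.mk_one, index_eq_iff, coe_mkUnit]
    have e : alphaM ζ (ζ ^ q) (((1 : h.groupUH hn) : GL (Fin 2) C) : Matrix (Fin 2) (Fin 2) C) = 1 :=
      alphaM_one h.zeta_sub_ne
    rw [e]
    simp
  map_mul' g g' := by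
    rw [← QuotientGroup.mk_mul, index_eq_iff, coe_mkUnit]
    exact h.norm_alphaM_mul_sub hn g.2 g'.2

/-- The group `H`. -/
def groupH (h : UnramData p q F ϖ ζ) (hn : 2 ≤ n) : Subgroup (GL (Fin 2) C) :=
  (h.indexChar hn).ker.map (h.groupUH hn).subtype

theorem indexChar_mul_eq_iff (h : UnramData p q F ϖ ζ) (hn : 2 ≤ n) (g : h.groupUH hn)
    (a b : unitFilt (adj F ζ) ϖ 0) : h.indexChar hn g * (a : IndexSet (adj F ζ) ϖ n) = b ↔
      ‖alphaM ζ (ζ ^ q) (g : GL (Fin 2) C) * (((a : (adj F ζ)ˣ) : adj F ζ) : C)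
        - (((b : (adj F ζ)ˣ) : adj F ζ) : C)‖ ≤ ‖ϖ‖ ^ (n - 1) := by
  change ((mkUnit F ϖ ζ _ _ _ : unitFilt (adj F ζ) ϖ 0) : IndexSet (adj F ζ) ϖ n) * _ = _ ↔ _
  rw [← QuotientGroup.mk_mul, index_eq_iff]
  rfl

theorem indexChar_mul_one (h : UnramData p q F ϖ ζ) (hn : 2 ≤ n) (g : h.groupUH hn) :
    h.indexChar hn g * ((1 : unitFilt (adj F ζ) ϖ 0) : IndexSet (adj F ζ) ϖ n)
      = h.indexChar hn g := by
  rw [QuotientGroup.mk_one]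
  exact mul_one (h.indexChar hn g)

theorem indexChar_eq_one_iff (h : UnramData p q F ϖ ζ) (hn : 2 ≤ n) (g : h.groupUH hn) :
    h.indexChar hn g = 1 ↔
      ((g : GL (Fin 2) C) : Matrix (Fin 2) (Fin 2) C) ∈ setH F q n ϖ ζ := by
  have := h.indexChar_mul_eq_iff hn g 1 1
  rw [indexChar_mul_one, QuotientGroup.mk_one] at this
  rw [this, h.mem_setH_iff_setUH hn]
  simp only [OneMemClass.coe_one, Units.val_one, mul_one]
  exact ⟨fun h1 => ⟨g.2, h1⟩, fun h1 => h1.2⟩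

theorem mem_groupH_iff (h : UnramData p q F ϖ ζ) (hn : 2 ≤ n) (g : GL (Fin 2) C) :
    g ∈ h.groupH hn ↔ (g : Matrix (Fin 2) (Fin 2) C) ∈ setH F q n ϖ ζ := by
  constructor
  · rintro ⟨x, hx, rfl⟩
    exact (h.indexChar_eq_one_iff hn x).mp hx
  · intro hg
    exact ⟨⟨g, ((h.mem_setH_iff_setUH hn).mp hg).1⟩, (h.indexChar_eq_one_iff hn _).mpr hg, rfl⟩

/-- The right action on the index set. -/
abbrev indexAction (h : UnramData p q F ϖ ζ) (hn : 2 ≤ n) :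
    MulAction (h.groupUH hn)ᵐᵒᵖ (IndexSet (adj F ζ) ϖ n) where
  smul g s := h.indexChar hn g.unop * s
  one_smul s := by
    change h.indexChar hn (1 : h.groupUH hn) * s = s
    rw [map_one]
    exact one_mul s
  -- The product is reversed in the opposite group; commutativity of the index group reconciles the
  -- two orders.
  mul_smul g g' s := by
    change h.indexChar hn (g'.unop * g.unop) * s = h.indexChar hn g.unop * (h.indexChar hn g'.unop * s)
    rw [map_mul, mul_comm (h.indexChar hn g'.unop), mul_assoc]

theorem norm_entry_mem (h : UnramData p q F ϖ ζ) (hn : 2 ≤ n) {M : Matrix (Fin 2) (Fin 2) C}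
    (hM : M ∈ setUH F q n ϖ ζ) (i j : Fin 2) : M i j ∈ F ∧ ‖M i j‖ ≤ 1 :=
  ⟨((h.mem_setUH_iff hn).mp hM).1 i j, h.norm_entry_le_of_mem hn hM i j⟩

theorem rightAct_mem_affinoid_of_mul_eq (h : UnramData p q F ϖ ζ) (hn : 2 ≤ n)
    (hw : w ∈ primTorsion q n ϖ) (g : h.groupUH hn) {a b : unitFilt (adj F ζ) ϖ 0}
    (hab : h.indexChar hn g * (a : IndexSet (adj F ζ) ϖ n) = b) {P : Fin 3 → C}
    (hP : P ∈ affinoid q n ϖ ζ (smul q ϖ 0 ((a : (adj F ζ)ˣ) : adj F ζ) w)) :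
    rightAct q ϖ (g : GL (Fin 2) C) P ∈
      affinoid q n ϖ ζ (smul q ϖ 0 ((b : (adj F ζ)ˣ) : adj F ζ) w) := by
  obtain ⟨ha, ha1⟩ := mem_index a
  obtain ⟨hb, hb1⟩ := mem_index b
  obtain ⟨hMF, hα, hβ⟩ := (h.mem_setUH_iff hn).mp g.2
  have h1 := h.rightAct_mem_affinoid hn (h.smul_mem_primTorsion hn hw ha ha1) g.2 hP
  rw [← h.mul_smul hw.1 ⟨alphaM_mem hMF, hα.le⟩ ⟨ha, ha1.le⟩ (h.isScalar_zero ⟨ha, ha1.le⟩)] at h1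
  rw [h.indexChar_mul_eq_iff] at hab
  rwa [h.affinoid_smul_eq hn hw ((adj F ζ).mul_mem (alphaM_mem hMF) ha)
    (by rw [norm_mul, hα, ha1, one_mul]) hb hb1 hab] at h1

/-- Surjectivity comes from the inverse matrix, which maps the target affinoid back and composes to
the identity. -/
theorem image_rightAct (h : UnramData p q F ϖ ζ) (hn : 2 ≤ n)
    (hw : w ∈ primTorsion q n ϖ) (g : h.groupUH hn) {a b : unitFilt (adj F ζ) ϖ 0}
    (hab : h.indexChar hn g * (a : IndexSet (adj F ζ) ϖ n) = b) :
    rightAct q ϖ (g : GL (Fin 2) C) ''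
        affinoid q n ϖ ζ (smul q ϖ 0 ((a : (adj F ζ)ˣ) : adj F ζ) w) =
      affinoid q n ϖ ζ (smul q ϖ 0 ((b : (adj F ζ)ˣ) : adj F ζ) w) := by
  refine Set.Subset.antisymm ?_ fun P hP => ?_
  · rintro _ ⟨P, hP, rfl⟩
    exact h.rightAct_mem_affinoid_of_mul_eq hn hw g hab hP
  · have hba : h.indexChar hn g⁻¹ * (b : IndexSet (adj F ζ) ϖ n) = a := by
      rw [← hab, map_inv, inv_mul_cancel_left]
    refine ⟨_, h.rightAct_mem_affinoid_of_mul_eq hn hw g⁻¹ hba hP, ?_⟩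
    rw [← h.rightAct_mul hP.1 (h.norm_entry_mem hn (g⁻¹).2) (h.norm_entry_mem hn g.2)]
    have e : (((g⁻¹ : h.groupUH hn) : GL (Fin 2) C) : Matrix (Fin 2) (Fin 2) C)
        * ((g : GL (Fin 2) C) : Matrix (Fin 2) (Fin 2) C) = 1 := by
      have := congrArg Units.val (inv_mul_cancel (g : GL (Fin 2) C))
      rwa [Units.val_mul] at this
    rw [e, h.rightAct_one hP.1]

theorem isPretransitive_indexAction (h : UnramData p q F ϖ ζ) (hn : 2 ≤ n) :
    letI := h.indexAction hn
    MulAction.IsPretransitive (h.groupUH hn)ᵐᵒᵖ (IndexSet (adj F ζ) ϖ n) := by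
  let _ := h.indexAction hn
  refine ⟨fun s t => ?_⟩
  obtain ⟨c, hc⟩ := QuotientGroup.mk_surjective (t * s⁻¹)
  obtain ⟨hcm, hc1⟩ := mem_index c
  obtain ⟨a, ha, b, hb, e⟩ := h.mem_adj_iff.mp hcm
  have hM : iota q ζ a b ∈ setUH F q n ϖ ζ := by
    refine (h.mem_setUH_iff hn).mpr ⟨h.iota_mem ha hb, ?_, ?_⟩
    · rw [alphaM_iota h.zeta_sub_ne, ← e, hc1]
    · rw [betaM_iota, norm_zero]; positivity
  let g : h.groupUH hn := ⟨(h.isUnit_of_mem_setUH hn hM).unit, hM⟩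
  have hg : h.indexChar hn g = c := by
    rw [← h.indexChar_mul_one, h.indexChar_mul_eq_iff]
    have e1 : alphaM ζ (ζ ^ q) ((g : GL (Fin 2) C) : Matrix (Fin 2) (Fin 2) C) = a + b * ζ :=
      alphaM_iota h.zeta_sub_ne a b
    simp only [e1, OneMemClass.coe_one, Units.val_one, mul_one]
    rw [e, sub_self, norm_zero]
    positivity
  refine ⟨MulOpposite.op g, ?_⟩
  change h.indexChar hn g * s = t
  rw [hg, hc]
  exact inv_mul_cancel_right t s

theorem exists_index_action (h : UnramData p q F ϖ ζ) (hn : 2 ≤ n) (hw : w ∈ primTorsion q n ϖ) :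
    ∃ G H : Subgroup (GL (Fin 2) C),
      (∀ g, g ∈ G ↔ (g : Matrix (Fin 2) (Fin 2) C) ∈ setUH F q n ϖ ζ) ∧
      (∀ g, g ∈ H ↔ (g : Matrix (Fin 2) (Fin 2) C) ∈ setH F q n ϖ ζ) ∧
      (∀ h ∈ setH F q n ϖ ζ, IsUnit h) ∧ H ≤ G ∧
      (∀ P ∈ curve q n ϖ, rightAct q ϖ 1 P = P ∧ ∀ g ∈ G, rightAct q ϖ g P ∈ curve q n ϖ ∧
        ∀ g' ∈ G, rightAct q ϖ (g * g' : GL (Fin 2) C) P =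
          rightAct q ϖ g' (rightAct q ϖ g P)) ∧
      ∃ _ : MulAction Gᵐᵒᵖ (IndexSet (adj F ζ) ϖ n),
        (∀ (g : G) (a b : unitFilt (adj F ζ) ϖ 0),
          MulOpposite.op g • (a : IndexSet (adj F ζ) ϖ n) = b →
          rightAct q ϖ (g : GL (Fin 2) C) ''
              affinoid q n ϖ ζ (smul q ϖ 0 ((a : (adj F ζ)ˣ) : adj F ζ) w) =
            affinoid q n ϖ ζ (smul q ϖ 0 ((b : (adj F ζ)ˣ) : adj F ζ) w)) ∧
        MulAction.IsPretransitive Gᵐᵒᵖ (IndexSet (adj F ζ) ϖ n) ∧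
        (∀ g : G, MulOpposite.op g • ((1 : unitFilt (adj F ζ) ϖ 0) : IndexSet (adj F ζ) ϖ n) =
          ((1 : unitFilt (adj F ζ) ϖ 0) : IndexSet (adj F ζ) ϖ n) ↔ (g : GL (Fin 2) C) ∈ H) ∧
        (∀ g : G, rightAct q ϖ (g : GL (Fin 2) C) '' affinoid q n ϖ ζ w = affinoid q n ϖ ζ w ↔
          (g : GL (Fin 2) C) ∈ H) := by
  have hstab : ∀ g : h.groupUH hn, h.indexChar hn g *
      ((1 : unitFilt (adj F ζ) ϖ 0) : IndexSet (adj F ζ) ϖ n)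
      = ((1 : unitFilt (adj F ζ) ϖ 0) : IndexSet (adj F ζ) ϖ n) ↔
        (g : GL (Fin 2) C) ∈ h.groupH hn := fun g => by
    rw [h.mem_groupH_iff, indexChar_mul_one, QuotientGroup.mk_one, h.indexChar_eq_one_iff]
  have e1 : smul q ϖ 0 (((1 : unitFilt (adj F ζ) ϖ 0) : (adj F ζ)ˣ) : adj F ζ) w = w :=
    h.one_smul hw.1
  refine ⟨h.groupUH hn, h.groupH hn, fun g => Iff.rfl, h.mem_groupH_iff hn,
    fun g hg => h.isUnit_of_mem_setUH hn ((h.mem_setH_iff_setUH hn).mp hg).1, ?_,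
    fun P hP => ⟨h.rightAct_one hP, fun g hg => ⟨h.rightAct_mem_curve hn hP hg, fun g' hg' =>
      h.rightAct_mul hP (h.norm_entry_mem hn hg) (h.norm_entry_mem hn hg')⟩⟩,
    h.indexAction hn, fun g a b hab => h.image_rightAct hn hw g hab,
    h.isPretransitive_indexAction hn, hstab, fun g => ?_⟩
  · rintro _ ⟨x, -, rfl⟩
    exact x.2
  · rw [← hstab]
    constructor
    · intro himg
      obtain ⟨c, hc⟩ := QuotientGroup.mk_surjective (h.indexChar hn g *
        ((1 : unitFilt (adj F ζ) ϖ 0) : IndexSet (adj F ζ) ϖ n))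
      have h1 := h.image_rightAct hn hw g hc.symm
      rw [e1, himg] at h1
      rw [← hc]
      -- Were the index moved, the affinoid would be disjoint from itself and hence empty,
      -- contradicting the existence of the point with complex multiplication.
      by_contra hne
      have h2 := (h.affinoid_index hn hw c 1).2.2 hne
      rw [e1, ← h1, disjoint_self, Set.bot_eq_empty] at h2
      exact (h.ltData hn hw).affinoid_nonempty.ne_empty h2
    · intro h1
      have h2 := h.image_rightAct hn hw g h1
      rwa [e1] at h2

end UnramData

/-! ### The ground field is complete -/

section GroundField

variable {C : Type*} [NormedField C] [IsUltrametricDist C] [CompleteSpace C] {F : Subfield C}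
  {ϖ w : C} {q n : ℕ}

theorem mem_hatUr {x : C} (hx : x ∈ F) (q : ℕ) : x ∈ hatUr F q :=
  Subfield.le_topologicalClosure _ (Subfield.subset_closure (Or.inl hx))

theorem completeSpace_hatUr (F : Subfield C) (q : ℕ) : CompleteSpace (hatUr F q) :=
  (Subfield.isClosed_topologicalClosure _).completeSpace_coe

/-- The torsion point is a root of the `n`-fold composite of `x^{q²} + ϖ x`, which is nonzero by its
degree. -/
theorem isIntegral_torsion {K : Subfield C} (hϖ : ϖ ∈ K) (hq : 2 ≤ q)
    (hw : (mulUnif q ϖ 0)^[n] w = 0) : IsIntegral K w := by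
  rw [← isAlgebraic_iff_isIntegral]
  let f : Polynomial K := Polynomial.X ^ q ^ 2 + Polynomial.C ⟨ϖ, hϖ⟩ * Polynomial.X
  have hf : f.natDegree = q ^ 2 := by
    have h1 : 1 < q ^ 2 := Nat.one_lt_pow two_ne_zero hq
    rw [Polynomial.natDegree_add_eq_left_of_natDegree_lt, Polynomial.natDegree_X_pow]
    rw [Polynomial.natDegree_X_pow]
    exact (Polynomial.natDegree_C_mul_le _ _).trans_lt (by rwa [Polynomial.natDegree_X])
  refine ⟨f.comp^[n] Polynomial.X, fun h0 => ?_, ?_⟩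
  · have h1 := Polynomial.natDegree_iterate_comp (p := f) (q := Polynomial.X) n
    rw [h0, Polynomial.natDegree_zero, hf, Polynomial.natDegree_X, mul_one] at h1
    exact pow_ne_zero n (pow_ne_zero 2 (by omega)) h1.symm
  · rw [Polynomial.aeval_def, Polynomial.iterate_comp_eval₂, Polynomial.eval₂_X, ← hw]
    congr 1
    funext x
    simp [f, mulUnif]
    exact Or.inl rfl

/-- A finite extension of a complete nontrivially normed field is closed in `C`; the element `ϖ⁻¹`
witnesses nontriviality. -/
theorem completeSpace_adj {K : Subfield C} (hϖ : ϖ ∈ K) (hϖ0 : ϖ ≠ 0) (hϖ1 : ‖ϖ‖ < 1)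
    (hK : CompleteSpace K) (hw : IsIntegral K w) : CompleteSpace (adj K w) := by
  let _ : NontriviallyNormedField K :=
    { (inferInstance : NormedField K) with
      non_trivial := ⟨⟨ϖ⁻¹, K.inv_mem hϖ⟩, by
        change 1 < ‖ϖ⁻¹‖
        rw [norm_inv]
        exact (one_lt_inv₀ (norm_pos_iff.mpr hϖ0)).mpr hϖ1⟩ }
  let _ : NormedSpace K C := { norm_smul_le := fun a b => (norm_mul (a : C) b).le }
  let E : IntermediateField K C := IntermediateField.adjoin K {w}
  have : FiniteDimensional K E := IntermediateField.adjoin.finiteDimensional hw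
  have hc : IsClosed ((E.toSubalgebra.toSubmodule : Submodule K C) : Set C) := by
    have : FiniteDimensional K (E.toSubalgebra.toSubmodule : Submodule K C) := this
    exact Submodule.closed_of_finiteDimensional _
  have hle : (adj K w : Set C) = (E.toSubalgebra.toSubmodule : Submodule K C) := by
    have h1 : adj K w = E.toSubfield := by
      rw [IntermediateField.adjoin_toSubfield]
      change adj K w = Subfield.closure (Set.range (Subtype.val : K → C) ∪ {w})
      rw [Subtype.range_coe_subtype]
      rfl
    rw [h1]
    rfl
  have : IsClosed (adj K w : Set C) := by rwa [hle]
  exact this.completeSpace_coe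

end GroundField

namespace LTData

/-! ### The action of the stabilizer in normalized coordinates -/

theorem norm_sum_sub_lt {S : Type*} [SeminormedAddCommGroup S] [IsUltrametricDist S] {r : ℝ}
    {n k : ℕ} (hk : k < n) {f : ℕ → S} {T : S} (hr : 0 < r)
    (h : ∀ i < n, i ≠ k → ‖f i‖ < r) (hT : ‖f k - T‖ < r) :
    ‖∑ i ∈ Finset.range n, f i - T‖ < r := by
  rw [← Finset.add_sum_erase _ f (Finset.mem_range.mpr hk), add_sub_right_comm]
  refine norm_add_lt_of_lt' hT (norm_sum_lt' hr _ _ fun i hi => ?_)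
  rw [Finset.mem_erase, Finset.mem_range] at hi
  exact h i hi.2 hi.1

variable {k R : Type*} [NormedField k] [IsUltrametricDist k] [NormedCommRing R]
  [NormedAlgebra k R] [NormOneClass R] [IsUltrametricDist R]
  {p q n : ℕ} {ϖ ζ w : k} {u₀ x y : R} {a b a' b' : ℕ → k}

theorem norm_algebraMap_mul_le {c : k} (hc : ‖c‖ ≤ 1) (z : R) : ‖algebraMap k R c * z‖ ≤ ‖z‖ := by
  rw [← Algebra.smul_def]
  exact (norm_smul_le _ _).trans (mul_le_of_le_one_left (norm_nonneg _) hc)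

/-- The diagonal coordinates of the image of a point under a matrix with given digits. -/
def actOrbit (q n : ℕ) (ϖ w : k) (a b a' b' : ℕ → k) (u₀ x y : R) : R × R :=
  UnramData.actAB n (fun i => algebraMap k R (a i)) (fun i => algebraMap k R (b i))
    (fun i => algebraMap k R (a' i)) (fun i => algebraMap k R (b' i)) (orbit q n ϖ w u₀ x y)

/-- Terms below `n / 2` vanish and those above gain a factor `‖ϖ‖`. The middle term has leading part
`ϖ_1 y^{q^{n-1}}` for `n` odd, while for `n` even it is of order `ϖ_1^q` and disappears. This is the
source of the difference between the two parities. -/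
theorem norm_sum_snd_lt (h : LTData p q n ϖ ζ w) (hu : ‖u₀‖ ≤ 1) (hx : ‖x‖ ≤ 1) (hy : ‖y‖ ≤ 1)
    (hb1 : ∀ i, ‖b' i‖ ≤ 1) (hb : ∀ i < n / 2, b' i = 0) :
    ‖∑ i ∈ Finset.range n, algebraMap k R (b' i) * (orbit q n ϖ w u₀ x y i).2
      - torsionPt q n ϖ w 1 • (if Odd n then algebraMap k R (b' (n / 2)) * y ^ q ^ (n - 1) else 0)‖
      < ‖torsionPt q n ϖ w 1‖ := by
  have hn := h.two_le
  have hδ := h.delta_pos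
  refine norm_sum_sub_lt (k := n / 2) (by omega) hδ (fun i hi hik => ?_) ?_
  · rcases lt_or_gt_of_ne hik with hlt | hgt
    · rwa [hb i hlt, map_zero, zero_mul, norm_zero]
    · obtain ⟨j, rfl⟩ := Nat.exists_eq_add_of_lt hgt
      refine (norm_algebraMap_mul_le (hb1 _) _).trans_lt ?_
      refine (h.norm_orbit_snd_le_pow hu hx hy (j := j + 1) (by omega)).trans_lt ?_
      exact mul_lt_of_lt_one_left hδ (pow_lt_one₀ (norm_nonneg _) h.lt (by omega))
  · have h1 := h.norm_orbit_snd_sub_le hu hx hy (i := 1) (j := n / 2) (by omega)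
    have h2 : max ‖ϖ‖ (‖ϖ‖ ^ (n / 2) * ‖torsionPt q n ϖ w 1‖) < ‖torsionPt q n ϖ w 1‖ :=
      max_lt h.norm_lt_delta
        (mul_lt_of_lt_one_left hδ (pow_lt_one₀ (norm_nonneg _) h.lt (by omega)))
    split_ifs with ho
    · have e : expS q n = 1 := if_pos ho
      have e2 : 2 * (n / 2) = n - 1 := by
        obtain ⟨r, rfl⟩ := ho
        omega
      rw [e, e2, pow_one] at h1
      rw [← mul_smul_comm, ← mul_sub]
      exact (norm_algebraMap_mul_le (hb1 _) _).trans_lt (h1.trans_lt h2)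
    · have e : expS q n = q := if_neg ho
      rw [smul_zero, sub_zero]
      refine (norm_algebraMap_mul_le (hb1 _) _).trans_lt ?_
      have h3 : ‖torsionPt q n ϖ w 1 ^ expS q n • y ^ q ^ (2 * (n / 2))‖
          < ‖torsionPt q n ϖ w 1‖ := by
        refine (norm_smul_le_of _ (norm_pow_le_one' hy _)).trans_lt ?_
        rw [e, norm_pow]
        exact pow_lt_self_of_lt_one₀ hδ h.delta_lt_one h.two_le_q
      have := norm_add_lt_of_lt' (h1.trans_lt h2) h3
      rwa [sub_add_cancel] at this

theorem sum_eq_first_add_last (hn : 2 ≤ n) (ha0 : a 0 = 1)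
    (ha : ∀ i, 0 < i → i + 1 < n → a i = 0) (f : ℕ → R) :
    ∑ i ∈ Finset.range n, algebraMap k R (a i) * f i
      = f 0 + algebraMap k R (a (n - 1)) * f (n - 1) := by
  obtain ⟨m, rfl⟩ := Nat.exists_eq_add_of_le' hn
  rw [Finset.sum_range_succ, Finset.sum_range_succ', Finset.sum_eq_zero, ha0, map_one, one_mul,
    zero_add]
  · rfl
  · intro i hi
    rw [Finset.mem_range] at hi
    rw [ha _ (by omega) (by omega), map_zero, zero_mul]

/-- The first normalized coordinate after the action. -/
theorem norm_actOrbit_fst_sub_lt (h : LTData p q n ϖ ζ w) (hu : ‖u₀‖ ≤ 1) (hx : ‖x‖ ≤ 1)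
    (hy : ‖y‖ ≤ 1) (ha1 : ∀ i, ‖a i‖ ≤ 1) (ha0 : a 0 = 1)
    (ha : ∀ i, 0 < i → i + 1 < n → a i = 0)
    (hb1 : ∀ i, ‖b' i‖ ≤ 1) (hb : ∀ i < n / 2, b' i = 0) :
    ‖(actOrbit q n ϖ w a b a' b' u₀ x y).1 - algebraMap k R w - torsionPt q n ϖ w 1 •
      (x + (if Odd n then algebraMap k R (b' (n / 2)) * y ^ q ^ (n - 1) else 0)
        + algebraMap k R (a (n - 1)))‖ < ‖torsionPt q n ϖ w 1‖ := by
  have hn := h.two_le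
  rw [actOrbit, UnramData.actAB, Finset.sum_add_distrib, sum_eq_first_add_last hn ha0 ha]
  have h1 := h.norm_sum_snd_lt hu hx hy hb1 hb
  have h2 := (h.norm_orbit_fst_sub_le_norm hu hx hy (j := n - 1) (by omega) (by omega)).trans_lt
    h.norm_lt_delta
  rw [show n - (n - 1) = 1 by omega] at h2
  have h3 := (norm_algebraMap_mul_le (ha1 (n - 1)) _).trans_lt h2
  refine lt_of_eq_of_lt (congrArg norm ?_) (norm_add_lt_of_lt' h3 h1)
  have e0 : (orbit q n ϖ w u₀ x y 0).1 = algebraMap k R w + torsionPt q n ϖ w 1 • x := rfl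
  rw [e0, smul_add, smul_add, Algebra.smul_def (torsionPt q n ϖ w 1) (algebraMap k R (a (n - 1)))]
  ring

/-- The second normalized coordinate after the action. -/
theorem norm_actOrbit_add_sub_lt (h : LTData p q n ϖ ζ w) (hu : ‖u₀‖ ≤ 1) (hx : ‖x‖ ≤ 1)
    (hy : ‖y‖ ≤ 1) (ha1 : ∀ i, ‖a i‖ ≤ 1) (ha0 : a 0 = 1)
    (ha : ∀ i, 0 < i → i + 1 < n → a i = 0) (ha1' : ∀ i, ‖a' i‖ ≤ 1) (ha0' : a' 0 = 1)
    (ha' : ∀ i, 0 < i → i + 1 < n → a' i = 0) (hb1 : ∀ i, ‖b i‖ ≤ 1)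
    (hb : ∀ i < n / 2, b i = 0) (hb1' : ∀ i, ‖b' i‖ ≤ 1) (hb' : ∀ i < n / 2, b' i = 0) :
    ‖(actOrbit q n ϖ w a b a' b' u₀ x y).1 + (actOrbit q n ϖ w a b a' b' u₀ x y).2
      - algebraMap k R w - scaleS q n ϖ w •
      (y + if Odd n then algebraMap k R (b (n / 2)) else 0)‖ < ‖scaleS q n ϖ w‖ := by
  have hn := h.two_le
  have hδ := h.delta_lt_norm_scaleS
  have hs := h.norm_scaleS_pos
  have ht := fun i (hi : i ≤ n) => h.norm_orbit_fst_sub_le_delta hu hx hy hi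
  have h1 := (h.norm_actOrbit_fst_sub_lt (b := b) (a' := a') hu hx hy ha1 ha0 ha hb1' hb').trans hδ
  have h2 : ‖torsionPt q n ϖ w 1 •
      (x + (if Odd n then algebraMap k R (b' (n / 2)) * y ^ q ^ (n - 1) else 0)
        + algebraMap k R (a (n - 1)))‖ < ‖scaleS q n ϖ w‖ := by
    refine (norm_smul_le_of _ ?_).trans_lt hδ
    refine norm_add_le_of_le' (norm_add_le_of_le' hx ?_) ((norm_algebraMap' R _).trans_le (ha1 _))
    split_ifs
    · exact (norm_algebraMap_mul_le (hb1' _) _).trans (norm_pow_le_one' hy _)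
    · rw [norm_zero]; exact zero_le_one
  have h3 : ‖algebraMap k R (a' (n - 1)) * (orbit q n ϖ w u₀ x y (n - 1)).2‖
      < ‖scaleS q n ϖ w‖ :=
    (norm_algebraMap_mul_le (ha1' _) _).trans_lt
      ((h.norm_orbit_snd_le_delta hu hx hy (by omega) (by omega)).trans_lt hδ)
  have h4 : ‖torsionPt q n ϖ w 1 • x‖ < ‖scaleS q n ϖ w‖ := (norm_smul_le_of _ hx).trans_lt hδ
  have hO : ∀ i ≤ n, ‖torsionPt q n ϖ w (n - i)‖ < ‖scaleS q n ϖ w‖ →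
      ‖algebraMap k R (b i) * (orbit q n ϖ w u₀ x y i).1‖ < ‖scaleS q n ϖ w‖ := fun i hi hlt => by
    refine (norm_algebraMap_mul_le (hb1 _) _).trans_lt ?_
    have := norm_add_lt_of_lt' ((ht i hi).trans_lt hδ)
      ((norm_algebraMap' R (torsionPt q n ϖ w (n - i))).trans_lt hlt)
    rwa [sub_add_cancel] at this
  -- The parity enters through the middle term: `A_{n/2}` is close to `ϖ_{n - n/2}`, which is the
  -- scaling constant of `Y` itself for `n` odd and strictly smaller than it for `n` even.
  have h5 : ‖∑ i ∈ Finset.range n, algebraMap k R (b i) * (orbit q n ϖ w u₀ x y i).1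
      - scaleS q n ϖ w • (if Odd n then algebraMap k R (b (n / 2)) else 0)‖
        < ‖scaleS q n ϖ w‖ := by
    refine norm_sum_sub_lt (k := n / 2) (by omega) hs (fun i hi hik => ?_) ?_
    · rcases lt_or_gt_of_ne hik with hlt | hgt
      · rwa [hb i hlt, map_zero, zero_mul, norm_zero]
      · refine hO i hi.le ?_
        by_cases ho : Odd n
        · exact h.torsionPt_lt_scaleS_odd ho (by omega)
        · exact h.torsionPt_lt_scaleS_even ho (by omega)
    · split_ifs with ho
      · have e : scaleS q n ϖ w = torsionPt q n ϖ w (n - n / 2) := by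
          rw [scaleS_eq, if_pos ho]
          congr 1
          omega
        rw [Algebra.smul_def, mul_comm (algebraMap k R (scaleS q n ϖ w)), ← mul_sub]
        refine (norm_algebraMap_mul_le (hb1 _) _).trans_lt ?_
        rw [e] at hδ ⊢
        exact (ht (n / 2) (by omega)).trans_lt hδ
      · rw [smul_zero, sub_zero]
        exact hO _ (by omega) (h.torsionPt_lt_scaleS_even ho (by omega))
  have h6 := norm_add_lt_of_lt' (norm_add_lt_of_lt' (norm_add_lt_of_lt' h1 h2)
    (norm_sub_lt_of_lt' h3 h4)) h5
  refine lt_of_eq_of_lt (congrArg norm ?_) h6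
  have e0 : (orbit q n ϖ w u₀ x y 0).2 = scaleS q n ϖ w • y - torsionPt q n ϖ w 1 • x := rfl
  have e1 : (actOrbit q n ϖ w a b a' b' u₀ x y).2
      = ∑ i ∈ Finset.range n, algebraMap k R (b i) * (orbit q n ϖ w u₀ x y i).1
        + (scaleS q n ϖ w • y - torsionPt q n ϖ w 1 • x
          + algebraMap k R (a' (n - 1)) * (orbit q n ϖ w u₀ x y (n - 1)).2) := by
    rw [← e0, ← sum_eq_first_add_last hn ha0' ha' fun i => (orbit q n ϖ w u₀ x y i).2,
      ← Finset.sum_add_distrib]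
    rfl
  rw [e1, smul_add]
  ring

end LTData

open LTData

/-! ### The action of the stabilizer on the reduction -/

section Bar

variable {C : Type*} [NormedField C] [IsUltrametricDist C] {K : Subfield C}

theorem bar_eq (x : intRing K) : bar K ((x : K) : C) = IsLocalRing.residue (intRing K) x :=
  dif_pos ⟨(x : K).2, x.2⟩

theorem bar_congr {x y : C} (hx : x ∈ K) (hy : y ∈ K) (hy1 : ‖y‖ ≤ 1) (hxy : ‖x - y‖ < 1) :
    bar K x = bar K y := by
  have hx1 : ‖x‖ ≤ 1 := by
    have := norm_add_le_of_le' hxy.le hy1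
    rwa [sub_add_cancel] at this
  have e1 := bar_eq (⟨⟨x, hx⟩, hx1⟩ : intRing K)
  have e2 := bar_eq (⟨⟨y, hy⟩, hy1⟩ : intRing K)
  exact e1.trans (((residue_eq_iff _ _).mpr hxy).trans e2.symm)

end Bar

section Action

variable {C : Type*} [NormedField C] [IsUltrametricDist C] [CompleteSpace C] {p q n : ℕ}
  {F K : Subfield C} {ϖ ζ w : K} {M : Matrix (Fin 2) (Fin 2) C}

theorem eval_actOrbit (P : Fin 3 → C) (hP : ∀ i, ‖P i‖ ≤ 1) (a b a' b' : ℕ → K)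
    (u x y : Tate K 3) :
    (Tate.eval P hP (actOrbit q n ϖ w a b a' b' u x y).1,
        Tate.eval P hP (actOrbit q n ϖ w a b a' b' u x y).2)
      = UnramData.actAB n (fun i => ((a i : K) : C)) (fun i => ((b i : K) : C))
        (fun i => ((a' i : K) : C)) (fun i => ((b' i : K) : C))
        (LTData.orbit q n (ϖ : C) (w : C) (Tate.eval P hP u) (Tate.eval P hP x)
          (Tate.eval P hP y)) := by
  have hc : ∀ a : K, Tate.eval P hP (algebraMap K (Tate K 3) a) = (a : C) :=
    fun a => (Tate.eval (K := K) P hP).commutes a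
  have ho := fun j => eval_orbit (q := q) (n := n) (ϖ := ϖ) (w := w) P hP u x y j
  simp only [actOrbit, UnramData.actAB, map_sum, map_add, map_mul, hc]
  simp only [← ho]

/-- The coordinates after the action, as elements of the Tate algebra. -/
def actCoord (q n : ℕ) (ϖ w : K) (a b : ℕ → K) : Fin 3 → Tate K 3 :=
  let D := actOrbit q n ϖ w a b (fun i => a i ^ q) (fun i => b i ^ q) (Tate.X K (d := 3) 0)
    (Tate.X K 1) (Tate.X K 2)
  ![Tate.X K 0, (torsionPt q n ϖ w 1)⁻¹ • (D.1 - algebraMap K _ w),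
    (scaleS q n ϖ w)⁻¹ • (D.1 + D.2 - algebraMap K _ w)]

/-- The series in `actCoord` undo the normalization of `startAB` after the action, so passing back
to ambient coordinates leaves exactly the diagonal point given by `actAB`. -/
theorem coords_eval_actCoord (hL : LTData p q n ϖ ζ w) (a b : ℕ → K) (P : Fin 3 → C)
    (hP : ∀ i, ‖P i‖ ≤ 1) :
    coords q n (ϖ : C) (ζ : C) (w : C) (fun i => Tate.eval P hP (actCoord q n ϖ w a b i))
      = diagPt q (ζ : C) (scaleU q n (ϖ : C) (w : C) • P 0) (UnramData.actAB n
        (fun i => ((a i : K) : C)) (fun i => ((b i : K) : C)) (fun i => ((a i : K) : C) ^ q)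
        (fun i => ((b i : K) : C) ^ q)
        (LTData.orbit q n (ϖ : C) (w : C) (P 0) (P 1) (P 2))) := by
  have hc : ∀ a : K, Tate.eval P hP (algebraMap K (Tate K 3) a) = (a : C) :=
    fun a => (Tate.eval (K := K) P hP).commutes a
  have hs : ∀ (a : K) (f : Tate K 3), Tate.eval P hP (a • f) = (a : C) * Tate.eval P hP f :=
    fun a f => (map_smul (Tate.eval P hP) a f)
  have ec := LTData.coords_eq_diagPt (R := C) (q := q) (n := n) (ϖ := (ϖ : C)) (ζ := (ζ : C))
    (w := (w : C)) (fun i => Tate.eval P hP (actCoord q n ϖ w a b i))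
  simp only [Algebra.algebraMap_self, RingHom.id_apply] at ec
  have ea := eval_actOrbit (q := q) (n := n) (ϖ := ϖ) (w := w) P hP a b (fun i => a i ^ q)
    (fun i => b i ^ q) (Tate.X K 0) (Tate.X K 1) (Tate.X K 2)
  simp only [Tate.eval_X, SubmonoidClass.coe_pow] at ea
  rw [ec, ← ea]
  have hτ : torsionPt q n (ϖ : C) (w : C) 1 * (((torsionPt q n ϖ w 1)⁻¹ : K) : C) = 1 := by
    have := map_torsionPt K.subtype q n ϖ w 1
    simp only [Subfield.subtype_apply] at this
    rw [← this]
    exact mul_inv_cancel₀ (by simpa using hL.torsionPt_one_ne)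
  have hσ : scaleS q n (ϖ : C) (w : C) * (((scaleS q n ϖ w)⁻¹ : K) : C) = 1 := by
    rw [← LTData.coe_scaleS]
    exact mul_inv_cancel₀ (by simpa using norm_pos_iff.mp hL.norm_scaleS_pos)
  congr 1
  · simp [actCoord, Tate.eval_X]
  · simp only [startAB, actCoord, Matrix.cons_val_one, Matrix.cons_val_zero, Matrix.cons_val, hs,
      map_sub, map_add, hc, smul_eq_mul, Algebra.algebraMap_self, RingHom.id_apply]
    rw [← mul_assoc, ← mul_assoc, hτ, hσ]
    ext <;> simp

/-- The digits of a matrix in `H`. -/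
theorem digit_of_mem_setH (h : UnramData p q F (ϖ : C) (ζ : C)) (hn : 2 ≤ n)
    (hM : M ∈ setH F q n (ϖ : C) (ζ : C)) :
    (∀ i, ‖digit q (ϖ : C) i (alphaM (ζ : C) (ζ ^ q : C) M)‖ ≤ 1) ∧
    digit q (ϖ : C) 0 (alphaM (ζ : C) (ζ ^ q : C) M) = 1 ∧
    (∀ i, 0 < i → i + 1 < n → digit q (ϖ : C) i (alphaM (ζ : C) (ζ ^ q : C) M) = 0) ∧
    (∀ i, ‖digit q (ϖ : C) i (betaM (ζ : C) (ζ ^ q : C) M)‖ ≤ 1) ∧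
    (∀ i < n / 2, digit q (ϖ : C) i (betaM (ζ : C) (ζ ^ q : C) M) = 0) ∧
    ‖(alphaM (ζ : C) (ζ ^ q : C) M - 1) / (ϖ : C) ^ (n - 1)
      - digit q (ϖ : C) (n - 1) (alphaM (ζ : C) (ζ ^ q : C) M)‖ < 1 ∧
    ‖betaM (ζ : C) (ζ ^ q : C) M / (ϖ : C) ^ (n / 2)
      - digit q (ϖ : C) (n / 2) (betaM (ζ : C) (ζ ^ q : C) M)‖ < 1 ∧
    (alphaM (ζ : C) (ζ ^ q : C) M - 1) / (ϖ : C) ^ (n - 1) ∈ adj F (ζ : C) ∧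
    betaM (ζ : C) (ζ ^ q : C) M / (ϖ : C) ^ (n / 2) ∈ adj F (ζ : C) := by
  obtain ⟨h1, h2, h3⟩ := h.mem_setH_iff.mp hM
  have hα := h.norm_alphaM_of_mem_setH hn hM
  have h1' := h.norm_entry_le_of_mem hn ((h.mem_setH_iff_setUH hn).mp hM).1
  set α := alphaM (ζ : C) (ζ ^ q : C) M with eα
  set β := betaM (ζ : C) (ζ ^ q : C) M with eβ
  have hαO : α ∈ UnramData.ringO F (ζ : C) := ⟨UnramData.alphaM_mem h1, hα.le⟩
  have hβO : β ∈ UnramData.ringO F (ζ : C) := ⟨UnramData.betaM_mem h1, h.norm_betaM_le h1'⟩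
  have hγ := h.div_unif_pow_mem (Subfield.sub_mem _ hαO.1 (Subfield.one_mem _)) h2
  have hb := h.div_unif_pow_mem hβO.1 h3
  have hϖ := h.unif.2.1
  -- Since digits add without carries, this presentation shows that the digits of `α` at the indices
  -- `0, …, n - 1` are `1, 0, …, 0` followed by the reduction of `(α - 1) / ϖ^{n-1}`.
  have e1 : α = 1 + (ϖ : C) ^ (n - 1) * ((α - 1) / (ϖ : C) ^ (n - 1)) := by
    rw [mul_div_cancel₀ _ (pow_ne_zero _ hϖ)]; ring
  have e2 : β = (ϖ : C) ^ (n / 2) * (β / (ϖ : C) ^ (n / 2)) := by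
    rw [mul_div_cancel₀ _ (pow_ne_zero _ hϖ)]
  have hϖO : (ϖ : C) ^ (n - 1) * ((α - 1) / (ϖ : C) ^ (n - 1)) ∈ UnramData.ringO F (ζ : C) :=
    Subring.mul_mem _ (Subring.pow_mem _ h.unif_mem_ringO _) hγ
  have hd : ∀ i, digit q (ϖ : C) i α = digit q (ϖ : C) i 1
      + digit q (ϖ : C) i ((ϖ : C) ^ (n - 1) * ((α - 1) / (ϖ : C) ^ (n - 1))) := fun i => by
    conv_lhs => rw [e1]
    exact h.digit_add i (Subring.one_mem _) hϖO
  have hs : ∀ i, 0 < i → digit q (ϖ : C) i 1 = 0 := fun i hi => by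
    obtain ⟨j, rfl⟩ := Nat.exists_eq_add_of_lt hi
    rw [zero_add]
    exact h.digit_succ_of_fixed j (one_pow _)
  refine ⟨fun i => h.norm_digit_le i hαO, ?_, fun i hi hin => ?_, fun i => h.norm_digit_le i hβO,
    fun i hi => h.digit_eq_zero_of_norm_le hi hβO.1 h3, ?_, ?_, hγ.1, hb.1⟩
  · rw [hd, h.digit_zero_of_fixed (one_pow _), h.digit_unif_pow_mul_of_lt (by omega) hγ, add_zero]
  · rw [hd, hs i hi, h.digit_unif_pow_mul_of_lt (by omega) hγ, add_zero]
  · have e3 := h.digit_unif_pow_mul 0 (n - 1) hγ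
    rw [zero_add] at e3
    rw [hd, hs (n - 1) (by omega), zero_add, e3]
    exact (h.teich_spec hγ).2
  · have e3 := h.digit_unif_pow_mul 0 (n / 2) hb
    rw [zero_add, ← e2] at e3
    rw [e3]
    exact (h.teich_spec hb).2

theorem norm_actCoord_sub_lt (hL : LTData p q n ϖ ζ w) {a b : ℕ → K} (ha1 : ∀ i, ‖a i‖ ≤ 1)
    (ha0 : a 0 = 1) (ha : ∀ i, 0 < i → i + 1 < n → a i = 0) (hb1 : ∀ i, ‖b i‖ ≤ 1)
    (hb : ∀ i < n / 2, b i = 0) :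
    ‖actCoord q n ϖ w a b 1 - (Tate.X K 1 + (if Odd n then
      algebraMap K (Tate K 3) (b (n / 2) ^ q) * Tate.X K 2 ^ q ^ (n - 1) else 0)
        + algebraMap K _ (a (n - 1)))‖ < 1 ∧
    ‖actCoord q n ϖ w a b 2 - (Tate.X K 2 + if Odd n then algebraMap K (Tate K 3) (b (n / 2))
      else 0)‖ < 1 := by
  have hq := hL.two_le_q
  have hu := Tate.norm_X_le (K := K) (d := 3) 0
  have hx := Tate.norm_X_le (K := K) (d := 3) 1
  have hy := Tate.norm_X_le (K := K) (d := 3) 2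
  have ha1' : ∀ i, ‖a i ^ q‖ ≤ 1 := fun i => norm_pow_le_one' (ha1 i) q
  have hb1' : ∀ i, ‖b i ^ q‖ ≤ 1 := fun i => norm_pow_le_one' (hb1 i) q
  have hb' : ∀ i < n / 2, b i ^ q = 0 := fun i hi => by rw [hb i hi, zero_pow (by omega)]
  refine ⟨norm_inv_smul_sub_lt
    (hL.norm_actOrbit_fst_sub_lt hu hx hy ha1 ha0 ha hb1' hb'), norm_inv_smul_sub_lt
    (hL.norm_actOrbit_add_sub_lt hu hx hy ha1 ha0 ha ha1' ?_ ?_ hb1 hb hb1' hb')⟩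
  · rw [ha0, one_pow]
  · intro i hi hin
    rw [ha i hi hin, zero_pow (by omega)]

end Action

open LTData

/-! ### The endomorphisms induced by the stabilizer -/

section Stabilizer

variable {C : Type*} [NormedField C] [IsUltrametricDist C] [CompleteSpace C] {p q n : ℕ}
  {F K : Subfield C} {ϖ ζ w : K} {M : Matrix (Fin 2) (Fin 2) C}

theorem rightAct_mem_affinoid_of_mem_setH (h : UnramData p q F (ϖ : C) (ζ : C)) (hn : 2 ≤ n)
    (hw : (w : C) ∈ primTorsion q n (ϖ : C)) (hM : M ∈ setH F q n (ϖ : C) (ζ : C))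
    {P : Fin 3 → C} (hP : P ∈ affinoid q n (ϖ : C) (ζ : C) (w : C)) :
    rightAct q (ϖ : C) M P ∈ affinoid q n (ϖ : C) (ζ : C) (w : C) := by
  obtain ⟨hM1, hM2⟩ := (h.mem_setH_iff_setUH hn).mp hM
  have h1 := h.rightAct_mem_affinoid hn hw hM1 hP
  rwa [h.affinoid_smul_eq hn hw (UnramData.alphaM_mem (h.mem_setH_iff.mp hM).1)
    (h.norm_alphaM_of_mem_setH hn hM) (Subfield.one_mem _) norm_one hM2, h.one_smul hw.1] at h1

/-- The action of an element of `H` on points is given by the coordinates `actCoord`. -/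
theorem eval_actCoord_mem_points (h : UnramData p q F (ϖ : C) (ζ : C)) (hn : 2 ≤ n)
    (hw : (w : C) ∈ primTorsion q n (ϖ : C)) (hM : M ∈ setH F q n (ϖ : C) (ζ : C)) {a b : ℕ → K}
    (ha : ∀ i, (a i : C) = digit q (ϖ : C) i (alphaM (ζ : C) (ζ ^ q : C) M))
    (hb : ∀ i, (b i : C) = digit q (ϖ : C) i (betaM (ζ : C) (ζ ^ q : C) M))
    (P : Fin 3 → C) (hP : ∀ i, ‖P i‖ ≤ 1) (hPI : P ∈ Points (affIdeal q n ϖ ζ w)) :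
    (fun i => Tate.eval P hP (actCoord q n ϖ w a b i)) ∈ Points (affIdeal q n ϖ ζ w) ∧
    coords q n (ϖ : C) (ζ : C) (w : C) (fun i => Tate.eval P hP (actCoord q n ϖ w a b i))
      = rightAct q (ϖ : C) M (coords q n (ϖ : C) (ζ : C) (w : C) P) := by
  have hLC := h.ltData hn hw
  have hL : LTData p q n ϖ ζ w := LTData.of_coe hLC
  have hbij := hL.bijOn_points
  have hM' := (h.mem_setH_iff_setUH hn).mp hM
  have ec := LTData.coords_eq_diagPt (R := C) (q := q) (n := n) (ϖ := (ϖ : C)) (ζ := (ζ : C))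
    (w := (w : C)) P
  simp only [Algebra.algebraMap_self, RingHom.id_apply] at ec
  have hP' := hPI
  rw [hL.points_affIdeal] at hP'
  have e : coords q n (ϖ : C) (ζ : C) (w : C) (fun i => Tate.eval P hP (actCoord q n ϖ w a b i))
      = rightAct q (ϖ : C) M (coords q n (ϖ : C) (ζ : C) (w : C) P) := by
    rw [coords_eval_actCoord hL, ec, h.rightAct_diagPt hLC (h.norm_entry_mem hn hM'.1) hP'.2]
    simp only [ha, hb]
    rfl
  refine ⟨?_, e⟩
  -- The transformed coordinates are identified, by injectivity of the chart, with the preimage of a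
  -- point already known to lie in the affinoid.
  obtain ⟨Q, hQ, hQe⟩ := hbij.surjOn (rightAct_mem_affinoid_of_mem_setH h hn hw hM (hbij.mapsTo hPI))
  rw [← e] at hQe
  rwa [← hLC.coords_injective hQe]

/-- The action of an element of `H` on the affinoid algebra and on its reduction. -/
theorem exists_stabilizer_action [IsAlgClosed C] [Fact p.Prime] [CharP C p] [CompleteSpace K]
    (h : UnramData p q F (ϖ : C) (ζ : C)) (hn : 2 ≤ n)
    (hw : (w : C) ∈ primTorsion q n (ϖ : C)) (hM : M ∈ setH F q n (ϖ : C) (ζ : C))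
    (hK : ∀ x : C, x ^ q ^ 2 = x → x ∈ K) (hFK : adj F (ζ : C) ≤ K) :
    let I := affIdeal q n ϖ ζ w
    let β := bar K (betaM (ζ : C) (ζ ^ q : C) M / (ϖ : C) ^ (n / 2))
    let γ := bar K ((alphaM (ζ : C) (ζ ^ q : C) M - 1) / (ϖ : C) ^ (n - 1))
    ∃ φ : AffAlg I →ₐ[K] AffAlg I,
      IsPullback (coords q n (ϖ : C) (ζ : C) (w : C)) (rightAct q (ϖ : C) M) φ ∧
      (∀ φ', IsPullback (coords q n (ϖ : C) (ζ : C) (w : C)) (rightAct q (ϖ : C) M) φ' → φ' = φ) ∧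
      ∃ φbar : Reduction I →ₐ[Residue K] Reduction I, IsReductionOf φ φbar ∧
        (Odd n → φbar (redCoord I 1) = redCoord I 1 + β ^ q • redCoord I 2 ^ q ^ (n - 1)
            + algebraMap _ _ γ ∧
          φbar (redCoord I 2) = redCoord I 2 + algebraMap _ _ β) ∧
        (Even n → φbar (redCoord I 1) = redCoord I 1 + algebraMap _ _ γ ∧
          φbar (redCoord I 2) = redCoord I 2) := by
  intro I β γ
  have hLC := h.ltData hn hw
  have hL : LTData p q n ϖ ζ w := LTData.of_coe hLC
  obtain ⟨hM', -⟩ := (h.mem_setH_iff_setUH hn).mp hM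
  obtain ⟨d1, d2, d3, d4, d5, d6, d7, d8, d9⟩ := digit_of_mem_setH h hn hM
  have hMF := (h.mem_setH_iff.mp hM).1
  have hαO : alphaM (ζ : C) (ζ ^ q : C) M ∈ UnramData.ringO F (ζ : C) :=
    ⟨UnramData.alphaM_mem hMF, (h.norm_alphaM_of_mem_setH hn hM).le⟩
  have hβO : betaM (ζ : C) (ζ ^ q : C) M ∈ UnramData.ringO F (ζ : C) :=
    ⟨UnramData.betaM_mem hMF, h.norm_betaM_le (h.norm_entry_le_of_mem hn hM')⟩
  -- The digits are fixed by the `q²`-power map and therefore lie in `K`, so the transformed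
  -- coordinates have coefficients in `K`.
  let a : ℕ → K := fun i => ⟨_, hK _ (h.digit_fixed i hαO)⟩
  let b : ℕ → K := fun i => ⟨_, hK _ (h.digit_fixed i hβO)⟩
  have hγ : γ = IsLocalRing.residue (intRing K) ⟨a (n - 1), d1 (n - 1)⟩ := by
    rw [← bar_eq]
    exact bar_congr (hFK d8) (a (n - 1)).2 (d1 (n - 1)) d6
  have hβ : β = IsLocalRing.residue (intRing K) ⟨b (n / 2), d4 (n / 2)⟩ := by
    rw [← bar_eq]
    exact bar_congr (hFK d9) (b (n / 2)).2 (d4 (n / 2)) d7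
  obtain ⟨g1, g2⟩ := norm_actCoord_sub_lt hL (a := a) (b := b) d1 (Subtype.ext d2)
    (fun i hi hin => Subtype.ext (d3 i hi hin)) d4 (fun i hi => Subtype.ext (d5 i hi))
  have hx := Tate.norm_X_le (K := K) (d := 3) 1
  have hy := Tate.norm_X_le (K := K) (d := 3) 2
  have hb1 : ‖b (n / 2) ^ q‖ ≤ 1 := norm_pow_le_one' (d4 (n / 2)) q
  have hA : ∀ c : K, ‖c‖ ≤ 1 → ‖algebraMap K (Tate K 3) c‖ ≤ 1 := fun c hc =>
    (norm_algebraMap' (Tate K 3) c).trans_le hc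
  have t1 : ‖(Tate.X K 1 + (if Odd n then
      algebraMap K (Tate K 3) (b (n / 2) ^ q) * Tate.X K 2 ^ q ^ (n - 1) else 0)
        + algebraMap K _ (a (n - 1)))‖ ≤ 1 := by
    refine norm_add_le_of_le' (norm_add_le_of_le' hx ?_) (hA _ (d1 _))
    split_ifs
    · exact norm_mul_le_one' (hA _ hb1) (norm_pow_le_one' hy _)
    · rw [norm_zero]; exact zero_le_one
  have t2 : ‖(Tate.X K 2 + if Odd n then algebraMap K (Tate K 3) (b (n / 2)) else 0)‖ ≤ 1 := by
    refine norm_add_le_of_le' hy ?_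
    split_ifs
    · exact hA _ (d4 _)
    · rw [norm_zero]; exact zero_le_one
  have hG : ∀ i, ‖actCoord q n ϖ w a b i‖ ≤ 1 := fun i => by
    fin_cases i
    · exact Tate.norm_X_le 0
    · have := norm_add_le_of_le' g1.le t1
      rwa [sub_add_cancel] at this
    · have := norm_add_le_of_le' g2.le t2
      rwa [sub_add_cancel] at this
  have : CompleteSpace (Tate K 3) := Tate.completeSpace inferInstance
  obtain ⟨e, g, ε, f1, f2, s1, s2, he, hε, hchart⟩ := hL.exists_isChart
  have hpts := fun (P : Points I) => eval_actCoord_mem_points h hn hw hM (a := a) (b := b)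
    (fun _ => rfl) (fun _ => rfl) P.1 P.2.choose P.2
  -- No computation with the generators is needed: a substituted equation vanishes at every point
  -- because points go to points, hence it lies in the ideal.
  have hI : ∀ f ∈ I, Tate.subst (actCoord q n ϖ w a b) hG f ∈ I := fun f hf =>
    hchart.mem_of_vanish hε _ fun P => by
      rw [evalAt_mk, Tate.eval_subst _ hG P.1 P.2.choose (hpts P).1.choose]
      exact (hpts P).1.choose_spec f hf
  obtain ⟨φ, hφX, hφ⟩ := exists_endomorphism (actCoord q n ϖ w a b) hG hI
  have hpull : IsPullback (coords q n (ϖ : C) (ζ : C) (w : C)) (rightAct q (ϖ : C) M) φ :=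
    fun P => by
      obtain ⟨P', h1, h2⟩ := hφ P
      refine ⟨P', ?_, h2⟩
      rw [← (hpts P).2]
      congr 1
      funext i
      exact h1 i
  obtain ⟨φbar, hbar⟩ := exists_reduction φ fun P => (hφ P).imp fun P' h => h.2
  -- Errors of Gauss norm less than one die in the reduction, leaving the leading parts computed in
  -- `norm_actCoord_sub_lt`.
  have r1 := (hbar.map_redCoord (hG 1) (hφX 1)).trans (redMk_congr (hG 1) t1 g1)
  have r2 := (hbar.map_redCoord (hG 2) (hφX 2)).trans (redMk_congr (hG 2) t2 g2)
  refine ⟨φ, hpull, fun φ' hφ' =>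
    hchart.pullback_unique hε hL.bijOn_points.injOn hpull hφ', φbar, hbar, fun ho => ?_, fun hev => ?_⟩
  · simp only [ho, if_true] at r1 r2
    constructor
    · rw [r1, hγ, hβ, ← map_pow, algebraMap_residue, redCoord_eq, redCoord_eq, redMk_pow,
        residue_smul_redMk, redMk_add, redMk_add]
      congr 1
      rw [Algebra.smul_def]
      rfl
    · rw [r2, hβ, algebraMap_residue, redCoord_eq, redMk_add]
  · have ho : ¬ Odd n := Nat.not_odd_iff_even.mpr hev
    simp only [ho, if_false, add_zero] at r1 r2
    constructor
    · rw [r1, hγ, algebraMap_residue, redCoord_eq, redMk_add]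
    · exact r2

end Stabilizer

end LubinTate

end

/-! ### Assembly of the main theorem -/

open LubinTate in
theorem mainTheorem11 {C : Type*} [NormedField C] [IsUltrametricDist C] [CompleteSpace C]
    [IsAlgClosed C] (p : ℕ) [Fact p.Prime] [CharP C p]
    (F : Subfield C) [LocallyCompactSpace F] (ϖ : C) (hϖ : IsUniformizer F ϖ)
    (q : ℕ) (hq : q = Nat.card (Residue F)) (n : ℕ) (hn : 2 ≤ n)
    (ζ : C) (hζ : ζ ^ q ^ 2 = ζ) (hζF : ζ ∉ F)
    (w : C) (hw : w ∈ primTorsion q n ϖ) :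
    -- the index set of the affinoids
    (∀ w', w' ∈ primTorsion q n ϖ ↔
      ∃ a : unitFilt (adj F ζ) ϖ 0, w' = smul q ϖ 0 ((a : (adj F ζ)ˣ) : adj F ζ) w) ∧
    (∀ a b : unitFilt (adj F ζ) ϖ 0,
      let Xa := affinoid q n ϖ ζ (smul q ϖ 0 ((a : (adj F ζ)ˣ) : adj F ζ) w)
      let Xb := affinoid q n ϖ ζ (smul q ϖ 0 ((b : (adj F ζ)ˣ) : adj F ζ) w)
      Xa.Nonempty ∧
      ((a : IndexSet (adj F ζ) ϖ n) = b → Xa = Xb) ∧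
      ((a : IndexSet (adj F ζ) ϖ n) ≠ b → Disjoint Xa Xb)) ∧
    -- the action on the index set
    (∃ G H : Subgroup (GL (Fin 2) C),
      (∀ g, g ∈ G ↔ (g : Matrix (Fin 2) (Fin 2) C) ∈ setUH F q n ϖ ζ) ∧
      (∀ g, g ∈ H ↔ (g : Matrix (Fin 2) (Fin 2) C) ∈ setH F q n ϖ ζ) ∧
      (∀ h ∈ setH F q n ϖ ζ, IsUnit h) ∧ H ≤ G ∧
      (∀ P ∈ curve q n ϖ, rightAct q ϖ 1 P = P ∧ ∀ g ∈ G, rightAct q ϖ g P ∈ curve q n ϖ ∧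
        ∀ g' ∈ G, rightAct q ϖ (g * g' : GL (Fin 2) C) P =
          rightAct q ϖ g' (rightAct q ϖ g P)) ∧
      ∃ _ : MulAction Gᵐᵒᵖ (IndexSet (adj F ζ) ϖ n),
        (∀ (g : G) (a b : unitFilt (adj F ζ) ϖ 0),
          MulOpposite.op g • (a : IndexSet (adj F ζ) ϖ n) = b →
          rightAct q ϖ (g : GL (Fin 2) C) ''
              affinoid q n ϖ ζ (smul q ϖ 0 ((a : (adj F ζ)ˣ) : adj F ζ) w) =
            affinoid q n ϖ ζ (smul q ϖ 0 ((b : (adj F ζ)ˣ) : adj F ζ) w)) ∧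
        MulAction.IsPretransitive Gᵐᵒᵖ (IndexSet (adj F ζ) ϖ n) ∧
        (∀ g : G, MulOpposite.op g • ((1 : unitFilt (adj F ζ) ϖ 0) : IndexSet (adj F ζ) ϖ n) =
          ((1 : unitFilt (adj F ζ) ϖ 0) : IndexSet (adj F ζ) ϖ n) ↔ (g : GL (Fin 2) C) ∈ H) ∧
        (∀ g : G, rightAct q ϖ (g : GL (Fin 2) C) '' affinoid q n ϖ ζ w = affinoid q n ϖ ζ w ↔
          (g : GL (Fin 2) C) ∈ H)) ∧
    -- the reduction and the action of the stabilizer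
    (let K := adj (hatUr F q) w
      let I : Ideal (Tate K 3) := affIdeal q n ⟨ϖ, mem_adj_hatUr hϖ.1 q w⟩
        ⟨ζ, mem_adj_hatUr_of_pow F hζ w⟩ ⟨w, mem_adj_self (hatUr F q) w⟩
      let x : Reduction I := redCoord I 1
      let y : Reduction I := redCoord I 2
      Set.BijOn (coords q n ϖ ζ w) (Points I) (affinoid q n ϖ ζ w) ∧
      (∃ e : (MvPolynomial (Fin 2) (Residue K) ⧸ Ideal.span {curveEq (Residue K) q n})
          ≃ₐ[Residue K] Reduction I,
        e (Ideal.Quotient.mk _ (MvPolynomial.X 0)) = x ∧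
        e (Ideal.Quotient.mk _ (MvPolynomial.X 1)) = y) ∧
      ∀ a ∈ F, ∀ b ∈ F, ‖a‖ ≤ 1 → ‖b‖ ≤ 1 →
      ∀ M : Matrix (Fin 2) (Fin 2) C, (∀ i j, M i j ∈ F ∧ ‖M i j‖ ≤ 1) →
        let g := 1 + ϖ ^ (n / 2) • gC q ζ a b + ϖ ^ (n - 1) • M
        let β := bar K (a + b * ζ)
        let γ := bar K ((ζ ^ q - ζ)⁻¹ *
          (ζ ^ q * (M 0 0 + M 1 0 * ζ) - (M 0 1 + M 1 1 * ζ)))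
        g ∈ setH F q n ϖ ζ ∧
        (∃ φ : AffAlg I →ₐ[K] AffAlg I,
          IsPullback (coords q n ϖ ζ w) (rightAct q ϖ g) φ ∧
          (∀ φ', IsPullback (coords q n ϖ ζ w) (rightAct q ϖ g) φ' → φ' = φ) ∧
          ∃ φbar : Reduction I →ₐ[Residue K] Reduction I, IsReductionOf φ φbar ∧
            (Odd n → φbar x = x + β ^ q • y ^ q ^ (n - 1) + algebraMap _ _ γ ∧
              φbar y = y + algebraMap _ _ β) ∧
            (Even n → φbar x = x + algebraMap _ _ γ ∧ φbar y = y)) ∧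
        ∀ a' ∈ F, ∀ b' ∈ F, ‖a'‖ ≤ 1 → ‖b'‖ ≤ 1 → M = iota q ζ a' b' →
          γ = bar K (a' + b' * ζ)) := by
  have h := unramData (p := p) hϖ hq hζ hζF
  have hLC := h.ltData hn hw
  refine ⟨fun w' => h.mem_primTorsion_iff' hn hw, h.affinoid_index hn hw,
    h.exists_index_action hn hw, ?_⟩
  intro K I x y
  have hFK : adj F ζ ≤ K := by
    refine Subfield.closure_le.mpr (Set.union_subset (fun x hx => ?_) ?_)
    · exact mem_adj_hatUr hx q w
    · rintro _ rfl
      exact mem_adj_hatUr_of_pow F hζ w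
  have hK : ∀ x : C, x ^ q ^ 2 = x → x ∈ K := fun x hx => mem_adj_hatUr_of_pow F hx w
  -- Completeness of the ground field is needed for substitution and for summing the series that
  -- express vanishing functions in terms of the equations.
  have hKc : CompleteSpace K := completeSpace_adj (mem_hatUr hϖ.1 q) hϖ.2.1 hϖ.2.2.1
    (completeSpace_hatUr F q) (isIntegral_torsion (mem_hatUr hϖ.1 q) h.two_le_q hw.1)
  have hL : LTData p q n (⟨ϖ, mem_adj_hatUr hϖ.1 q w⟩ : K) ⟨ζ, mem_adj_hatUr_of_pow F hζ w⟩
      ⟨w, mem_adj_self (hatUr F q) w⟩ := LTData.of_coe hLC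
  refine ⟨hL.bijOn_points, ?_, fun a ha b hb ha1 hb1 M hM => ?_⟩
  · obtain ⟨e, g, ε, f1, f2, s1, s2, he, hε, hchart⟩ := hL.exists_isChart
    exact hchart.exists_algEquiv hε _ (by rw [curveEq_eq, he])
  · intro g β γ
    have hζ' := h.zeta_sub_ne
    -- The summand in `C_1` has no `α`, so `α` sees only `M`, and `γ` is the reduction of its
    -- normalized coordinate.
    have eα : alphaM ζ (ζ ^ q) g = 1 + ϖ ^ (n - 1) * alphaM ζ (ζ ^ q) M := by
      rw [alphaM_add, alphaM_add, alphaM_smul, alphaM_smul, alphaM_one hζ', alphaM_gC]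
      ring
    have eβ : betaM ζ (ζ ^ q) g
        = ϖ ^ (n / 2) * (a + b * ζ) + ϖ ^ (n - 1) * betaM ζ (ζ ^ q) M := by
      rw [betaM_add, betaM_add, betaM_smul, betaM_smul, betaM_one, betaM_gC hζ']
      ring
    have hαM := h.norm_alphaM_le fun i j => (hM i j).2
    have hβM := h.norm_betaM_le fun i j => (hM i j).2
    have hϖ1 := hϖ.2.2.1.le
    have hab : ‖a + b * ζ‖ ≤ 1 := by
      rw [h.norm_add_mul_zeta ha hb]
      exact max_le ha1 hb1
    have hg : g ∈ setH F q n ϖ ζ := by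
      refine h.mem_setH_iff.mpr ⟨fun i j => ?_, ?_, ?_⟩
      · refine F.add_mem (F.add_mem ?_ ?_) ?_
        · rw [Matrix.one_apply]
          split_ifs
          · exact F.one_mem
          · exact F.zero_mem
        · exact F.mul_mem (F.pow_mem hϖ.1 _) (h.gC_mem ha hb i j)
        · exact F.mul_mem (F.pow_mem hϖ.1 _) (hM i j).1
      · rw [eα, add_sub_cancel_left, norm_mul, norm_pow]
        exact mul_le_of_le_one_right (by positivity) hαM
      · rw [eβ]
        refine norm_add_le_of_le' ?_ ?_
        · rw [norm_mul, norm_pow]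
          exact mul_le_of_le_one_right (by positivity) hab
        · rw [norm_mul, norm_pow]
          exact (mul_le_of_le_one_right (by positivity) hβM).trans
            (pow_le_pow_of_le_one (norm_nonneg _) hϖ1 (by omega))
    refine ⟨hg, ?_, fun a' _ b' _ _ _ hMi => ?_⟩
    · obtain ⟨φ, h1, h2, φbar, h3, hodd, heven⟩ := exists_stabilizer_action
        (ϖ := ⟨ϖ, mem_adj_hatUr hϖ.1 q w⟩) (ζ := ⟨ζ, mem_adj_hatUr_of_pow F hζ w⟩)
        (w := ⟨w, mem_adj_self (hatUr F q) w⟩) (K := K) h hn hw hg hK hFK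
      have hγ : (alphaM ζ (ζ ^ q) g - 1) / ϖ ^ (n - 1) = alphaM ζ (ζ ^ q) M := by
        rw [eα, add_sub_cancel_left, mul_div_cancel_left₀ _ (pow_ne_zero _ hϖ.2.1)]
      refine ⟨φ, h1, h2, φbar, h3, fun ho => ?_, fun he => ?_⟩
      -- The part of `M` in `C_1` also contributes to `β`, but with the factor `ϖ^{n - 1 - n/2}`,
      -- whose exponent is positive for odd `n ≥ 3`. For `n = 2` it would be zero, but in even level
      -- the formula does not involve `β`.
      · have hβ : bar K (betaM ζ (ζ ^ q) g / ϖ ^ (n / 2)) = β := by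
          have e : betaM ζ (ζ ^ q) g / ϖ ^ (n / 2) - (a + b * ζ)
              = ϖ ^ (n - 1 - n / 2) * betaM ζ (ζ ^ q) M := by
            have e1 : ϖ ^ (n - 1) = ϖ ^ (n / 2) * ϖ ^ (n - 1 - n / 2) := by
              rw [← pow_add]; congr 1; omega
            rw [eβ, e1, mul_assoc, ← mul_add,
              mul_div_cancel_left₀ _ (pow_ne_zero _ hϖ.2.1), add_sub_cancel_left]
          have habK : a + b * ζ ∈ K := hFK (h.mem_adj_iff.mpr ⟨a, ha, b, hb, rfl⟩)
          refine bar_congr (hFK ?_) habK hab ?_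
          · exact Subfield.div_mem _ (UnramData.betaM_mem (h.mem_setH_iff.mp hg).1)
              (Subfield.pow_mem _ (UnramData.mem_adj_of_mem hϖ.1) _)
          · rw [e, norm_mul, norm_pow]
            refine mul_lt_one_of_nonneg_of_lt_one_left (by positivity)
              (pow_lt_one₀ (norm_nonneg _) hϖ.2.2.1 ?_) hβM
            obtain ⟨r, rfl⟩ := ho
            omega
        have := hodd ho
        simp only [hγ, hβ] at this
        exact this
      · have := heven he
        simp only [hγ] at this
        exact this
    · have : γ = bar K (alphaM ζ (ζ ^ q) M) := rfl
      rw [this, hMi, alphaM_iota hζ']
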